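/- **Setting.** Let $A,S$ be holomorphic in a simply connected open neighbourhood $\Omega\subseteq\mathbb C$ of the real axis and real on $\mathbb R$, with $A,S,S',A',S''$ integrable on $\mathbb R$ and $A',S''$ bounded on $\mathbb R$. For $\epsilon>0$ let $$\mathfrak D_\epsilon=\begin{bmatrix}-\frac{\epsilon}{i}\frac{d}{dx}&\omega\\-\omega^*&\frac{\epsilon}{i}\frac{d}{dx}\end{bmatrix},\qquad \omega(x,\epsilon)=-iA(x)e^{iS(x)/\epsilon},$$ on $L^2(\mathbb R;\mathbb C^2)$. Put $g_\pm(x,\lambda)=\mp[\lambda+\tfrac12S'(x)\pm iA(x)]$ and $V_0=g_+g_-=-(\lambda+\tfrac12S')^2-A^2$. The zeros of $V_0(\cdot,\lambda)$ are the turning points. Write $z(x,\lambda,a)=i\int_a^x\sqrt{-V_0(t,\lambda)}\,dt$. **Asymptotic spectral arc.** Let $\lambda_0\in\mathbb C\setminus\mathbb R$ lie on an asymptotic spectral arc. That is, there is an admissible contour $C=C^-\cup C^0\cup C^+\subset\Omega$ for $\lambda_0$ that coincides with $\mathbb R$ near $\pm\infty$. It passes through two distinct simple turning points $\alpha_0$,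 $\beta_0$. The part $C^0$ is a path from $\alpha_0$ to $\beta_0$ along which $\Re z$ is constant (a Stokes line). The parts $C^-$ (between $-\infty$ and $\alpha_0$) and $C^+$ (between $\beta_0$ and $+\infty$) are free of other turning points, and $\Re z$ is strictly monotone along each of them. The three pieces are regular $C^1$ curves, and $C^-$ (resp. $C^+$) leaves $\alpha_0$ (resp. $\beta_0$) through the sector opposite to $C^0$, i.e. it makes with $C^0$ an angle larger than $2\pi/3$. Assume * **(H1)** $C^0$ contains no turning point other than $\alpha_0,\beta_0$; * $\alpha_0$ and $\beta_0$ are zeros of the same one of the two functions $g_+(\cdot,\lambda_0)$, $g_-(\cdot,\lambda_0)$. **Norming constant.** For $\lambda$ near $\lambda_0$ let $\alpha(\lambda),\beta(\lambda)$ be the turning points continuing $\alpha_0,\beta_0$, and deform $C$ near $\alpha_0,\beta_0$ to a contour through $\alpha(\lambda),\beta(\lambda)$. On its left part and on its right part choose the branch of $\sqrt{-V_0}$ for which $\Re z$ increases (near infinity) from left to right, and a branch of $H=(g_- /g_+)^{1/4}$ with $\sqrt{-V_0}=-ig_+H^2$, all continuous jointly in $\lambda$ and the point of the contour. Put $$Q=\begin{bmatrix}e^{iS/(2\epsilon)}&0\\0&e^{-iS/(2\epsilon)}\end{bmatrix}\begin{bmatrix}1&1\\-1&1\end{bmatrix}\begin{bmatrix}H^{-1}&H^{-1}\\iH&-iH\end{bmatrix}.$$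 Let $\mathbf u^\alpha$ and $\mathbf u^\beta$ be the exact WKB solutions of $\mathfrak D_\epsilon\mathbf u=\lambda\mathbf u$ on $\mathbb R$ with symbols based at $-\infty$ and $+\infty$: $$\mathbf u^\alpha=e^{z(x,\lambda,\alpha(\lambda))/\epsilon}\,Q\begin{bmatrix}0&1\\1&0\end{bmatrix}\mathbf w^+,\ \ \mathbf w^+\to\begin{bmatrix}1\\0\end{bmatrix}\ (x\to-\infty),\qquad \mathbf u^\beta=e^{-z(x,\lambda,\beta(\lambda))/\epsilon}\,Q\,\mathbf w^-,\ \ \mathbf w^-\to\begin{bmatrix}1\\0\end{bmatrix}\ (x\to+\infty).$$ They decay at $-\infty$ and at $+\infty$ respectively. If $\lambda$ is an eigenvalue, its norming constant is the $\kappa$ with $\mathbf u^\beta=\kappa\,\mathbf u^\alpha$. **Statement.** There are an open neighbourhood $U$ of $\lambda_0$ and constants $C_0,\epsilon_0>0$ such that for all $0<\epsilon<\epsilon_0$: 1. every eigenvalue $\lambda\in U$ of $\mathfrak D_\epsilon$ has a norming constant $\kappa$, and $|\kappa-1|\le C_0\epsilon$ or $|\kappa+1|\le C_0\epsilon$, i.e.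 $\kappa=\pm1+\mathcal O(\epsilon)$ uniformly for eigenvalues in $U$; 2. the signs alternate along the arc. Let $I(\lambda)=z(\beta(\lambda),\lambda,\alpha(\lambda))$ be the action integral along $C^0$ (for a branch of $\sqrt{-V_0}$ continuous in $\lambda$ and the point of $C^0$), and suppose $I'(\lambda_0)\ne0$, so that $\Re I=0$ is a regular arc near $\lambda_0$, along which $\Im I$ is strictly monotone. If $\lambda_1,\lambda_2\in U$ are eigenvalues with $\Im I(\lambda_1)<\Im I(\lambda_2)$ and no eigenvalue in $U$ has $\Im I$ strictly between these two values, then one of their norming constants is within $C_0\epsilon$ of $1$ and the other is within $C_0\epsilon$ of $-1$. -/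

import Mathlib

open Set Filter Topology MeasureTheory

namespace ZakharovShabat

noncomputable section

/-! Potentials, the Dirac operator and its eigenvalues -/

/-- `A` and `S` are holomorphic in a simply connected complex neighbourhood `Ω` of the real axis
and real on the real axis; `A`, `S`, `S'` are integrable on `ℝ`, and `A'`, `S''` are
integrable and bounded on `ℝ`. Here `deriv` is the complex derivative. -/
structure AdmissiblePotentials (Ω : Set ℂ) (A S : ℂ → ℂ) : Prop where
  isOpen : IsOpen Ω
  simplyConnected : IsSimplyConnected Ω
  real_mem : ∀ x : ℝ, (x : ℂ) ∈ Ω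
  holomorphic_A : DifferentiableOn ℂ A Ω
  holomorphic_S : DifferentiableOn ℂ S Ω
  real_A : ∀ x : ℝ, (A x).im = 0
  real_S : ∀ x : ℝ, (S x).im = 0
  integrable_A : Integrable (fun x : ℝ => A x)
  integrable_S : Integrable (fun x : ℝ => S x)
  integrable_S' : Integrable (fun x : ℝ => deriv S x)
  integrable_A' : Integrable (fun x : ℝ => deriv A x)
  integrable_S'' : Integrable (fun x : ℝ => deriv (deriv S) x)
  bounded : ∃ M : ℝ, ∀ x : ℝ, ‖deriv A x‖ ≤ M ∧ ‖deriv (deriv S) x‖ ≤ M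

/-- The potential `ω(x, ε) = -i A(x) exp(i S(x) / ε)`. -/
def omega (A S : ℂ → ℂ) (ε x : ℝ) : ℂ :=
  -Complex.I * A x * Complex.exp (Complex.I * S x / ε)

/-- The Dirac (Zakharov-Shabat) operator
`[[-(ε/i) d/dx, ω], [-ω^*, (ε/i) d/dx]]` applied to `u`. -/
def diracOp (A S : ℂ → ℂ) (ε : ℝ) (u : ℝ → Fin 2 → ℂ) (x : ℝ) : Fin 2 → ℂ :=
  ![-(ε / Complex.I) * deriv (fun y => u y 0) x + omega A S ε x * u x 1,
    -(starRingEnd ℂ (omega A S ε x)) * u x 0 + (ε / Complex.I) * deriv (fun y => u y 1) x]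

/-- `u` solves `𝔇_ε u = lam u` on the real line. -/
def IsSolution (A S : ℂ → ℂ) (ε : ℝ) (lam : ℂ) (u : ℝ → Fin 2 → ℂ) : Prop :=
  Differentiable ℝ u ∧ ∀ x, diracOp A S ε u x = lam • u x

/-- `lam` is an eigenvalue of `𝔇_ε` on `L²(ℝ; ℂ²)`. -/
def IsEigenvalue (A S : ℂ → ℂ) (ε : ℝ) (lam : ℂ) : Prop :=
  ∃ u : ℝ → Fin 2 → ℂ, IsSolution A S ε lam u ∧ MemLp u 2 volume ∧ u ≠ 0

/-! Turning points, progressive paths, Stokes lines, admissible contours -/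

/-- `g₊(x, lam) = -(lam + S'(x)/2 + i A(x))`. -/
def gPlus (A S : ℂ → ℂ) (lam x : ℂ) : ℂ := -(lam + deriv S x / 2 + Complex.I * A x)

/-- `g₋(x, lam) = lam + S'(x)/2 - i A(x)`. -/
def gMinus (A S : ℂ → ℂ) (lam x : ℂ) : ℂ := lam + deriv S x / 2 - Complex.I * A x

/-- `V₀ = g₊ g₋ = -(lam + S'/2)² - A²`; its zeros in `x` are the turning points. -/
def V0 (A S : ℂ → ℂ) (lam x : ℂ) : ℂ := -(lam + deriv S x / 2) ^ 2 - A x ^ 2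

/-- A simple turning point: a simple zero of `V₀(·, lam)`. -/
def IsSimpleTurningPoint (A S : ℂ → ℂ) (lam x : ℂ) : Prop :=
  V0 A S lam x = 0 ∧ deriv (V0 A S lam) x ≠ 0

/-- `i ∫ √(-V₀) dx` along the part `a ≤ s ≤ b` of the curve `γ`, where `q s` is the value at
`γ s` of the chosen branch of `√(-V₀)`. -/
def phase (γ q : ℝ → ℂ) (a b : ℝ) : ℂ :=
  Complex.I * ∫ t in a..b, q t * deriv γ t

/-- `q` is a continuous branch of `√(-V₀(·, lam))` along `γ` over the parameter set `J`. -/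
def IsSqrtBranch (A S : ℂ → ℂ) (lam : ℂ) (γ q : ℝ → ℂ) (J : Set ℝ) : Prop :=
  ContinuousOn q J ∧ ∀ s ∈ J, q s ^ 2 = -V0 A S lam (γ s)

/-- The part of `γ` over the interval `J` is free of turning points and progressive:
`Re z` is strictly monotone along it (strictly increasing for one of the two branches). -/
def IsProgressive (A S : ℂ → ℂ) (lam : ℂ) (γ : ℝ → ℂ) (J : Set ℝ) : Prop :=
  (∀ s ∈ J, V0 A S lam (γ s) ≠ 0) ∧
  ∃ q : ℝ → ℂ, IsSqrtBranch A S lam γ q J ∧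
    ∀ s ∈ J, ∀ t ∈ J, s < t → 0 < (phase γ q s t).re

/-- `Re z` is constant along the part of `γ` over the interval `J`. -/
def IsStokes (A S : ℂ → ℂ) (lam : ℂ) (γ : ℝ → ℂ) (J : Set ℝ) : Prop :=
  ∃ q : ℝ → ℂ, IsSqrtBranch A S lam γ q J ∧
    ∀ s ∈ J, ∀ t ∈ J, s < t → (phase γ q s t).re = 0

/-- `γ` parametrizes an admissible contour for `lam`: `C⁻` is the part `s ≤ 0`, `C⁰` the part
`0 ≤ s ≤ 1` and `C⁺` the part `1 ≤ s`, with `x₋ = γ 0` and `x₊ = γ 1`. As `Ω` is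
simply connected, the region enclosed by the contour and the real axis lies in `Ω`.
The three Stokes lines at a simple turning point meet at angles `2π/3`, so the angle conditions
say that `C⁻` (resp. `C⁺`) leaves `x₋` (resp. `x₊`) through the sector
between the two Stokes lines other than `C⁰`. -/
structure IsAdmissibleContour (A S : ℂ → ℂ) (Ω : Set ℂ) (lam : ℂ) (γ : ℝ → ℂ) : Prop where
  mem : ∀ s, γ s ∈ Ω
  continuous : Continuous γ
  smooth_left : ContDiffOn ℝ 1 γ (Iic 0)
  smooth_mid : ContDiffOn ℝ 1 γ (Icc 0 1)
  smooth_right : ContDiffOn ℝ 1 γ (Ici 1)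
  regular_left : ∀ s ∈ Iic (0 : ℝ), derivWithin γ (Iic 0) s ≠ 0
  regular_mid : ∀ s ∈ Icc (0 : ℝ) 1, derivWithin γ (Icc 0 1) s ≠ 0
  regular_right : ∀ s ∈ Ici (1 : ℝ), derivWithin γ (Ici 1) s ≠ 0
  real_left : ∀ᶠ s : ℝ in atBot, γ s = s
  real_right : ∀ᶠ s : ℝ in atTop, γ s = s
  turning_left : IsSimpleTurningPoint A S lam (γ 0)
  turning_right : IsSimpleTurningPoint A S lam (γ 1)
  turning_ne : γ 0 ≠ γ 1
  progressive_left : IsProgressive A S lam γ (Iio 0)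
  progressive_right : IsProgressive A S lam γ (Ioi 1)
  stokes : IsStokes A S lam γ (Ioo 0 1)
  sector_left : 2 * Real.pi / 3 <
    InnerProductGeometry.angle (-derivWithin γ (Iic 0) 0) (derivWithin γ (Icc 0 1) 0)
  sector_right : 2 * Real.pi / 3 <
    InnerProductGeometry.angle (derivWithin γ (Ici 1) 1) (-derivWithin γ (Icc 0 1) 1)

/-- `a` is the continuation in `lam` of the turning point `a₀` of `lam₀`. -/
def IsTurningPointFamily (A S : ℂ → ℂ) (lam₀ a₀ : ℂ) (a : ℂ → ℂ) : Prop :=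
  a lam₀ = a₀ ∧ ContinuousAt a lam₀ ∧ ∀ᶠ lam in 𝓝 lam₀, V0 A S lam (a lam) = 0

/-! Exact WKB solutions for `lam` near `lam₀` -/

/-- A `C¹` bump function, equal to `1` at `0` and supported in `[-1/2, 1/2]`. -/
def bump (s : ℝ) : ℝ := (max 0 (1 - 4 * s ^ 2)) ^ 2

/-- The contour `γ`, deformed near its two turning points so that it passes through
`α(lam)` at `s = 0` and through `β(lam)` at `s = 1`. -/
def deformed (γ : ℝ → ℂ) (α β : ℂ → ℂ) (lam : ℂ) (s : ℝ) : ℂ :=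
  γ s + bump s * (α lam - γ 0) + bump (s - 1) * (β lam - γ 1)

/-- Branches of `√(-V₀)` along the deformed contours, and of `H = (g₋/g₊)^{1/4}` along their
left and right parts, jointly continuous in `lam ∈ U` and the parameter of the contour. The
relation `√(-V₀) = -i g₊ H²` is the one that the WKB ansatz requires; it implies
`H⁴ = g₋/g₊`. On the left and on the right part the sign of `√(-V₀)` is such that `Re z`
increases with the parameter near infinity. -/
structure Branches (A S : ℂ → ℂ) (γ : ℝ → ℂ) (α β : ℂ → ℂ) (U : Set ℂ) where
  qL : ℂ → ℝ → ℂ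
  qC : ℂ → ℝ → ℂ
  qR : ℂ → ℝ → ℂ
  HL : ℂ → ℝ → ℂ
  HR : ℂ → ℝ → ℂ
  continuous_qL : ContinuousOn (fun p : ℂ × ℝ => qL p.1 p.2) (U ×ˢ Iio 0)
  continuous_qC : ContinuousOn (fun p : ℂ × ℝ => qC p.1 p.2) (U ×ˢ Ioo 0 1)
  continuous_qR : ContinuousOn (fun p : ℂ × ℝ => qR p.1 p.2) (U ×ˢ Ioi 1)
  continuous_HL : ContinuousOn (fun p : ℂ × ℝ => HL p.1 p.2) (U ×ˢ Iio 0)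
  continuous_HR : ContinuousOn (fun p : ℂ × ℝ => HR p.1 p.2) (U ×ˢ Ioi 1)
  sqrt_L : ∀ lam ∈ U, IsSqrtBranch A S lam (deformed γ α β lam) (qL lam) (Iio 0)
  sqrt_C : ∀ lam ∈ U, IsSqrtBranch A S lam (deformed γ α β lam) (qC lam) (Ioo 0 1)
  sqrt_R : ∀ lam ∈ U, IsSqrtBranch A S lam (deformed γ α β lam) (qR lam) (Ioi 1)
  root_L : ∀ lam ∈ U, ∀ s ∈ Iio (0 : ℝ),
    qL lam s = -Complex.I * gPlus A S lam (deformed γ α β lam s) * HL lam s ^ 2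
  root_R : ∀ lam ∈ U, ∀ s ∈ Ioi (1 : ℝ),
    qR lam s = -Complex.I * gPlus A S lam (deformed γ α β lam s) * HR lam s ^ 2
  sign_L : ∀ lam ∈ U, ∀ᶠ s in atBot, 0 < (Complex.I * qL lam s).re
  sign_R : ∀ lam ∈ U, ∀ᶠ s in atTop, 0 < (Complex.I * qR lam s).re

/-- The matrix `Q` of the WKB ansatz at the real point `x`, with `h` the value of `H`. -/
def wkbMatrix (S : ℂ → ℂ) (ε x : ℝ) (h : ℂ) : Matrix (Fin 2) (Fin 2) ℂ :=
  !![Complex.exp (Complex.I * S x / (2 * ε)), 0; 0, Complex.exp (-(Complex.I * S x / (2 * ε)))] *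
    !![1, 1; -1, 1] * !![h⁻¹, h⁻¹; Complex.I * h, -(Complex.I * h)]

section Solutions

variable {A S : ℂ → ℂ} {γ : ℝ → ℂ} {α β : ℂ → ℂ} {U : Set ℂ}

/-- `z(x, lam, α)` at the point with parameter `s ≤ 0` of the left part of the contour. -/
def zLeft (W : Branches A S γ α β U) (lam : ℂ) (s : ℝ) : ℂ :=
  phase (deformed γ α β lam) (W.qL lam) 0 s

/-- `z(x, lam, β)` at the point with parameter `s ≥ 1` of the right part of the contour. -/
def zRight (W : Branches A S γ α β U) (lam : ℂ) (s : ℝ) : ℂ :=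
  phase (deformed γ α β lam) (W.qR lam) 1 s

/-- The action integral `z(β(lam), lam, α(lam))` along `C⁰`. -/
def actionIntegral (W : Branches A S γ α β U) (lam : ℂ) : ℂ :=
  phase (deformed γ α β lam) (W.qC lam) 0 1

/-- `u` is the exact WKB solution `u⁺` whose phase is based at `α(lam)` and whose symbol `w` is
based at `-∞`: `u = e^{z/ε} Q [[0,1],[1,0]] w` with `w → (1,0)` at `-∞` (where the contour
is the real axis with parameter `x`). This is the WKB-normalized solution decaying at `-∞`. -/
def IsLeftWKB (W : Branches A S γ α β U) (ε : ℝ) (lam : ℂ) (u : ℝ → Fin 2 → ℂ) : Prop :=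
  IsSolution A S ε lam u ∧
  ∃ w : ℝ → Fin 2 → ℂ, Tendsto w atBot (𝓝 ![1, 0]) ∧
    ∀ᶠ x in atBot, u x = Complex.exp (zLeft W lam x / ε) •
      (wkbMatrix S ε x (W.HL lam x) * !![0, 1; 1, 0]).mulVec (w x)

/-- `u` is the exact WKB solution `u⁻` whose phase is based at `β(lam)` and whose symbol `w` is
based at `+∞`: `u = e^{-z/ε} Q w` with `w → (1,0)` at `+∞`. This is the
WKB-normalized solution decaying at `+∞`. -/
def IsRightWKB (W : Branches A S γ α β U) (ε : ℝ) (lam : ℂ) (u : ℝ → Fin 2 → ℂ) : Prop :=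
  IsSolution A S ε lam u ∧
  ∃ w : ℝ → Fin 2 → ℂ, Tendsto w atTop (𝓝 ![1, 0]) ∧
    ∀ᶠ x in atTop, u x = Complex.exp (-(zRight W lam x) / ε) •
      (wkbMatrix S ε x (W.HR lam x)).mulVec (w x)

/-- `κ` is the norming constant: the ratio of the solution decaying at `+∞` to the solution
decaying at `-∞`. -/
def IsNormingConstant (W : Branches A S γ α β U) (ε : ℝ) (lam κ : ℂ) : Prop :=
  ∃ uL uR : ℝ → Fin 2 → ℂ, IsLeftWKB W ε lam uL ∧ IsRightWKB W ε lam uR ∧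
    ∀ x, uR x = κ • uL x

/-- `lam₂` is the next eigenvalue in `N` after `lam₁` as one moves along the arc, that is, in
the order of the imaginary part of the action integral. -/
def IsNextEigenvalue (W : Branches A S γ α β U) (N : Set ℂ) (ε : ℝ) (lam₁ lam₂ : ℂ) : Prop :=
  lam₁ ∈ N ∧ lam₂ ∈ N ∧ IsEigenvalue A S ε lam₁ ∧ IsEigenvalue A S ε lam₂ ∧
  (actionIntegral W lam₁).im < (actionIntegral W lam₂).im ∧
  ∀ mu ∈ N, IsEigenvalue A S ε mu →
    ¬ ((actionIntegral W lam₁).im < (actionIntegral W mu).im ∧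
      (actionIntegral W mu).im < (actionIntegral W lam₂).im)

end Solutions

end

end ZakharovShabat

open ComplexConjugate
open Complex (I exp I_sq exp_add norm_real exp_ne_zero re_ofReal_mul exp_nat_mul I_ne_zero norm_I)
open Metric (ball isOpen_ball mem_ball_self ball_mem_nhds ball_subset_ball)

namespace ZakharovShabat

variable {P M A S α β : ℂ → ℂ} {Ω U N B : Set ℂ} {ε ρ x0 ς R a b s t : ℝ} {lam μ p a₀ x τ : ℂ} {e : ℤ}
variable {γ : ℝ → ℂ} {H Z H' Z' ξ ξ' ν ω : ℂ → ℂ → ℂ} {y : ℝ → ℂ → ℂ → ℂ × ℂ} {r h rC : ℂ → ℝ → ℂ}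
variable (hΩ : IsOpen Ω) (hΩ' : IsSimplyConnected Ω)
variable (hP : DifferentiableOn ℂ P Ω) (hM : DifferentiableOn ℂ M Ω)

/-- Points of a local system: a base point together with a value over it. -/
structure LocalSystem (X V : Type*) where
  base : X
  val : V

/-- A local system with locally trivial transport `T` over a simply connected space has global
horizontal sections. -/
theorem exists_horizontal_section {X V : Type*} [TopologicalSpace X] [SimplyConnectedSpace X]
    [LocallyPathConnectedSpace X] (T : X → X → V → V) (hT : ∀ x0, ∃ B : Set X, IsOpen B ∧ x0 ∈ B ∧ ∃
    φ : X → V ≃ V, ∀ x ∈ B, ∀ᶠ y in 𝓝 x, ∀ v, T x y v = φ y ((φ x).symm v)) (x0 : X) (v0 : V) : ∃ s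
    : X → V, s x0 = v0 ∧ ∀ x, ∀ᶠ y in 𝓝 x, s y = T x y (s x) := by
  classical
  let top : TopologicalSpace (LocalSystem X V) :=
    { IsOpen := fun W => ∀ e ∈ W, ∀ᶠ y in 𝓝 e.base, LocalSystem.mk y (T e.base y e.val) ∈ W
      isOpen_univ := fun e _ => by simp
      isOpen_inter := fun W1 W2 h₁ h₂ e he => (h₁ e he.1).and (h₂ e he.2)
      isOpen_sUnion := fun 𝒲 h e ⟨W, hW, he⟩ =>
        (h W hW e he).mono fun y hy => ⟨W, hW, hy⟩ }
  have open_def : ∀ W : Set (LocalSystem X V), IsOpen W ↔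
    ∀ e ∈ W, ∀ᶠ y in 𝓝 e.base, LocalSystem.mk y (T e.base y e.val) ∈ W := fun W => Iff.rfl
  let : TopologicalSpace V := ⊥
  have : DiscreteTopology V := ⟨rfl⟩
  have : Nonempty V := ⟨v0⟩
  have : Nonempty (X → LocalSystem X V) := ⟨fun x => ⟨x, v0⟩⟩
  choose B hBo hxB φ hφ using hT
  have sheet_open : ∀ x0 v, ∀ W ⊆ B x0, IsOpen W →
      IsOpen (LocalSystem.base ⁻¹' W ∩ {e : LocalSystem X V | e.val = φ x0 e.base v}) := by
    intro x0 v W hW hWo e he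
    filter_upwards [hφ x0 e.base (hW he.1), hWo.mem_nhds he.1] with y hy hyW
    refine ⟨hyW, ?_⟩
    have := he.2
    simp only [mem_ofPred_eq] at this
    simp [hy, this]
  have cov : IsCoveringMap (LocalSystem.base : LocalSystem X V → X) := by
    refine IsCoveringMap.mk _ (fun _ => V) (fun x0 => IsOpen.trivializationDiscrete
      (fun v => {e : LocalSystem X V | e.val = φ x0 e.base v}) (B x0) (hBo x0) ?_ ?_ ?_ ?_ ?_)
      fun x => hxB x
    · intro v W hW
      refine ⟨sheet_open x0 v W hW, fun h => isOpen_iff_mem_nhds.2 fun x hx => ?_⟩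
      have := (open_def _).1 h ⟨x, φ x0 x v⟩ ⟨hx, rfl⟩
      exact this.mono fun y hy => hy.1
    · rintro v ⟨x, a⟩ ha ⟨y, b⟩ hb hxy
      simp only [mem_ofPred_eq] at ha hb hxy
      subst hxy; subst ha; subst hb; rfl
    · intro v x hx
      exact ⟨⟨x, φ x0 x v⟩, rfl, rfl⟩
    · intro v w hvw
      refine Set.disjoint_left.2 fun e h₁ h₂ => hvw ?_
      simp only [mem_ofPred_eq] at h₁ h₂
      exact (φ x0 e.base).injective (h₁.symm.trans h₂)
    · intro e he
      exact mem_iUnion.2 ⟨(φ x0 e.base).symm e.val, by simp⟩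
  obtain ⟨F, ⟨hF0, hF⟩, -⟩ := cov.existsUnique_continuousMap_lifts (ContinuousMap.id X) x0
    ⟨x0, v0⟩ rfl
  have hbase : ∀ x, (F x).base = x := fun x => congrFun hF x
  refine ⟨fun x => (F x).val, by simp [hF0], fun x => ?_⟩
  have h₁ := (sheet_open x ((φ x x).symm (F x).val) (B x) subset_rfl (hBo x)).mem_nhds
    (x := F x) ⟨by simp [hbase, hxB], by simp [hbase]⟩
  filter_upwards [F.continuous.continuousAt.preimage_mem_nhds h₁, hφ x x (hxB x)] with y hy hy'
  have := hy.2
  simp only [mem_ofPred_eq, hbase] at this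
  simp [this, hy']

/-! Integrals depending holomorphically on a parameter, and primitives on discs -/

theorem differentiableOn_integral_param {E : Type*} [NormedAddCommGroup E] [NormedSpace ℂ E]
    [CompleteSpace E] {mu : Measure ℝ} (hU : IsOpen U) {F : ℂ → ℝ → E} {b : ℝ → ℝ}
    (hm : ∀ lam ∈ U, AEStronglyMeasurable (F lam) mu) (hb : ∀ᵐ t ∂mu, ∀ lam ∈ U, ‖F lam t‖ ≤ b t)
    (hbi : Integrable b mu) (hd : ∀ᵐ t ∂mu, DifferentiableOn ℂ (fun lam => F lam t) U) :
    DifferentiableOn ℂ (fun lam => ∫ t, F lam t ∂mu) U := by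
  intro μ h₀
  obtain ⟨r, hr, hrU⟩ := Metric.isOpen_iff.1 hU μ h₀
  have hball : ∀ lam ∈ ball μ (r / 2), Metric.closedBall lam (r / 4) ⊆ U := by
    intro lam hl x hx
    apply hrU
    simp only [Metric.mem_ball, Metric.mem_closedBall] at *
    linarith [dist_triangle x lam μ]
  have hr4 : 0 < r / 4 := by positivity
  refine ((hasDerivAt_integral_of_dominated_loc_of_deriv_le (F := F)
    (F' := fun lam t => deriv (fun l => F l t) lam) (bound := fun t => b t / (r / 4))
    (ball_mem_nhds μ (half_pos hr)) ?_ ?_ ?_ ?_ (hbi.div_const _) ?_).2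
    |>.differentiableAt.differentiableWithinAt)
  · filter_upwards [hU.mem_nhds h₀] with lam hl using hm lam hl
  · exact hbi.mono' (hm _ h₀) (hb.mono fun t ht => ht _ h₀)
  · have hseq : Tendsto (fun n : ℕ => μ + ((r / 4 / (n + 1) : ℝ) : ℂ)) atTop (𝓝[≠] μ) := by
      refine tendsto_nhdsWithin_iff.2 ⟨?_, Eventually.of_forall fun n => ?_⟩
      · have h1 : Tendsto (fun n : ℕ => r / 4 / ((n : ℝ) + 1)) atTop (𝓝 0) :=
          tendsto_const_nhds.div_atTop (tendsto_atTop_add_const_right _ _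
            tendsto_natCast_atTop_atTop)
        have := (Complex.continuous_ofReal.tendsto 0).comp h1
        simpa using this.const_add μ
      · have : (r / 4 / ((n : ℝ) + 1)) ≠ 0 := by positivity
        simp only [mem_compl_iff, mem_singleton_iff, add_eq_left]
        exact_mod_cast this
    have hmem : ∀ n : ℕ, μ + ((r / 4 / (n + 1) : ℝ) : ℂ) ∈ U := by
      intro n
      apply hball μ (mem_ball_self (half_pos hr))
      have : r / 4 / ((n : ℝ) + 1) ≤ r / 4 := div_le_self hr4.le (by linarith [n.cast_nonneg (α := ℝ)])
      rw [Metric.mem_closedBall, dist_eq_norm, add_sub_cancel_left, norm_real,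
        Real.norm_of_nonneg (by positivity)]
      exact this
    refine aestronglyMeasurable_of_tendsto_ae atTop
      (f := fun (n : ℕ) t => slope (fun l => F l t) μ (μ + ((r / 4 / (n + 1) : ℝ) : ℂ)))
      (fun n => ?_) ?_
    · simp only [slope_def_module]
      exact ((hm _ (hmem n)).sub (hm _ h₀)).const_smul _
    · filter_upwards [hd] with t ht
      exact (hasDerivAt_iff_tendsto_slope.1
        ((ht μ h₀).differentiableAt (hU.mem_nhds h₀)).hasDerivAt).comp hseq
  · filter_upwards [hb, hd] with t ht ht' lam hl
    refine Complex.norm_deriv_le_of_forall_mem_sphere_norm_le hr4 ?_ fun z hz =>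
      ht z (hball lam hl (Metric.sphere_subset_closedBall hz))
    exact (ht'.mono (hball lam hl)).diffContOnCl_ball subset_rfl
  · filter_upwards [hd] with t ht lam hl
    have hlU := hball lam hl (Metric.mem_closedBall_self hr4.le)
    exact ((ht lam hlU).differentiableAt (hU.mem_nhds hlU)).hasDerivAt

/-- The primitive of `f` along the segment from `c`. -/
noncomputable def radialPrimitive {E : Type*} [NormedAddCommGroup E] [NormedSpace ℂ E] (f : ℂ → E)
    (c x : ℂ) : E :=
  ∫ t in (0 : ℝ)..1, (x - c) • f (c + t * (x - c))

theorem add_mul_sub_mem_ball {c : ℂ} {r : ℝ} (hx : x ∈ ball c r) (ht : t ∈ Icc (0 : ℝ) 1) : c + t *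
    (x - c) ∈ ball c r := by
  have h := (convex_ball c r).add_smul_sub_mem (mem_ball_self
    (Metric.pos_of_mem_ball hx)) hx ht
  simpa using h

theorem hasDerivAt_radialPrimitive {E : Type*} [NormedAddCommGroup E] [NormedSpace ℂ E]
    [CompleteSpace E] {f : ℂ → E} {c : ℂ} {r : ℝ} (hf : DifferentiableOn ℂ f (ball c r))
    (hx : x ∈ ball c r) : HasDerivAt (radialPrimitive f c) (f x) x := by
  obtain ⟨g, hg⟩ := hf.isExactOn_ball
  have hc := mem_ball_self (x := c) (Metric.pos_of_mem_ball hx)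
  have key : ∀ y ∈ ball c r, radialPrimitive f c y = g y - g c := by
    intro y hy
    have h1 : ∀ t ∈ uIcc (0 : ℝ) 1, HasDerivAt (fun t : ℝ => g (c + t * (y - c)))
        ((y - c) • f (c + t * (y - c))) t := by
      intro t ht
      rw [uIcc_of_le zero_le_one] at ht
      have h2 : HasDerivAt (fun t : ℝ => c + t * (y - c)) (y - c) t := by
        simpa using ((Complex.ofRealCLM.hasDerivAt (x := t)).mul_const (y - c)).const_add c
      exact (hg _ (add_mul_sub_mem_ball hy ht)).scomp t h2
    have h3 : IntervalIntegrable (fun t : ℝ => (y - c) • f (c + t * (y - c))) volume 0 1 := by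
      apply ContinuousOn.intervalIntegrable
      rw [uIcc_of_le zero_le_one]
      refine (hf.continuousOn.comp (by fun_prop) fun t ht => add_mul_sub_mem_ball hy ht).const_smul _
    have := intervalIntegral.integral_eq_sub_of_hasDerivAt h1 h3
    simpa [radialPrimitive] using this
  refine ((hg x hx).sub_const (g c)).congr_of_eventuallyEq ?_
  filter_upwards [isOpen_ball.mem_nhds hx] with y hy using key y hy

theorem radialPrimitive_self {E : Type*} [NormedAddCommGroup E] [NormedSpace ℂ E] (f : ℂ → E)
    (c : ℂ) : radialPrimitive f c c = 0 := by
  simp [radialPrimitive]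

theorem norm_radialPrimitive_le {E : Type*} [NormedAddCommGroup E] [NormedSpace ℂ E] {f : ℂ → E}
    {c : ℂ} {r K : ℝ} (hx : x ∈ ball c r) (hK : ∀ y ∈ ball c r, ‖f y‖ ≤ K) : ‖radialPrimitive f c x‖
    ≤ r * K := by
  have hr := Metric.pos_of_mem_ball hx
  have h := intervalIntegral.norm_integral_le_of_norm_le_const (a := (0 : ℝ)) (b := 1)
    (f := fun t : ℝ => (x - c) • f (c + t * (x - c))) (C := r * K) fun t ht => by
      rw [uIoc_of_le zero_le_one] at ht
      rw [norm_smul]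
      have hx' : ‖x - c‖ ≤ r := by rw [← dist_eq_norm]; exact (Metric.mem_ball.1 hx).le
      exact mul_le_mul hx' (hK _ (add_mul_sub_mem_ball hx ⟨ht.1.le, ht.2⟩)) (norm_nonneg _) hr.le
  simpa [radialPrimitive] using h

theorem differentiableOn_radialPrimitive_param {E : Type*} [NormedAddCommGroup E] [NormedSpace ℂ E]
    [CompleteSpace E] (hU : IsOpen U) {f : ℂ → ℂ → E} {c : ℂ} {r K : ℝ} (hx : x ∈ ball c r)
    (hf : ∀ lam ∈ U, ContinuousOn (fun y => f y lam) (ball c r))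
    (hf' : ∀ y ∈ ball c r, DifferentiableOn ℂ (f y) U)
    (hK : ∀ y ∈ ball c r, ∀ lam ∈ U, ‖f y lam‖ ≤ K) : DifferentiableOn ℂ (fun lam => radialPrimitive
    (fun y => f y lam) c x) U := by
  simp only [radialPrimitive, intervalIntegral.integral_of_le zero_le_one]
  refine differentiableOn_integral_param hU (b := fun _ => ‖x - c‖ * K) ?_ ?_ ?_ ?_
  · intro lam hl
    refine ContinuousOn.aestronglyMeasurable ?_ measurableSet_Ioc
    exact (((hf lam hl).comp (by fun_prop) fun t ht => add_mul_sub_mem_ball hx ht).const_smul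
      _).mono Ioc_subset_Icc_self
  · refine (ae_restrict_iff' measurableSet_Ioc).2 (Eventually.of_forall fun t ht lam hl => ?_)
    rw [norm_smul]
    exact mul_le_mul_of_nonneg_left
      (hK _ (add_mul_sub_mem_ball hx (Ioc_subset_Icc_self ht)) _ hl) (norm_nonneg _)
  · exact integrable_const _
  · refine (ae_restrict_iff' measurableSet_Ioc).2 (Eventually.of_forall fun t ht => ?_)
    exact (hf' _ (add_mul_sub_mem_ball hx (Ioc_subset_Icc_self ht))).const_smul _

/-! Linear systems of differential equations with a holomorphic parameter -/

theorem exists_local_linear_solution {E : Type*} [NormedAddCommGroup E] [NormedSpace ℂ E]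
    [CompleteSpace E] (hU : IsOpen U) {N : ℂ → ℂ → E →L[ℂ] E} {r K : ℝ} (hr : 0 < r) (hN : ∀ lam ∈
    U, DifferentiableOn ℂ (fun x => N x lam) (ball p r))
    (hN' : ∀ x ∈ ball p r, DifferentiableOn ℂ (N x) U)
    (hK : ∀ x ∈ ball p r, ∀ lam ∈ U, ‖N x lam‖ ≤ K) (hrK : r * K ≤ 1 / 2) (e : E) : ∃ Y : ℂ → ℂ → E,
    (∀ lam, Y p lam = e) ∧ (∀ lam ∈ U, ∀ x ∈ ball p r, HasDerivAt (fun x => Y x lam) (N x lam (Y x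
    lam)) x) ∧ ∀ x ∈ ball p r, DifferentiableOn ℂ (Y x) U := by
  let D : ℕ → ℂ → ℂ → E := fun n => n.rec (fun _ _ => e)
    fun _ f x lam => radialPrimitive (fun y => N y lam (f y lam)) p x
  have D0 : ∀ x lam, D 0 x lam = e := fun _ _ => rfl
  have Ds : ∀ n x lam, D (n + 1) x lam = radialPrimitive (fun y => N y lam (D n y lam)) p x :=
    fun _ _ _ => rfl
  have main : ∀ n, (∀ lam ∈ U, DifferentiableOn ℂ (fun x => D n x lam) (ball p r)) ∧
      (∀ x ∈ ball p r, DifferentiableOn ℂ (D n x) U) ∧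
      ∀ x ∈ ball p r, ∀ lam ∈ U, ‖D n x lam‖ ≤ (1 / 2) ^ n * ‖e‖ := by
    intro n
    induction n with
    | zero => exact ⟨fun lam _ => differentiableOn_const _, fun x _ => differentiableOn_const _,
        fun x _ lam _ => by simp [D0]⟩
    | succ n ih =>
      obtain ⟨h1, h2, h3⟩ := ih
      have hb : ∀ x ∈ ball p r, ∀ lam ∈ U,
          ‖N x lam (D n x lam)‖ ≤ K * ((1 / 2) ^ n * ‖e‖) := fun x hx lam hl =>
        (ContinuousLinearMap.le_opNorm _ _).trans
          (mul_le_mul (hK x hx lam hl) (h3 x hx lam hl) (norm_nonneg _)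
            ((norm_nonneg _).trans (hK x hx lam hl)))
      refine ⟨fun lam hl x hx => ?_, fun x hx => ?_, fun x hx lam hl => ?_⟩
      · exact (hasDerivAt_radialPrimitive ((hN lam hl).clm_apply (h1 lam hl))
          hx).differentiableAt.differentiableWithinAt
      · exact differentiableOn_radialPrimitive_param hU hx
          (fun lam hl => ((hN lam hl).clm_apply (h1 lam hl)).continuousOn)
          (fun y hy => (hN' y hy).clm_apply (h2 y hy)) hb
      · rw [Ds]
        refine (norm_radialPrimitive_le hx fun y hy => hb y hy lam hl).trans ?_
        calc r * (K * ((1 / 2) ^ n * ‖e‖)) = r * K * ((1 / 2) ^ n * ‖e‖) := by ring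
          _ ≤ 1 / 2 * ((1 / 2) ^ n * ‖e‖) := by gcongr
          _ = _ := by ring
  have hsum : Summable fun n : ℕ => (1 / 2 : ℝ) ^ n * ‖e‖ :=
    (summable_geometric_of_lt_one (by norm_num) (by norm_num)).mul_right _
  have hDsum : ∀ x ∈ ball p r, ∀ lam ∈ U, Summable fun n => D n x lam := fun x hx lam hl =>
    Summable.of_norm_bounded hsum fun n => (main n).2.2 x hx lam hl
  have hp := mem_ball_self (x := p) hr
  refine ⟨fun x lam => ∑' n, D n x lam, fun lam => ?_, fun lam hl x hx => ?_, fun x hx =>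
    Complex.differentiableOn_tsum_of_summable_norm hsum (fun n => (main n).2.1 x hx) hU
      fun n lam hl => (main n).2.2 x hx lam hl⟩
  · refine (tsum_eq_single 0 fun n hn => ?_).trans (D0 p lam)
    obtain ⟨m, rfl⟩ := Nat.exists_eq_succ_of_ne_zero hn
    exact radialPrimitive_self _ _
  · have hder : ∀ n, ∀ y ∈ ball p r, HasDerivAt (fun x => D (n + 1) x lam)
        (N y lam (D n y lam)) y := fun n y hy =>
      hasDerivAt_radialPrimitive ((hN lam hl).clm_apply ((main n).1 lam hl)) hy
    have h1 := hasDerivAt_tsum_of_isPreconnected (hsum.mul_left K) isOpen_ball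
      (convex_ball p r).isPreconnected hder (fun n y hy =>
        (ContinuousLinearMap.le_opNorm _ _).trans (mul_le_mul (hK y hy lam hl)
          ((main n).2.2 y hy lam hl) (norm_nonneg _) ((norm_nonneg _).trans (hK y hy lam hl))))
      hp ((summable_nat_add_iff 1).2 (hDsum p hp lam hl)) hx
    rw [← (N x lam).map_tsum (hDsum x hx lam hl)] at h1
    refine (h1.const_add e).congr_of_eventuallyEq ?_
    filter_upwards [isOpen_ball.mem_nhds hx] with y hy
    rw [(hDsum y hy lam hl).tsum_eq_zero_add, D0]

/-- The Wronskian of two vectors. -/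
def det2 (u v : ℂ × ℂ) : ℂ := u.1 * v.2 - u.2 * v.1

/-- The coefficient matrix of the system `ε y0' = i g₊ y1`, `ε y1' = -i g₋ y0` with
`g₊ = P - lam` and `g₋ = lam - M`. -/
noncomputable def sysMatrix (P M : ℂ → ℂ) (ε : ℝ) (x lam : ℂ) : ℂ × ℂ →L[ℂ] ℂ × ℂ :=
  (I * (P x - lam) / ε) • (ContinuousLinearMap.inl ℂ ℂ ℂ).comp (ContinuousLinearMap.snd ℂ ℂ ℂ) +
    (-(I * (lam - M x) / ε)) •
      (ContinuousLinearMap.inr ℂ ℂ ℂ).comp (ContinuousLinearMap.fst ℂ ℂ ℂ)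

theorem sysMatrix_apply (P M : ℂ → ℂ) (ε : ℝ) (x lam : ℂ) (y : ℂ × ℂ) : sysMatrix P M ε x lam y = (I
    * (P x - lam) / ε * y.2, -(I * (lam - M x) / ε) * y.1) := by
  simp [sysMatrix]

/-- `y` solves the system on `B`. -/
def IsSol (P M : ℂ → ℂ) (ε : ℝ) (lam : ℂ) (B : Set ℂ) (y : ℂ → ℂ × ℂ) : Prop :=
  ∀ x ∈ B, HasDerivAt y (sysMatrix P M ε x lam (y x)) x

theorem HasDerivAt.fst' {𝕜 : Type*} [NontriviallyNormedField 𝕜] [NormedAlgebra 𝕜 ℂ] {y : 𝕜 → ℂ × ℂ}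
    {y' : ℂ × ℂ} {x : 𝕜} (h : HasDerivAt y y' x) : HasDerivAt (fun x => (y x).1) y'.1 x :=
  ((ContinuousLinearMap.fst 𝕜 ℂ ℂ).hasFDerivAt).comp_hasDerivAt x h

theorem HasDerivAt.snd' {𝕜 : Type*} [NontriviallyNormedField 𝕜] [NormedAlgebra 𝕜 ℂ] {y : 𝕜 → ℂ × ℂ}
    {y' : ℂ × ℂ} {x : 𝕜} (h : HasDerivAt y y' x) : HasDerivAt (fun x => (y x).2) y'.2 x :=
  ((ContinuousLinearMap.snd 𝕜 ℂ ℂ).hasFDerivAt).comp_hasDerivAt x h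

section

variable {y u v : ℂ → ℂ × ℂ}

theorem IsSol.mono {B' : Set ℂ} (h : IsSol P M ε lam B y) (hB : B' ⊆ B) : IsSol P M ε lam B' y :=
  fun x hx => h x (hB hx)

theorem IsSol.add (hu : IsSol P M ε lam B u) (hv : IsSol P M ε lam B v) : IsSol P M ε lam B (fun x
    => u x + v x) := fun x hx => by
  rw [map_add]; exact (hu x hx).add (hv x hx)

theorem IsSol.smul (c : ℂ) (hu : IsSol P M ε lam B u) : IsSol P M ε lam B (fun x => c • u x) :=
  fun x hx => by rw [map_smul]; exact (hu x hx).const_smul c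

theorem IsSol.hasDerivAt_det2 (hu : IsSol P M ε lam B u) (hv : IsSol P M ε lam B v) (hx : x ∈ B) :
    HasDerivAt (fun x => det2 (u x) (v x)) 0 x := by
  have h1 := hu x hx
  have h2 := hv x hx
  rw [sysMatrix_apply] at h1 h2
  refine ((HasDerivAt.fst' h1).mul (HasDerivAt.snd' h2)).sub
    ((HasDerivAt.snd' h1).mul (HasDerivAt.fst' h2)) |>.congr_deriv ?_
  simp only
  ring

theorem IsSol.det2_eq (hB : IsOpen B) (hB' : IsPreconnected B) (hu : IsSol P M ε lam B u)
    (hv : IsSol P M ε lam B v) {x' : ℂ} (hx : x ∈ B) (hx' : x' ∈ B) : det2 (u x) (v x) = det2 (u x')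
    (v x') :=
  hB.is_const_of_deriv_eq_zero hB' (f := fun x => det2 (u x) (v x))
    (fun _ hz => (hu.hasDerivAt_det2 hv hz).differentiableAt.differentiableWithinAt)
    (fun _ hz => (hu.hasDerivAt_det2 hv hz).deriv) hx hx'

theorem det2_expand (w a b : ℂ × ℂ) (h : det2 a b = 1) : w = det2 w b • a + det2 a w • b := by
  simp only [det2] at h ⊢
  ext
  · simp only [Prod.fst_add, Prod.smul_fst, smul_eq_mul]; linear_combination -w.1 * h
  · simp only [Prod.snd_add, Prod.smul_snd, smul_eq_mul]; linear_combination -w.2 * h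

end

theorem differentiableOn_det2 {u v : ℂ → ℂ × ℂ} (hu : DifferentiableOn ℂ u U)
    (hv : DifferentiableOn ℂ v U) : DifferentiableOn ℂ (fun x => det2 (u x) (v x)) U := by
  unfold det2
  exact ((hu.fst.mul hv.snd).sub (hu.snd.mul hv.fst))

include hΩ in
theorem exists_local_fundamental (hU : IsOpen U) (hUb : Bornology.IsBounded U)
    (hP : DifferentiableOn ℂ P Ω) (hM : DifferentiableOn ℂ M Ω) (ε : ℝ) (hp : p ∈ Ω) (e : ℂ × ℂ) : ∃
    r > 0, ∃ Y : ℂ → ℂ → ℂ × ℂ, ball p r ⊆ Ω ∧ (∀ lam, Y p lam = e) ∧ (∀ lam ∈ U, IsSol P M ε lam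
    (ball p r) (fun x => Y x lam)) ∧ ∀ x ∈ ball p r, DifferentiableOn ℂ (Y x) U := by
  obtain ⟨R, hR⟩ := hUb.exists_norm_le
  have hPc := (hP.continuousOn.continuousAt (hΩ.mem_nhds hp)).norm.eventually_lt
    (continuousAt_const (y := ‖P p‖ + 1)) (by simp)
  have hMc := (hM.continuousOn.continuousAt (hΩ.mem_nhds hp)).norm.eventually_lt
    (continuousAt_const (y := ‖M p‖ + 1)) (by simp)
  obtain ⟨r0, hr₀, hr0'⟩ := Metric.eventually_nhds_iff_ball.1
    ((hPc.and hMc).and (hΩ.mem_nhds hp))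
  set K : ℝ := (‖P p‖ + 1 + |R|) / |ε| + (‖M p‖ + 1 + |R|) / |ε| with hKdef
  have hK0 : 0 ≤ K := by positivity
  set r := min r0 (1 / (2 * (K + 1)))
  have hr : 0 < r := lt_min hr₀ (by positivity)
  have hrK : r * K ≤ 1 / 2 := by
    calc r * K ≤ 1 / (2 * (K + 1)) * K := by gcongr; exact min_le_right _ _
      _ ≤ 1 / 2 := by rw [div_mul_eq_mul_div, div_le_div_iff₀ (by positivity) (by norm_num)]; linarith
  have hsub : ball p r ⊆ ball p r0 := ball_subset_ball (min_le_left _ _)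
  have hΩb : ball p r ⊆ Ω := fun x hx => (hr0' x (hsub hx)).2
  obtain ⟨Y, h1, h2, h3⟩ := exists_local_linear_solution hU (N := sysMatrix P M ε) (K := K) hr
    (fun lam _ => by
      have hP' := hP.mono hΩb
      have hM' := hM.mono hΩb
      unfold sysMatrix
      intro x hx
      have a1 := (((hP' x hx).sub_const lam).const_mul I).div_const (ε : ℂ)
      have a2 := ((((hM' x hx).const_sub lam).const_mul I).div_const (ε : ℂ)).neg
      exact (a1.smul_const _).add (a2.smul_const _))
    (fun x hx => by
      unfold sysMatrix
      intro lam hl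
      have a1 : DifferentiableWithinAt ℂ (fun lam => I * (P x - lam) / (ε : ℂ)) U lam := by
        fun_prop
      have a2 : DifferentiableWithinAt ℂ (fun lam => -(I * (lam - M x) / (ε : ℂ))) U lam := by
        fun_prop
      exact (a1.smul_const _).add (a2.smul_const _))
    (fun x hx lam hl => by
      have h := (hr0' x (hsub hx)).1
      have hl' := (hR lam hl).trans (le_abs_self R)
      refine ContinuousLinearMap.opNorm_le_bound _ hK0 fun y => ?_
      rw [sysMatrix_apply]
      have n1 : ‖I * (P x - lam) / (ε : ℂ)‖ ≤ K := by
        rw [norm_div, norm_mul, norm_I, one_mul, norm_real, Real.norm_eq_abs]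
        have : ‖P x - lam‖ / |ε| ≤ (‖P p‖ + 1 + |R|) / |ε| := by
          gcongr; linarith [norm_sub_le (P x) lam, h.1]
        have : 0 ≤ (‖M p‖ + 1 + |R|) / |ε| := by positivity
        linarith
      have n2 : ‖-(I * (lam - M x) / (ε : ℂ))‖ ≤ K := by
        rw [norm_neg, norm_div, norm_mul, norm_I, one_mul, norm_real,
          Real.norm_eq_abs]
        have : ‖lam - M x‖ / |ε| ≤ (‖M p‖ + 1 + |R|) / |ε| := by
          gcongr; linarith [norm_sub_le lam (M x), h.2]
        have : 0 ≤ (‖P p‖ + 1 + |R|) / |ε| := by positivity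
        linarith
      refine max_le ?_ ?_
      · rw [norm_mul]
        exact mul_le_mul n1 (norm_snd_le y) (norm_nonneg _) hK0
      · rw [norm_mul]
        exact mul_le_mul n2 (norm_fst_le y) (norm_nonneg _) hK0)
    hrK e
  exact ⟨r, hr, Y, hΩb, h1, h2, h3⟩

/-- The transport of vectors depending on a parameter in `U`. -/
noncomputable def propagator (U : Set ℂ) (Y1 Y2 : ℂ → ℂ → ℂ × ℂ) (x : ℂ) (v : ℂ → ℂ × ℂ) (lam : ℂ) :
    ℂ × ℂ :=
  open scoped Classical in
  if lam ∈ U then (v lam).1 • Y1 x lam + (v lam).2 • Y2 x lam else v lam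

/-- The inverse transport. -/
noncomputable def propagatorInv (U : Set ℂ) (Y1 Y2 : ℂ → ℂ → ℂ × ℂ) (x : ℂ) (v : ℂ → ℂ × ℂ)
    (lam : ℂ) : ℂ × ℂ :=
  open scoped Classical in
  if lam ∈ U then (det2 (v lam) (Y2 x lam), det2 (Y1 x lam) (v lam)) else v lam

include hΩ hΩ' in
theorem exists_fundamental (hU : IsOpen U) (hUb : Bornology.IsBounded U)
    (hP : DifferentiableOn ℂ P Ω) (hM : DifferentiableOn ℂ M Ω) (ε : ℝ) (hp : p ∈ Ω) {e : ℂ → ℂ × ℂ}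
    (he : DifferentiableOn ℂ e U) : ∃ Y : ℂ → ℂ → ℂ × ℂ, (∀ lam, Y p lam = e lam) ∧ (∀ lam ∈ U,
    IsSol P M ε lam Ω (fun x => Y x lam)) ∧ ∀ x ∈ Ω, DifferentiableOn ℂ (Y x) U := by
  classical
  have hloc : ∀ x : Ω, ∃ r > 0, ∃ Y1 Y2 : ℂ → ℂ → ℂ × ℂ, ball (x : ℂ) r ⊆ Ω ∧
      (∀ lam, Y1 x lam = (1, 0)) ∧ (∀ lam, Y2 x lam = (0, 1)) ∧
      (∀ lam ∈ U, IsSol P M ε lam (ball (x : ℂ) r) (fun x => Y1 x lam)) ∧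
      (∀ lam ∈ U, IsSol P M ε lam (ball (x : ℂ) r) (fun x => Y2 x lam)) ∧
      (∀ z ∈ ball (x : ℂ) r, DifferentiableOn ℂ (Y1 z) U) ∧
      ∀ z ∈ ball (x : ℂ) r, DifferentiableOn ℂ (Y2 z) U := by
    intro x
    obtain ⟨r₁, h₁, Y1, a₁, b₁, c₁, d₁⟩ :=
      exists_local_fundamental hΩ hU hUb hP hM ε x.2 (1, 0)
    obtain ⟨r₂, h₂, Y2, a₂, b₂, c₂, d2⟩ :=
      exists_local_fundamental hΩ hU hUb hP hM ε x.2 (0, 1)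
    have s1 : ball (x : ℂ) (min r₁ r₂) ⊆ ball (x : ℂ) r₁ :=
      ball_subset_ball (min_le_left _ _)
    have s2 : ball (x : ℂ) (min r₁ r₂) ⊆ ball (x : ℂ) r₂ :=
      ball_subset_ball (min_le_right _ _)
    exact ⟨min r₁ r₂, lt_min h₁ h₂, Y1, Y2, s1.trans a₁, b₁, b₂, fun lam hl => (c₁ lam hl).mono s1,
      fun lam hl => (c₂ lam hl).mono s2, fun z hz => d₁ z (s1 hz), fun z hz => d2 z (s2 hz)⟩
  choose r hr Y1 Y2 hball hY1 hY2 hs₁ hs₂ hd₁ hd₂ using hloc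
  have hdet : ∀ (q : Ω), ∀ lam ∈ U, ∀ x ∈ ball (q : ℂ) (r q),
      det2 (Y1 q x lam) (Y2 q x lam) = 1 := by
    intro q lam hl x hx
    rw [(hs₁ q lam hl).det2_eq isOpen_ball (convex_ball _ _).isPreconnected
      (hs₂ q lam hl) hx (mem_ball_self (hr q)), hY1, hY2]
    simp [det2]
  let V := {v : ℂ → ℂ × ℂ // DifferentiableOn ℂ v U}
  have hprop : ∀ (q : Ω), ∀ x ∈ ball (q : ℂ) (r q), ∀ v : ℂ → ℂ × ℂ,
      DifferentiableOn ℂ v U → DifferentiableOn ℂ (propagator U (Y1 q) (Y2 q) x v) U := by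
    intro q x hx v hv
    refine DifferentiableOn.congr (f := fun lam => (v lam).1 • Y1 q x lam + (v lam).2 • Y2 q x lam)
      ((hv.fst.smul (hd₁ q x hx)).add (hv.snd.smul (hd₂ q x hx))) fun lam hl => ?_
    simp [propagator, hl]
  have hprop' : ∀ (q : Ω), ∀ x ∈ ball (q : ℂ) (r q), ∀ v : ℂ → ℂ × ℂ,
      DifferentiableOn ℂ v U → DifferentiableOn ℂ (propagatorInv U (Y1 q) (Y2 q) x v) U := by
    intro q x hx v hv
    refine DifferentiableOn.congr
      (f := fun lam => (det2 (v lam) (Y2 q x lam), det2 (Y1 q x lam) (v lam)))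
      ((differentiableOn_det2 hv (hd₂ q x hx)).prodMk
        (differentiableOn_det2 (hd₁ q x hx) hv)) fun lam hl => ?_
    simp [propagatorInv, hl]
  let φ : Ω → Ω → V ≃ V := fun q x =>
    if hx : (x : ℂ) ∈ ball (q : ℂ) (r q) then
      { toFun := fun v => ⟨propagator U (Y1 q) (Y2 q) x v.1, hprop q x hx v.1 v.2⟩
        invFun := fun v => ⟨propagatorInv U (Y1 q) (Y2 q) x v.1, hprop' q x hx v.1 v.2⟩
        left_inv := fun v => by
          ext lam : 2
          by_cases hl : lam ∈ U
          · have h := hdet q lam hl x hx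
            simp only [det2] at h
            simp only [propagatorInv, propagator, hl, if_true, det2]
            ext
            · simp only [Prod.fst_add, Prod.snd_add, Prod.smul_fst, Prod.smul_snd, smul_eq_mul]
              linear_combination (v.1 lam).1 * h
            · simp only [Prod.fst_add, Prod.snd_add, Prod.smul_fst, Prod.smul_snd, smul_eq_mul]
              linear_combination (v.1 lam).2 * h
          · simp [propagatorInv, propagator, hl]
        right_inv := fun v => by
          ext lam : 2
          by_cases hl : lam ∈ U
          · simp only [propagatorInv, propagator, hl, if_true]
            exact (det2_expand _ _ _ (hdet q lam hl x hx)).symm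
          · simp [propagatorInv, propagator, hl] }
    else Equiv.refl V
  have hφ : ∀ (q x : Ω), (x : ℂ) ∈ ball (q : ℂ) (r q) → ∀ v : V, ∀ lam ∈ U,
      (φ q x v).1 lam = (v.1 lam).1 • Y1 q x lam + (v.1 lam).2 • Y2 q x lam := by
    intro q x hx v lam hl
    simp only [φ]
    rw [dif_pos hx]
    simp [propagator, hl]
  have hφ' : ∀ (q x : Ω), (x : ℂ) ∈ ball (q : ℂ) (r q) → ∀ v : V, ∀ lam, lam ∉ U →
      (φ q x v).1 lam = v.1 lam := by
    intro q x hx v lam hl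
    simp only [φ]
    rw [dif_pos hx]
    simp [propagator, hl]
  have hself : ∀ (x : Ω) (v : V), φ x x v = v := by
    intro x v
    ext lam : 2
    by_cases hl : lam ∈ U
    · rw [hφ x x (mem_ball_self (hr x)) v lam hl, hY1, hY2]
      ext <;> simp
    · rw [hφ' x x (mem_ball_self (hr x)) v lam hl]
  have hΩs : SimplyConnectedSpace Ω := hΩ'.simplyConnectedSpace
  have hΩl : LocallyPathConnectedSpace Ω := hΩ.locallyPathConnectedSpace
  obtain ⟨s, hs₀, hs⟩ := exists_horizontal_section (fun x y v => φ x y v) (fun q =>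
    ⟨{x : Ω | (x : ℂ) ∈ ball (q : ℂ) (r q)},
      isOpen_ball.preimage continuous_subtype_val, mem_ball_self (hr q), φ q, by
    intro x hx
    obtain ⟨t, ht, htb⟩ := Metric.isOpen_iff.1 (isOpen_ball.inter isOpen_ball)
      (x : ℂ) ⟨mem_ball_self (hr x), hx⟩
    filter_upwards [(continuous_subtype_val (p := fun z => z ∈ Ω)).continuousAt.preimage_mem_nhds
      (ball_mem_nhds (x : ℂ) ht)] with y hy v
    obtain ⟨hy1, hy₂⟩ := htb hy
    set w := (φ q x).symm v with hw
    have hv : v = φ q x w := by simp [hw]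
    ext lam : 2
    by_cases hl : lam ∈ U
    · rw [hφ x y hy1 _ lam hl, hφ q y hy₂ _ lam hl]
      have hu : IsSol P M ε lam (ball (x : ℂ) t) (fun z =>
          (w.1 lam).1 • Y1 q z lam + (w.1 lam).2 • Y2 q z lam) :=
        (((hs₁ q lam hl).smul _).add ((hs₂ q lam hl).smul _)).mono fun z hz => (htb hz).2
      have hpre := (convex_ball (x : ℂ) t).isPreconnected
      have e₁ := hu.det2_eq isOpen_ball hpre ((hs₂ x lam hl).mono fun z hz => (htb hz).1)
        hy (mem_ball_self ht)
      have e₂ := ((hs₁ x lam hl).mono fun z hz => (htb hz).1).det2_eq isOpen_ball hpre hu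
        hy (mem_ball_self ht)
      have hvx : v.1 lam = (w.1 lam).1 • Y1 q x lam + (w.1 lam).2 • Y2 q x lam := by
        rw [hv, hφ q x hx _ lam hl]
      simp only [← hvx, hY1, hY2] at e₁ e₂
      rw [det2_expand ((w.1 lam).1 • Y1 q y lam + (w.1 lam).2 • Y2 q y lam) _ _
        (hdet x lam hl y hy1), e₁, e₂]
      simp [det2]
    · rw [hφ' x y hy1 _ lam hl, hφ' q y hy₂ _ lam hl, hv, hφ' q x hx _ lam hl]⟩)
    ⟨p, hp⟩ ⟨e, he⟩
  refine ⟨fun x lam => if hx : x ∈ Ω then (s ⟨x, hx⟩).1 lam else 0, fun lam => ?_,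
    fun lam hl x hx => ?_, fun x hx => ?_⟩
  · simp [hp, hs₀]
  · have hev : (fun y => if hy : y ∈ Ω then (s ⟨y, hy⟩).1 lam else 0) =ᶠ[𝓝 x]
        fun y => ((s ⟨x, hx⟩).1 lam).1 • Y1 ⟨x, hx⟩ y lam +
          ((s ⟨x, hx⟩).1 lam).2 • Y2 ⟨x, hx⟩ y lam := by
      have h := hs ⟨x, hx⟩
      rw [nhds_subtype_eq_comap, eventually_comap] at h
      filter_upwards [h, hΩ.mem_nhds hx, ball_mem_nhds x (hr ⟨x, hx⟩)] with y hy hyΩ hyb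
      rw [dif_pos hyΩ, hy ⟨y, hyΩ⟩ rfl, hφ ⟨x, hx⟩ ⟨y, hyΩ⟩ hyb _ lam hl]
    have hsol := ((hs₁ ⟨x, hx⟩ lam hl).smul ((s ⟨x, hx⟩).1 lam).1).add
      ((hs₂ ⟨x, hx⟩ lam hl).smul ((s ⟨x, hx⟩).1 lam).2)
    have := (hsol x (mem_ball_self (hr ⟨x, hx⟩))).congr_of_eventuallyEq hev
    refine this.congr_deriv ?_
    rw [← hev.self_of_nhds]
  · refine ((s ⟨x, hx⟩).2).congr fun lam _ => ?_
    simp [hx]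

/-! Continuous branches of roots -/

theorem hasDerivAt_of_pow_eq {𝕜 : Type*} [NontriviallyNormedField 𝕜] [NormedAlgebra 𝕜 ℂ]
    {f g : 𝕜 → ℂ} {g' : ℂ} {x : 𝕜} {n : ℕ} (hn : n ≠ 0) (hf : ContinuousAt f x)
    (hfg : ∀ᶠ y in 𝓝 x, f y ^ n = g y) (hg : HasDerivAt g g' x) (hx : f x ≠ 0) : HasDerivAt f (g' /
    (n * f x ^ (n - 1))) x := by
  have hs : HasStrictDerivAt (fun z : ℂ => z ^ n) (n * f x ^ (n - 1)) (f x) :=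
    hasStrictDerivAt_pow n (f x)
  have hne : (n * f x ^ (n - 1) : ℂ) ≠ 0 :=
    mul_ne_zero (Nat.cast_ne_zero.2 hn) (pow_ne_zero _ hx)
  have h1 : ∀ᶠ z in 𝓝 (f x), hs.localInverse _ _ _ hne (z ^ n) = z :=
    hs.eventually_left_inverse hne
  have h2 := (hs.to_localInverse hne).hasDerivAt
  have hx' : f x ^ n = g x := hfg.self_of_nhds
  rw [hx'] at h2
  have h3 := h2.scomp x hg
  rw [smul_eq_mul, ← div_eq_mul_inv] at h3
  refine h3.congr_of_eventuallyEq ?_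
  filter_upwards [hfg, hf.eventually h1] with y hy hy'
  rw [Function.comp_apply, ← hy, hy']

theorem eventuallyEq_of_pow_eq {X : Type*} [TopologicalSpace X] {f g : X → ℂ} {x : X} {n : ℕ}
    (hn : n ≠ 0) (hf : ContinuousAt f x) (hg : ContinuousAt g x)
    (hfg : ∀ᶠ y in 𝓝 x, f y ^ n = g y ^ n) (hx : f x = g x) (hx' : f x ≠ 0) : f =ᶠ[𝓝 x] g := by
  have hs : HasStrictDerivAt (fun z : ℂ => z ^ n) (n * f x ^ (n - 1)) (f x) :=
    hasStrictDerivAt_pow n (f x)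
  have hne : (n * f x ^ (n - 1) : ℂ) ≠ 0 :=
    mul_ne_zero (Nat.cast_ne_zero.2 hn) (pow_ne_zero _ hx')
  have h1 : ∀ᶠ z in 𝓝 (f x), hs.localInverse _ _ _ hne (z ^ n) = z :=
    hs.eventually_left_inverse hne
  have h1' : ∀ᶠ z in 𝓝 (g x), hs.localInverse _ _ _ hne (z ^ n) = z := by rw [← hx]; exact h1
  filter_upwards [hfg, hf.eventually h1, hg.eventually h1'] with y h2 h3 h4
  rw [← h3, h2, h4]

theorem exists_local_root {X : Type*} [TopologicalSpace X] {G : X → ℂ} {x : X} {n : ℕ} (hn : n ≠ 0)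
    (hG : ∀ᶠ y in 𝓝 x, ContinuousAt G y) (hx : G x ≠ 0) {h₀ : ℂ} (hh : h₀ ^ n = G x) : ∃ H : X → ℂ,
    H x = h₀ ∧ ∀ᶠ y in 𝓝 x, ContinuousAt H y ∧ H y ≠ 0 ∧ H y ^ n = G y := by
  have hh₀ : h₀ ≠ 0 := fun h => hx (by rw [← hh, h, zero_pow hn])
  refine ⟨fun y => h₀ * (G y / G x) ^ (1 / n : ℂ), by simp [div_self hx], ?_⟩
  have h1 : ∀ᶠ y in 𝓝 x, G y / G x ∈ Complex.slitPlane := by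
    have hc : ContinuousAt (fun y => G y / G x) x := hG.self_of_nhds.div_const _
    refine hc.eventually (Complex.isOpen_slitPlane.mem_nhds ?_)
    simp [div_self hx]
  filter_upwards [h1, hG] with y hy hGy
  refine ⟨continuousAt_const.mul ((hGy.div_const _).cpow continuousAt_const hy),
    mul_ne_zero hh₀ ?_, ?_⟩
  · rw [Complex.cpow_def_of_ne_zero (Complex.slitPlane_ne_zero hy)]
    exact exp_ne_zero _
  · rw [mul_pow, hh, ← Complex.cpow_mul_nat, one_div, inv_mul_cancel₀ (Nat.cast_ne_zero.2 hn),
      Complex.cpow_one, mul_div_cancel₀ _ hx]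

/-! Estimates for the WKB symbols along a curve -/

section Apriori

variable {c K N W : ℝ} {w₀ w₁ ρ k R : ℝ → ℂ} {B κ : ℝ → ℝ}

theorem norm_sub_le_of_norm_deriv_le {f f' : ℝ → ℂ} (hf : ∀ t ∈ Icc a b, HasDerivAt f (f' t) t)
    (hB : ∀ t ∈ Icc a b, HasDerivAt B (κ t) t) (hle : ∀ t ∈ Icc a b, ‖f' t‖ ≤ κ t)
    (hs : s ∈ Icc a b) : ‖f s - f a‖ ≤ B s - B a := by
  refine image_norm_le_of_norm_deriv_right_le_deriv_boundary' (f := fun t => f t - f a)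
    (f' := f') (B := fun t => B t - B a) (B' := κ) (a := a) (b := b) ?_ ?_ (by simp) ?_ ?_ ?_ hs
  · exact fun t ht => ((hf t ht).sub_const _).continuousAt.continuousWithinAt
  · exact fun t ht => ((hf t (Ico_subset_Icc_self ht)).sub_const _).hasDerivWithinAt
  · exact fun t ht => ((hB t ht).sub_const _).continuousAt.continuousWithinAt
  · exact fun t ht => ((hB t (Ico_subset_Icc_self ht)).sub_const _).hasDerivWithinAt
  · exact fun t ht => hle t (Ico_subset_Icc_self ht)

theorem hasDerivAt_weighted (hε : ε ≠ 0) (h1 : HasDerivAt w₁ (k t * w₀ t - 2 / ε * ρ t * w₁ t) t)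
    (hR : HasDerivAt R (ρ t) t) : HasDerivAt (fun t => exp (2 * R t / ε) * w₁ t) (exp (2 * R t / ε)
    * (k t * w₀ t)) t := by
  have hε' : (ε : ℂ) ≠ 0 := by exact_mod_cast hε
  refine ((((hR.const_mul 2).div_const (ε : ℂ)).cexp).mul h1).congr_deriv ?_
  field_simp
  ring

theorem norm_exp_two_mul (z : ℂ) : ‖exp (2 * z / ε)‖ = Real.exp (2 * z.re / ε) := by
  rw [Complex.norm_exp]
  congr 1
  rw [Complex.div_ofReal_re]
  simp

theorem hasDerivAt_re_of_hasDerivAt {f : ℝ → ℂ} {f' : ℂ} (h : HasDerivAt f f' t) : HasDerivAt (fun t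
    => (f t).re) f'.re t :=
  (Complex.reCLM.hasFDerivAt).comp_hasDerivAt t h

theorem re_mono_of_deriv (hc : 0 ≤ c) (hR : ∀ t ∈ Icc a b, HasDerivAt R (ρ t) t)
    (hρ : ∀ t ∈ Icc a b, c ≤ (ρ t).re) : MonotoneOn (fun t => (R t).re) (Icc a b) := by
  refine monotoneOn_of_deriv_nonneg (convex_Icc a b)
    (fun t ht => (hasDerivAt_re_of_hasDerivAt (hR t ht)).continuousAt.continuousWithinAt)
    (fun t ht => (hasDerivAt_re_of_hasDerivAt
      (hR t (interior_subset ht))).differentiableAt.differentiableWithinAt) fun t ht => ?_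
  rw [(hasDerivAt_re_of_hasDerivAt (hR t (interior_subset ht))).deriv]
  exact hc.trans (hρ t (interior_subset ht))

variable (hε : 0 < ε) (h0 : ∀ t ∈ Icc a b, HasDerivAt w₀ (k t * w₁ t) t)
  (h1 : ∀ t ∈ Icc a b, HasDerivAt w₁ (k t * w₀ t - 2 / ε * ρ t * w₁ t) t)
  (hR : ∀ t ∈ Icc a b, HasDerivAt R (ρ t) t) (hρ : ∀ t ∈ Icc a b, c ≤ (ρ t).re)
  (hB : ∀ t ∈ Icc a b, HasDerivAt B (κ t) t) (hk' : ∀ t ∈ Icc a b, ‖k t‖ ≤ κ t)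

include hε h1 hR hρ in
theorem norm_symbol_odd_le (hc : 0 < c) (hk : ∀ t ∈ Icc a b, ‖k t‖ ≤ K) (hN : ∀ t ∈ Icc a b, ‖w₀ t‖ ≤ N)
    (hs : s ∈ Icc a b) : ‖w₁ s‖ ≤ ‖w₁ a‖ + K * N * ε / (2 * c) := by
  have ha : a ∈ Icc a b := left_mem_Icc.2 (hs.1.trans hs.2)
  have hK0 : 0 ≤ K := (norm_nonneg _).trans (hk a ha)
  have hN0 : 0 ≤ N := (norm_nonneg _).trans (hN a ha)
  have hmono := re_mono_of_deriv hc.le hR hρ ha hs hs.1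
  have key := norm_sub_le_of_norm_deriv_le (a := a) (b := b)
    (f := fun t => exp (2 * R t / ε) * w₁ t)
    (B := fun t => K * N * ε / (2 * c) * Real.exp (2 * (R t).re / ε))
    (fun t ht => hasDerivAt_weighted hε.ne' (h1 t ht) (hR t ht))
    (fun t ht => ((((hasDerivAt_re_of_hasDerivAt (hR t ht)).const_mul 2).div_const
      ε).exp).const_mul _) (fun t ht => ?_) hs
  · have h2 : ‖exp (2 * R s / ε) * w₁ s‖ ≤ ‖exp (2 * R a / ε) * w₁ a‖ +
          K * N * ε / (2 * c) * Real.exp (2 * (R s).re / ε) := by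
      have h3 := norm_sub_norm_le (exp (2 * R s / ε) * w₁ s)
        (exp (2 * R a / ε) * w₁ a)
      have : 0 ≤ K * N * ε / (2 * c) * Real.exp (2 * (R a).re / ε) := by positivity
      linarith
    rw [norm_mul, norm_mul, norm_exp_two_mul, norm_exp_two_mul] at h2
    have h4 : Real.exp (2 * (R a).re / ε) ≤ Real.exp (2 * (R s).re / ε) := by
      gcongr
    have h5 : Real.exp (2 * (R s).re / ε) * ‖w₁ s‖ ≤
        Real.exp (2 * (R s).re / ε) * (‖w₁ a‖ + K * N * ε / (2 * c)) := by
      nlinarith [mul_le_mul_of_nonneg_right h4 (norm_nonneg (w₁ a))]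
    exact le_of_mul_le_mul_left h5 (Real.exp_pos _)
  · rw [norm_mul, norm_mul, norm_exp_two_mul]
    have h6 : ‖k t‖ * ‖w₀ t‖ ≤ K * N := mul_le_mul (hk t ht) (hN t ht) (norm_nonneg _) hK0
    have h7 : K * N ≤ K * N * ((ρ t).re / c) :=
      le_mul_of_one_le_right (by positivity) ((one_le_div hc).2 (hρ t ht))
    calc Real.exp (2 * (R t).re / ε) * (‖k t‖ * ‖w₀ t‖)
        ≤ Real.exp (2 * (R t).re / ε) * (K * N * ((ρ t).re / c)) :=
          mul_le_mul_of_nonneg_left (h6.trans h7) (Real.exp_pos _).le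
      _ = _ := by field_simp

include hε h1 hR hρ hB hk' in
theorem norm_symbol_odd_le' (hc : 0 ≤ c) (hN : ∀ t ∈ Icc a b, ‖w₀ t‖ ≤ N) (hs : s ∈ Icc a b) :
    ‖w₁ s‖ ≤ ‖w₁ a‖ + N * (B s - B a) := by
  have ha : a ∈ Icc a b := left_mem_Icc.2 (hs.1.trans hs.2)
  have hmono := re_mono_of_deriv hc hR hρ
  have hsub : Icc a s ⊆ Icc a b := Icc_subset_Icc_right hs.2
  have key := norm_sub_le_of_norm_deriv_le (a := a) (b := s)
    (f := fun t => exp (2 * R t / ε) * w₁ t)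
    (B := fun t => Real.exp (2 * (R s).re / ε) * N * B t)
    (fun t ht => hasDerivAt_weighted hε.ne' (h1 t (hsub ht)) (hR t (hsub ht)))
    (fun t ht => (hB t (hsub ht)).const_mul _) (fun t ht => ?_) (right_mem_Icc.2 hs.1)
  · have h3 := norm_sub_norm_le (exp (2 * R s / ε) * w₁ s) (exp (2 * R a / ε) * w₁ a)
    have h2 := h3.trans key
    rw [norm_mul, norm_mul, norm_exp_two_mul, norm_exp_two_mul] at h2
    have h4 : Real.exp (2 * (R a).re / ε) ≤ Real.exp (2 * (R s).re / ε) := by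
      have := hmono ha hs hs.1
      simp only at this
      gcongr
    have h5 : Real.exp (2 * (R s).re / ε) * ‖w₁ s‖ ≤
        Real.exp (2 * (R s).re / ε) * (‖w₁ a‖ + N * (B s - B a)) := by
      nlinarith [mul_le_mul_of_nonneg_right h4 (norm_nonneg (w₁ a))]
    exact le_of_mul_le_mul_left h5 (Real.exp_pos _)
  · rw [norm_mul, norm_mul, norm_exp_two_mul]
    have hm := hmono (hsub ht) hs ht.2
    simp only at hm
    have h6 : ‖k t‖ * ‖w₀ t‖ ≤ κ t * N := mul_le_mul (hk' t (hsub ht)) (hN t (hsub ht))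
      (norm_nonneg _) ((norm_nonneg _).trans (hk' t (hsub ht)))
    have h7 : 0 ≤ κ t * N := (by positivity : 0 ≤ ‖k t‖ * ‖w₀ t‖).trans h6
    calc Real.exp (2 * (R t).re / ε) * (‖k t‖ * ‖w₀ t‖)
        ≤ Real.exp (2 * (R s).re / ε) * (κ t * N) := by gcongr
      _ = _ := by ring

include h0 hB hk' in
theorem norm_symbol_even_sub_le (hW : ∀ t ∈ Icc a b, ‖w₁ t‖ ≤ W) (hs : s ∈ Icc a b) :
    ‖w₀ s - w₀ a‖ ≤ W * (B s - B a) := by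
  have key := norm_sub_le_of_norm_deriv_le (B := fun t => W * B t) h0
    (fun t ht => (hB t ht).const_mul W) (fun t ht => ?_) hs
  · linarith
  · rw [norm_mul, mul_comm]
    exact mul_le_mul (hW t ht) (hk' t ht) (norm_nonneg _) ((norm_nonneg _).trans (hW t ht))

include hB hk' in
theorem monotoneOn_of_norm_le : MonotoneOn B (Icc a b) := by
  refine monotoneOn_of_deriv_nonneg (convex_Icc a b)
    (fun t ht => (hB t ht).continuousAt.continuousWithinAt)
    (fun t ht => (hB t (interior_subset ht)).differentiableAt.differentiableWithinAt)
    fun t ht => ?_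
  rw [(hB t (interior_subset ht)).deriv]
  exact (norm_nonneg _).trans (hk' t (interior_subset ht))

include hε h0 h1 hR hρ hB hk' in
/-- Semiclassical estimate: along a curve on which `Re R` increases at a definite rate, the odd
symbol is of order `ε` and the even symbol nearly constant. -/
theorem symbol_estimate {K1 : ℝ} (hab : a ≤ b) (hc : 0 < c) (hk : ∀ t ∈ Icc a b, ‖k t‖ ≤ K)
    (hK1 : B b - B a ≤ K1) (hsmall : K * K1 * ε ≤ c) (hs : s ∈ Icc a b) :
    ‖w₁ s‖ ≤ ‖w₁ a‖ + K * ε / c * (‖w₀ a‖ + K1 * ‖w₁ a‖) ∧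
    ‖w₀ s - w₀ a‖ ≤ K1 * (‖w₁ a‖ + K * ε / c * (‖w₀ a‖ + K1 * ‖w₁ a‖)) := by
  have ha := left_mem_Icc.2 hab
  have hb := right_mem_Icc.2 hab
  have hmono := monotoneOn_of_norm_le hB hk'
  have hK0 : 0 ≤ K := (norm_nonneg _).trans (hk a ha)
  have hBs : ∀ t ∈ Icc a b, 0 ≤ B t - B a ∧ B t - B a ≤ K1 := fun t ht =>
    ⟨by linarith [hmono ha ht ht.1], by linarith [hmono ht hb ht.2]⟩
  have hK10 : 0 ≤ K1 := (hBs a ha).1.trans (hBs a ha).2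
  obtain ⟨t0, ht₀, hmax⟩ := isCompact_Icc.exists_isMaxOn (nonempty_Icc.2 hab)
    (f := fun t => ‖w₀ t‖) fun t ht => (h0 t ht).continuousAt.norm.continuousWithinAt
  set N := ‖w₀ t0‖
  have hN : ∀ t ∈ Icc a b, ‖w₀ t‖ ≤ N := fun t ht => hmax ht
  have h2 := fun t ht => norm_symbol_odd_le hε h1 hR hρ hc hk hN (s := t) ht
  have h3 := fun t ht => norm_symbol_even_sub_le h0 hB hk' h2 (s := t) ht
  have hW0 : 0 ≤ ‖w₁ a‖ + K * N * ε / (2 * c) := by positivity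
  have hNle : N ≤ 2 * (‖w₀ a‖ + K1 * ‖w₁ a‖) := by
    have h4 := h3 t0 ht₀
    have h5 : N ≤ ‖w₀ a‖ + ‖w₀ t0 - w₀ a‖ := by
      simpa using norm_add_le (w₀ a) (w₀ t0 - w₀ a)
    have h6 : (‖w₁ a‖ + K * N * ε / (2 * c)) * (B t0 - B a) ≤
        (‖w₁ a‖ + K * N * ε / (2 * c)) * K1 := by
      gcongr; exact (hBs t0 ht₀).2
    have h7 : K * N * ε / (2 * c) * K1 ≤ N / 2 := by
      rw [div_mul_eq_mul_div, div_le_div_iff₀ (by positivity) (by norm_num)]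
      nlinarith [mul_le_mul_of_nonneg_left hsmall (norm_nonneg (w₀ t0))]
    nlinarith
  have h8 : ∀ t ∈ Icc a b, ‖w₁ t‖ ≤ ‖w₁ a‖ + K * ε / c * (‖w₀ a‖ + K1 * ‖w₁ a‖) := by
    intro t ht
    refine (h2 t ht).trans ?_
    have : K * N * ε / (2 * c) = K * ε / c * (N / 2) := by field_simp
    rw [this]
    gcongr
    linarith
  refine ⟨h8 s hs, (norm_symbol_even_sub_le h0 hB hk' h8 hs).trans ?_⟩
  rw [mul_comm]
  have : 0 ≤ ‖w₁ a‖ + K * ε / c * (‖w₀ a‖ + K1 * ‖w₁ a‖) := by positivity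
  gcongr
  exact (hBs s hs).2

include hε h0 h1 hR hρ hB hk' in
/-- Estimate near infinity: if the coupling has small total mass, both symbols are nearly
constant, respectively nearly nonincreasing. -/
theorem symbol_estimate_of_small {δ : ℝ} (hab : a ≤ b) (hc : 0 ≤ c) (hδ : B b - B a ≤ δ)
    (hδ' : δ ≤ 1 / 2) (hs : s ∈ Icc a b) : ‖w₁ s‖ ≤ ‖w₁ a‖ + 2 * δ * (‖w₀ a‖ + ‖w₁ a‖) ∧
    ‖w₀ s - w₀ a‖ ≤ 2 * δ * (‖w₀ a‖ + ‖w₁ a‖) := by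
  have ha := left_mem_Icc.2 hab
  have hb := right_mem_Icc.2 hab
  have hmono := monotoneOn_of_norm_le hB hk'
  have hBs : ∀ t ∈ Icc a b, 0 ≤ B t - B a ∧ B t - B a ≤ δ := fun t ht =>
    ⟨by linarith [hmono ha ht ht.1], by linarith [hmono ht hb ht.2]⟩
  have hδ0 : 0 ≤ δ := (hBs a ha).1.trans (hBs a ha).2
  obtain ⟨t0, ht₀, hmax⟩ := isCompact_Icc.exists_isMaxOn (nonempty_Icc.2 hab)
    (f := fun t => ‖w₀ t‖) fun t ht => (h0 t ht).continuousAt.norm.continuousWithinAt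
  set N := ‖w₀ t0‖
  have hN : ∀ t ∈ Icc a b, ‖w₀ t‖ ≤ N := fun t ht => hmax ht
  have hN0 : 0 ≤ N := norm_nonneg _
  have h2 : ∀ t ∈ Icc a b, ‖w₁ t‖ ≤ ‖w₁ a‖ + N * δ := fun t ht =>
    (norm_symbol_odd_le' hε h1 hR hρ hB hk' hc hN ht).trans (by
      gcongr; exact (hBs t ht).2)
  have h3 : ∀ t ∈ Icc a b, ‖w₀ t - w₀ a‖ ≤ (‖w₁ a‖ + N * δ) * δ := fun t ht =>
    (norm_symbol_even_sub_le h0 hB hk' h2 ht).trans (by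
      gcongr; exact (hBs t ht).2)
  have hNle : N ≤ 2 * (‖w₀ a‖ + ‖w₁ a‖) := by
    have h5 : N ≤ ‖w₀ a‖ + ‖w₀ t0 - w₀ a‖ := by
      simpa using norm_add_le (w₀ a) (w₀ t0 - w₀ a)
    have h6 := h3 t0 ht₀
    have h7 : ‖w₁ a‖ * δ ≤ ‖w₁ a‖ * (1 / 2) := by gcongr
    have h8 : N * δ * δ ≤ N * (1 / 2) * (1 / 2) := by gcongr
    nlinarith [norm_nonneg (w₁ a), norm_nonneg (w₀ a)]
  refine ⟨(h2 s hs).trans ?_, (h3 s hs).trans ?_⟩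
  · nlinarith [mul_le_mul_of_nonneg_right hNle hδ0]
  · have h7 : ‖w₁ a‖ + N * δ ≤ 2 * (‖w₀ a‖ + ‖w₁ a‖) := by
      have : N * δ ≤ N * (1 / 2) := by gcongr
      linarith [norm_nonneg (w₁ a), norm_nonneg (w₀ a)]
    nlinarith [mul_le_mul_of_nonneg_right h7 hδ0]

end Apriori

/-! WKB coordinates -/

/-- The coefficient of the growing WKB vector `e^{E/ε} (1/h, -i h)` in `y`. -/
noncomputable def wPlus (h E : ℂ) (ε : ℝ) (y : ℂ × ℂ) : ℂ :=
  exp (-(E / ε)) * (h * y.1 + I * y.2 / h) / 2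

/-- The coefficient of `e^{E/ε} (1/h, i h)` in `y`. -/
noncomputable def wMinus (h E : ℂ) (ε : ℝ) (y : ℂ × ℂ) : ℂ :=
  exp (-(E / ε)) * (h * y.1 - I * y.2 / h) / 2

/-- The logarithmic derivative of `(g₋/g₊)^{1/4}` with respect to `x`. -/
noncomputable def logDerivRoot (P M : ℂ → ℂ) (x lam : ℂ) : ℂ :=
  (-(deriv M x) / (lam - M x) - deriv P x / (P x - lam)) / 4

section

variable {X x' kap ρ : ℂ} {y : ℝ → ℂ × ℂ} {h E : ℝ → ℂ}

theorem wkb_aux (hε : ε ≠ 0) (hy : HasDerivAt y (x' • sysMatrix P M ε X lam (y t)) t)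
    (hh : HasDerivAt h (kap * h t) t) (h0 : h t ≠ 0) (hr : (P X - lam) * h t ^ 4 = lam - M X)
    (hρ : ρ = (P X - lam) * h t ^ 2 * x') : HasDerivAt (fun t => h t * (y t).1) (kap * (h t * (y
    t).1) + ρ / ε * (I * (y t).2 / h t)) t ∧ HasDerivAt (fun t => I * (y t).2 / h t) (-(kap * (I *
    (y t).2 / h t)) + ρ / ε * (h t * (y t).1)) t := by
  have hε' : (ε : ℂ) ≠ 0 := by exact_mod_cast hε
  rw [sysMatrix_apply] at hy
  have h1 := HasDerivAt.fst' hy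
  have h2 := HasDerivAt.snd' hy
  simp only [Prod.smul_fst, Prod.smul_snd, smul_eq_mul] at h1 h2
  constructor
  · refine (hh.mul h1).congr_deriv ?_
    rw [hρ]
    field_simp
  · refine ((h2.const_mul I).div hh h0).congr_deriv ?_
    rw [hρ, ← hr]
    field_simp
    ring_nf
    simp only [I_sq]
    ring

theorem hasDerivAt_wPlus (hε : ε ≠ 0) (hy : HasDerivAt y (x' • sysMatrix P M ε X lam (y t)) t)
    (hh : HasDerivAt h (kap * h t) t) (h0 : h t ≠ 0) (hr : (P X - lam) * h t ^ 4 = lam - M X)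
    (hρ : ρ = (P X - lam) * h t ^ 2 * x') (hE : HasDerivAt E ρ t) : HasDerivAt (fun t => wPlus (h t)
    (E t) ε (y t)) (kap * wMinus (h t) (E t) ε (y t)) t := by
  obtain ⟨h1, h2⟩ := wkb_aux hε hy hh h0 hr hρ
  refine ((((hE.div_const (ε : ℂ)).neg.cexp).mul (h1.add h2)).div_const 2).congr_deriv ?_
  simp only [wMinus, Pi.add_apply, Pi.neg_apply]
  ring

theorem hasDerivAt_wMinus (hε : ε ≠ 0) (hy : HasDerivAt y (x' • sysMatrix P M ε X lam (y t)) t)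
    (hh : HasDerivAt h (kap * h t) t) (h0 : h t ≠ 0) (hr : (P X - lam) * h t ^ 4 = lam - M X)
    (hρ : ρ = (P X - lam) * h t ^ 2 * x') (hE : HasDerivAt E ρ t) : HasDerivAt (fun t => wMinus (h
    t) (E t) ε (y t)) (kap * wPlus (h t) (E t) ε (y t) - 2 / ε * ρ * wMinus (h t) (E t) ε (y t)) t
    := by
  obtain ⟨h1, h2⟩ := wkb_aux hε hy hh h0 hr hρ
  refine ((((hE.div_const (ε : ℂ)).neg.cexp).mul (h1.sub h2)).div_const 2).congr_deriv ?_
  simp only [wMinus, wPlus, Pi.sub_apply, Pi.neg_apply]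
  ring

theorem wkb_expand {h E : ℂ} (h0 : h ≠ 0) (y : ℂ × ℂ) : y = (exp (E / ε) * (wPlus h E ε y + wMinus h
    E ε y) / h, -I * exp (E / ε) * (wPlus h E ε y - wMinus h E ε y) * h) := by
  have he : exp (-(E / ε)) * exp (E / ε) = 1 := by
    rw [← exp_add]; simp
  simp only [wPlus, wMinus]
  generalize exp (-(E / ε)) = u at *
  generalize exp (E / ε) = v at *
  ext
  · field_simp
    linear_combination -2 * y.1 * h ^ 2 * he
  · simp only
    field_simp
    ring_nf
    simp only [I_sq]
    linear_combination -2 * y.2 * he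

/-- A fourth root of `g₋/g₊` along a curve has the expected logarithmic derivative. -/
theorem hasDerivAt_root {𝕜 : Type*} [NontriviallyNormedField 𝕜] [NormedAlgebra 𝕜 ℂ] {h x : 𝕜 → ℂ}
    {x' : ℂ} {t : 𝕜} (hh : ContinuousAt h t) (hr : ∀ᶠ s in 𝓝 t, (P (x s) - lam) * h s ^ 4 = lam - M
    (x s)) (hx : HasDerivAt x x' t) (hP : DifferentiableAt ℂ P (x t))
    (hM : DifferentiableAt ℂ M (x t)) (h0 : h t ≠ 0) (hPne : P (x t) - lam ≠ 0) : HasDerivAt h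
    (logDerivRoot P M (x t) lam * x' * h t) t := by
  have h1 := hP.hasDerivAt.scomp t hx
  have h2 := hM.hasDerivAt.scomp t hx
  have hPc : ∀ᶠ s in 𝓝 t, P (x s) - lam ≠ 0 :=
    (h1.continuousAt.sub continuousAt_const).eventually_ne hPne
  have hG : HasDerivAt (fun s => (lam - M (x s)) / (P (x s) - lam))
      ((-(x' * deriv M (x t)) * (P (x t) - lam) - (lam - M (x t)) * (x' * deriv P (x t))) /
        (P (x t) - lam) ^ 2) t := by
    exact ((h2.const_sub lam).div (h1.sub_const lam) hPne).congr_deriv (by simp)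
  refine (hasDerivAt_of_pow_eq (n := 4) (by norm_num) hh ?_ hG h0).congr_deriv ?_
  · filter_upwards [hr, hPc] with s h3 h4
    rw [eq_div_iff h4, mul_comm, h3]
  · have h5 := hr.self_of_nhds
    have h6 : lam - M (x t) ≠ 0 := by rw [← h5]; exact mul_ne_zero hPne (pow_ne_zero _ h0)
    simp only [logDerivRoot]
    rw [← h5] at h6 ⊢
    norm_num
    field_simp

end

/-! Germs of WKB branches -/

/-- `H` is a branch of `(g₋/g₊)^{1/4}` and `Z` a phase with `∂Z/∂x = g₊ H²`, near `(p, μ)`. -/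
def IsGerm (P M : ℂ → ℂ) (μ p : ℂ) (H Z : ℂ → ℂ → ℂ) : Prop :=
  ∀ᶠ v : ℂ × ℂ in 𝓝 (p, μ), ContinuousAt (fun v : ℂ × ℂ => H v.1 v.2) v ∧ H v.1 v.2 ≠ 0 ∧
    (P v.1 - v.2) * H v.1 v.2 ^ 4 = v.2 - M v.1 ∧ P v.1 - v.2 ≠ 0 ∧
    HasDerivAt (fun x => Z x v.2) ((P v.1 - v.2) * H v.1 v.2 ^ 2) v.1

/-- `y` is given near `μ`, up to relative errors of order `ε`, by the growing WKB vector with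
amplitude `h` and phase `E` at the point `X`. -/
def HasWKB (μ : ℂ) (y : ℝ → ℂ → ℂ → ℂ × ℂ) (X E h : ℂ → ℂ) : Prop :=
  ∃ C > 0, ∃ ε0 > 0, ∀ᶠ lam in 𝓝 μ, ∀ ε : ℝ, 0 < ε → ε < ε0 →
    ‖wPlus (h lam) (E lam) ε (y ε lam (X lam)) - 1‖ ≤ C * ε ∧
    ‖wMinus (h lam) (E lam) ε (y ε lam (X lam))‖ ≤ C * ε

/-- A family of solutions on `Ω`, for small `ε` and `lam` near `μ`. -/
def IsSolFamily (P M : ℂ → ℂ) (Ω : Set ℂ) (μ : ℂ) (y : ℝ → ℂ → ℂ → ℂ × ℂ) : Prop :=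
  ∃ ε0 > 0, ∀ᶠ lam in 𝓝 μ, ∀ ε : ℝ, 0 < ε → ε < ε0 → IsSol P M ε lam Ω (y ε lam)

theorem HasWKB.congr {X E h X' E' h' : ℂ → ℂ} (hy : HasWKB μ y X E h) (hX : X =ᶠ[𝓝 μ] X')
    (hE : E =ᶠ[𝓝 μ] E') (hh : h =ᶠ[𝓝 μ] h') : HasWKB μ y X' E' h' := by
  obtain ⟨C, hC, ε0, hε0, H⟩ := hy
  refine ⟨C, hC, ε0, hε0, ?_⟩
  filter_upwards [H, hX, hE, hh] with lam H h1 h2 h3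
  rwa [← h1, ← h2, ← h3]

theorem exists_localHomeomorph {f : ℂ → ℂ} (hf : ∀ᶠ x in 𝓝 p, DifferentiableAt ℂ f x)
    (hp : deriv f p ≠ 0) {A : Set ℂ} (hA : A ∈ 𝓝 p) : ∃ φ : OpenPartialHomeomorph ℂ ℂ, p ∈ φ.source
    ∧ ⇑φ = f ∧ φ.source ⊆ A := by
  have han : AnalyticAt ℂ f p := Complex.analyticAt_iff_eventually_differentiableAt.2 hf
  have hs := han.hasStrictDerivAt
  obtain ⟨B, hBA, hBo, hpB⟩ := mem_nhds_iff.1 hA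
  let φ := (hs.hasStrictFDerivAt_equiv hp).toOpenPartialHomeomorph f
  refine ⟨φ.restrOpen B hBo, ⟨(hs.hasStrictFDerivAt_equiv hp).mem_toOpenPartialHomeomorph_source,
    hpB⟩, rfl, fun x hx => hBA hx.2⟩

/-- Along the direction of increasing `Re Z`, WKB asymptotics propagate locally. -/
theorem IsGerm.transfer (hg : IsGerm P M μ p H Z) (hΩ : IsOpen Ω) (hP : DifferentiableOn ℂ P Ω)
    (hM : DifferentiableOn ℂ M Ω) (hp : p ∈ Ω) : ∃ D ∈ 𝓝 p, ∀ X X' : ℂ → ℂ, ContinuousAt X μ →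
    ContinuousAt X' μ → X μ ∈ D → X' μ ∈ D → (Z (X μ) μ).re < (Z (X' μ) μ).re → ∀ y, IsSolFamily P M
    Ω μ y → HasWKB μ y X (fun lam => Z (X lam) lam) (fun lam => H (X lam) lam) → HasWKB μ y X' (fun
    lam => Z (X' lam) lam) (fun lam => H (X' lam) lam) := by
  rw [IsGerm, nhds_prod_eq] at hg
  obtain ⟨pA, hA, pL, hL, hAL⟩ := eventually_prod_iff.1 hg
  obtain ⟨A, hAs, hAo, hpA⟩ := mem_nhds_iff.1 (Filter.inter_mem hA (hΩ.mem_nhds hp))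
  have hLp := hL.self_of_nhds
  set r : ℂ → ℂ → ℂ := fun x lam => (P x - lam) * H x lam ^ 2 with hr
  have hr0 : ∀ x ∈ A, r x μ ≠ 0 := fun x hx => by
    have := hAL (hAs hx).1 hLp
    exact mul_ne_zero this.2.2.2.1 (pow_ne_zero _ this.2.1)
  have hZ0 : ∀ x ∈ A, HasDerivAt (fun x => Z x μ) (r x μ) x := fun x hx =>
    (hAL (hAs hx).1 hLp).2.2.2.2
  obtain ⟨φ, hpφ, hφ, hφA⟩ := exists_localHomeomorph (f := fun x => Z x μ) (p := p)
    (by filter_upwards [hAo.mem_nhds hpA] with x hx using (hZ0 x hx).differentiableAt)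
    (by rw [(hZ0 p hpA).deriv]; exact hr0 p hpA) (hAo.mem_nhds hpA)
  have hφ' : ∀ x, φ x = Z x μ := fun x => congrFun hφ x
  have htarget : φ.target ∈ 𝓝 (φ p) := φ.open_target.mem_nhds (φ.map_source hpφ)
  obtain ⟨R, hR, hRt⟩ := Metric.nhds_basis_closedBall.mem_iff.1 htarget
  set Kc : Set ℂ := φ.symm '' Metric.closedBall (φ p) R with hKc
  have hKcomp : IsCompact Kc := (isCompact_closedBall _ _).image_of_continuousOn
    (φ.continuousOn_symm.mono hRt)
  have hKA : Kc ⊆ A := by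
    rintro _ ⟨z, hz, rfl⟩
    exact hφA (φ.map_target (hRt hz))
  have hKΩ : ∀ x ∈ Kc, x ∈ Ω := fun x hx => (hAs (hKA hx)).2
  refine ⟨φ.source ∩ φ ⁻¹' ball (φ p) R, Filter.inter_mem (φ.open_source.mem_nhds hpφ)
    ((φ.continuousAt hpφ).preimage_mem_nhds (ball_mem_nhds _ hR)), ?_⟩
  intro X X' hX hX' hXD hXD' hlt y hysol hgood
  obtain ⟨C, hC, ε0, hε0, hgood⟩ := hgood
  obtain ⟨ε1, hε₁, hysol⟩ := hysol
  have hcontP : ∀ x ∈ Kc, ContinuousAt P x := fun x hx =>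
    hP.continuousOn.continuousAt (hΩ.mem_nhds (hKΩ x hx))
  have hcontM : ∀ x ∈ Kc, ContinuousAt M x := fun x hx =>
    hM.continuousOn.continuousAt (hΩ.mem_nhds (hKΩ x hx))
  have hcontP' : ∀ x ∈ Kc, ContinuousAt (deriv P) x := fun x hx =>
    (hP.deriv hΩ).continuousOn.continuousAt (hΩ.mem_nhds (hKΩ x hx))
  have hcontM' : ∀ x ∈ Kc, ContinuousAt (deriv M) x := fun x hx =>
    (hM.deriv hΩ).continuousOn.continuousAt (hΩ.mem_nhds (hKΩ x hx))
  have hrc : ∀ x ∈ Kc, ∀ lam, pL lam → ContinuousAt (fun v : ℂ × ℂ => r v.1 v.2) (x, lam) := by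
    intro x hx lam hl
    have h1 : ContinuousAt (fun v : ℂ × ℂ => H v.1 v.2) (x, lam) := (hAL (hAs (hKA hx)).1 hl).1
    have h2 : ContinuousAt (fun v : ℂ × ℂ => P v.1) (x, lam) :=
      ContinuousAt.comp (x := (x, lam)) (f := Prod.fst) (g := P) (hcontP x hx) continuousAt_fst
    exact (h2.sub continuousAt_snd).mul (h1.pow 2)
  have hrc0 : ∀ x ∈ Kc, ∀ lam, ContinuousAt (fun v : ℂ × ℂ => r v.1 μ) (x, lam) := by
    intro x hx lam
    exact ContinuousAt.comp (x := (x, lam)) (f := fun v : ℂ × ℂ => (v.1, μ))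
      (g := fun v : ℂ × ℂ => r v.1 v.2) (hrc x hx μ hLp) (by fun_prop)
  set κ : ℂ → ℂ → ℂ := logDerivRoot P M with hκ
  have hκc : ∀ x ∈ Kc, ∀ lam, pL lam → ContinuousAt (fun v : ℂ × ℂ => κ v.1 v.2) (x, lam) := by
    intro x hx lam hl
    have h0 := hAL (hAs (hKA hx)).1 hl
    have hne : lam - M x ≠ 0 := by
      rw [← h0.2.2.1]; exact mul_ne_zero h0.2.2.2.1 (pow_ne_zero _ h0.2.1)
    have cf : ∀ {f : ℂ → ℂ}, ContinuousAt f x → ContinuousAt (fun v : ℂ × ℂ => f v.1) (x, lam) :=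
      fun {f} hf => ContinuousAt.comp (x := (x, lam)) (f := Prod.fst) (g := f) hf continuousAt_fst
    simp only [hκ, logDerivRoot]
    exact (((cf (hcontM' x hx)).neg.div (continuousAt_snd.sub (cf (hcontM x hx))) hne).sub
      ((cf (hcontP' x hx)).div ((cf (hcontP x hx)).sub continuousAt_snd) h0.2.2.2.1)).div_const _
  -- uniform control for `lam` near `μ`
  set Δ0 : ℂ := φ (X' μ) - φ (X μ) with hΔ0
  set m : ℝ := Δ0.re with hm
  have hmpos : 0 < m := by simp only [hm, hΔ0, Complex.sub_re, hφ']; linarith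
  set η : ℝ := m / (4 * (‖Δ0‖ + 1)) with hη
  have hηpos : 0 < η := by positivity
  have hq : ∀ᶠ lam in 𝓝 μ, ∀ x ∈ Kc, ‖r x lam / r x μ - 1‖ < η := by
    refine hKcomp.eventually_forall_of_forall_eventually fun x hx => ?_
    have h1 : ContinuousAt (fun v : ℂ × ℂ => ‖r v.1 v.2 / r v.1 μ - 1‖) (x, μ) :=
      (((hrc x hx μ hLp).div (hrc0 x hx μ) (hr0 x (hKA hx))).sub continuousAt_const).norm
    have h2 : ∀ᶠ v : ℂ × ℂ in 𝓝 (x, μ), ‖r v.1 v.2 / r v.1 μ - 1‖ < η := by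
      refine h1.eventually_lt continuousAt_const ?_
      simpa [div_self (hr0 x (hKA hx))] using hηpos
    exact (continuous_swap.tendsto (μ, x)).eventually h2
  have hκr0 : ContinuousOn (fun x => ‖κ x μ / r x μ‖) Kc := fun x hx => by
    have e1 : ContinuousAt (fun x => κ x μ) x :=
      (hκc x hx μ hLp).comp₂ continuousAt_id continuousAt_const
    have e2 : ContinuousAt (fun x => r x μ) x :=
      (hrc x hx μ hLp).comp₂ continuousAt_id continuousAt_const
    exact ((e1.div e2 (hr0 x (hKA hx))).norm).continuousWithinAt
  obtain ⟨K0, hK₀⟩ := (hKcomp.image_of_continuousOn hκr0).bddAbove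
  have hκb : ∀ᶠ lam in 𝓝 μ, ∀ x ∈ Kc, ‖κ x lam / r x μ‖ < K0 + 1 := by
    refine hKcomp.eventually_forall_of_forall_eventually fun x hx => ?_
    have h1 : ContinuousAt (fun v : ℂ × ℂ => ‖κ v.1 v.2 / r v.1 μ‖) (x, μ) :=
      ((hκc x hx μ hLp).div (hrc0 x hx μ) (hr0 x (hKA hx))).norm
    have h2 : ∀ᶠ v : ℂ × ℂ in 𝓝 (x, μ), ‖κ v.1 v.2 / r v.1 μ‖ < K0 + 1 := by
      refine h1.eventually_lt continuousAt_const ?_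
      have := hK₀ (mem_image_of_mem _ hx)
      simp only at this ⊢
      linarith
    exact (continuous_swap.tendsto (μ, x)).eventually h2
  have hXc : ContinuousAt (fun lam => φ (X lam)) μ :=
    ContinuousAt.comp (φ.continuousAt hXD.1) hX
  have hXc' : ContinuousAt (fun lam => φ (X' lam)) μ :=
    ContinuousAt.comp (φ.continuousAt hXD'.1) hX'
  have hΔc : ContinuousAt (fun lam => φ (X' lam) - φ (X lam)) μ := hXc'.sub hXc
  have hΔre : ∀ᶠ lam in 𝓝 μ, m / 2 < (φ (X' lam) - φ (X lam)).re :=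
    (continuousAt_const.eventually_lt (Complex.continuous_re.continuousAt.comp hΔc)
      (by simp only [← hΔ0, ← hm]; linarith))
  have hΔn : ∀ᶠ lam in 𝓝 μ, ‖φ (X' lam) - φ (X lam)‖ < ‖Δ0‖ + 1 :=
    hΔc.norm.eventually_lt continuousAt_const (by simp only [← hΔ0]; linarith)
  have hXs : ∀ᶠ lam in 𝓝 μ, X lam ∈ φ.source ∧ φ (X lam) ∈ ball (φ p) R :=
    (hX.eventually (φ.open_source.mem_nhds hXD.1)).and
      (hXc.eventually (isOpen_ball.mem_nhds hXD.2))
  have hXs' : ∀ᶠ lam in 𝓝 μ, X' lam ∈ φ.source ∧ φ (X' lam) ∈ ball (φ p) R :=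
    (hX'.eventually (φ.open_source.mem_nhds hXD'.1)).and
      (hXc'.eventually (isOpen_ball.mem_nhds hXD'.2))
  set K : ℝ := (|K0| + 1) * (‖Δ0‖ + 1) with hK
  have hKpos : 0 < K := by positivity
  set c : ℝ := m / 4 with hc
  have hcpos : 0 < c := by positivity
  -- the final constants
  set C' : ℝ := C + K * (C + K / c * (2 + K)) + (C + K / c * (2 + K)) + 1 with hC'
  refine ⟨C', by positivity, min (min ε0 ε1) (min (c / (K * K)) (1 / C)),
    lt_min (lt_min hε0 hε₁) (lt_min (by positivity) (by positivity)), ?_⟩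
  filter_upwards [hgood, hysol, hq, hκb, hΔre, hΔn, hXs, hXs', hL] with lam hgood hysol hq hκb
    hΔre hΔn hXs hXs' hLl ε hε hεlt
  have hεε0 : ε < ε0 := hεlt.trans_le ((min_le_left _ _).trans (min_le_left _ _))
  have hεε1 : ε < ε1 := hεlt.trans_le ((min_le_left _ _).trans (min_le_right _ _))
  have hεK : K * K * ε ≤ c := by
    have := (hεlt.trans_le ((min_le_right _ _).trans (min_le_left _ _))).le
    rw [le_div_iff₀ (by positivity)] at this
    linarith
  have hCε : C * ε ≤ 1 := by
    have := (hεlt.trans_le ((min_le_right _ _).trans (min_le_right _ _))).le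
    rw [le_div_iff₀ hC] at this
    linarith
  obtain ⟨g0, g1⟩ := hgood ε hε hεε0
  have hysol := hysol ε hε hεε1
  set Δ : ℂ := φ (X' lam) - φ (X lam) with hΔ
  set Γ : ℝ → ℂ := fun t => φ.symm (φ (X lam) + t * Δ) with hΓ
  have hmemb : ∀ t ∈ Icc (0 : ℝ) 1, φ (X lam) + t * Δ ∈ ball (φ p) R := by
    intro t ht
    have := (convex_ball (φ p) R).add_smul_sub_mem hXs.2 hXs'.2 ht
    simpa using this
  have hmemt : ∀ t ∈ Icc (0 : ℝ) 1, φ (X lam) + t * Δ ∈ φ.target := fun t ht =>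
    hRt (Metric.ball_subset_closedBall (hmemb t ht))
  have hΓK : ∀ t ∈ Icc (0 : ℝ) 1, Γ t ∈ Kc := fun t ht =>
    ⟨_, Metric.ball_subset_closedBall (hmemb t ht), rfl⟩
  have hΓd : ∀ t ∈ Icc (0 : ℝ) 1, HasDerivAt Γ (Δ / r (Γ t) μ) t := by
    intro t ht
    have h1 : HasDerivAt φ.symm (r (Γ t) μ)⁻¹ (φ (X lam) + t * Δ) := by
      refine φ.hasDerivAt_symm (hmemt t ht) (hr0 _ (hKA (hΓK t ht))) ?_
      have := hZ0 _ (hKA (hΓK t ht))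
      rwa [← hφ] at this
    have h2 : HasDerivAt (fun t : ℝ => φ (X lam) + t * Δ) Δ t := by
      simpa using ((Complex.ofRealCLM.hasDerivAt (x := t)).mul_const Δ).const_add (φ (X lam))
    exact (h1.scomp t h2).congr_deriv (by simp [div_eq_mul_inv])
  have hΓ0 : Γ 0 = X lam := by simp [hΓ, φ.left_inv hXs.1]
  have hΓ1 : Γ 1 = X' lam := by simp [hΓ, hΔ, φ.left_inv hXs'.1]
  have hgerm : ∀ t ∈ Icc (0 : ℝ) 1, _ := fun t ht => hAL (hAs (hKA (hΓK t ht))).1 hLl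
  set x' : ℝ → ℂ := fun t => Δ / r (Γ t) μ with hx'
  have hyd : ∀ t ∈ Icc (0 : ℝ) 1, HasDerivAt (fun t => y ε lam (Γ t))
      (x' t • sysMatrix P M ε (Γ t) lam (y ε lam (Γ t))) t := fun t ht =>
    (hysol (Γ t) (hKΩ _ (hΓK t ht))).scomp t (hΓd t ht)
  have hhd : ∀ t ∈ Icc (0 : ℝ) 1, HasDerivAt (fun t => H (Γ t) lam)
      (κ (Γ t) lam * x' t * H (Γ t) lam) t := by
    intro t ht
    have hcontΓ := (hΓd t ht).continuousAt
    refine hasDerivAt_root (x := Γ) ?_ ?_ (hΓd t ht)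
      (hP.differentiableAt (hΩ.mem_nhds (hKΩ _ (hΓK t ht))))
      (hM.differentiableAt (hΩ.mem_nhds (hKΩ _ (hΓK t ht)))) (hgerm t ht).2.1 (hgerm t ht).2.2.2.1
    · exact (hgerm t ht).1.comp₂ hcontΓ continuousAt_const
    · filter_upwards [hcontΓ.eventually (hAo.mem_nhds (hKA (hΓK t ht)))] with s hs
      exact (hAL (hAs hs).1 hLl).2.2.1
  set ρ : ℝ → ℂ := fun t => r (Γ t) lam * x' t with hρ
  have hEd : ∀ t ∈ Icc (0 : ℝ) 1, HasDerivAt (fun t => Z (Γ t) lam) (ρ t) t := by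
    intro t ht
    have := (hgerm t ht).2.2.2.2.scomp t (hΓd t ht)
    exact this.congr_deriv (by simp [hρ, hx', hr, mul_comm])
  have hρre : ∀ t ∈ Icc (0 : ℝ) 1, c ≤ (ρ t).re := by
    intro t ht
    have h1 : ρ t = Δ + (r (Γ t) lam / r (Γ t) μ - 1) * Δ := by
      simp only [hρ, hx']
      have := hr0 _ (hKA (hΓK t ht))
      field_simp
      ring
    have h2 : ‖(r (Γ t) lam / r (Γ t) μ - 1) * Δ‖ ≤ η * (‖Δ0‖ + 1) := by
      rw [norm_mul]
      exact mul_le_mul (hq _ (hΓK t ht)).le hΔn.le (norm_nonneg _) hηpos.le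
    have h3 : η * (‖Δ0‖ + 1) = m / 4 := by
      rw [hη]; field_simp
    have h4 := (Complex.abs_re_le_norm _).trans h2
    rw [h1, Complex.add_re]
    have := (abs_le.1 h4).1
    linarith
  have hkb : ∀ t ∈ Icc (0 : ℝ) 1, ‖κ (Γ t) lam * x' t‖ ≤ K := by
    intro t ht
    have h1 : κ (Γ t) lam * x' t = κ (Γ t) lam / r (Γ t) μ * Δ := by
      simp only [hx']; ring
    rw [h1, norm_mul]
    exact mul_le_mul ((hκb _ (hΓK t ht)).le.trans (by linarith [le_abs_self K0])) hΔn.le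
      (norm_nonneg _) (by positivity)
  have est := symbol_estimate (a := 0) (b := 1) (K1 := K) (c := c) (B := fun t => K * t)
    (κ := fun _ => K) (w₀ := fun t => wPlus (H (Γ t) lam) (Z (Γ t) lam) ε (y ε lam (Γ t)))
    (w₁ := fun t => wMinus (H (Γ t) lam) (Z (Γ t) lam) ε (y ε lam (Γ t)))
    (k := fun t => κ (Γ t) lam * x' t) hε
    (fun t ht => hasDerivAt_wPlus hε.ne' (hyd t ht) (hhd t ht) (hgerm t ht).2.1
      (hgerm t ht).2.2.1 rfl (hEd t ht))
    (fun t ht => hasDerivAt_wMinus hε.ne' (hyd t ht) (hhd t ht) (hgerm t ht).2.1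
      (hgerm t ht).2.2.1 rfl (hEd t ht))
    hEd hρre (fun t _ => by simpa using (hasDerivAt_id t).const_mul K) hkb zero_le_one hcpos hkb
    (by simp) hεK (right_mem_Icc.2 zero_le_one)
  simp only [hΓ0, hΓ1] at est
  set a0 := wPlus (H (X lam) lam) (Z (X lam) lam) ε (y ε lam (X lam))
  set a1 := wMinus (H (X lam) lam) (Z (X lam) lam) ε (y ε lam (X lam))
  have ha0 : ‖a0‖ ≤ 2 := by
    have : ‖a0‖ ≤ ‖a0 - 1‖ + ‖(1 : ℂ)‖ := by simpa using norm_add_le (a0 - 1) 1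
    rw [norm_one] at this
    linarith
  have ha1 : ‖a1‖ ≤ 1 := g1.trans hCε
  have hW : ‖a1‖ + K * ε / c * (‖a0‖ + K * ‖a1‖) ≤ (C + K / c * (2 + K)) * ε := by
    have h1 : ‖a0‖ + K * ‖a1‖ ≤ 2 + K * 1 := by gcongr
    have h2 : K * ε / c * (‖a0‖ + K * ‖a1‖) ≤ K * ε / c * (2 + K * 1) := by gcongr
    calc _ ≤ C * ε + K * ε / c * (2 + K * 1) := add_le_add g1 h2
      _ = _ := by field_simp
  have hpos : 0 ≤ (C + K / c * (2 + K)) * ε := by positivity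
  constructor
  · set b0 := wPlus (H (X' lam) lam) (Z (X' lam) lam) ε (y ε lam (X' lam))
    have h1 : ‖b0 - 1‖ ≤ ‖b0 - a0‖ + ‖a0 - 1‖ := by
      simpa using norm_add_le (b0 - a0) (a0 - 1)
    have h2 := est.2.trans (mul_le_mul_of_nonneg_left hW hKpos.le)
    calc ‖b0 - 1‖ ≤ K * ((C + K / c * (2 + K)) * ε) + C * ε := by linarith
      _ ≤ C' * ε := by rw [hC']; nlinarith
  · refine (est.1.trans hW).trans ?_
    have : C' * ε = (C + K / c * (2 + K)) * ε + K * (C + K / c * (2 + K)) * ε + C * ε + ε := by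
      rw [hC']; ring
    have h5 : 0 ≤ K * (C + K / c * (2 + K)) * ε := by positivity
    have h6 : 0 ≤ C * ε := by positivity
    linarith

/-! Chains of local transfers -/

theorem interval_chain {G : ℝ → Prop} (hab : a ≤ b) (h : ∀ t ∈ Icc a b, ∃ δ > 0, ∀ s ∈ Icc a b, ∀ s'
    ∈ Icc a b, |s - t| < δ → |s' - t| < δ → s < s' → G s → G s') (ha : G a) : G b := by
  choose! δ hδ hG using h
  obtain ⟨u, hu0, hmono, ⟨m, hm⟩, hcov⟩ := exists_monotone_Icc_subset_open_cover_Icc (ι := Icc a b)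
    hab (c := fun t => {s | |(s : ℝ) - t| < δ t})
    (fun t => isOpen_lt (by fun_prop) continuous_const)
    (fun t _ => mem_iUnion.2 ⟨t, by simpa using hδ t t.2⟩)
  have key : ∀ n, G (u n) := by
    intro n
    induction n with
    | zero => simpa [hu0] using ha
    | succ n ih =>
      obtain ⟨t, ht⟩ := hcov n
      rcases (hmono (Nat.le_succ n)).eq_or_lt with h | h
      · rwa [← h]
      · exact hG t t.2 _ (u n).2 _ (u (n + 1)).2 (ht ⟨le_rfl, h.le⟩) (ht ⟨h.le, le_rfl⟩)
          (by exact_mod_cast h) ih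
  have := key m
  rwa [hm m le_rfl] at this

/-- Near the parameter `t0`, the amplitude `h` and the phase `E` along the curves `D lam` come
from a germ of WKB branches. -/
def LocalBranch (P M : ℂ → ℂ) (μ : ℂ) (D E h : ℂ → ℝ → ℂ) (t0 : ℝ) : Prop :=
  ∃ H Z : ℂ → ℂ → ℂ, IsGerm P M μ (D μ t0) H Z ∧ ContinuousAt (D μ) t0 ∧
    ∀ᶠ t in 𝓝 t0, ContinuousAt (fun lam => D lam t) μ ∧
      ∀ᶠ lam in 𝓝 μ, H (D lam t) lam = h lam t ∧ Z (D lam t) lam = E lam t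

include hΩ hP hM in
theorem HasWKB.chain {D E : ℂ → ℝ → ℂ} (hab : a ≤ b) (hD : ∀ t ∈ Icc a b, D μ t ∈ Ω)
    (hloc : ∀ t ∈ Icc a b, LocalBranch P M μ D E h t)
    (hmono : StrictMonoOn (fun t => (E μ t).re) (Icc a b)) (hy : IsSolFamily P M Ω μ y) (ha : HasWKB
    μ y (fun lam => D lam a) (fun lam => E lam a) (fun lam => h lam a)) : HasWKB μ y (fun lam => D
    lam b) (fun lam => E lam b) (fun lam => h lam b) := by
  refine interval_chain (G := fun t => HasWKB μ y (fun lam => D lam t) (fun lam => E lam t)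
    (fun lam => h lam t)) hab (fun t ht => ?_) ha
  obtain ⟨H, Z, hg, hc, hloc⟩ := hloc t ht
  obtain ⟨B, hB, htr⟩ := hg.transfer hΩ hP hM (hD t ht)
  obtain ⟨δ, hδ, hball⟩ := Metric.eventually_nhds_iff.1 (hloc.and (hc.eventually hB))
  refine ⟨δ, hδ, fun s hs s' hs' hsδ hsδ' hss' hG => ?_⟩
  obtain ⟨⟨hcs, hes⟩, hBs⟩ := hball (by rwa [Real.dist_eq] : dist s t < δ)
  obtain ⟨⟨hcs', hes'⟩, hBs'⟩ := hball (by rwa [Real.dist_eq] : dist s' t < δ)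
  have hlt := hmono hs hs' hss'
  have e1 := hes.self_of_nhds
  have e2 := hes'.self_of_nhds
  refine (htr _ _ hcs hcs' hBs hBs' ?_ y hy (hG.congr EventuallyEq.rfl ?_ ?_)).congr
    EventuallyEq.rfl ?_ ?_
  · rw [e1.2, e2.2]; exact hlt
  · filter_upwards [hes] with lam h using h.2.symm
  · filter_upwards [hes] with lam h using h.1.symm
  · filter_upwards [hes'] with lam h using h.2
  · filter_upwards [hes'] with lam h using h.1

/-- Near `(μ, t0)`, `r` is a branch of `√(g₊ g₋)` along the curves `D lam`, and `E` is a
primitive of `r` along them. -/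
def IsArmAt (P M : ℂ → ℂ) (μ : ℂ) (D r E : ℂ → ℝ → ℂ) (t0 : ℝ) : Prop :=
  ∃ D' : ℂ → ℝ → ℂ, ∀ᶠ v : ℂ × ℝ in 𝓝 (μ, t0),
    ContinuousAt (fun v : ℂ × ℝ => D v.1 v.2) v ∧ ContinuousAt (fun v : ℂ × ℝ => r v.1 v.2) v ∧
    r v.1 v.2 ^ 2 = (P (D v.1 v.2) - v.1) * (v.1 - M (D v.1 v.2)) ∧
    HasDerivAt (D v.1) (D' v.1 v.2) v.2 ∧ HasDerivAt (E v.1) (r v.1 v.2 * D' v.1 v.2) v.2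

theorem IsArmAt.exists_germ {D E : ℂ → ℝ → ℂ} {t0 : ℝ} (harm : IsArmAt P M μ D r E t0)
    (hΩ : IsOpen Ω) (hP : DifferentiableOn ℂ P Ω) (hM : DifferentiableOn ℂ M Ω) (hD : D μ t0 ∈ Ω)
    (hr : r μ t0 ≠ 0) {h₀ : ℂ} (hh₀ : (P (D μ t0) - μ) * h₀ ^ 2 = r μ t0) : ∃ H Z : ℂ → ℂ → ℂ,
    IsGerm P M μ (D μ t0) H Z ∧ H (D μ t0) μ = h₀ ∧ ∀ᶠ v : ℂ × ℝ in 𝓝 (μ, t0), (P (D v.1 v.2) - v.1)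
    * H (D v.1 v.2) v.1 ^ 2 = r v.1 v.2 ∧ Z (D v.1 v.2) v.1 = E v.1 v.2 := by
  obtain ⟨D', harm⟩ := harm
  set p := D μ t0 with hp
  obtain ⟨hDc, hrc, hr2, -, -⟩ := harm.self_of_nhds
  simp only at hDc hrc hr2
  have hg : (P p - μ) * (μ - M p) ≠ 0 := by rw [← hr2]; exact pow_ne_zero _ hr
  have hPp : P p - μ ≠ 0 := left_ne_zero_of_mul hg
  have hMp : μ - M p ≠ 0 := right_ne_zero_of_mul hg
  have hcΩ : ∀ {f : ℂ → ℂ}, DifferentiableOn ℂ f Ω → ∀ᶠ v : ℂ × ℂ in 𝓝 (p, μ),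
      ContinuousAt (fun v : ℂ × ℂ => f v.1) v := by
    intro f hf
    filter_upwards [continuousAt_fst.eventually (hΩ.mem_nhds hD)] with v hv
    exact ContinuousAt.comp (x := v) (f := Prod.fst) (g := f)
      (hf.continuousOn.continuousAt (hΩ.mem_nhds hv)) continuousAt_fst
  have hPne : ∀ᶠ v : ℂ × ℂ in 𝓝 (p, μ), P v.1 - v.2 ≠ 0 :=
    ((hcΩ hP).self_of_nhds.sub continuousAt_snd).eventually_ne hPp
  obtain ⟨H, hHp, hH⟩ := exists_local_root (n := 4) (x := (p, μ)) (h₀ := h₀)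
    (G := fun v : ℂ × ℂ => (v.2 - M v.1) / (P v.1 - v.2)) (by norm_num)
    (by filter_upwards [hcΩ hP, hcΩ hM, hPne] with v h1 h2 h3
        exact (continuousAt_snd.sub h2).div (h1.sub continuousAt_snd) h3)
    (div_ne_zero hMp hPp) (by
      rw [eq_div_iff hPp]
      have : h₀ ^ 4 * (P p - μ) * (P p - μ) = (μ - M p) * (P p - μ) := by
        rw [mul_comm (μ - M p), ← hr2, ← hh₀]; ring
      exact mul_right_cancel₀ hPp this)
  have hall : ∀ᶠ v : ℂ × ℂ in 𝓝 (p, μ), ContinuousAt H v ∧ H v ≠ 0 ∧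
      (P v.1 - v.2) * H v ^ 4 = v.2 - M v.1 ∧ P v.1 - v.2 ≠ 0 ∧ v.1 ∈ Ω := by
    filter_upwards [hH, hPne, continuousAt_fst.eventually (hΩ.mem_nhds hD)] with v h1 h2 h3
    refine ⟨h1.1, h1.2.1, ?_, h2, h3⟩
    rw [h1.2.2]; field_simp
  obtain ⟨ρ, hρ, hball⟩ := Metric.eventually_nhds_iff.1 hall
  have hmem : ∀ x ∈ ball p ρ, ∀ lam ∈ ball μ ρ, _ := fun x hx lam hl =>
    hball (y := (x, lam)) (by rw [Prod.dist_eq]; exact max_lt hx hl)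
  set R : ℂ → ℂ → ℂ := fun lam x => (P x - lam) * H (x, lam) ^ 2 with hR
  have hHd : ∀ x ∈ ball p ρ, ∀ lam ∈ ball μ ρ, DifferentiableAt ℂ (fun x => H (x, lam)) x := by
    intro x hx lam hl
    have hm := hmem x hx lam hl
    refine (hasDerivAt_root (P := P) (M := M) (lam := lam) (x := fun x => x) ?_ ?_
      (hasDerivAt_id x) (hP.differentiableAt (hΩ.mem_nhds hm.2.2.2.2))
      (hM.differentiableAt (hΩ.mem_nhds hm.2.2.2.2)) hm.2.1 hm.2.2.2.1).differentiableAt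
    · exact hm.1.comp₂ continuousAt_id continuousAt_const
    · filter_upwards [isOpen_ball.mem_nhds hx] with s hs using (hmem s hs lam hl).2.2.1
  have hRd : ∀ lam ∈ ball μ ρ, DifferentiableOn ℂ (R lam) (ball p ρ) := by
    intro lam hl x hx
    have hm := hmem x hx lam hl
    exact (((hP.differentiableAt (hΩ.mem_nhds hm.2.2.2.2)).sub_const lam).mul
      ((hHd x hx lam hl).pow 2)).differentiableWithinAt
  set Z : ℂ → ℂ → ℂ := fun x lam => E lam t0 +
    (radialPrimitive (R lam) p x - radialPrimitive (R lam) p (D lam t0)) with hZ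
  have hZd : ∀ x ∈ ball p ρ, ∀ lam ∈ ball μ ρ,
      HasDerivAt (fun x => Z x lam) (R lam x) x := fun x hx lam hl =>
    ((hasDerivAt_radialPrimitive (hRd lam hl) hx).sub_const _).const_add _
  -- along the curves
  have hDnear : ∀ᶠ v : ℂ × ℝ in 𝓝 (μ, t0), D v.1 v.2 ∈ ball p ρ ∧ v.1 ∈ ball μ ρ :=
    (hDc.eventually (ball_mem_nhds _ hρ)).and
      (continuousAt_fst.eventually (ball_mem_nhds _ hρ))
  have hRr : ∀ᶠ v : ℂ × ℝ in 𝓝 (μ, t0), R v.1 (D v.1 v.2) = r v.1 v.2 := by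
    refine eventuallyEq_of_pow_eq (n := 2) (x := (μ, t0))
      (f := fun v : ℂ × ℝ => R v.1 (D v.1 v.2)) (g := fun v : ℂ × ℝ => r v.1 v.2) (by norm_num)
      ?_ hrc ?_ (by simp only [hR]; rw [hHp]; exact hh₀) (by
        simp only [hR]; rw [hHp, hh₀]; exact hr)
    · have c1 : ContinuousAt (fun v : ℂ × ℝ => (D v.1 v.2, v.1)) (μ, t0) :=
        hDc.prodMk continuousAt_fst
      have c2 : ContinuousAt (fun v : ℂ × ℂ => (P v.1 - v.2) * H v ^ 2) (p, μ) :=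
        ((hcΩ hP).self_of_nhds.sub continuousAt_snd).mul (hall.self_of_nhds.1.pow 2)
      exact ContinuousAt.comp (x := (μ, t0)) (f := fun v : ℂ × ℝ => (D v.1 v.2, v.1))
        (g := fun v : ℂ × ℂ => (P v.1 - v.2) * H v ^ 2) c2 c1
    · filter_upwards [hDnear, harm] with v h1 h2
      rw [h2.2.2.1, ← (hmem _ h1.1 _ h1.2).2.2.1]
      simp only [hR]
      ring
  refine ⟨fun x lam => H (x, lam), Z, ?_, hHp, ?_⟩
  · filter_upwards [ball_mem_nhds (p, μ) hρ] with v hv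
    rw [Metric.mem_ball, Prod.dist_eq, max_lt_iff] at hv
    have hm := hmem v.1 hv.1 v.2 hv.2
    exact ⟨hm.1, hm.2.1, hm.2.2.1, hm.2.2.2.1, hZd v.1 hv.1 v.2 hv.2⟩
  · refine hRr.and ?_
    obtain ⟨δ, hδ, hδb⟩ := Metric.eventually_nhds_iff.1 (hRr.and (hDnear.and harm))
    filter_upwards [ball_mem_nhds (μ, t0) hδ] with v hv
    rw [Metric.mem_ball, Prod.dist_eq, max_lt_iff] at hv
    obtain ⟨lam, t⟩ := v
    simp only at hv ⊢
    have hin : ∀ s ∈ ball t0 δ, _ := fun s hs =>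
      hδb (y := (lam, s)) (by rw [Prod.dist_eq]; exact max_lt hv.1 hs)
    have hd : ∀ s ∈ ball t0 δ, HasDerivAt (fun s => Z (D lam s) lam - E lam s) 0 s := by
      intro s hs
      obtain ⟨h1, h2, -, -, -, h3, h4⟩ := hin s hs
      refine (((hZd _ h2.1 _ h2.2).scomp s h3).sub h4).congr_deriv ?_
      simp only [smul_eq_mul] at h1 ⊢
      rw [h1]; ring
    have hconst := (convex_ball t0 δ).is_const_of_fderivWithin_eq_zero (𝕜 := ℝ)
      (f := fun s => Z (D lam s) lam - E lam s)
      (fun s hs => (hd s hs).differentiableAt.differentiableWithinAt)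
      (fun s hs => by
        rw [fderivWithin_of_isOpen isOpen_ball hs]
        ext
        simpa using (hd s hs).deriv) (Metric.mem_ball.2 hv.2) (mem_ball_self hδ)
    simp only [hZ, sub_self, add_zero] at hconst
    exact sub_eq_zero.1 hconst

theorem IsArmAt.localBranch {D E : ℂ → ℝ → ℂ} {t0 : ℝ} (harm : IsArmAt P M μ D r E t0)
    (hΩ : IsOpen Ω) (hP : DifferentiableOn ℂ P Ω) (hM : DifferentiableOn ℂ M Ω) (hD : D μ t0 ∈ Ω)
    (hr : r μ t0 ≠ 0) (hh : ContinuousAt (fun v : ℂ × ℝ => h v.1 v.2) (μ, t0)) (hhr : ∀ᶠ v : ℂ × ℝ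
    in 𝓝 (μ, t0), (P (D v.1 v.2) - v.1) * h v.1 v.2 ^ 2 = r v.1 v.2) : LocalBranch P M μ D E h t0 :=
    by
  obtain ⟨H, Z, hg, hH, hHZ⟩ := harm.exists_germ hΩ hP hM hD hr hhr.self_of_nhds
  obtain ⟨D', harm⟩ := harm
  have hDc : ContinuousAt (fun v : ℂ × ℝ => D v.1 v.2) (μ, t0) := harm.self_of_nhds.1
  have h0 : h μ t0 ≠ 0 := fun h0 => hr (by rw [← hhr.self_of_nhds, h0]; simp)
  have hPne : ∀ᶠ v : ℂ × ℝ in 𝓝 (μ, t0), P (D v.1 v.2) - v.1 ≠ 0 := by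
    have c1 : ContinuousAt (fun v : ℂ × ℝ => (D v.1 v.2, v.1)) (μ, t0) :=
      hDc.prodMk continuousAt_fst
    filter_upwards [c1.eventually hg] with v hv using hv.2.2.2.1
  have hHh : ∀ᶠ v : ℂ × ℝ in 𝓝 (μ, t0), H (D v.1 v.2) v.1 = h v.1 v.2 := by
    refine eventuallyEq_of_pow_eq (n := 2) (x := (μ, t0))
      (f := fun v : ℂ × ℝ => H (D v.1 v.2) v.1) (g := fun v : ℂ × ℝ => h v.1 v.2) (by norm_num)
      ?_ hh ?_ hH (by simpa only [hH] using h0)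
    · exact hg.self_of_nhds.1.comp₂ hDc continuousAt_fst
    · filter_upwards [hHZ, hhr, hPne] with v h1 h2 h3
      exact mul_left_cancel₀ h3 (h1.1.trans h2.symm)
  refine ⟨H, Z, hg, ?_, ?_⟩
  · exact hDc.comp₂ continuousAt_const continuousAt_id
  · have e1 : ∀ᶠ v : ℂ × ℝ in 𝓝 (μ, t0), ContinuousAt (fun v : ℂ × ℝ => D v.1 v.2) v ∧
        H (D v.1 v.2) v.1 = h v.1 v.2 ∧ Z (D v.1 v.2) v.1 = E v.1 v.2 := by
      filter_upwards [harm, hHh, hHZ] with v h1 h2 h3 using ⟨h1.1, h2, h3.2⟩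
    rw [nhds_prod_eq] at e1
    have e2 : ∀ᶠ t in 𝓝 t0, ∀ᶠ lam in 𝓝 μ, _ := (eventually_swap_iff.1 e1).curry
    filter_upwards [e2] with t ht
    refine ⟨?_, by filter_upwards [ht] with lam hl using hl.2⟩
    have := ht.self_of_nhds.1
    exact ContinuousAt.comp₂ (f := fun v : ℂ × ℝ => D v.1 v.2) this continuousAt_id continuousAt_const

/-! Uniqueness of germs -/

theorem IsGerm.eventuallyEq (hg : IsGerm P M μ p H Z) (hg' : IsGerm P M μ p H' Z')
    (hH : H p μ = H' p μ) {D : ℂ → ℂ} (hD : ContinuousAt D μ) (hDp : D μ = p)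
    (hZ : ∀ᶠ lam in 𝓝 μ, Z (D lam) lam = Z' (D lam) lam) : ∀ᶠ v : ℂ × ℂ in 𝓝 (p, μ), H v.1 v.2 = H'
    v.1 v.2 ∧ Z v.1 v.2 = Z' v.1 v.2 := by
  have e1 : ∀ᶠ v : ℂ × ℂ in 𝓝 (p, μ), H v.1 v.2 = H' v.1 v.2 := by
    refine eventuallyEq_of_pow_eq (n := 4) (x := (p, μ)) (f := fun v : ℂ × ℂ => H v.1 v.2)
      (g := fun v : ℂ × ℂ => H' v.1 v.2) (by norm_num) hg.self_of_nhds.1 hg'.self_of_nhds.1 ?_ hH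
      hg.self_of_nhds.2.1
    filter_upwards [hg, hg'] with v h1 h2
    exact mul_left_cancel₀ h1.2.2.2.1 (h1.2.2.1.trans h2.2.2.1.symm)
  refine e1.and ?_
  obtain ⟨δ, hδ, hb⟩ := Metric.eventually_nhds_iff.1 (e1.and (hg.and hg'))
  have e2 : ∀ᶠ lam in 𝓝 μ, D lam ∈ ball p δ ∧ lam ∈ ball μ δ :=
    (hD.eventually (by rw [hDp]; exact ball_mem_nhds _ hδ)).and
      (ball_mem_nhds _ hδ)
  filter_upwards [continuousAt_snd.eventually (hZ.and e2), ball_mem_nhds (p, μ) hδ]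
    with v h1 h2
  obtain ⟨x, lam⟩ := v
  rw [Metric.mem_ball, Prod.dist_eq, max_lt_iff] at h2
  simp only at h1 h2 ⊢
  have hd : ∀ s ∈ ball p δ, HasDerivAt (fun s => Z s lam - Z' s lam) 0 s := by
    intro s hs
    obtain ⟨f1, f2, f3⟩ := hb (y := (s, lam)) (by rw [Prod.dist_eq]; exact max_lt hs h2.2)
    refine (f2.2.2.2.2.sub f3.2.2.2.2).congr_deriv ?_
    simp only at f1 ⊢
    rw [f1, sub_self]
  have hconst := (convex_ball p δ).is_const_of_fderivWithin_eq_zero (𝕜 := ℂ)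
    (f := fun s => Z s lam - Z' s lam)
    (fun s hs => (hd s hs).differentiableAt.differentiableWithinAt)
    (fun s hs => by
      rw [fderivWithin_of_isOpen isOpen_ball hs]
      ext
      simpa using (hd s hs).deriv) (Metric.mem_ball.2 h2.1) h1.2.1
  simp only [h1.1, sub_self] at hconst
  exact sub_eq_zero.1 hconst

theorem IsGerm.mul_const (hg : IsGerm P M μ p H Z) {c : ℂ} {e : ℂ} (hc : c ^ 2 = e) (he : e ^ 2 = 1)
    (k : ℂ → ℂ) : IsGerm P M μ p (fun x lam => c * H x lam) (fun x lam => e * Z x lam + k lam) := by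
  have hc0 : c ≠ 0 := by
    rintro rfl
    rw [← hc] at he
    norm_num at he
  filter_upwards [hg] with v h
  refine ⟨continuousAt_const.mul h.1, mul_ne_zero hc0 h.2.1, ?_, h.2.2.2.1, ?_⟩
  · rw [← h.2.2.1, mul_pow, show c ^ 4 = (c ^ 2) ^ 2 by ring, hc, he, one_mul]
  · refine ((h.2.2.2.2.const_mul e).add_const _).congr_deriv ?_
    rw [mul_pow, hc]; ring

theorem IsGerm.hasDerivAt_phase (hg : IsGerm P M μ p H Z) : HasDerivAt (fun x => Z x μ) ((P p - μ) *
    H p μ ^ 2) p ∧ (P p - μ) * H p μ ^ 2 ≠ 0 :=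
  ⟨hg.self_of_nhds.2.2.2.2,
    mul_ne_zero hg.self_of_nhds.2.2.2.1 (pow_ne_zero _ hg.self_of_nhds.2.1)⟩

theorem IsGerm.eventually (hg : IsGerm P M μ p H Z) : ∀ᶠ x in 𝓝 p, IsGerm P M μ x H Z := by
  have c : ContinuousAt (fun x : ℂ => (x, μ)) p := by fun_prop
  exact c.eventually (eventually_eventually_nhds.2 hg)

/-! Uniformization at a simple turning point -/

/-- Coordinates near a simple turning point: `w = ω(x, lam)` is `g₊` (if `e = -1`) or `g₋`
(if `e = 1`), `x = ξ(w, lam)` is the inverse, and `ν` is a fourth root of the other one of the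
two functions, so that `(σ / ν) ^ e` is a branch of `(g₋/g₊)^{1/4}` when `σ ^ 4 = w`. -/
structure TurningCoord (P M : ℂ → ℂ) (μ a₀ : ℂ) (e : ℤ) (N : Set ℂ) (ρ : ℝ)
    (ξ ξ' ν ω : ℂ → ℂ → ℂ) : Prop where
  sign : e = 1 ∨ e = -1
  isOpen : IsOpen N
  mem : a₀ ∈ N
  pos : 0 < ρ
  base : ω a₀ μ = 0
  cont_ω : ∀ x ∈ N, ∀ lam, ContinuousAt (fun v : ℂ × ℂ => ω v.1 v.2) (x, lam)
  diff_ω : ∀ x ∈ N, ∀ lam, DifferentiableAt ℂ (fun x => ω x lam) x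
  inv_ω : ∀ x ∈ N, ∀ lam, ξ (ω x lam) lam = x
  inv_ξ : ∀ w ∈ ball (0 : ℂ) ρ, ∀ lam ∈ ball μ ρ, ω (ξ w lam) lam = w
  mem_ξ : ∀ w ∈ ball (0 : ℂ) ρ, ∀ lam ∈ ball μ ρ, ξ w lam ∈ N
  cont_ξ : ∀ w ∈ ball (0 : ℂ) ρ, ∀ lam ∈ ball μ ρ,
    ContinuousAt (fun v : ℂ × ℂ => ξ v.1 v.2) (w, lam)
  deriv_ξ : ∀ w ∈ ball (0 : ℂ) ρ, ∀ lam ∈ ball μ ρ,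
    HasDerivAt (fun w => ξ w lam) (ξ' w lam) w
  deriv_ξ_ne : ∀ w ∈ ball (0 : ℂ) ρ, ∀ lam ∈ ball μ ρ, ξ' w lam ≠ 0
  diff_ξ' : ∀ w ∈ ball (0 : ℂ) ρ, ∀ lam ∈ ball μ ρ,
    DifferentiableAt ℂ (fun w => ξ' w lam) w
  cont_ν : ∀ w ∈ ball (0 : ℂ) ρ, ∀ lam ∈ ball μ ρ,
    ContinuousAt (fun v : ℂ × ℂ => ν v.1 v.2) (w, lam)
  diff_ν : ∀ w ∈ ball (0 : ℂ) ρ, ∀ lam ∈ ball μ ρ,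
    DifferentiableAt ℂ (fun w => ν w lam) w
  ν_ne : ∀ w ∈ ball (0 : ℂ) ρ, ∀ lam ∈ ball μ ρ, ν w lam ≠ 0
  prod : ∀ w ∈ ball (0 : ℂ) ρ, ∀ lam ∈ ball μ ρ,
    (P (ξ w lam) - lam) * (lam - M (ξ w lam)) = w * ν w lam ^ 4
  ne : ∀ w ∈ ball (0 : ℂ) ρ, ∀ lam ∈ ball μ ρ, w ≠ 0 → P (ξ w lam) - lam ≠ 0
  root : ∀ w ∈ ball (0 : ℂ) ρ, ∀ lam ∈ ball μ ρ, ∀ σ : ℂ, σ ≠ 0 → σ ^ 4 = w →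
    (P (ξ w lam) - lam) * ((σ / ν w lam) ^ e) ^ 4 = lam - M (ξ w lam) ∧
    (P (ξ w lam) - lam) * ((σ / ν w lam) ^ e) ^ 2 = σ ^ 2 * ν w lam ^ 2
  of_root : ∀ w ∈ ball (0 : ℂ) ρ, ∀ lam ∈ ball μ ρ, w ≠ 0 → ∀ h : ℂ,
    (P (ξ w lam) - lam) * h ^ 4 = lam - M (ξ w lam) → (ν w lam * h ^ e) ^ 4 = w

variable (T : TurningCoord P M μ a₀ e N ρ ξ ξ' ν ω)

include hΩ in
theorem exists_turningCoord {Λ Λ2 : ℂ → ℂ} (hΛ : DifferentiableOn ℂ Λ Ω)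
    (hΛ2 : DifferentiableOn ℂ Λ2 Ω) (hcase : (e = -1 ∧ Λ = P ∧ Λ2 = M) ∨ (e = 1 ∧ Λ = M ∧ Λ2 = P))
    (ha : a₀ ∈ Ω) (h1 : Λ a₀ = μ) (h2 : deriv Λ a₀ ≠ 0) (h3 : Λ2 a₀ ≠ μ) : ∃ N ρ ξ ξ' ν, N ⊆ Ω ∧
    TurningCoord P M μ a₀ e N ρ ξ ξ' ν (fun x lam => -e * (Λ x - lam)) := by
  have he : e = 1 ∨ e = -1 := by tauto
  have hee : (e : ℂ) * e = 1 := by rcases he with rfl | rfl <;> norm_num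
  have he0 : (e : ℂ) ≠ 0 := left_ne_zero_of_mul_eq_one hee
  have hdc : ContinuousAt (deriv Λ) a₀ :=
    (hΛ.deriv hΩ).continuousOn.continuousAt (hΩ.mem_nhds ha)
  obtain ⟨φ, haφ, hφ, hφs⟩ := exists_localHomeomorph (f := Λ) (p := a₀)
    (by filter_upwards [hΩ.mem_nhds ha] with x hx using hΛ.differentiableAt (hΩ.mem_nhds hx)) h2
    (Filter.inter_mem (hΩ.mem_nhds ha) (hdc.eventually_ne h2))
  have hφ' : ∀ x, φ x = Λ x := congrFun hφ
  set ξ : ℂ → ℂ → ℂ := fun w lam => φ.symm (lam - e * w) with hξ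
  have hsa : φ.symm μ = a₀ := by rw [← h1, ← hφ', φ.left_inv haφ]
  have htgt : μ ∈ φ.target := by rw [← h1, ← hφ']; exact φ.map_source haφ
  have hmapc : Continuous (fun v : ℂ × ℂ => v.2 - e * v.1) := by fun_prop
  have htev : ∀ᶠ v : ℂ × ℂ in 𝓝 (0, μ), v.2 - e * v.1 ∈ φ.target :=
    hmapc.continuousAt.eventually (φ.open_target.mem_nhds (by simpa using htgt))
  have hξc : ∀ v : ℂ × ℂ, v.2 - e * v.1 ∈ φ.target →
      ContinuousAt (fun v : ℂ × ℂ => ξ v.1 v.2) v := fun v hv =>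
    ContinuousAt.comp (x := v) (f := fun v : ℂ × ℂ => v.2 - e * v.1) (g := φ.symm)
      (φ.continuousAt_symm hv) hmapc.continuousAt
  set G : ℂ × ℂ → ℂ := fun v => -e * (v.2 - Λ2 (ξ v.1 v.2)) with hG
  have hGc : ∀ v : ℂ × ℂ, v.2 - e * v.1 ∈ φ.target → ContinuousAt G v := by
    intro v hv
    have hx : ξ v.1 v.2 ∈ Ω := (hφs (φ.map_target hv)).1
    exact continuousAt_const.mul (continuousAt_snd.sub (ContinuousAt.comp (x := v)
      (f := fun v : ℂ × ℂ => ξ v.1 v.2) (g := Λ2)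
      (hΛ2.continuousOn.continuousAt (hΩ.mem_nhds hx)) (hξc v hv)))
  have hG0 : G (0, μ) ≠ 0 := by
    simp only [hG, hξ, mul_zero, sub_zero, hsa]
    exact mul_ne_zero (neg_ne_zero.2 he0) (sub_ne_zero.2 h3.symm)
  obtain ⟨mu, -, hmu⟩ := exists_local_root (n := 4) (x := ((0 : ℂ), μ)) (G := G)
    (h₀ := (G (0, μ)) ^ (1 / 4 : ℂ)) (by norm_num)
    (by filter_upwards [htev] with v hv using hGc v hv) hG0 (by
      rw [← Complex.cpow_nat_mul]; norm_num)
  obtain ⟨ρ, hρ, hb⟩ := Metric.eventually_nhds_iff.1 (hmu.and htev)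
  have hin : ∀ w ∈ ball (0 : ℂ) ρ, ∀ lam ∈ ball μ ρ, _ := fun w hw lam hl =>
    hb (y := (w, lam)) (by rw [Prod.dist_eq]; exact max_lt hw hl)
  set ξ' : ℂ → ℂ → ℂ := fun w lam => -e / deriv Λ (ξ w lam) with hξ'
  have hsrc : ∀ w ∈ ball (0 : ℂ) ρ, ∀ lam ∈ ball μ ρ, ξ w lam ∈ φ.source :=
    fun w hw lam hl => φ.map_target (hin w hw lam hl).2
  have hΛξ : ∀ w ∈ ball (0 : ℂ) ρ, ∀ lam ∈ ball μ ρ,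
      Λ (ξ w lam) = lam - e * w := fun w hw lam hl => by
    rw [← hφ']; exact φ.right_inv (hin w hw lam hl).2
  have hξd : ∀ w ∈ ball (0 : ℂ) ρ, ∀ lam ∈ ball μ ρ,
      HasDerivAt (fun w => ξ w lam) (ξ' w lam) w := by
    intro w hw lam hl
    have hx := hφs (hsrc w hw lam hl)
    have h4 : HasDerivAt φ.symm (deriv Λ (ξ w lam))⁻¹ (lam - e * w) := by
      refine φ.hasDerivAt_symm (hin w hw lam hl).2 hx.2 ?_
      rw [hφ]
      exact (hΛ.differentiableAt (hΩ.mem_nhds hx.1)).hasDerivAt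
    have h5 : HasDerivAt (fun w : ℂ => lam - e * w) (-e) w := by
      simpa using ((hasDerivAt_id w).const_mul (e : ℂ)).const_sub lam
    exact (h4.comp w h5).congr_deriv (by simp only [hξ']; ring)
  have hpm : ∀ w ∈ ball (0 : ℂ) ρ, ∀ lam ∈ ball μ ρ,
      (e = -1 ∧ P (ξ w lam) - lam = w ∧ lam - M (ξ w lam) = mu (w, lam) ^ 4) ∨
      (e = 1 ∧ lam - M (ξ w lam) = w ∧ P (ξ w lam) - lam = mu (w, lam) ^ 4) := by
    intro w hw lam hl
    have h4 := (hin w hw lam hl).1.2.2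
    have h5 := hΛξ w hw lam hl
    simp only [hG] at h4
    rw [h4]
    rcases hcase with ⟨rfl, rfl, rfl⟩ | ⟨rfl, rfl, rfl⟩
    · left; refine ⟨rfl, ?_, ?_⟩
      · rw [h5]; push_cast; ring
      · push_cast; ring
    · right; refine ⟨rfl, ?_, ?_⟩
      · rw [h5]; push_cast; ring
      · push_cast; ring
  refine ⟨φ.source, ρ, ξ, ξ', fun w lam => mu (w, lam), fun x hx => (hφs hx).1,
    { sign := he, isOpen := φ.open_source, mem := haφ, pos := hρ, base := by simp [h1],
      cont_ω := ?_, diff_ω := ?_, inv_ω := ?_, inv_ξ := ?_, mem_ξ := hsrc, cont_ξ := ?_,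
      deriv_ξ := hξd, deriv_ξ_ne := ?_, diff_ξ' := ?_, cont_ν := ?_, diff_ν := ?_, ν_ne := ?_,
      prod := ?_, ne := ?_, root := ?_, of_root := ?_ }⟩
  · intro x hx lam
    have : ContinuousAt Λ x := hΛ.continuousOn.continuousAt (hΩ.mem_nhds (hφs hx).1)
    exact continuousAt_const.mul ((ContinuousAt.comp (x := (x, lam)) (f := Prod.fst) (g := Λ) this
      continuousAt_fst).sub continuousAt_snd)
  · intro x hx lam
    exact ((hΛ.differentiableAt (hΩ.mem_nhds (hφs hx).1)).sub_const lam).const_mul _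
  · intro x hx lam
    have : lam - e * (-e * (Λ x - lam)) = Λ x := by linear_combination (Λ x - lam) * hee
    simp only [hξ]
    rw [this, ← hφ', φ.left_inv hx]
  · intro w hw lam hl
    rw [hΛξ w hw lam hl]
    linear_combination w * hee
  · intro w hw lam hl
    exact hξc (w, lam) (hin w hw lam hl).2
  · intro w hw lam hl
    exact div_ne_zero (neg_ne_zero.2 he0) (hφs (hsrc w hw lam hl)).2
  · intro w hw lam hl
    have hx := hφs (hsrc w hw lam hl)
    have h4 : DifferentiableAt ℂ (deriv Λ) (ξ w lam) :=
      (hΛ.deriv hΩ).differentiableAt (hΩ.mem_nhds hx.1)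
    exact (differentiableAt_const _).div (DifferentiableAt.comp w (g := deriv Λ)
      (f := fun w => ξ w lam) h4 (hξd w hw lam hl).differentiableAt) hx.2
  · intro w hw lam hl
    exact (hin w hw lam hl).1.1
  · intro w hw lam hl
    have hx := hφs (hsrc w hw lam hl)
    have h4 : DifferentiableAt ℂ (fun w => G (w, lam)) w :=
      (((hΛ2.differentiableAt (hΩ.mem_nhds hx.1)).comp w
        (hξd w hw lam hl).differentiableAt).const_sub lam).const_mul _
    refine (hasDerivAt_of_pow_eq (n := 4) (g := fun w => G (w, lam)) (by norm_num) ?_ ?_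
      h4.hasDerivAt (hin w hw lam hl).1.2.1).differentiableAt
    · exact (hin w hw lam hl).1.1.comp₂ continuousAt_id continuousAt_const
    · filter_upwards [isOpen_ball.mem_nhds hw] with s hs using (hin s hs lam hl).1.2.2
  · intro w hw lam hl
    exact (hin w hw lam hl).1.2.1
  · intro w hw lam hl
    rcases hpm w hw lam hl with ⟨-, h4, h5⟩ | ⟨-, h4, h5⟩ <;> rw [h4, h5] <;> ring
  · intro w hw lam hl hw0
    rcases hpm w hw lam hl with ⟨-, h4, h5⟩ | ⟨-, h4, h5⟩
    · rwa [h4]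
    · rw [h5]; exact pow_ne_zero _ (hin w hw lam hl).1.2.1
  · intro w hw lam hl σ hσ hσw
    have hm0 := (hin w hw lam hl).1.2.1
    rcases hpm w hw lam hl with ⟨h3, h4, h5⟩ | ⟨h3, h4, h5⟩ <;> rw [h4, h5, h3] <;>
      refine ⟨?_, ?_⟩ <;> simp only [zpow_neg, zpow_one, ← hσw] <;> rw [← hσw] at hm0 <;>
      field_simp
  · intro w hw lam hl hw0 h hh
    have hm0 := (hin w hw lam hl).1.2.1
    rcases hpm w hw lam hl with ⟨h3, h4, h5⟩ | ⟨h3, h4, h5⟩ <;> rw [h4, h5] at hh <;> rw [h3]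
    · have hh0 : h ≠ 0 := by
        rintro rfl
        exact pow_ne_zero 4 hm0 (by rw [← hh]; ring)
      simp only [zpow_neg, zpow_one]
      rw [mul_pow, ← hh]
      field_simp
    · rw [zpow_one, mul_pow, hh]

/-- The phase `∫ √(g₊ g₋) dx` from the turning point, as a function of a square root of `w`. -/
noncomputable def turningPhase (ξ' ν : ℂ → ℂ → ℂ) (τ lam : ℂ) : ℂ :=
  radialPrimitive (fun τ => 2 * τ ^ 2 * (ν (τ ^ 2) lam ^ 2 * ξ' (τ ^ 2) lam)) 0 τ

@[simp] theorem turningPhase_zero (lam : ℂ) : turningPhase ξ' ν 0 lam = 0 :=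
  radialPrimitive_self _ _

theorem turningPhase_eq (τ lam : ℂ) : turningPhase ξ' ν τ lam = τ ^ 3 * ∫ t in (0 : ℝ)..1, 2 * (t :
    ℂ) ^ 2 * (ν (t ^ 2 * τ ^ 2) lam ^ 2 * ξ' (t ^ 2 * τ ^ 2) lam) := by
  rw [turningPhase, radialPrimitive, ← intervalIntegral.integral_const_mul]
  congr 1
  ext t
  simp only [sub_zero, zero_add, smul_eq_mul, mul_pow]
  ring

theorem turningPhase_neg (τ lam : ℂ) : turningPhase ξ' ν (-τ) lam = -turningPhase ξ' ν τ lam := by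
  rw [turningPhase_eq, turningPhase_eq, neg_sq]
  ring

theorem sq_mem_ball (hτ : τ ∈ ball (0 : ℂ) (√ρ)) : τ ^ 2 ∈ ball (0 : ℂ) ρ := by
  rw [mem_ball_zero_iff] at hτ ⊢
  rw [norm_pow]
  have h := Real.sqrt_pos.1 ((norm_nonneg _).trans_lt hτ)
  calc ‖τ‖ ^ 2 < √ρ ^ 2 := by gcongr
    _ = ρ := Real.sq_sqrt h.le

theorem mem_ball_of_sq (hτ : τ ^ 2 ∈ ball (0 : ℂ) ρ) : τ ∈ ball (0 : ℂ) (√ρ) := by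
  rw [mem_ball_zero_iff] at hτ ⊢
  rw [norm_pow] at hτ
  exact Real.lt_sqrt_of_sq_lt hτ

include T in
theorem TurningCoord.hasDerivAt_phase (hτ : τ ^ 2 ∈ ball (0 : ℂ) ρ) (hlam : lam ∈ ball μ ρ) :
    HasDerivAt (fun τ => turningPhase ξ' ν τ lam) (2 * τ ^ 2 * (ν (τ ^ 2) lam ^ 2 * ξ' (τ ^ 2) lam))
    τ := by
  refine hasDerivAt_radialPrimitive (r := √ρ)
    (f := fun τ => 2 * τ ^ 2 * (ν (τ ^ 2) lam ^ 2 * ξ' (τ ^ 2) lam)) ?_ (mem_ball_of_sq hτ)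
  intro s hs
  have h1 : DifferentiableAt ℂ (fun s : ℂ => ν (s ^ 2) lam) s :=
    (T.diff_ν _ (sq_mem_ball hs) lam hlam).comp s (differentiableAt_pow 2)
  have h2 : DifferentiableAt ℂ (fun s : ℂ => ξ' (s ^ 2) lam) s :=
    (T.diff_ξ' _ (sq_mem_ball hs) lam hlam).comp s (differentiableAt_pow 2)
  exact ((((differentiableAt_pow 2).const_mul 2).mul ((h1.pow 2).mul h2))).differentiableWithinAt

include T in
theorem TurningCoord.hasDerivAt_ω (hx : x ∈ N) (hw : ω x lam ∈ ball (0 : ℂ) ρ)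
    (hlam : lam ∈ ball μ ρ) : HasDerivAt (fun x => ω x lam) (ξ' (ω x lam) lam)⁻¹ x := by
  have h1 := (T.diff_ω x hx lam).hasDerivAt
  have h2 : HasDerivAt (fun x => ξ (ω x lam) lam)
      (ξ' (ω x lam) lam * deriv (fun x => ω x lam) x) x :=
    HasDerivAt.comp x (h₂ := fun w => ξ w lam) (h := fun x => ω x lam)
      (T.deriv_ξ _ hw lam hlam) h1
  have h3 : (fun x => ξ (ω x lam) lam) =ᶠ[𝓝 x] id := by
    filter_upwards [T.isOpen.mem_nhds hx] with z hz using T.inv_ω z hz lam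
  have h4 := (h2.congr_of_eventuallyEq h3.symm).unique (hasDerivAt_id x)
  refine h1.congr_deriv ?_
  rw [eq_inv_of_mul_eq_one_right h4]

include T in
/-- The germ of WKB branches at a point near the turning point, given by a value of `w^{1/4}`. -/
theorem TurningCoord.exists_germ {σ1 : ℂ} (hσ1 : σ1 ≠ 0) (hσρ : σ1 ^ 4 ∈ ball (0 : ℂ) ρ) : ∃ s : ℂ →
    ℂ → ℂ, s (ξ (σ1 ^ 4) μ) μ = σ1 ∧ IsGerm P M μ (ξ (σ1 ^ 4) μ) (fun x lam => (s x lam / ν (ω x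
    lam) lam) ^ e) (fun x lam => turningPhase ξ' ν (s x lam ^ 2) lam) ∧ ∀ᶠ v : ℂ × ℂ in 𝓝 (ξ (σ1 ^
    4) μ, μ), ContinuousAt (fun v : ℂ × ℂ => s v.1 v.2) v ∧ s v.1 v.2 ^ 4 = ω v.1 v.2 ∧ v.1 ∈ N ∧ ω
    v.1 v.2 ∈ ball (0 : ℂ) ρ := by
  have hl0 := mem_ball_self (x := μ) T.pos
  set p := ξ (σ1 ^ 4) μ with hp
  have hpN : p ∈ N := T.mem_ξ _ hσρ _ hl0
  have hωp : ω p μ = σ1 ^ 4 := T.inv_ξ _ hσρ _ hl0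
  have hNev : ∀ᶠ v : ℂ × ℂ in 𝓝 (p, μ), v.1 ∈ N :=
    continuousAt_fst.eventually (T.isOpen.mem_nhds hpN)
  obtain ⟨s, hs1, hs⟩ := exists_local_root (n := 4) (x := (p, μ)) (h₀ := σ1)
    (G := fun v : ℂ × ℂ => ω v.1 v.2) (by norm_num)
    (by filter_upwards [hNev] with v hv using T.cont_ω _ hv _)
    (by simp only [hωp]; exact pow_ne_zero _ hσ1) hωp.symm
  have hωev : ∀ᶠ v : ℂ × ℂ in 𝓝 (p, μ), ω v.1 v.2 ∈ ball (0 : ℂ) ρ :=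
    (T.cont_ω p hpN μ).eventually (isOpen_ball.mem_nhds (by simpa [hωp] using hσρ))
  have hall : ∀ᶠ v : ℂ × ℂ in 𝓝 (p, μ), ContinuousAt s v ∧ s v ≠ 0 ∧
      s v ^ 4 = ω v.1 v.2 ∧ v.1 ∈ N ∧ ω v.1 v.2 ∈ ball (0 : ℂ) ρ ∧
      v.2 ∈ ball μ ρ := by
    filter_upwards [hs, hNev, hωev, continuousAt_snd.eventually (ball_mem_nhds μ T.pos)]
      with v h1 h2 h3 h4 using ⟨h1.1, h1.2.1, h1.2.2, h2, h3, h4⟩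
  refine ⟨fun x lam => s (x, lam), hs1, ?_, ?_⟩
  · filter_upwards [eventually_eventually_nhds.2 hall] with v hv'
    obtain ⟨h1, h2, h3, h4, h5, h6⟩ := hv'.self_of_nhds
    have hν0 := T.ν_ne _ h5 _ h6
    have hsν : s v / ν (ω v.1 v.2) v.2 ≠ 0 := div_ne_zero h2 hν0
    have hrt := T.root _ h5 _ h6 _ h2 h3
    rw [T.inv_ω _ h4] at hrt
    refine ⟨?_, zpow_ne_zero _ hsν, hrt.1, ?_, ?_⟩
    · have c1 : ContinuousAt (fun v : ℂ × ℂ => ν (ω v.1 v.2) v.2) v :=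
        (T.cont_ν _ h5 _ h6).comp₂ (T.cont_ω _ h4 _) continuousAt_snd
      exact (h1.div c1 hν0).zpow₀ e (Or.inl hsν)
    · have := T.ne _ h5 _ h6 (by rw [← h3]; exact pow_ne_zero _ h2)
      rwa [T.inv_ω _ h4] at this
    · have hsd : HasDerivAt (fun x => s (x, v.2)) ((ξ' (ω v.1 v.2) v.2)⁻¹ / (4 * s v ^ 3)) v.1 := by
        have := hasDerivAt_of_pow_eq (n := 4) (x := v.1) (f := fun x => s (x, v.2))
          (g := fun x => ω x v.2) (by norm_num)
          (h1.comp₂ (g := fun x => x) (h := fun _ => v.2) continuousAt_id continuousAt_const) ?_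
          (T.hasDerivAt_ω h4 h5 h6) h2
        · simpa using this
        · have c : ContinuousAt (fun x : ℂ => (x, v.2)) v.1 := by fun_prop
          filter_upwards [c.eventually hv'] with x hx using hx.2.2.1
      have hs4 : (s v ^ 2) ^ 2 = ω v.1 v.2 := by rw [← h3]; ring
      have h7 := T.hasDerivAt_phase (τ := s v ^ 2) (lam := v.2) (by rwa [hs4]) h6
      have h8 := HasDerivAt.comp v.1 (h₂ := fun τ => turningPhase ξ' ν τ v.2)
        (h := fun x => s (x, v.2) ^ 2) h7 (hsd.pow 2)
      refine h8.congr_deriv ?_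
      rw [hrt.2, hs4]
      have := T.deriv_ξ_ne _ h5 _ h6
      push_cast
      field_simp
      rw [← h3]
      norm_num
      ring
  · filter_upwards [hall] with v h using ⟨h.1, h.2.2.1, h.2.2.2.1, h.2.2.2.2.1⟩

/-- WKB asymptotics at the point with coordinate `σ`. -/
def HasWKBAt (μ : ℂ) (e : ℤ) (ξ ξ' ν : ℂ → ℂ → ℂ) (y : ℝ → ℂ → ℂ → ℂ × ℂ) (σ : ℂ → ℂ) : Prop :=
  HasWKB μ y (fun lam => ξ (σ lam ^ 4) lam) (fun lam => turningPhase ξ' ν (σ lam ^ 2) lam)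
    (fun lam => (σ lam / ν (σ lam ^ 4) lam) ^ e)

include T hΩ hP hM in
theorem TurningCoord.transfer (hN : N ⊆ Ω) {σ1 : ℂ} (hσ1 : σ1 ≠ 0) (hσρ : σ1 ^ 4 ∈ ball (0 : ℂ) ρ) :
    ∃ B ∈ 𝓝 σ1, ∀ σ σ' : ℂ → ℂ, ContinuousAt σ μ → ContinuousAt σ' μ → σ μ ∈ B → σ' μ ∈ B →
    (turningPhase ξ' ν (σ μ ^ 2) μ).re < (turningPhase ξ' ν (σ' μ ^ 2) μ).re → ∀ y, IsSolFamily P M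
    Ω μ y → HasWKBAt μ e ξ ξ' ν y σ → HasWKBAt μ e ξ ξ' ν y σ' := by
  have hl0 := mem_ball_self (x := μ) T.pos
  obtain ⟨s, hs1, hg, hs⟩ := T.exists_germ hσ1 hσρ
  set p := ξ (σ1 ^ 4) μ with hp
  obtain ⟨D, hD, htr⟩ := hg.transfer hΩ hP hM (hN (T.mem_ξ _ hσρ _ hl0))
  have hqc : ContinuousAt (fun u : ℂ × ℂ => ξ (u.1 ^ 4) u.2) (σ1, μ) :=
    ContinuousAt.comp (x := (σ1, μ)) (f := fun u : ℂ × ℂ => (u.1 ^ 4, u.2))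
      (g := fun v : ℂ × ℂ => ξ v.1 v.2) (T.cont_ξ _ hσρ _ hl0) (by fun_prop)
  have hinv : ∀ᶠ u : ℂ × ℂ in 𝓝 (σ1, μ), s (ξ (u.1 ^ 4) u.2) u.2 = u.1 ∧
      ω (ξ (u.1 ^ 4) u.2) u.2 = u.1 ^ 4 ∧ ξ (u.1 ^ 4) u.2 ∈ D ∧
      ContinuousAt (fun u : ℂ × ℂ => ξ (u.1 ^ 4) u.2) u := by
    have hq2 : ContinuousAt (fun u : ℂ × ℂ => (ξ (u.1 ^ 4) u.2, u.2)) (σ1, μ) :=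
      hqc.prodMk continuousAt_snd
    have hbb : ∀ᶠ u : ℂ × ℂ in 𝓝 (σ1, μ), u.1 ^ 4 ∈ ball (0 : ℂ) ρ ∧ u.2 ∈ ball μ ρ := by
      have c : ContinuousAt (fun u : ℂ × ℂ => u.1 ^ 4) (σ1, μ) := by fun_prop
      exact (c.eventually (isOpen_ball.mem_nhds hσρ)).and
        (continuousAt_snd.eventually (ball_mem_nhds μ T.pos))
    have e1 : ∀ᶠ u : ℂ × ℂ in 𝓝 (σ1, μ), s (ξ (u.1 ^ 4) u.2) u.2 = u.1 := by
      refine eventuallyEq_of_pow_eq (n := 4) (x := (σ1, μ))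
        (f := fun u : ℂ × ℂ => s (ξ (u.1 ^ 4) u.2) u.2) (g := fun u : ℂ × ℂ => u.1)
        (by norm_num) ?_ continuousAt_fst ?_ hs1 (by simpa only [← hp, hs1] using hσ1)
      · exact ContinuousAt.comp (x := (σ1, μ))
          (f := fun u : ℂ × ℂ => (ξ (u.1 ^ 4) u.2, u.2)) (g := fun v : ℂ × ℂ => s v.1 v.2)
          hs.self_of_nhds.1 hq2
      · filter_upwards [hq2.eventually hs, hbb] with u h1 h2
        rw [h1.2.1, T.inv_ξ _ h2.1 _ h2.2]
    filter_upwards [e1, hbb, hqc.eventually hD] with u h1 h2 h3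
    exact ⟨h1, T.inv_ξ _ h2.1 _ h2.2, h3,
      ContinuousAt.comp (x := u) (f := fun u : ℂ × ℂ => (u.1 ^ 4, u.2))
        (g := fun v : ℂ × ℂ => ξ v.1 v.2) (T.cont_ξ _ h2.1 _ h2.2) (by fun_prop)⟩
  obtain ⟨pB, hB, pL, hL, hBL⟩ := eventually_prod_iff.1 (by rw [nhds_prod_eq] at hinv; exact hinv)
  refine ⟨interior {x | pB x}, interior_mem_nhds.2 hB, ?_⟩
  intro σ σ' hσ hσ' hσB hσB' hlt y hy hyσ
  have key : ∀ σ : ℂ → ℂ, ContinuousAt σ μ → σ μ ∈ interior {x | pB x} →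
      ∀ᶠ lam in 𝓝 μ, s (ξ (σ lam ^ 4) lam) lam = σ lam ∧
        ω (ξ (σ lam ^ 4) lam) lam = σ lam ^ 4 := by
    intro σ hσ hσB
    filter_upwards [hσ.eventually (isOpen_interior.mem_nhds hσB), hL] with lam h1 h2
    exact ⟨(hBL (interior_subset h1) h2).1, (hBL (interior_subset h1) h2).2.1⟩
  have hXc : ∀ σ : ℂ → ℂ, ContinuousAt σ μ → σ μ ∈ interior {x | pB x} →
      ContinuousAt (fun lam => ξ (σ lam ^ 4) lam) μ := fun σ hσ hσB =>
    (hBL (interior_subset hσB) hL.self_of_nhds).2.2.2.comp₂ hσ continuousAt_id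
  have k1 := key σ hσ hσB
  have k2 := key σ' hσ' hσB'
  refine (htr _ _ (hXc σ hσ hσB) (hXc σ' hσ' hσB')
    (hBL (interior_subset hσB) hL.self_of_nhds).2.2.1
    (hBL (interior_subset hσB') hL.self_of_nhds).2.2.1 ?_ y hy
    (hyσ.congr EventuallyEq.rfl ?_ ?_)).congr EventuallyEq.rfl ?_ ?_
  · simp only [k1.self_of_nhds.1, k2.self_of_nhds.1]; exact hlt
  · filter_upwards [k1] with lam h; simp only [h.1]
  · filter_upwards [k1] with lam h; simp only [h.1, h.2]
  · filter_upwards [k2] with lam h; simp only [h.1]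
  · filter_upwards [k2] with lam h; simp only [h.1, h.2]

include T hΩ hP hM in
theorem TurningCoord.chain (hN : N ⊆ Ω) (hy : IsSolFamily P M Ω μ y) {σ : ℝ → ℂ} (hab : a < b)
    (hσc : ContinuousOn σ (Icc a b)) (hσ0 : ∀ t ∈ Icc a b, σ t ≠ 0)
    (hσρ : ∀ t ∈ Icc a b, σ t ^ 4 ∈ ball (0 : ℂ) ρ) (hmono : StrictMonoOn (fun t => (turningPhase ξ'
    ν (σ t ^ 2) μ).re) (Icc a b)) {σa σb : ℂ → ℂ} (ha : ContinuousAt σa μ) (ha' : σa μ = σ a)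
    (hb : ContinuousAt σb μ) (hb' : σb μ = σ b) (hw : HasWKBAt μ e ξ ξ' ν y σa) : HasWKBAt μ e ξ ξ'
    ν y σb := by
  have hloc : ∀ t ∈ Icc a b, ∃ δ > 0, ∀ s ∈ Icc a b, ∀ s' ∈ Icc a b, |s - t| < δ →
      |s' - t| < δ → s < s' → ∀ τ τ' : ℂ → ℂ, ContinuousAt τ μ → ContinuousAt τ' μ →
      τ μ = σ s → τ' μ = σ s' → HasWKBAt μ e ξ ξ' ν y τ →
      HasWKBAt μ e ξ ξ' ν y τ' := by
    intro t ht
    obtain ⟨B, hB, htr⟩ := T.transfer hΩ hP hM hN (hσ0 t ht) (hσρ t ht)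
    obtain ⟨δ, hδ, hδB⟩ := Metric.mem_nhdsWithin_iff.1 ((hσc t ht).preimage_mem_nhdsWithin hB)
    refine ⟨δ, hδ, fun s hs s' hs' h1 h2 hlt τ τ' hτ hτ' h3 h4 h5 => ?_⟩
    refine htr τ τ' hτ hτ' ?_ ?_ ?_ y hy h5
    · rw [h3]; exact hδB ⟨by rwa [Metric.mem_ball, Real.dist_eq], hs⟩
    · rw [h4]; exact hδB ⟨by rwa [Metric.mem_ball, Real.dist_eq], hs'⟩
    · rw [h3, h4]; exact hmono hs hs' hlt
  obtain ⟨δ, hδ, hδs⟩ := hloc a (left_mem_Icc.2 hab.le)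
  set a' := min b (a + δ / 2) with ha'd
  have haa' : a < a' := lt_min hab (by linarith)
  have ha'b : a' ≤ b := min_le_left _ _
  have h0 : ∀ τ' : ℂ → ℂ, ContinuousAt τ' μ → τ' μ = σ a' →
      HasWKBAt μ e ξ ξ' ν y τ' := fun τ' hτ' h =>
    hδs a (left_mem_Icc.2 hab.le) a' ⟨haa'.le, ha'b⟩ (by simpa using hδ)
      (by rw [abs_of_pos (by linarith)]; have := min_le_right b (a + δ / 2); linarith)
      haa' σa τ' ha hτ' ha' h hw
  refine interval_chain (G := fun t => ∀ τ' : ℂ → ℂ, ContinuousAt τ' μ → τ' μ = σ t →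
    HasWKBAt μ e ξ ξ' ν y τ') ha'b (fun t ht => ?_) h0 σb hb hb'
  have hsub : Icc a' b ⊆ Icc a b := Icc_subset_Icc_left haa'.le
  obtain ⟨δ, hδ, hδs⟩ := hloc t (hsub ht)
  exact ⟨δ, hδ, fun s hs s' hs' h1 h2 hlt hG τ' hτ' h => hδs s (hsub hs) s' (hsub hs') h1 h2 hlt
    (fun _ => σ s) τ' continuousAt_const hτ' rfl h (hG _ continuousAt_const rfl)⟩

theorem bump_zero : bump 0 = 1 := by simp [bump]

theorem bump_nonneg (t : ℝ) : 0 ≤ bump t := by simp only [bump]; positivity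

theorem bump_le_one (t : ℝ) : bump t ≤ 1 := by
  have h : max 0 (1 - 4 * t ^ 2) ≤ 1 := max_le zero_le_one (by nlinarith [sq_nonneg t])
  exact pow_le_one₀ (le_max_left _ _) h

theorem one_sub_bump_le (t : ℝ) : 1 - bump t ≤ 8 * t ^ 2 := by
  have h : 1 - 4 * t ^ 2 ≤ max 0 (1 - 4 * t ^ 2) := le_max_right _ _
  have h0 : 0 ≤ max 0 (1 - 4 * t ^ 2) := le_max_left _ _
  simp only [bump]
  nlinarith [sq_nonneg (max 0 (1 - 4 * t ^ 2) - 1)]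

theorem continuous_bump : Continuous bump := by unfold bump; fun_prop

theorem bump_eq_zero (ht : 1 / 2 ≤ |t|) : bump t = 0 := by
  have : 1 - 4 * t ^ 2 ≤ 0 := by rw [← sq_abs]; nlinarith
  simp [bump, max_eq_left this]

/-- An end of an arm at the turning point `α lam`, with tangent vector `c₁`, parametrized by
`0 < t < δ0`; `r` is a branch of `√(g₊ g₋)` along it and `E` the phase from the turning point. -/
structure IsArmEnd (P M : ℂ → ℂ) (μ : ℂ) (α : ℂ → ℂ) (c₁ : ℂ) (D r E : ℂ → ℝ → ℂ) (δ0 : ℝ) :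
    Prop where
  pos : 0 < δ0
  tangent : c₁ ≠ 0
  shape : ∃ c : ℝ → ℂ, HasDerivWithinAt c c₁ (Ici 0) 0 ∧ c 0 = α μ ∧
    ∀ᶠ lam in 𝓝 μ, ∀ t ∈ Ioo 0 δ0, D lam t = c t + bump t * (α lam - α μ)
  ode : ∀ᶠ lam in 𝓝 μ, ∀ t ∈ Ioo 0 δ0, ContinuousAt (r lam) t ∧
    r lam t ^ 2 = (P (D lam t) - lam) * (lam - M (D lam t)) ∧
    ∃ D', HasDerivAt (D lam) D' t ∧ HasDerivAt (E lam) (r lam t * D') t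
  lim : ∀ᶠ lam in 𝓝 μ, Tendsto (E lam) (𝓝[>] 0) (𝓝 0)

theorem eq_of_hasDerivAt_of_tendsto {f g : ℝ → ℂ} {f' : ℝ → ℂ} {δ : ℝ}
    (hf : ∀ t ∈ Ioo 0 δ, HasDerivAt f (f' t) t) (hg : ∀ t ∈ Ioo 0 δ, HasDerivAt g (f' t) t) {l : ℂ}
    (hf0 : Tendsto f (𝓝[>] 0) (𝓝 l)) (hg0 : Tendsto g (𝓝[>] 0) (𝓝 l)) (ht : t ∈ Ioo 0 δ) : f t = g t
    := by
  have hd : ∀ s ∈ Ioo 0 δ, HasDerivAt (fun s => f s - g s) 0 s := fun s hs =>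
    ((hf s hs).sub (hg s hs)).congr_deriv (sub_self _)
  have hconst : ∀ s ∈ Ioo 0 δ, f s - g s = f t - g t := fun s hs =>
    (convex_Ioo 0 δ).is_const_of_fderivWithin_eq_zero (𝕜 := ℝ)
      (f := fun s => f s - g s)
      (fun s hs => (hd s hs).differentiableAt.differentiableWithinAt)
      (fun s hs => by
        rw [fderivWithin_of_isOpen isOpen_Ioo hs]
        ext
        simpa using (hd s hs).deriv) hs ht
  have h1 : Tendsto (fun s => f s - g s) (𝓝[>] 0) (𝓝 (f t - g t)) :=
    tendsto_const_nhds.congr' (by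
      filter_upwards [Ioo_mem_nhdsGT (ht.1.trans ht.2)] with s hs using (hconst s hs).symm)
  have h2 := hf0.sub hg0
  rw [sub_self] at h2
  exact sub_eq_zero.1 (tendsto_nhds_unique h1 h2)

include T in
theorem TurningCoord.arm {c₁ : ℂ} {D E : ℂ → ℝ → ℂ} {δ0 : ℝ} (harm : IsArmEnd P M μ α c₁ D r E δ0)
    (hα0 : α μ = a₀) (hαc : ContinuousAt α μ) (hα : ∀ᶠ lam in 𝓝 μ, ω (α lam) lam = 0) {ρ1 : ℝ}
    (hρ1 : 0 < ρ1) : ∃ δ ∈ Ioc 0 δ0, ∀ᶠ lam in 𝓝 μ, ∀ t ∈ Ioo 0 δ, D lam t ∈ N ∧ ω (D lam t) lam ∈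
    ball (0 : ℂ) ρ1 ∧ ω (D lam t) lam ≠ 0 ∧ (r lam t / ν (ω (D lam t) lam) lam ^ 2) ^ 2 = ω (D lam
    t) lam ∧ turningPhase ξ' ν (r lam t / ν (ω (D lam t) lam) lam ^ 2) lam = E lam t := by
  obtain ⟨c, hc, hc0, hshape⟩ := harm.shape
  rw [hα0] at hc0 hshape
  have hωe : ∀ᶠ v : ℂ × ℂ in 𝓝 (a₀, μ), v.1 ∈ N ∧ ω v.1 v.2 ∈ ball (0 : ℂ) (min ρ ρ1) :=
    (continuousAt_fst.eventually (T.isOpen.mem_nhds T.mem)).and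
      ((T.cont_ω a₀ T.mem μ).eventually (isOpen_ball.mem_nhds (by
        simp only [T.base]; exact mem_ball_self (lt_min T.pos hρ1))))
  obtain ⟨r₁, hr1, hb⟩ := Metric.eventually_nhds_iff.1 hωe
  have hcn : ∀ᶠ t in 𝓝[>] (0 : ℝ), dist (c t) a₀ < r₁ / 2 ∧ ‖c₁‖ / 2 * t ≤ ‖c t - a₀‖ := by
    have h1 : ∀ᶠ t in 𝓝[≥] (0 : ℝ), dist (c t) a₀ < r₁ / 2 := by
      have := hc.continuousWithinAt.eventually (ball_mem_nhds (c 0) (half_pos hr1))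
      simpa only [hc0, Metric.mem_ball] using this
    have h2 : ∀ᶠ t in 𝓝[≥] (0 : ℝ), ‖c₁‖ / 2 * t ≤ ‖c t - a₀‖ := by
      have := hc.isLittleO.def (c := ‖c₁‖ / 2) (by have := norm_pos_iff.2 harm.tangent; positivity)
      filter_upwards [this, self_mem_nhdsWithin] with t ht ht0
      have ht0' : 0 ≤ t := ht0
      simp only [sub_zero, hc0, Real.norm_eq_abs, abs_of_nonneg ht0'] at ht
      have h3 : ‖(t : ℝ) • c₁‖ = t * ‖c₁‖ := by rw [norm_smul, Real.norm_of_nonneg ht0']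
      have h4 := norm_sub_norm_le (t • c₁) (c t - a₀)
      rw [norm_sub_rev (t • c₁)] at h4
      linarith
    exact (h1.and h2).filter_mono (nhdsWithin_mono _ Ioi_subset_Ici_self)
  obtain ⟨δ1, hδ1, hδ1s⟩ := mem_nhdsGT_iff_exists_Ioo_subset.1 hcn
  have hδ10 : 0 < δ1 := hδ1
  refine ⟨min (min δ1 δ0) 1, ⟨lt_min (lt_min hδ10 harm.pos) one_pos,
    (min_le_left _ _).trans (min_le_right _ _)⟩, ?_⟩
  have hαn : ∀ᶠ lam in 𝓝 μ, ‖α lam - a₀‖ < min (r₁ / 2) (‖c₁‖ / 16) := by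
    have h1 : ContinuousAt (fun lam => ‖α lam - a₀‖) μ := (hαc.sub continuousAt_const).norm
    refine h1.eventually_lt continuousAt_const ?_
    simp only [hα0, sub_self, norm_zero]
    have := norm_pos_iff.2 harm.tangent
    positivity
  filter_upwards [hshape, harm.ode, harm.lim, hα, hαn, ball_mem_nhds μ T.pos,
    ball_mem_nhds μ hr1] with lam hshape hode hlim hα hαn hl hl'
  have hαn1 := hαn.trans_le (min_le_left _ _)
  have hαn2 := hαn.trans_le (min_le_right _ _)
  have hin : ∀ x ∈ ball a₀ r₁, x ∈ N ∧ ω x lam ∈ ball (0 : ℂ) ρ ∧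
      ω x lam ∈ ball (0 : ℂ) ρ1 := fun x hx => by
    have := hb (y := (x, lam)) (by rw [Prod.dist_eq]; exact max_lt hx hl')
    exact ⟨this.1, ball_subset_ball (min_le_left _ _) this.2,
      ball_subset_ball (min_le_right _ _) this.2⟩
  have hαN : α lam ∈ ball a₀ r₁ := by
    rw [Metric.mem_ball, dist_eq_norm]; linarith
  have hmain : ∀ t ∈ Ioo 0 (min (min δ1 δ0) 1), t ∈ Ioo 0 δ0 ∧ D lam t ∈ ball a₀ r₁ ∧
      ω (D lam t) lam ≠ 0 := by
    intro t ht
    have htδ1 : t ∈ Ioo 0 δ1 := ⟨ht.1, ht.2.trans_le ((min_le_left _ _).trans (min_le_left _ _))⟩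
    have htδ0 : t ∈ Ioo 0 δ0 := ⟨ht.1, ht.2.trans_le ((min_le_left _ _).trans (min_le_right _ _))⟩
    have ht1 : t < 1 := ht.2.trans_le (min_le_right _ _)
    obtain ⟨h1, h2⟩ := hδ1s htδ1
    have hbt : ‖(bump t : ℂ)‖ ≤ 1 := by
      rw [norm_real, Real.norm_of_nonneg (bump_nonneg t)]; exact bump_le_one t
    have hDb : D lam t ∈ ball a₀ r₁ := by
      rw [Metric.mem_ball, dist_eq_norm, hshape t htδ0]
      rw [dist_eq_norm] at h1
      have h3 : ‖(bump t : ℂ) * (α lam - a₀)‖ ≤ 1 * ‖α lam - a₀‖ := by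
        rw [norm_mul]; gcongr
      calc ‖c t + bump t * (α lam - a₀) - a₀‖
          = ‖(c t - a₀) + bump t * (α lam - a₀)‖ := by congr 1; ring
        _ ≤ ‖c t - a₀‖ + ‖(bump t : ℂ) * (α lam - a₀)‖ := norm_add_le _ _
        _ < r₁ := by linarith
    refine ⟨htδ0, hDb, fun hω0 => ?_⟩
    have h3 : D lam t = α lam := by
      rw [← T.inv_ω _ (hin _ hDb).1 lam, ← T.inv_ω _ (hin _ hαN).1 lam, hω0, hα]
    rw [hshape t htδ0] at h3
    have h4 : c t - a₀ = (1 - bump t : ℝ) * (α lam - a₀) := by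
      push_cast
      linear_combination h3
    rw [h4, norm_mul, norm_real, Real.norm_of_nonneg (by linarith [bump_le_one t])] at h2
    have h5 := one_sub_bump_le t
    have ht0 := ht.1
    have h6 : (1 - bump t) * ‖α lam - a₀‖ ≤ 8 * t ^ 2 * ‖α lam - a₀‖ := by gcongr
    have h7 : 8 * t ^ 2 * ‖α lam - a₀‖ ≤ 8 * (t * 1) * ‖α lam - a₀‖ := by
      gcongr
      nlinarith
    have h8 : 8 * (t * 1) * ‖α lam - a₀‖ < 8 * (t * 1) * (‖c₁‖ / 16) := by gcongr
    linarith
  have hτsq : ∀ t ∈ Ioo 0 (min (min δ1 δ0) 1),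
      (r lam t / ν (ω (D lam t) lam) lam ^ 2) ^ 2 = ω (D lam t) lam := by
    intro t ht
    obtain ⟨ht0, hDb, -⟩ := hmain t ht
    obtain ⟨hN, hω1, -⟩ := hin _ hDb
    have h1 := T.prod _ hω1 lam hl
    rw [T.inv_ω _ hN, ← (hode t ht0).2.1] at h1
    have hν0 := T.ν_ne _ hω1 lam hl
    rw [div_pow, h1]
    field_simp
  intro t ht
  obtain ⟨ht0, hDb, hω0⟩ := hmain t ht
  refine ⟨(hin _ hDb).1, (hin _ hDb).2.2, hω0, hτsq t ht, ?_⟩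
  choose! D' hD'1 hD'2 using fun t ht => (hode t ht).2.2
  refine eq_of_hasDerivAt_of_tendsto (δ := min (min δ1 δ0) 1)
    (f := fun t => turningPhase ξ' ν (r lam t / ν (ω (D lam t) lam) lam ^ 2) lam)
    (f' := fun t => r lam t * D' t) (l := 0) ?_ (fun s hs => hD'2 s (hmain s hs).1) ?_ hlim ht
  · intro s hs
    obtain ⟨hs0, hDs, hωs⟩ := hmain s hs
    obtain ⟨hN, hω1, -⟩ := hin _ hDs
    have hν0 := T.ν_ne _ hω1 lam hl
    have hωd : HasDerivAt (fun s => ω (D lam s) lam) ((ξ' (ω (D lam s) lam) lam)⁻¹ * D' s) s :=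
      ((T.hasDerivAt_ω hN hω1 hl).scomp s (hD'1 s hs0)).congr_deriv (by simp [mul_comm])
    have hνc : ContinuousAt (fun s => ν (ω (D lam s) lam) lam) s :=
      ContinuousAt.comp (x := s) (f := fun s => ω (D lam s) lam) (g := fun w => ν w lam)
        (T.diff_ν _ hω1 lam hl).continuousAt hωd.continuousAt
    have hτ0 : r lam s / ν (ω (D lam s) lam) lam ^ 2 ≠ 0 := fun h => hωs (by
      rw [← hτsq s hs, h]; simp)
    have hτd := hasDerivAt_of_pow_eq (n := 2) (x := s) two_ne_zero
      (f := fun s => r lam s / ν (ω (D lam s) lam) lam ^ 2)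
      (((hode s hs0).1.div (hνc.pow 2) (pow_ne_zero _ hν0)))
      (by filter_upwards [isOpen_Ioo.mem_nhds hs] with u hu using hτsq u hu) hωd hτ0
    have hF := T.hasDerivAt_phase (τ := r lam s / ν (ω (D lam s) lam) lam ^ 2) (lam := lam)
      (by rw [hτsq s hs]; exact hω1) hl
    refine (HasDerivAt.comp s (h₂ := fun τ => turningPhase ξ' ν τ lam) hF hτd).congr_deriv ?_
    have hξ0 := T.deriv_ξ_ne _ hω1 lam hl
    have hsq := hτsq s hs
    have hr : r lam s = r lam s / ν (ω (D lam s) lam) lam ^ 2 * ν (ω (D lam s) lam) lam ^ 2 := by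
      field_simp
    rw [hr]
    rw [← hr]
    generalize r lam s / ν (ω (D lam s) lam) lam ^ 2 = τ at *
    rw [hsq]
    rw [hr]
    generalize ω (D lam s) lam = w at *
    rw [← hsq]
    push_cast
    rw [← hsq] at hξ0
    field_simp
  · have hDlim : Tendsto (D lam) (𝓝[>] 0) (𝓝 (α lam)) := by
      have h1 : Tendsto (fun t => c t + bump t * (α lam - a₀)) (𝓝[>] 0)
          (𝓝 (a₀ + ((1 : ℝ) : ℂ) * (α lam - a₀))) := by
        refine Tendsto.add ?_ (Tendsto.mul_const _ ?_)
        · rw [← hc0]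
          exact hc.continuousWithinAt.mono_left (nhdsWithin_mono _ Ioi_subset_Ici_self)
        · rw [← bump_zero]
          exact ((Complex.continuous_ofReal.comp continuous_bump).tendsto 0).mono_left
            nhdsWithin_le_nhds
      have h2 : a₀ + ((1 : ℝ) : ℂ) * (α lam - a₀) = α lam := by push_cast; ring
      rw [h2] at h1
      refine h1.congr' ?_
      filter_upwards [Ioo_mem_nhdsGT harm.pos] with s hs using (hshape s hs).symm
    have hωlim : Tendsto (fun t => ω (D lam t) lam) (𝓝[>] 0) (𝓝 0) := by
      rw [← hα]
      exact ((T.diff_ω _ (hin _ hαN).1 lam).continuousAt.tendsto).comp hDlim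
    have hτlim : Tendsto (fun t => r lam t / ν (ω (D lam t) lam) lam ^ 2) (𝓝[>] 0) (𝓝 0) := by
      rw [tendsto_zero_iff_norm_tendsto_zero] at hωlim ⊢
      have h3 : Tendsto (fun t => √‖ω (D lam t) lam‖) (𝓝[>] 0) (𝓝 0) := by
        simpa [Function.comp_def] using (Real.continuous_sqrt.tendsto 0).comp hωlim
      refine h3.congr' ?_
      filter_upwards [Ioo_mem_nhdsGT (lt_min (lt_min hδ10 harm.pos) one_pos)] with s hs
      have h4 := congrArg norm (hτsq s hs)
      rw [norm_pow] at h4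
      rw [← h4, Real.sqrt_sq (norm_nonneg _)]
    have h4 := (T.hasDerivAt_phase (τ := 0) (lam := lam) (by simpa using T.pos) hl).continuousAt
    have h5 := h4.tendsto.comp hτlim
    simpa [Function.comp_def] using h5

include T in
theorem TurningCoord.tendsto_div {c₁ : ℂ} {D E : ℂ → ℝ → ℂ} {δ0 : ℝ}
    (harm : IsArmEnd P M μ α c₁ D r E δ0) (hα0 : α μ = a₀) : Tendsto (fun t : ℝ => ω (D μ t) μ / t)
    (𝓝[>] 0) (𝓝 ((ξ' 0 μ)⁻¹ * c₁)) := by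
  obtain ⟨c, hc, hc0, hshape⟩ := harm.shape
  rw [hα0] at hc0
  have h1 := T.hasDerivAt_ω T.mem (lam := μ) (by rw [T.base]; exact mem_ball_self T.pos)
    (mem_ball_self T.pos)
  rw [T.base] at h1
  have h2 : HasDerivWithinAt (fun t => ω (c t) μ) ((ξ' 0 μ)⁻¹ * c₁) (Ioi 0) 0 := by
    have hc' := hc.mono (Ioi_subset_Ici_self)
    rw [← hc0] at h1
    exact (h1.scomp_hasDerivWithinAt 0 hc').congr_deriv (by simp [mul_comm])
  rw [hasDerivWithinAt_iff_tendsto_slope' (by simp)] at h2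
  refine h2.congr' ?_
  filter_upwards [Ioo_mem_nhdsGT harm.pos] with t ht
  rw [hshape.self_of_nhds t ht]
  simp only [slope, vsub_eq_sub, sub_zero, hc0, T.base, sub_self, mul_zero, add_zero]
  rw [div_eq_inv_mul, Complex.real_smul, Complex.ofReal_inv]

include T in
/-- A conformal coordinate `η = f(σ)` with `η⁶` equal to the phase, and `f(iσ) = i f(σ)`. -/
theorem TurningCoord.exists_sixth_root : ∃ (R ρ1 : ℝ) (f ψ χ : ℂ → ℂ) (χ' : ℂ), 0 < R ∧ 0 < ρ1 ∧ ρ1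
    ≤ ρ ∧ (∀ η, η ≠ 0 → η ∈ ball 0 R → ψ η ≠ 0 ∧ ψ η ^ 4 ∈ ball (0 : ℂ) ρ ∧ turningPhase ξ' ν (ψ η ^
    2) μ = η ^ 6) ∧ ContinuousOn ψ (ball 0 R) ∧ (∀ σ, σ ^ 4 ∈ ball (0 : ℂ) ρ1 → ψ (f σ) = σ ∧ f σ ∈
    ball 0 R ∧ f (I * σ) = I * f σ ∧ f σ ^ 4 = χ (σ ^ 4) ∧ f σ ^ 6 = turningPhase ξ' ν (σ ^ 2) μ ∧
    ContinuousAt f σ) ∧ HasDerivAt χ χ' 0 ∧ χ' ≠ 0 ∧ χ 0 = 0 ∧ (∀ σ, σ ≠ 0 → σ ^ 4 ∈ ball (0 : ℂ) ρ1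
    → f σ ≠ 0) := by
  have hl0 := mem_ball_self (x := μ) T.pos
  have hρ2 : ρ / 2 < ρ := half_lt_self T.pos
  set j : ℂ → ℂ := fun w => ν w μ ^ 2 * ξ' w μ with hj
  have hjd : DifferentiableOn ℂ j (ball 0 ρ) := fun w hw =>
    (((T.diff_ν w hw _ hl0).pow 2).mul (T.diff_ξ' w hw _ hl0)).differentiableWithinAt
  obtain ⟨K, hK⟩ := (isCompact_closedBall (0 : ℂ) (ρ / 2)).exists_bound_of_continuousOn
    (hjd.continuousOn.mono (Metric.closedBall_subset_ball hρ2))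
  have hmem : ∀ t ∈ Ioc (0 : ℝ) 1, ∀ w ∈ ball (0 : ℂ) (ρ / 2),
      (t : ℂ) ^ 2 * w ∈ ball (0 : ℂ) (ρ / 2) := by
    intro t ht w hw
    rw [mem_ball_zero_iff] at hw ⊢
    rw [norm_mul, norm_pow, norm_real, Real.norm_of_nonneg ht.1.le]
    have : t ^ 2 ≤ 1 := pow_le_one₀ ht.1.le ht.2
    nlinarith [norm_nonneg w]
  set G : ℂ → ℂ := fun w => ∫ t in (0 : ℝ)..1, 2 * (t : ℂ) ^ 2 * j (t ^ 2 * w) with hG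
  have hGd : DifferentiableOn ℂ G (ball 0 (ρ / 2)) := by
    simp only [hG, intervalIntegral.integral_of_le zero_le_one]
    refine differentiableOn_integral_param isOpen_ball (b := fun _ => 2 * K) ?_ ?_ ?_ ?_
    · intro w hw
      refine ContinuousOn.aestronglyMeasurable ?_ measurableSet_Ioc
      have h1 : ContinuousOn (fun t : ℝ => j ((t : ℂ) ^ 2 * w)) (Ioc 0 1) :=
        hjd.continuousOn.comp (by fun_prop) fun t ht =>
          ball_subset_ball hρ2.le (hmem t ht w hw)
      exact (by fun_prop : ContinuousOn (fun t : ℝ => 2 * (t : ℂ) ^ 2) (Ioc 0 1)).mul h1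
    · filter_upwards [ae_restrict_mem measurableSet_Ioc] with t ht w hw
      have h1 := hK _ (Metric.ball_subset_closedBall (hmem t ht w hw))
      rw [norm_mul, norm_mul, norm_pow, norm_real, Real.norm_of_nonneg ht.1.le]
      have : t ^ 2 ≤ 1 := pow_le_one₀ ht.1.le ht.2
      have h2 : ‖(2 : ℂ)‖ = 2 := by norm_num
      rw [h2]
      calc 2 * t ^ 2 * ‖j (t ^ 2 * w)‖ ≤ 2 * 1 * K := by gcongr
        _ = 2 * K := by ring
    · exact integrable_const _
    · filter_upwards [ae_restrict_mem measurableSet_Ioc] with t ht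
      have h1 : DifferentiableOn ℂ (fun w : ℂ => j ((t : ℂ) ^ 2 * w)) (ball 0 (ρ / 2)) :=
        hjd.comp ((differentiable_id.const_mul _).differentiableOn) fun w hw =>
          ball_subset_ball hρ2.le (hmem t ht w hw)
      exact h1.const_mul _
  have hF : ∀ τ, turningPhase ξ' ν τ μ = τ ^ 3 * G (τ ^ 2) := fun τ => turningPhase_eq _ _
  have hG0 : G 0 ≠ 0 := by
    have h1 : G 0 = 2 / 3 * j 0 := by
      simp only [hG, mul_zero]
      rw [intervalIntegral.integral_mul_const, intervalIntegral.integral_const_mul]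
      have : (∫ t in (0 : ℝ)..1, (t : ℂ) ^ 2) = 1 / 3 := by
        have h := integral_pow (a := 0) (b := 1) 2
        have h' : (∫ t in (0 : ℝ)..1, (t : ℂ) ^ 2) = ((∫ t in (0 : ℝ)..1, t ^ 2 : ℝ) : ℂ) := by
          rw [← intervalIntegral.integral_ofReal]; simp
        rw [h', h]; norm_num
      rw [this]; ring
    rw [h1]
    have h0 := mem_ball_self (x := (0 : ℂ)) T.pos
    exact mul_ne_zero (by norm_num) (mul_ne_zero (pow_ne_zero _ (T.ν_ne 0 h0 _ hl0))
      (T.deriv_ξ_ne 0 h0 _ hl0))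
  have hGat : ∀ᶠ w in 𝓝 (0 : ℂ), DifferentiableAt ℂ G w := by
    filter_upwards [ball_mem_nhds (0 : ℂ) (half_pos T.pos)] with w hw
    exact hGd.differentiableAt (isOpen_ball.mem_nhds hw)
  obtain ⟨c, -, hc⟩ := exists_local_root (n := 6) (x := (0 : ℂ)) (G := G)
    (h₀ := (G 0) ^ (1 / 6 : ℂ)) (by norm_num) (hGat.mono fun w h => h.continuousAt) hG0
    (by rw [← Complex.cpow_nat_mul]; norm_num)
  have hcd : ∀ᶠ w in 𝓝 (0 : ℂ), DifferentiableAt ℂ c w := by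
    filter_upwards [eventually_eventually_nhds.2 hc, hGat] with w h1 h2
    exact (hasDerivAt_of_pow_eq (n := 6) (by norm_num) h1.self_of_nhds.1
      (h1.mono fun _ h => h.2.2) h2.hasDerivAt h1.self_of_nhds.2.1).differentiableAt
  obtain ⟨r, hr, hrb⟩ := Metric.eventually_nhds_iff.1 (hc.and hcd)
  have hrb' : ∀ w ∈ ball (0 : ℂ) r, _ := fun w hw => hrb hw
  set f : ℂ → ℂ := fun σ => σ * c (σ ^ 4) with hf
  have hfd : ∀ σ, σ ^ 4 ∈ ball (0 : ℂ) r → HasDerivAt f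
      (1 * c (σ ^ 4) + σ * (deriv c (σ ^ 4) * (4 * σ ^ 3))) σ := by
    intro σ hσ
    refine (hasDerivAt_id σ).mul ?_
    have h1 := (hrb' _ hσ).2.hasDerivAt
    have h2 : HasDerivAt (fun σ : ℂ => σ ^ 4) (4 * σ ^ 3) σ := by simpa using hasDerivAt_pow 4 σ
    exact HasDerivAt.comp σ h1 h2
  have h4c : ContinuousAt (fun σ : ℂ => σ ^ 4) 0 := by fun_prop
  set ρ0 := min r ρ with hρ₀
  have hρ0p : 0 < ρ0 := lt_min hr T.pos
  have h4n : {σ : ℂ | σ ^ 4 ∈ ball (0 : ℂ) ρ0} ∈ 𝓝 (0 : ℂ) :=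
    h4c.eventually (isOpen_ball.mem_nhds (by simpa using hρ0p))
  obtain ⟨φ, h0φ, hφ, hφs⟩ := exists_localHomeomorph (f := f) (p := 0)
    (by filter_upwards [h4n] with σ hσ using
          (hfd σ (ball_subset_ball (min_le_left _ _) hσ)).differentiableAt)
    (by
      rw [(hfd 0 (by simpa using hr)).deriv]
      simpa using (hrb' 0 (mem_ball_self hr)).1.2.1) h4n
  have hφ' : ∀ σ, φ σ = f σ := congrFun hφ
  have hf0 : f 0 = 0 := by simp [hf]
  have ht0 : φ.target ∈ 𝓝 (0 : ℂ) := by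
    refine φ.open_target.mem_nhds ?_
    rw [← hf0, ← hφ']; exact φ.map_source h0φ
  obtain ⟨R, hR, hRt⟩ := Metric.mem_nhds_iff.1 ht0
  have hs0 : φ.symm 0 = 0 := by
    have := φ.left_inv h0φ
    rwa [hφ', hf0] at this
  have hf6 : ∀ σ, σ ^ 4 ∈ ball (0 : ℂ) ρ0 → f σ ^ 6 = turningPhase ξ' ν (σ ^ 2) μ := by
    intro σ hσ
    have h1 := (hrb' _ (ball_subset_ball (min_le_left _ _) hσ)).1.2.2
    have h2 : (σ ^ 2) ^ 2 = σ ^ 4 := by ring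
    rw [hF, h2, ← h1]
    simp only [hf]
    ring
  -- a smaller radius for `σ`
  have hsm : ∀ᶠ σ in 𝓝 (0 : ℂ), σ ∈ φ.source ∧ f σ ∈ ball 0 R :=
    (φ.open_source.eventually_mem h0φ).and
      ((hfd 0 (by simpa using hr)).continuousAt.eventually_mem
        (by rw [hf0]; exact ball_mem_nhds _ hR))
  obtain ⟨r₂, hr₂, hr2s⟩ := Metric.mem_nhds_iff.1 hsm
  have hback : ∀ σ : ℂ, σ ^ 4 ∈ ball (0 : ℂ) (r₂ ^ 4) → σ ∈ ball (0 : ℂ) r₂ := by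
    intro σ hσ
    rw [mem_ball_zero_iff] at hσ ⊢
    rw [norm_pow] at hσ
    exact lt_of_pow_lt_pow_left₀ 4 hr₂.le hσ
  refine ⟨R, min ρ0 (r₂ ^ 4), f, φ.symm, fun w => w * c w ^ 4, 1 * c 0 ^ 4 + 0, hR,
    lt_min hρ0p (by positivity), (min_le_left _ _).trans (min_le_right _ _), ?_, ?_, ?_, ?_, ?_,
    ?_, ?_⟩
  · intro η hη hηR
    have h1 := φ.map_target (hRt hηR)
    have h2 := hφs h1
    have h3 : f (φ.symm η) = η := by rw [← hφ']; exact φ.right_inv (hRt hηR)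
    refine ⟨fun h => hη ?_, ball_subset_ball (min_le_right _ _) h2, ?_⟩
    · rw [← h3, h, hf0]
    · rw [← hf6 _ h2, h3]
  · exact φ.continuousOn_symm.mono hRt
  · intro σ hσ
    have h1 := ball_subset_ball (min_le_left _ _) hσ
    have h2 := hr2s (hback σ (ball_subset_ball (min_le_right _ _) hσ))
    refine ⟨?_, h2.2, ?_, ?_, hf6 σ h1,
      (hfd σ (ball_subset_ball (min_le_left _ _) h1)).continuousAt⟩
    · rw [← hφ']; exact φ.left_inv h2.1
    · simp only [hf, mul_pow, Complex.I_pow_four]; ring_nf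
    · simp only [hf, mul_pow]
  · have h1 := (hrb' 0 (mem_ball_self hr)).2.hasDerivAt
    exact ((hasDerivAt_id (0 : ℂ)).mul (h1.pow 4)).congr_deriv (by simp)
  · have := (hrb' 0 (mem_ball_self hr)).1.2.1
    simpa using this
  · simp
  · intro σ hσ hσb
    have h1 := ball_subset_ball (min_le_left r ρ)
      (ball_subset_ball (min_le_left _ _) hσb)
    exact mul_ne_zero hσ (hrb' _ h1).1.2.1

/-! Sixth roots -/

theorem exp_pi_div_six_pow_three : exp (Real.pi / 6 * I) ^ 3 = I := by
  rw [← exp_nat_mul]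
  refine Eq.trans ?_ Complex.exp_pi_div_two_mul_I
  congr 1
  push_cast
  ring

theorem exp_pi_div_six_pow_six : exp (Real.pi / 6 * I) ^ 6 = -1 := by
  rw [show (6 : ℕ) = 3 * 2 by norm_num, pow_mul, exp_pi_div_six_pow_three, I_sq]

theorem cpow_one_div_six_pow (z : ℂ) : (z ^ (1 / 6 : ℂ)) ^ 6 = z := by
  rw [← Complex.cpow_nat_mul]; norm_num

theorem neg_I_mul_cpow {r : ℝ} (hr : 0 < r) : (-(I * r)) ^ (1 / 6 : ℂ) = exp ((Real.log r - Real.pi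
    / 2 * I) / 6) := by
  have h0 : -(I * r) ≠ 0 := by simp [hr.ne']
  rw [Complex.cpow_def_of_ne_zero h0, show -(I * r) = r * -I by ring,
    Complex.log_ofReal_mul hr (by simp), Complex.log_neg_I]
  congr 1
  ring

theorem I_mul_cpow {r : ℝ} (hr : 0 < r) : (I * r) ^ (1 / 6 : ℂ) = exp ((Real.log r + Real.pi / 2 *
    I) / 6) := by
  have h0 : I * r ≠ 0 := by simp [hr.ne']
  rw [Complex.cpow_def_of_ne_zero h0, show I * r = r * I by ring,
    Complex.log_ofReal_mul hr (by simp), Complex.log_I]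
  congr 1
  ring

theorem exp_mul_neg_I_mul_cpow {r : ℝ} (hr : 0 < r) : exp (Real.pi / 6 * I) * (-(I * r)) ^ (1 / 6 :
    ℂ) = (I * r) ^ (1 / 6 : ℂ) := by
  rw [neg_I_mul_cpow hr, I_mul_cpow hr, ← exp_add]
  congr 1
  ring

theorem eq_one_of_cube_of_sector {v : ℂ} (hv : v ^ 3 = 1) {c : ℝ} (hcs : c ^ 2 + s ^ 2 = 1)
    (hc : 1 / 2 < c) (h : 1 / 2 < c * v.re + s * v.im) : v = 1 := by
  have h1 : (v - 1) * (v ^ 2 + v + 1) = 0 := by linear_combination hv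
  rcases mul_eq_zero.1 h1 with h2 | h2
  · exact sub_eq_zero.1 h2
  exfalso
  have hre := congrArg Complex.re h2
  have him := congrArg Complex.im h2
  simp only [pow_two, Complex.add_re, Complex.mul_re, Complex.one_re, Complex.zero_re,
    Complex.add_im, Complex.mul_im, Complex.one_im, Complex.zero_im] at hre him
  have h3 : v.im * (2 * v.re + 1) = 0 := by linarith
  have h4 : v.re = -1 / 2 := by
    rcases mul_eq_zero.1 h3 with h5 | h5
    · rw [h5] at hre; nlinarith [sq_nonneg (v.re + 1 / 2)]
    · linarith
  have h5 : v.im ^ 2 = 3 / 4 := by rw [h4] at hre; nlinarith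
  rw [h4] at h
  have h6 : (1 + c) / 2 < s * v.im := by linarith
  have h7 : ((1 + c) / 2) ^ 2 < (s * v.im) ^ 2 := by gcongr
  rw [mul_pow, h5] at h7
  nlinarith

theorem exists_sixth_root_of_unity {η ζ : ℂ} {r : ℝ} (hr : 0 < r) (hη : (η ^ 6).re < 0)
    (hζ : ζ ^ 3 = -(r : ℂ) ^ 2) (hang : (η ^ 4 * conj ζ).re < -(1 / 2) * (‖η ^ 4‖ * ‖ζ‖)) : ∃ u : ℂ,
    u ^ 6 = 1 ∧ η = u * exp (Real.pi / 6 * I) * (-(η ^ 6)) ^ (1 / 6 : ℂ) ∧ ζ = (u * (-(I * r)) ^ (1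
    / 6 : ℂ)) ^ 4 := by
  have hη0 : η ^ 6 ≠ 0 := fun h => by rw [h] at hη; simp at hη
  set b := (-(η ^ 6)) ^ (1 / 6 : ℂ) with hb
  have hb6 : b ^ 6 = -(η ^ 6) := cpow_one_div_six_pow _
  have hb0 : b ≠ 0 := fun h => hη0 (by rw [h] at hb6; simpa using hb6.symm)
  set k := exp (Real.pi / 6 * I) with hk
  have hk0 : k ≠ 0 := exp_ne_zero _
  have hk6 : k ^ 6 = -1 := exp_pi_div_six_pow_six
  set u := η / (k * b) with hu
  have hηu : η = u * k * b := by rw [hu]; field_simp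
  have hu6 : u ^ 6 = 1 := by
    rw [hu, div_pow, mul_pow, hk6, hb6, neg_one_mul, neg_neg, div_self hη0]
  refine ⟨u, hu6, hηu, ?_⟩
  set m : ℝ := Real.exp (4 * Real.log r / 6) with hm
  have hm0 : 0 < m := Real.exp_pos _
  set q := (u * (-(I * r)) ^ (1 / 6 : ℂ)) ^ 4 with hq
  have hq4 : q * k ^ 2 = u ^ 4 * m := by
    rw [hq, neg_I_mul_cpow hr, mul_pow, ← exp_nat_mul, hk, ← exp_nat_mul,
      mul_assoc, ← exp_add, hm, Complex.ofReal_exp]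
    congr 2
    push_cast
    ring
  have hu0 : u ≠ 0 := fun h => by rw [h] at hu6; norm_num at hu6
  have hm0' : (m : ℂ) ≠ 0 := by exact_mod_cast hm0.ne'
  have hq0 : q ≠ 0 := fun h => by
    rw [h, zero_mul] at hq4
    exact mul_ne_zero (pow_ne_zero 4 hu0) hm0' hq4.symm
  have hq3 : q ^ 3 = -(r : ℂ) ^ 2 := by
    rw [hq, ← pow_mul, mul_pow, show (4 * 3 : ℕ) = 6 * 2 by norm_num, pow_mul u, hu6, pow_mul,
      cpow_one_div_six_pow]
    linear_combination (r : ℂ) ^ 2 * I_sq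
  set v := ζ / q with hv
  have hζv : ζ = q * v := by rw [hv]; field_simp
  have hr0 : (r : ℂ) ≠ 0 := by exact_mod_cast hr.ne'
  have hv3 : v ^ 3 = 1 := by
    rw [hv, div_pow, hζ, hq3, div_self]
    exact neg_ne_zero.2 (pow_ne_zero _ hr0)
  suffices v = 1 by rw [hζv, this, mul_one]
  have hη4 : η ^ 4 = -(q * (b ^ 4 / m)) := by
    have : η ^ 4 * m = -(q * b ^ 4) := by
      calc η ^ 4 * m = (u ^ 4 * m) * k ^ 4 * b ^ 4 := by rw [hηu]; ring
        _ = q * k ^ 6 * b ^ 4 := by rw [← hq4]; ring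
        _ = _ := by rw [hk6]; ring
    field_simp
    exact this
  -- the argument of `b ^ 4`
  set φ : ℝ := 2 / 3 * (-(η ^ 6)).arg with hφ
  have hargb : |(-(η ^ 6)).arg| < Real.pi / 2 :=
    Complex.abs_arg_lt_pi_div_two_iff.2 (Or.inl (by simpa using hη))
  have hb4 : b ^ 4 = (Real.exp (4 * Real.log ‖-(η ^ 6)‖ / 6) : ℝ) *
      (Real.cos φ + Real.sin φ * I) := by
    rw [hb, Complex.cpow_def_of_ne_zero (neg_ne_zero.2 hη0), ← exp_nat_mul,
      Complex.ofReal_cos, Complex.ofReal_sin, ← Complex.exp_mul_I, Complex.ofReal_exp,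
      ← exp_add, Complex.log, hφ]
    congr 1
    push_cast
    ring
  set B : ℝ := Real.exp (4 * Real.log ‖-(η ^ 6)‖ / 6) with hB
  have hB0 : 0 < B := Real.exp_pos _
  have hcosφ : 1 / 2 < Real.cos φ := by
    rw [← Real.cos_pi_div_three, ← Real.cos_abs φ]
    refine Real.cos_lt_cos_of_nonneg_of_le_pi (abs_nonneg _) (by linarith [Real.pi_pos]) ?_
    rw [hφ, abs_mul, abs_of_pos (by norm_num : (0 : ℝ) < 2 / 3)]
    linarith
  refine eq_one_of_cube_of_sector hv3 (Real.cos_sq_add_sin_sq φ) hcosφ ?_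
  have hvn : ‖v‖ = 1 := by
    have := congrArg norm hv3
    rw [norm_pow, norm_one] at this
    exact (pow_eq_one_iff_of_nonneg (norm_nonneg _) (by norm_num)).1 this
  have hcsn : ‖(Real.cos φ + Real.sin φ * I : ℂ)‖ = 1 := by
    rw [Complex.ofReal_cos, Complex.ofReal_sin, ← Complex.exp_mul_I, Complex.norm_exp_ofReal_mul_I]
  have e1 : η ^ 4 * conj ζ = ((-(‖q‖ ^ 2 * (B / m)) : ℝ) : ℂ) *
        ((Real.cos φ + Real.sin φ * I) * conj v) := by
    rw [hη4, hζv, hb4, map_mul]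
    have : q * conj q = ((‖q‖ ^ 2 : ℝ) : ℂ) := by
      rw [Complex.mul_conj, Complex.normSq_eq_norm_sq]
    push_cast at this ⊢
    linear_combination (-(B / m * (Complex.cos φ + Complex.sin φ * I) *
      conj v)) * this
  have e2 : ‖η ^ 4‖ * ‖ζ‖ = ‖q‖ ^ 2 * (B / m) := by
    rw [hη4, hζv, hb4, norm_neg, norm_mul, norm_mul, norm_div, norm_mul, hcsn, hvn,
      norm_real, norm_real, Real.norm_of_nonneg hB0.le, Real.norm_of_nonneg hm0.le]
    ring
  rw [e1, e2, re_ofReal_mul] at hang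
  have hpos : 0 < ‖q‖ ^ 2 * (B / m) := by
    have := norm_pos_iff.2 hq0
    positivity
  have e3 : ((Real.cos φ + Real.sin φ * I) * conj v).re =
      Real.cos φ * v.re + Real.sin φ * v.im := by
    simp only [Complex.mul_re, Complex.add_re, Complex.ofReal_re, Complex.I_re, Complex.add_im,
      Complex.ofReal_im, Complex.mul_im, Complex.I_im, Complex.conj_re, Complex.conj_im]
    ring
  rw [e3] at hang
  nlinarith

include T hΩ hP hM in
theorem TurningCoord.segment (hN : N ⊆ Ω) (hy : IsSolFamily P M Ω μ y) {ψ : ℂ → ℂ} (hR : 0 < R) (hψ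
    : ∀ η, η ≠ 0 → η ∈ ball 0 R → ψ η ≠ 0 ∧ ψ η ^ 4 ∈ ball (0 : ℂ) ρ ∧ turningPhase ξ' ν (ψ η ^ 2) μ
    = η ^ 6) (hψc : ContinuousOn ψ (ball 0 R)) {κ z0 z1 : ℂ} (hκ : κ ≠ 0) (hz : ∀ t ∈ Icc (0 : ℝ) 1,
    (z0 + t * (z1 - z0)) / κ ^ 6 ∈ Complex.slitPlane) (hz0 : ‖z0‖ < R ^ 6) (hz1 : ‖z1‖ < R ^ 6)
    (hre : z0.re < z1.re) {σa σb : ℂ → ℂ} (ha : ContinuousAt σa μ)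
    (ha' : σa μ = ψ (κ * (z0 / κ ^ 6) ^ (1 / 6 : ℂ))) (hb : ContinuousAt σb μ)
    (hb' : σb μ = ψ (κ * (z1 / κ ^ 6) ^ (1 / 6 : ℂ))) (hw : HasWKBAt μ e ξ ξ' ν y σa) : HasWKBAt μ e
    ξ ξ' ν y σb := by
  set η : ℝ → ℂ := fun t => κ * ((z0 + t * (z1 - z0)) / κ ^ 6) ^ (1 / 6 : ℂ) with hη
  have hη6 : ∀ t, η t ^ 6 = z0 + t * (z1 - z0) := by
    intro t
    simp only [hη]
    rw [mul_pow, cpow_one_div_six_pow]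
    field_simp
  have hηR : ∀ t ∈ Icc (0 : ℝ) 1, η t ∈ ball 0 R := by
    intro t ht
    have h1 := (convex_ball (0 : ℂ) (R ^ 6)).add_smul_sub_mem (mem_ball_zero_iff.2 hz0)
      (mem_ball_zero_iff.2 hz1) ht
    rw [Complex.real_smul, mem_ball_zero_iff, ← hη6, norm_pow] at h1
    rw [mem_ball_zero_iff]
    exact lt_of_pow_lt_pow_left₀ 6 hR.le h1
  have hη0 : ∀ t ∈ Icc (0 : ℝ) 1, η t ≠ 0 := by
    intro t ht h0
    have h1 := hη6 t
    rw [h0] at h1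
    have h2 := hz t ht
    rw [← h1] at h2
    simp at h2
  refine T.chain hΩ hP hM hN hy (σ := fun t => ψ (η t)) zero_lt_one ?_
    (fun t ht => (hψ _ (hη0 t ht) (hηR t ht)).1) (fun t ht => (hψ _ (hη0 t ht) (hηR t ht)).2.1) ?_
    ha (by simpa [hη] using ha') hb (by simpa [hη] using hb') hw
  · refine hψc.comp ?_ hηR
    refine continuousOn_const.mul (ContinuousOn.cpow_const ?_ hz)
    fun_prop
  · intro t ht t' ht' htt'
    simp only
    rw [(hψ _ (hη0 t ht) (hηR t ht)).2.2, (hψ _ (hη0 t' ht') (hηR t' ht')).2.2, hη6, hη6]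
    simp only [Complex.add_re, re_ofReal_mul, Complex.sub_re]
    nlinarith

include T hΩ hP hM in
/-- Routes around the turning point: from the half plane `Re z < 0` via `z2 ∈ iℝ` to the
half plane `Re z > 0` near `-z2`. -/
theorem TurningCoord.one_side (hN : N ⊆ Ω) (hy : IsSolFamily P M Ω μ y) {ρ1 : ℝ} {f ψ : ℂ → ℂ}
    (hR : 0 < R) (hψ : ∀ η, η ≠ 0 → η ∈ ball 0 R → ψ η ≠ 0 ∧ ψ η ^ 4 ∈ ball (0 : ℂ) ρ ∧ turningPhase
    ξ' ν (ψ η ^ 2) μ = η ^ 6) (hψc : ContinuousOn ψ (ball 0 R)) (hf : ∀ σ, σ ^ 4 ∈ ball (0 : ℂ) ρ1 →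
    ψ (f σ) = σ ∧ f σ ∈ ball 0 R ∧ f σ ^ 6 = turningPhase ξ' ν (σ ^ 2) μ ∧ ContinuousAt f σ)
    {κ1 κ2 z2 : ℂ} (hκ1 : κ1 ^ 6 = -1) (hκ2 : κ2 ^ 6 = 1) (hz2 : z2.re = 0) (hz20 : z2 ≠ 0)
    (hmid : κ1 * (-z2) ^ (1 / 6 : ℂ) = κ2 * z2 ^ (1 / 6 : ℂ)) {σa : ℂ → ℂ} (hσa : ContinuousAt σa μ)
    (hσa1 : σa μ ^ 4 ∈ ball (0 : ℂ) ρ1) (hre : (f (σa μ) ^ 6).re < 0)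
    (hσaκ : f (σa μ) = κ1 * (-(f (σa μ) ^ 6)) ^ (1 / 6 : ℂ)) (hw : HasWKBAt μ e ξ ξ' ν y σa)
    {s : ℂ → ℂ → ℂ} (hs1 : s p μ ^ 4 ∈ ball (0 : ℂ) ρ1) (hs2 : f (s p μ) = κ2 * (-z2) ^ (1 / 6 : ℂ))
    (hs : ∀ᶠ v : ℂ × ℂ in 𝓝 (p, μ), ContinuousAt (fun v : ℂ × ℂ => s v.1 v.2) v) : ∀ᶠ x in 𝓝 p, 0 <
    (turningPhase ξ' ν (s x μ ^ 2) μ).re → HasWKBAt μ e ξ ξ' ν y (s x) := by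
  have him : z2.im ≠ 0 := fun h => hz20 (Complex.ext hz2 h)
  have hκ10 : κ1 ≠ 0 := fun h => by rw [h] at hκ1; norm_num at hκ1
  have hκ20 : κ2 ≠ 0 := fun h => by rw [h] at hκ2; norm_num at hκ2
  obtain ⟨ha1, ha2, ha3, -⟩ := hf _ hσa1
  obtain ⟨hb1, hb2, hb3, hb4⟩ := hf _ hs1
  have hp6 : f (s p μ) ^ 6 = -z2 := by
    rw [hs2, mul_pow, hκ2, cpow_one_div_six_pow, one_mul]
  have hR6 : ∀ {η : ℂ}, η ∈ ball (0 : ℂ) R → ‖η ^ 6‖ < R ^ 6 := by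
    intro η hη
    rw [mem_ball_zero_iff] at hη
    rw [norm_pow]
    gcongr
  have hz2R : ‖z2‖ < R ^ 6 := by
    have := hR6 hb2
    rwa [hp6, norm_neg] at this
  -- first half
  have hfirst : HasWKBAt μ e ξ ξ' ν y (fun _ => ψ (κ1 * (-z2) ^ (1 / 6 : ℂ))) := by
    refine T.segment hΩ hP hM hN hy hR hψ hψc (κ := κ1) (z0 := f (σa μ) ^ 6) (z1 := z2) hκ10
      ?_ (hR6 ha2) hz2R (by rw [hz2]; exact hre) hσa ?_ continuousAt_const ?_ hw
    · intro t ht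
      rw [hκ1, div_neg, div_one]
      rcases ht.2.eq_or_lt with h1 | h1
      · right
        rw [h1]
        simpa using him
      · left
        simp only [Complex.neg_re, Complex.add_re, re_ofReal_mul, Complex.sub_re, hz2]
        nlinarith
    · rw [hκ1, div_neg, div_one, ← hσaκ, ha1]
    · rw [hκ1, div_neg, div_one]
  have hsc : ∀ᶠ x in 𝓝 p, ContinuousAt (s x) μ ∧ ContinuousAt (fun x => s x μ) x := by
    have c : ContinuousAt (fun x : ℂ => (x, μ)) p := by fun_prop
    filter_upwards [c.eventually hs] with x hx
    exact ⟨hx.comp₂ continuousAt_const continuousAt_id,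
      hx.comp₂ continuousAt_id continuousAt_const⟩
  have hscp := hsc.self_of_nhds.2
  have hsb : ∀ᶠ x in 𝓝 p, s x μ ^ 4 ∈ ball (0 : ℂ) ρ1 :=
    (hscp.pow 4).eventually_mem (isOpen_ball.mem_nhds hs1)
  have hfs : ContinuousAt (fun x => f (s x μ)) p :=
    ContinuousAt.comp (x := p) (f := fun x => s x μ) (g := f) hb4 hscp
  have hslit : f (s p μ) ^ 6 ∈ Complex.slitPlane := by
    rw [hp6]; right; simpa using him
  have hbr : ∀ᶠ x in 𝓝 p, f (s x μ) = κ2 * (f (s x μ) ^ 6) ^ (1 / 6 : ℂ) := by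
    refine eventuallyEq_of_pow_eq (n := 6) (x := p) (f := fun x => f (s x μ))
      (g := fun x => κ2 * (f (s x μ) ^ 6) ^ (1 / 6 : ℂ)) (by norm_num) hfs
      (continuousAt_const.mul ?_) ?_ ?_ ?_
    · exact ContinuousAt.comp (x := p) (f := fun x => f (s x μ) ^ 6)
        (g := fun z : ℂ => z ^ (1 / 6 : ℂ)) (continuousAt_cpow_const hslit) (hfs.pow 6)
    · refine Eventually.of_forall fun x => ?_
      rw [mul_pow, hκ2, cpow_one_div_six_pow, one_mul]
    · rw [hp6, hs2]
    · intro h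
      rw [h] at hp6
      exact hz20 (by simpa using hp6)
  filter_upwards [hsc, hsb, hbr] with x hx1 hx2 hx3 hpos
  obtain ⟨hx4, hx5, hx6, -⟩ := hf _ hx2
  rw [← hx6] at hpos
  refine T.segment hΩ hP hM hN hy hR hψ hψc (κ := κ2) (z0 := z2) (z1 := f (s x μ) ^ 6) hκ20
    ?_ hz2R (hR6 hx5) (by rw [hz2]; exact hpos) continuousAt_const ?_ hx1.1 ?_ hfirst
  · intro t ht
    rw [hκ2, div_one]
    rcases ht.1.eq_or_lt with h1 | h1
    · right
      rw [← h1]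
      simpa using him
    · left
      simp only [Complex.add_re, re_ofReal_mul, Complex.sub_re, hz2]
      nlinarith
  · rw [hκ2, div_one, hmid]
  · rw [hκ2, div_one, ← hx3, hx4]

/-- On the two sides of a Stokes line through `p` with `Re Z = 0`, the family `y` is given by the
growing WKB vector of `(H, Z)` where `Re Z > 0` and of `(c H, -Z)` where `Re Z < 0`. -/
def SideWKB (μ : ℂ) (y : ℝ → ℂ → ℂ → ℂ × ℂ) (p : ℂ) (H Z : ℂ → ℂ → ℂ) (c : ℂ) : Prop :=
  ∀ᶠ x in 𝓝 p,
    (0 < (Z x μ).re → HasWKB μ y (fun _ => x) (Z x) (H x)) ∧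
    ((Z x μ).re < 0 →
      HasWKB μ y (fun _ => x) (fun lam => -Z x lam) (fun lam => c * H x lam))

include T in
theorem TurningCoord.hasWKB_of_at {s : ℂ → ℂ} (hx : x ∈ N) (hs : ∀ᶠ lam in 𝓝 μ, s lam ^ 4 = ω x lam)
    (hw : HasWKBAt μ e ξ ξ' ν y s) : HasWKB μ y (fun _ => x) (fun lam => turningPhase ξ' ν (s lam ^
    2) lam) (fun lam => (s lam / ν (ω x lam) lam) ^ e) := by
  refine HasWKB.congr hw ?_ EventuallyEq.rfl ?_
  · filter_upwards [hs] with lam h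
    rw [h, T.inv_ω _ hx]
  · filter_upwards [hs] with lam h
    rw [h]

include T hΩ hP hM in
/-- Passage through a simple turning point: WKB asymptotics along an arm on which the solution
grows towards the turning point imply them on both sides of the opposite Stokes line. -/
theorem TurningCoord.sideWKB (hN : N ⊆ Ω) (hy : IsSolFamily P M Ω μ y) (hα0 : α μ = a₀)
    (hαc : ContinuousAt α μ) (hα : ∀ᶠ lam in 𝓝 μ, ω (α lam) lam = 0) {c₁ d₁ : ℂ}
    {D E D' r' E' : ℂ → ℝ → ℂ} {δ0 δ1 : ℝ} (harm : IsArmEnd P M μ α c₁ D r E δ0)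
    (harm' : IsArmEnd P M μ α d₁ D' r' E' δ1) (hang : (c₁ * conj d₁).re < -(1 / 2) * (‖c₁‖ * ‖d₁‖))
    (hh : ∀ t ∈ Ioo 0 δ0, ContinuousAt (fun lam => D lam t) μ ∧ ContinuousAt (fun lam => h lam t) μ
    ∧ ∀ᶠ lam in 𝓝 μ, (P (D lam t) - lam) * h lam t ^ 2 = r lam t)
    (hneg : ∀ t ∈ Ioo 0 δ0, (E μ t).re < 0) (hwkb : ∀ t ∈ Ioo 0 δ0, HasWKB μ y (fun lam => D lam t)
    (fun lam => E lam t) (fun lam => h lam t)) (hc' : ∀ t ∈ Ioo 0 δ1, ContinuousAt (fun lam => D'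
    lam t) μ ∧ ContinuousAt (fun lam => r' lam t) μ)
    (hst : ∀ t ∈ Ioo 0 δ1, (E' μ t).re = 0 ∧ (E' μ t).im < 0) : ∃ δ ∈ Ioc 0 δ1, ∀ t ∈ Ioo 0 δ, ∃ H
    Z, IsGerm P M μ (D' μ t) H Z ∧ (P (D' μ t) - μ) * H (D' μ t) μ ^ 2 = r' μ t ∧ (∀ᶠ lam in 𝓝 μ, Z
    (D' lam t) lam = E' lam t) ∧ SideWKB μ y (D' μ t) H Z (I ^ e) := by
  obtain ⟨R, ρ1, f, ψ, χ, χ', hR, hρ1, hρ1ρ, hψ, hψc, hf, hχ, hχ', hχ0, hf0⟩ := T.exists_sixth_root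
  have hl0 := mem_ball_self (x := μ) T.pos
  obtain ⟨δ, hδ, hA⟩ := T.arm harm hα0 hαc hα hρ1
  obtain ⟨δ', hδ', hA'⟩ := T.arm harm' hα0 hαc hα hρ1
  have hbb : ball (0 : ℂ) ρ1 ⊆ ball 0 ρ := ball_subset_ball hρ1ρ
  -- the angle between the two arms in the `η ^ 4`-plane
  have hlim : ∀ {c₁ : ℂ} {D r E : ℂ → ℝ → ℂ} {δ0 : ℝ}, IsArmEnd P M μ α c₁ D r E δ0 →
      Tendsto (fun t : ℝ => χ (ω (D μ t) μ) / t) (𝓝[>] 0)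
        (𝓝 (χ' * ((ξ' 0 μ)⁻¹ * c₁))) := by
    intro c₁ D r E δ0 harm
    have h1 := T.tendsto_div harm hα0
    have h0 : Tendsto (fun t : ℝ => ω (D μ t) μ) (𝓝[>] 0) (𝓝 0) := by
      have h2 : Tendsto (fun t : ℝ => (t : ℂ)) (𝓝[>] 0) (𝓝 0) := by
        have := (Complex.continuous_ofReal.tendsto 0).mono_left
          (nhdsWithin_le_nhds (s := Ioi (0 : ℝ)))
        simpa using this
      have h3 := h1.mul h2
      rw [mul_zero] at h3
      refine h3.congr' ?_
      filter_upwards [self_mem_nhdsWithin] with t ht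
      have ht' : (t : ℂ) ≠ 0 := by exact_mod_cast (ne_of_gt ht)
      field_simp
    have h4 : Tendsto (fun w => dslope χ 0 w) (𝓝 0) (𝓝 χ') := by
      have := (continuousAt_dslope_same.2 hχ.differentiableAt).tendsto
      rwa [dslope_same, hχ.deriv] at this
    refine ((h4.comp h0).mul h1).congr fun t => ?_
    have h5 := sub_smul_dslope χ 0 (ω (D μ t) μ)
    rw [sub_zero, hχ0, sub_zero, smul_eq_mul] at h5
    simp only [Function.comp_apply]
    rw [← h5]
    ring
  have hangle : ∀ᶠ q : ℝ × ℝ in 𝓝[>] 0 ×ˢ 𝓝[>] 0,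
      (χ (ω (D μ q.1) μ) * conj (χ (ω (D' μ q.2) μ))).re <
        -(1 / 2) * (‖χ (ω (D μ q.1) μ)‖ * ‖χ (ω (D' μ q.2) μ)‖) := by
    have hk : χ' * (ξ' 0 μ)⁻¹ ≠ 0 :=
      mul_ne_zero hχ' (inv_ne_zero (T.deriv_ξ_ne 0 (mem_ball_self T.pos) _ hl0))
    have h1 := ((hlim harm).comp tendsto_fst).prodMk_nhds ((hlim harm').comp tendsto_snd)
      (f := 𝓝[>] 0 ×ˢ 𝓝[>] 0)
    have hcont : Continuous (fun q : ℂ × ℂ => (q.1 * conj q.2).re + 1 / 2 * (‖q.1‖ * ‖q.2‖)) := by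
      have : Continuous (fun q : ℂ × ℂ => conj q.2) :=
        Complex.continuous_conj.comp continuous_snd
      exact (Complex.continuous_re.comp (continuous_fst.mul this)).add (by fun_prop)
    have h2 : (χ' * ((ξ' 0 μ)⁻¹ * c₁) * conj (χ' * ((ξ' 0 μ)⁻¹ * d₁))).re +
        1 / 2 * (‖χ' * ((ξ' 0 μ)⁻¹ * c₁)‖ * ‖χ' * ((ξ' 0 μ)⁻¹ * d₁)‖) < 0 := by
      rw [← mul_assoc, ← mul_assoc]
      set k := χ' * (ξ' 0 μ)⁻¹
      have h3 : k * c₁ * conj (k * d₁) = ((‖k‖ ^ 2 : ℝ) : ℂ) * (c₁ * conj d₁) := by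
        have : k * conj k = ((‖k‖ ^ 2 : ℝ) : ℂ) := by
          rw [Complex.mul_conj, Complex.normSq_eq_norm_sq]
        rw [map_mul, ← this]
        ring
      rw [h3, re_ofReal_mul, norm_mul k c₁, norm_mul k d₁]
      have : 0 < ‖k‖ ^ 2 := by have := norm_pos_iff.2 hk; positivity
      nlinarith
    have h3 := (hcont.tendsto _).comp h1
    filter_upwards [h3.eventually_lt_const h2,
      prod_mem_prod (self_mem_nhdsWithin (a := (0 : ℝ)) (s := Ioi 0))
        (self_mem_nhdsWithin (a := (0 : ℝ)) (s := Ioi 0))] with q hq hq0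
    obtain ⟨t, t'⟩ := q
    have ht : 0 < t := hq0.1
    have ht' : 0 < t' := hq0.2
    simp only [Function.comp_apply] at hq ⊢
    set u := χ (ω (D μ t) μ)
    set v := χ (ω (D' μ t') μ)
    have e1 : u / t * conj (v / t') = ((1 / (t * t') : ℝ) : ℂ) * (u * conj v) := by
      rw [map_div₀, Complex.conj_ofReal]
      push_cast
      have h5 : (t : ℂ) ≠ 0 := by exact_mod_cast ht.ne'
      have h6 : (t' : ℂ) ≠ 0 := by exact_mod_cast ht'.ne'
      field_simp
    rw [e1, re_ofReal_mul, norm_div, norm_div, norm_real, norm_real,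
      Real.norm_of_nonneg ht.le, Real.norm_of_nonneg ht'.le] at hq
    have e2 : 1 / (t * t') * (u * conj v).re + 1 / 2 * (‖u‖ / t * (‖v‖ / t')) =
        1 / (t * t') * ((u * conj v).re + 1 / 2 * (‖u‖ * ‖v‖)) := by
      field_simp
    rw [e2] at hq
    have e3 : 0 < 1 / (t * t') := by positivity
    by_contra hcon
    have e4 : 0 ≤ (u * conj v).re + 1 / 2 * (‖u‖ * ‖v‖) := by linarith [not_lt.1 hcon]
    exact absurd hq (not_lt.2 (mul_nonneg e3.le e4))
  obtain ⟨p1, hp1, p2, hp2, hp12⟩ := eventually_prod_iff.1 hangle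
  obtain ⟨δa, hδa, hδas⟩ := mem_nhdsGT_iff_exists_Ioo_subset.1 hp2
  obtain ⟨tL, htL⟩ := (hp1.and (Ioo_mem_nhdsGT hδ.1)).exists
  obtain ⟨hp1t, htL⟩ := htL
  have hδa0 : (0 : ℝ) < δa := hδa
  have htL' : tL ∈ Ioo 0 δ0 := ⟨htL.1, htL.2.trans_le hδ.2⟩
  -- the starting point in the `σ`-plane
  obtain ⟨hDc, hhc, hhr⟩ := hh tL htL'
  have hode : ∀ᶠ lam in 𝓝 μ, r lam tL ^ 2 = (P (D lam tL) - lam) * (lam - M (D lam tL)) :=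
    harm.ode.mono fun lam h => (h tL htL').2.1
  have hA1 : ∀ᶠ lam in 𝓝 μ, _ := hA.mono fun lam h => h tL htL
  set σa : ℂ → ℂ := fun lam => ν (ω (D lam tL) lam) lam * h lam tL ^ e with hσa
  have hee : e * e = 1 := by rcases T.sign with h | h <;> rw [h] <;> norm_num
  have hσa_all : ∀ᶠ lam in 𝓝 μ, h lam tL ≠ 0 ∧ σa lam ≠ 0 ∧ σa lam ^ 4 = ω (D lam tL) lam ∧
      turningPhase ξ' ν (σa lam ^ 2) lam = E lam tL ∧
      (σa lam / ν (ω (D lam tL) lam) lam) ^ e = h lam tL := by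
    filter_upwards [hA1, hhr, hode, ball_mem_nhds μ T.pos] with lam h1 h2 h3 hl
    obtain ⟨hN1, hw1, hw0, hτ1, hτ2⟩ := h1
    have hν0 := T.ν_ne _ (hbb hw1) lam hl
    have hg0 := T.ne _ (hbb hw1) lam hl hw0
    have hrt := T.of_root _ (hbb hw1) lam hl hw0
    rw [T.inv_ω _ hN1] at hg0 hrt
    have hr0 : r lam tL ≠ 0 := fun h0 => hw0 (by rw [← hτ1, h0]; simp)
    have hh0 : h lam tL ≠ 0 := fun h0 => hr0 (by rw [← h2, h0]; simp)
    have h4 : σa lam ^ 4 = ω (D lam tL) lam := by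
      refine hrt _ (mul_left_cancel₀ hg0 ?_)
      rw [← h3, ← h2]; ring
    have hσ0 : σa lam ≠ 0 := mul_ne_zero hν0 (zpow_ne_zero _ hh0)
    have h5 : (σa lam / ν (ω (D lam tL) lam) lam) ^ e = h lam tL := by
      have : σa lam / ν (ω (D lam tL) lam) lam = h lam tL ^ e := by
        simp only [hσa]; field_simp
      rw [this, ← zpow_mul, hee, zpow_one]
    refine ⟨hh0, hσ0, h4, ?_, h5⟩
    have h6 := (T.root _ (hbb hw1) lam hl _ hσ0 h4).2
    rw [T.inv_ω _ hN1, h5, h2] at h6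
    rw [← hτ2, h6]
    field_simp
  have hωc : ContinuousAt (fun lam => ω (D lam tL) lam) μ :=
    (T.cont_ω _ hA1.self_of_nhds.1 _).comp₂ (g := fun lam => D lam tL) hDc continuousAt_id
  have hσac : ContinuousAt σa μ := by
    refine ContinuousAt.mul ?_ (hhc.zpow₀ e (Or.inl hσa_all.self_of_nhds.1))
    exact (T.cont_ν _ (hbb hA1.self_of_nhds.2.1) _ hl0).comp₂ hωc continuousAt_id
  obtain ⟨-, hσa0, hσa4, hσaE, -⟩ := hσa_all.self_of_nhds
  have hσab : σa μ ^ 4 ∈ ball (0 : ℂ) ρ1 := by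
    rw [hσa4]; exact hA1.self_of_nhds.2.1
  have hwa : HasWKBAt μ e ξ ξ' ν y σa := by
    refine HasWKB.congr (hwkb tL htL') ?_ ?_ ?_
    · filter_upwards [hσa_all, hA1] with lam h1 h2
      rw [h1.2.2.1, T.inv_ω _ h2.1]
    · filter_upwards [hσa_all] with lam h1 using h1.2.2.2.1.symm
    · filter_upwards [hσa_all] with lam h1
      rw [← h1.2.2.2.2, h1.2.2.1]
  obtain ⟨hfa1, hfa2, -, hfa4, hfa6, -⟩ := hf _ hσab
  -- the end point
  refine ⟨min δ' δa, ⟨lt_min hδ'.1 hδa0, (min_le_left _ _).trans hδ'.2⟩, fun t ht => ?_⟩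
  have htδ' : t ∈ Ioo 0 δ' := ⟨ht.1, ht.2.trans_le (min_le_left _ _)⟩
  have htδ1 : t ∈ Ioo 0 δ1 := ⟨ht.1, htδ'.2.trans_le hδ'.2⟩
  have hA2 : ∀ᶠ lam in 𝓝 μ, _ := hA'.mono fun lam h => h t htδ'
  obtain ⟨hN2, hw2, hw20, hτ, hτE⟩ := hA2.self_of_nhds
  obtain ⟨hre, him⟩ := hst t htδ1
  set p := D' μ t with hp
  set w := ω p μ with hw
  set q : ℝ := -(E' μ t).im with hq
  have hq0 : 0 < q := by rw [hq]; linarith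
  have hEq : E' μ t = -(I * q) := by
    apply Complex.ext <;> simp [hq, hre]
  set σ2 : ℂ := w ^ (1 / 4 : ℂ) with hσ₂
  have hσ24 : σ2 ^ 4 = w := by rw [hσ₂, ← Complex.cpow_nat_mul]; norm_num
  obtain ⟨-, -, -, hf24, hf26, -⟩ := hf σ2 (by rw [hσ24]; exact hw2)
  have hE2 : turningPhase ξ' ν (σ2 ^ 2) μ ^ 2 = E' μ t ^ 2 := by
    rw [← hτE]
    have : (σ2 ^ 2) ^ 2 = (r' μ t / ν w μ ^ 2) ^ 2 := by
      rw [hτ, ← hσ24]; ring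
    rcases sq_eq_sq_iff_eq_or_eq_neg.1 this with h1 | h1
    · rw [h1]
    · rw [h1, turningPhase_neg, neg_sq]
  have hζ3 : χ w ^ 3 = -(q : ℂ) ^ 2 := by
    rw [← hσ24, ← hf24]
    calc (f σ2 ^ 4) ^ 3 = (f σ2 ^ 6) ^ 2 := by ring
      _ = -(q : ℂ) ^ 2 := by
        rw [hf26, hE2, hEq]; linear_combination (q : ℂ) ^ 2 * I_sq
  have hηre : (f (σa μ) ^ 6).re < 0 := by
    rw [hfa6, hσaE]; exact hneg tL htL'
  obtain ⟨u, hu6, hua, huζ⟩ := exists_sixth_root_of_unity (η := f (σa μ)) (ζ := χ w) hq0 hηre hζ3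
    (by rw [hfa4, hσa4]; exact hp12 hp1t (hδas ⟨ht.1, ht.2.trans_le (min_le_right _ _)⟩))
  set η0 : ℂ := u * (-(I * q)) ^ (1 / 6 : ℂ) with hη₀
  have hη06 : η0 ^ 6 = E' μ t := by
    rw [hη₀, mul_pow, hu6, cpow_one_div_six_pow, one_mul, hEq]
  -- choose the root
  obtain ⟨σ0, hσ04, hfσ0⟩ : ∃ σ0, σ0 ^ 4 = w ∧ f σ0 = η0 := by
    have hrot : ∀ σ, σ ^ 4 = w → (I * σ) ^ 4 = w ∧ f (I * σ) = I * f σ := fun σ hσ => by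
      refine ⟨by rw [mul_pow, Complex.I_pow_four, one_mul, hσ], ?_⟩
      exact (hf σ (by rw [hσ]; exact hw2)).2.2.1
    have h4 : f σ2 ^ 4 = η0 ^ 4 := by rw [hf24, hσ24, huζ]
    have h5 : (f σ2 - η0) * (f σ2 + η0) * ((I * f σ2 - η0) * (I * f σ2 + η0)) = 0 := by
      linear_combination (-1 : ℂ) * h4 + (f σ2 ^ 2 - η0 ^ 2) * f σ2 ^ 2 * I_sq
    obtain ⟨a1, a2⟩ := hrot σ2 hσ24
    obtain ⟨b1, b2⟩ := hrot _ a1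
    obtain ⟨c1, c2⟩ := hrot _ b1
    rcases mul_eq_zero.1 h5 with h6 | h6 <;> rcases mul_eq_zero.1 h6 with h7 | h7
    · exact ⟨_, hσ24, sub_eq_zero.1 h7⟩
    · refine ⟨_, b1, ?_⟩
      rw [b2, a2]
      linear_combination -h7 + f σ2 * I_sq
    · refine ⟨_, a1, ?_⟩
      rw [a2]; exact sub_eq_zero.1 h7
    · refine ⟨_, c1, ?_⟩
      rw [c2, b2, a2]
      linear_combination -h7 + I * f σ2 * I_sq
  have hw0 : w ≠ 0 := hw20
  have hσ00 : σ0 ≠ 0 := fun h => hw0 (by rw [← hσ04, h]; norm_num)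
  have hσ0b : σ0 ^ 4 ∈ ball (0 : ℂ) ρ1 := by rw [hσ04]; exact hw2
  obtain ⟨-, -, hIf, -, hf06, -⟩ := hf σ0 hσ0b
  obtain ⟨s, hs1, hg, hs⟩ := T.exists_germ hσ00 (hbb hσ0b)
  have hξp : ξ (σ0 ^ 4) μ = p := by rw [hσ04, hw, T.inv_ω _ hN2]
  rw [hξp] at hs1 hg hs
  have hE0 : turningPhase ξ' ν (σ0 ^ 2) μ = E' μ t := by rw [← hf06, hfσ0, hη06]
  have hEne : E' μ t ≠ 0 := fun h => by rw [h] at him; simp at him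
  have hσ0τ : σ0 ^ 2 = r' μ t / ν w μ ^ 2 := by
    have : (σ0 ^ 2) ^ 2 = (r' μ t / ν w μ ^ 2) ^ 2 := by
      rw [hτ, ← hσ04]; ring
    rcases sq_eq_sq_iff_eq_or_eq_neg.1 this with h1 | h1
    · exact h1
    · rw [h1, turningPhase_neg, hτE] at hE0
      exact absurd (self_eq_neg.1 hE0.symm) hEne
  obtain ⟨hD'c, hr'c⟩ := hc' t htδ1
  have hpair : ContinuousAt (fun lam => (D' lam t, lam)) μ := hD'c.prodMk continuousAt_id
  refine ⟨fun x lam => (s x lam / ν (ω x lam) lam) ^ e,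
    fun x lam => turningPhase ξ' ν (s x lam ^ 2) lam, hg, ?_, ?_, ?_⟩
  · have h6 := (T.root _ (hbb hw2) μ hl0 _ hσ00 hσ04).2
    have hν0 := T.ν_ne _ (hbb hw2) _ hl0
    rw [T.inv_ω _ hN2] at h6
    simp only
    rw [hs1, ← hw, h6, hσ0τ]
    field_simp
  · have hsτ : ∀ᶠ lam in 𝓝 μ, s (D' lam t) lam ^ 2 = r' lam t / ν (ω (D' lam t) lam) lam ^ 2 := by
      refine eventuallyEq_of_pow_eq (n := 2) (x := μ) (f := fun lam => s (D' lam t) lam ^ 2)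
        (g := fun lam => r' lam t / ν (ω (D' lam t) lam) lam ^ 2) two_ne_zero ?_ ?_ ?_ ?_ ?_
      · exact (ContinuousAt.comp (x := μ) (f := fun lam => (D' lam t, lam))
          (g := fun v : ℂ × ℂ => s v.1 v.2) hs.self_of_nhds.1 hpair).pow 2
      · refine hr'c.div (ContinuousAt.pow ?_ 2) (pow_ne_zero _ (T.ν_ne _ (hbb hw2) _ hl0))
        have c1 : ContinuousAt (fun lam => ω (D' lam t) lam) μ :=
          ContinuousAt.comp (x := μ) (f := fun lam => (D' lam t, lam))
            (g := fun v : ℂ × ℂ => ω v.1 v.2) (T.cont_ω _ hN2 _) hpair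
        exact (T.cont_ν _ (hbb hw2) _ hl0).comp₂ c1 continuousAt_id
      · filter_upwards [hpair.eventually hs, hA2] with lam h1 h2
        rw [h2.2.2.2.1, ← h1.2.1]; ring
      · rw [← hp, hs1, hσ0τ]
      · rw [← hp, hs1]; exact pow_ne_zero _ hσ00
    filter_upwards [hsτ, hA2] with lam h1 h2
    rw [h1, h2.2.2.2.2]
  · have hk6 := exp_pi_div_six_pow_six
    have hk3 := exp_pi_div_six_pow_three
    have hmid := exp_mul_neg_I_mul_cpow hq0
    set k := exp (Real.pi / 6 * I) with hk
    have hf' : ∀ σ, σ ^ 4 ∈ ball (0 : ℂ) ρ1 → ψ (f σ) = σ ∧ f σ ∈ ball 0 R ∧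
        f σ ^ 6 = turningPhase ξ' ν (σ ^ 2) μ ∧ ContinuousAt f σ := fun σ hσ =>
      ⟨(hf σ hσ).1, (hf σ hσ).2.1, (hf σ hσ).2.2.2.2.1, (hf σ hσ).2.2.2.2.2⟩
    have hκ1 : (u * k) ^ 6 = -1 := by rw [mul_pow, hu6, hk6, one_mul]
    have hIq : I * (q : ℂ) ≠ 0 := mul_ne_zero I_ne_zero (by exact_mod_cast hq0.ne')
    have hup := T.one_side hΩ hP hM hN hy hR hψ hψc hf' (κ1 := u * k) (κ2 := u)
      (z2 := I * q) hκ1 hu6 (by simp) hIq (by rw [mul_assoc, hmid]) hσac hσab hηre hua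
      hwa (s := s) (p := p) (by rw [hs1]; exact hσ0b) (by rw [hs1, hfσ0])
      (hs.mono fun v h => h.1)
    have hlow := T.one_side hΩ hP hM hN hy hR hψ hψc hf' (κ1 := u * k) (κ2 := u * k ^ 2)
      (z2 := -(I * q)) hκ1 (by rw [mul_pow, ← pow_mul, mul_comm 2 6, pow_mul, hk6, hu6]; norm_num)
      (by simp) (neg_ne_zero.2 hIq)
      (by rw [neg_neg, ← hmid]; ring) hσac hσab hηre hua
      hwa (s := fun x lam => I * s x lam) (p := p)
      (by rw [hs1, mul_pow, Complex.I_pow_four, one_mul]; exact hσ0b)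
      (by
        rw [hs1, hIf, hfσ0, neg_neg, ← hmid, hη₀]
        linear_combination (-(u * (-(I * q)) ^ (1 / 6 : ℂ))) * hk3)
      (hs.mono fun v h => continuousAt_const.mul h.1)
    have hsx : ∀ᶠ x in 𝓝 p, ∀ᶠ lam in 𝓝 μ, s x lam ^ 4 = ω x lam := by
      have := hs.mono fun v h => h.2.1
      rw [nhds_prod_eq] at this
      exact this.curry
    filter_upwards [hup, hlow, hsx, T.isOpen.mem_nhds hN2] with x h1 h2 h3 hxN
    constructor
    · intro hpos
      exact T.hasWKB_of_at hxN h3 (h1 hpos)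
    · intro hneg
      have hI2 : ∀ lam, (I * s x lam) ^ 2 = -(s x lam ^ 2) := fun lam => by
        rw [mul_pow, I_sq, neg_one_mul]
      have h4 := T.hasWKB_of_at hxN (s := fun lam => I * s x lam)
        (h3.mono fun lam h => by rw [mul_pow, Complex.I_pow_four, one_mul, h])
        (h2 (by rw [hI2, turningPhase_neg, Complex.neg_re]; linarith))
      refine h4.congr EventuallyEq.rfl ?_ ?_
      · exact Eventually.of_forall fun lam => by simp only [hI2, turningPhase_neg]
      · exact Eventually.of_forall fun lam => by simp only [mul_div_assoc, mul_zpow]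

/-! Solutions normalized at infinity -/

/-- Along the ray `X` over `t < T`, where `κ` bounds the logarithmic derivative of the amplitude
`h`, `B` is the primitive of `κ` vanishing at `-∞`, and the real part of the phase `E` increases at
least at the rate `c`. -/
structure IsTail (P M : ℂ → ℂ) (lam : ℂ) (T : ℝ) (ς : ℂ) (X h E : ℝ → ℂ) (κ B : ℝ → ℝ)
    (c K Hb : ℝ) : Prop where
  c_pos : 0 < c
  deriv_X : ∀ t < T, HasDerivAt X ς t
  diff_P : ∀ t < T, DifferentiableAt ℂ P (X t)
  diff_M : ∀ t < T, DifferentiableAt ℂ M (X t)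
  cont_h : ∀ t < T, ContinuousAt h t
  h_ne : ∀ t < T, h t ≠ 0
  P_ne : ∀ t < T, P (X t) - lam ≠ 0
  root : ∀ t < T, (P (X t) - lam) * h t ^ 4 = lam - M (X t)
  deriv_E : ∀ t < T, HasDerivAt E ((P (X t) - lam) * h t ^ 2 * ς) t
  re_E : ∀ t < T, c ≤ ((P (X t) - lam) * h t ^ 2 * ς).re
  bound : ∀ t < T, ‖logDerivRoot P M (X t) lam * ς‖ ≤ κ t
  bound' : ∀ t < T, κ t ≤ K
  deriv_B : ∀ t < T, HasDerivAt B (κ t) t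
  lim_B : Tendsto B atBot (𝓝 0)
  B_le : ∀ t < T, B t ≤ 1 / 2
  h_le : ∀ t < T, ‖h t‖ ≤ Hb ∧ ‖(h t)⁻¹‖ ≤ Hb

namespace IsTail

variable {T : ℝ} {ς : ℂ} {X h E : ℝ → ℂ} {κ B : ℝ → ℝ} {c K Hb : ℝ} {y y' : ℂ → ℂ × ℂ}
  (L : IsTail P M lam T ς X h E κ B c K Hb) (hε : 0 < ε) (hX : ∀ t, X t ∈ Ω)
  (hy : IsSol P M ε lam Ω y)

include L

include hε hX hy in
theorem symbol_deriv (ht : t < T) : HasDerivAt (fun t => wPlus (h t) (E t) ε (y (X t)))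
    (logDerivRoot P M (X t) lam * ς * wMinus (h t) (E t) ε (y (X t))) t ∧ HasDerivAt (fun t =>
    wMinus (h t) (E t) ε (y (X t))) (logDerivRoot P M (X t) lam * ς * wPlus (h t) (E t) ε (y (X t))
    - 2 / ε * ((P (X t) - lam) * h t ^ 2 * ς) * wMinus (h t) (E t) ε (y (X t))) t := by
  have h1 : HasDerivAt (fun t => y (X t)) (ς • sysMatrix P M ε (X t) lam (y (X t))) t :=
    (hy (X t) (hX t)).scomp t (L.deriv_X t ht)
  have h2 := hasDerivAt_root (P := P) (M := M) (lam := lam) (L.cont_h t ht)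
    (by filter_upwards [Iio_mem_nhds ht] with s hs using L.root s hs) (L.deriv_X t ht)
    (L.diff_P t ht) (L.diff_M t ht) (L.h_ne t ht) (L.P_ne t ht)
  exact ⟨hasDerivAt_wPlus (y := fun t => y (X t)) hε.ne' h1 h2 (L.h_ne t ht) (L.root t ht) rfl
      (L.deriv_E t ht),
    hasDerivAt_wMinus (y := fun t => y (X t)) hε.ne' h1 h2 (L.h_ne t ht) (L.root t ht) rfl
      (L.deriv_E t ht)⟩

theorem B_nonneg (hab : a ≤ b) (hb : b < T) : 0 ≤ B a ∧ B
    a ≤ B b := by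
  have hmono : ∀ a' b', a' ≤ b' → b' < T → B a' ≤ B b' := fun a' b' h hb' =>
    (monotoneOn_of_norm_le (a := a') (b := b')
      (k := fun t => logDerivRoot P M (X t) lam * ς)
      (fun t ht => L.deriv_B t (ht.2.trans_lt hb')) fun t ht => L.bound t (ht.2.trans_lt hb'))
      (left_mem_Icc.2 h) (right_mem_Icc.2 h) h
  refine ⟨le_of_tendsto L.lim_B ?_, hmono a b hab hb⟩
  filter_upwards [eventually_le_atBot a] with s hs using hmono s a hs (hab.trans_lt hb)

include hε hX hy in
theorem estimate (hab : a ≤ b) (hb : b < T) : ‖wMinus (h b) (E b) ε (y (X b))‖ ≤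
    ‖wMinus (h a) (E a) ε (y (X a))‖ + 2 * B b * (‖wPlus (h a) (E a) ε (y (X a))‖ + ‖wMinus (h a) (E
    a) ε (y (X a))‖) ∧ ‖wPlus (h b) (E b) ε (y (X b)) - wPlus (h a) (E a) ε (y (X a))‖ ≤ 2 * B b *
    (‖wPlus (h a) (E a) ε (y (X a))‖ + ‖wMinus (h a) (E a) ε (y (X a))‖) :=
  symbol_estimate_of_small hε
    (fun t ht => (L.symbol_deriv hε hX hy (ht.2.trans_lt hb)).1)
    (fun t ht => (L.symbol_deriv hε hX hy (ht.2.trans_lt hb)).2)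
    (fun t ht => L.deriv_E t (ht.2.trans_lt hb)) (fun t ht => L.re_E t (ht.2.trans_lt hb))
    (fun t ht => L.deriv_B t (ht.2.trans_lt hb)) (fun t ht => L.bound t (ht.2.trans_lt hb))
    hab L.c_pos.le (by linarith [(L.B_nonneg hab hb).1]) (L.B_le b hb) (right_mem_Icc.2 hab)

include hε hX hy in
theorem estimate_eps (hab : a ≤ b) (hb : b < T) (hsmall : K * (1 / 2) * ε ≤ c)
    (h0 : wPlus (h a) (E a) ε (y (X a)) = 1) (h1 : wMinus (h a) (E a) ε (y (X a)) = 0) : ‖wMinus (h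
    b) (E b) ε (y (X b))‖ ≤ K / c * ε ∧ ‖wPlus (h b) (E b) ε (y (X b)) - 1‖ ≤ K / c * ε := by
  have := symbol_estimate (K1 := 1 / 2) hε
    (fun t ht => (L.symbol_deriv hε hX hy (ht.2.trans_lt hb)).1)
    (fun t ht => (L.symbol_deriv hε hX hy (ht.2.trans_lt hb)).2)
    (fun t ht => L.deriv_E t (ht.2.trans_lt hb)) (fun t ht => L.re_E t (ht.2.trans_lt hb))
    (fun t ht => L.deriv_B t (ht.2.trans_lt hb)) (fun t ht => L.bound t (ht.2.trans_lt hb))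
    hab L.c_pos
    (fun t ht => (L.bound t (ht.2.trans_lt hb)).trans (L.bound' t (ht.2.trans_lt hb)))
    (by linarith [(L.B_nonneg hab hb).1, L.B_le b hb]) hsmall (right_mem_Icc.2 hab)
  simp only [h0, h1, norm_zero, norm_one, mul_zero, add_zero, mul_one, zero_add] at this
  have hK : 0 ≤ K := (norm_nonneg _).trans ((L.bound b hb).trans (L.bound' b hb))
  have hpos : 0 ≤ K / c * ε := by have := L.c_pos; positivity
  have he : K * ε / c = K / c * ε := by ring
  rw [he] at this
  exact ⟨this.1, by linarith [this.2]⟩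

include hε hX hy in
/-- A solution whose symbol tends to `0` at `-∞` vanishes. -/
theorem eq_zero (h0 : Tendsto (fun t => wPlus (h t) (E t) ε (y (X t))) atBot (𝓝 0))
    (h1 : Tendsto (fun t => wMinus (h t) (E t) ε (y (X t))) atBot (𝓝 0)) (ht : t < T) : y (X t) = 0
    := by
  have hw : wMinus (h t) (E t) ε (y (X t)) = 0 := by
    have h3 : Tendsto (fun a => ‖wMinus (h a) (E a) ε (y (X a))‖ + 2 * B t *
        (‖wPlus (h a) (E a) ε (y (X a))‖ + ‖wMinus (h a) (E a) ε (y (X a))‖)) atBot (𝓝 0) := by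
      simpa using h1.norm.add ((h0.norm.add h1.norm).const_mul (2 * B t))
    refine norm_le_zero_iff.1 (ge_of_tendsto h3 ?_)
    filter_upwards [eventually_le_atBot t] with a ha using (L.estimate hε hX hy ha ht).1
  have hw' : wPlus (h t) (E t) ε (y (X t)) = 0 := by
    have h3 : Tendsto (fun a => ‖wPlus (h a) (E a) ε (y (X a))‖ + 2 * B t *
        (‖wPlus (h a) (E a) ε (y (X a))‖ + ‖wMinus (h a) (E a) ε (y (X a))‖)) atBot (𝓝 0) := by
      simpa using h0.norm.add ((h0.norm.add h1.norm).const_mul (2 * B t))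
    refine norm_le_zero_iff.1 (ge_of_tendsto h3 ?_)
    filter_upwards [eventually_le_atBot t] with a ha
    have := (L.estimate hε hX hy ha ht).2
    have h5 := norm_add_le (wPlus (h a) (E a) ε (y (X a)))
      (wPlus (h t) (E t) ε (y (X t)) - wPlus (h a) (E a) ε (y (X a)))
    rw [add_sub_cancel] at h5
    linarith
  rw [wkb_expand (E := E t) (ε := ε) (L.h_ne t ht) (y (X t)), hw, hw']
  simp

theorem re_phase_le (hab : a ≤ b) (hb : b < T) : (E a).re
    ≤ (E b).re - c * (b - a) := by
  have hd : ∀ t ∈ Icc a b, HasDerivAt (fun t => (E t).re - c * t)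
      (((P (X t) - lam) * h t ^ 2 * ς).re - c * 1) t := fun t ht =>
    (hasDerivAt_re_of_hasDerivAt (L.deriv_E t (ht.2.trans_lt hb))).sub
      ((hasDerivAt_id t).const_mul c)
  have := monotoneOn_of_deriv_nonneg (convex_Icc a b)
    (fun t ht => (hd t ht).continuousAt.continuousWithinAt)
    (fun t ht => (hd t (interior_subset ht)).differentiableAt.differentiableWithinAt)
    (fun t ht => by
      rw [(hd t (interior_subset ht)).deriv]
      linarith [L.re_E t ((interior_subset ht : t ∈ Icc a b).2.trans_lt hb)])
    (left_mem_Icc.2 hab) (right_mem_Icc.2 hab) hab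
  simp only at this
  linarith

/-- A solution with symbol tending to `(1, 0)` decays exponentially at `-∞`. -/
theorem norm_le (hε : 0 < ε) (h0 : Tendsto (fun t => wPlus
    (h t) (E t) ε (y (X t))) atBot (𝓝 1)) (h1 : Tendsto (fun t => wMinus (h t) (E t) ε (y (X t)))
    atBot (𝓝 0)) : ∃ C > 0, ∀ᶠ t in atBot, ‖y (X t)‖ ≤ C * Real.exp (c / ε * t) := by
  set b := T - 1
  have hb : b < T := sub_one_lt T
  have hHb : 0 ≤ Hb := (norm_nonneg _).trans (L.h_le b hb).1
  refine ⟨(3 * Hb + 1) * Real.exp (((E b).re - c * b) / ε), by positivity, ?_⟩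
  filter_upwards [eventually_le_atBot b,
    h0.norm.eventually_lt_const (show ‖(1 : ℂ)‖ < 2 by rw [norm_one]; norm_num),
    h1.norm.eventually_lt_const (show ‖(0 : ℂ)‖ < 1 by rw [norm_zero]; norm_num)] with t ht hw0 hw1
  have htT := ht.trans_lt hb
  have he : ‖exp (E t / ε)‖ ≤ Real.exp (((E b).re - c * b) / ε) * Real.exp (c / ε * t) := by
    rw [Complex.norm_exp, ← Real.exp_add, Complex.div_ofReal_re]
    refine Real.exp_le_exp.2 ?_
    have := L.re_phase_le ht hb
    have h2 : ((E b).re - c * b) / ε + c / ε * t = ((E b).re - c * (b - t)) / ε := by ring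
    rw [h2]
    exact (div_le_div_iff_of_pos_right hε).2 this
  have h3 : ‖wPlus (h t) (E t) ε (y (X t)) + wMinus (h t) (E t) ε (y (X t))‖ ≤ 3 :=
    (norm_add_le _ _).trans (by linarith)
  have h4 : ‖wPlus (h t) (E t) ε (y (X t)) - wMinus (h t) (E t) ε (y (X t))‖ ≤ 3 :=
    (norm_sub_le _ _).trans (by linarith)
  obtain ⟨hh1, hh2⟩ := L.h_le t htT
  have hX : 0 ≤ Real.exp (((E b).re - c * b) / ε) * Real.exp (c / ε * t) := by positivity
  rw [wkb_expand (E := E t) (ε := ε) (L.h_ne t htT) (y (X t)), Prod.norm_def]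
  refine max_le ?_ ?_
  · rw [div_eq_mul_inv, norm_mul, norm_mul]
    calc _ ≤ (Real.exp (((E b).re - c * b) / ε) * Real.exp (c / ε * t)) * 3 * Hb := by gcongr
      _ ≤ _ := by nlinarith
  · rw [norm_mul, norm_mul, norm_mul, norm_neg, norm_I, one_mul]
    calc _ ≤ (Real.exp (((E b).re - c * b) / ε) * Real.exp (c / ε * t)) * 3 * Hb := by gcongr
      _ ≤ _ := by nlinarith

end IsTail

theorem exists_limit_of_cauchy {V : Set ℂ} (hV : IsOpen V) {f : ℕ → ℂ → ℂ} {b : ℕ → ℝ}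
    (hf : ∀ n, DifferentiableOn ℂ (f n) V) (hb : Tendsto b atTop (𝓝 0))
    (hfb : ∀ n m, n ≤ m → ∀ lam ∈ V, ‖f m lam - f n lam‖ ≤ b n) : ∃ g : ℂ → ℂ, DifferentiableOn ℂ g
    V ∧ ∀ lam ∈ V, Tendsto (fun n => f n lam) atTop (𝓝 (g lam)) := by
  have hc : ∀ lam ∈ V, ∃ l, Tendsto (fun n => f n lam) atTop (𝓝 l) := fun lam hl =>
    cauchySeq_tendsto_of_complete (cauchySeq_of_le_tendsto_0' b
      (fun n m h => by rw [dist_comm, dist_eq_norm]; exact hfb n m h lam hl) hb)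
  choose! g hg using hc
  refine ⟨g, ?_, hg⟩
  have hu : TendstoUniformlyOn f g atTop V := by
    rw [Metric.tendstoUniformlyOn_iff]
    intro e he
    filter_upwards [hb.eventually_lt_const he] with n hn lam hl
    refine lt_of_le_of_lt ?_ hn
    rw [dist_eq_norm]
    refine le_of_tendsto ((hg lam hl).sub_const (f n lam)).norm ?_
    filter_upwards [eventually_ge_atTop n] with m hm using hfb n m hm lam hl
  exact hu.tendstoLocallyUniformlyOn.differentiableOn (Eventually.of_forall hf) hV

include hΩ hΩ' hP hM in
theorem exists_solution_basis (ε : ℝ) (lam : ℂ) (hp : p ∈ Ω) : ∃ F1 F2 : ℂ → ℂ × ℂ, IsSol P M ε lam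
    Ω F1 ∧ IsSol P M ε lam Ω F2 ∧ F1 p = (1, 0) ∧ F2 p = (0, 1) ∧ ∀ y, IsSol P M ε lam Ω y → ∀ x ∈
    Ω, y x = (y p).1 • F1 x + (y p).2 • F2 x := by
  obtain ⟨F1, h1, h1', -⟩ := exists_fundamental hΩ hΩ' (isOpen_ball (x := lam) (ε := 1))
    Metric.isBounded_ball hP hM ε hp (e := fun _ => (1, 0)) (differentiableOn_const _)
  obtain ⟨F2, h2, h2', -⟩ := exists_fundamental hΩ hΩ' (isOpen_ball (x := lam) (ε := 1))
    Metric.isBounded_ball hP hM ε hp (e := fun _ => (0, 1)) (differentiableOn_const _)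
  have hl := mem_ball_self (x := lam) one_pos
  have hpre : IsPreconnected Ω := hΩ'.isPathConnected.isConnected.isPreconnected
  refine ⟨fun x => F1 x lam, fun x => F2 x lam, h1' lam hl, h2' lam hl, h1 lam, h2 lam,
    fun y hy x hx => ?_⟩
  have hw : det2 (F1 x lam) (F2 x lam) = 1 := by
    rw [(h1' lam hl).det2_eq hΩ hpre (h2' lam hl) hx hp, h1, h2]; simp [det2]
  rw [det2_expand (y x) _ _ hw, hy.det2_eq hΩ hpre (h2' lam hl) hx hp,
    (h1' lam hl).det2_eq hΩ hpre hy hx hp, h1, h2]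
  simp [det2]

include hΩ hΩ' hP hM in
/-- A solution vanishing at one point vanishes. -/
theorem IsSol.eq_zero {y : ℂ → ℂ × ℂ} (hy : IsSol P M ε lam Ω y) (hp : p ∈ Ω) (h0 : y p = 0)
    (hx : x ∈ Ω) : y x = 0 := by
  obtain ⟨F1, F2, -, -, -, -, h⟩ := exists_solution_basis hΩ hΩ' hP hM ε lam hp
  rw [h y hy x hx, h0]
  simp

theorem wPlus_wkb {h E : ℂ} (h0 : h ≠ 0) (ε : ℝ) (a b : ℂ) : wPlus h E ε (exp (E / ε) * (a + b) / h,
    -I * exp (E / ε) * (a - b) * h) = a ∧ wMinus h E ε (exp (E / ε) * (a + b) / h, -I * exp (E / ε)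
    * (a - b) * h) = b := by
  have he : exp (-(E / ε)) * exp (E / ε) = 1 := by
    rw [← exp_add]; simp
  have h1 : h * (exp (E / ε) * (a + b) / h) = exp (E / ε) * (a + b) := by
    field_simp
  have h2 : I * (-I * exp (E / ε) * (a - b) * h) / h = exp (E / ε) * (a - b) := by
    rw [div_eq_iff h0]
    linear_combination (-exp (E / ε) * (a - b) * h) * I_sq
  simp only [wPlus, wMinus, h1, h2]
  constructor
  · linear_combination a * he
  · linear_combination b * he

theorem differentiableOn_wPlus {V : Set ℂ} {h E : ℂ → ℂ} {y : ℂ → ℂ × ℂ}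
    (hh : DifferentiableOn ℂ h V) (h0 : ∀ lam ∈ V, h lam ≠ 0) (hE : DifferentiableOn ℂ E V)
    (hy : DifferentiableOn ℂ y V) : DifferentiableOn ℂ (fun lam => wPlus (h lam) (E lam) ε (y lam))
    V ∧ DifferentiableOn ℂ (fun lam => wMinus (h lam) (E lam) ε (y lam)) V := by
  have h1 : DifferentiableOn ℂ (fun lam => exp (-(E lam / ε))) V :=
    (hE.div_const _).neg.cexp
  have h2 := hh.mul hy.fst
  have h3 := (hy.snd.const_mul I).div hh h0
  exact ⟨(h1.mul (h2.add h3)).div_const 2, (h1.mul (h2.sub h3)).div_const 2⟩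

theorem wPlus_sub (h E : ℂ) (ε : ℝ) (y y' : ℂ × ℂ) : wPlus h E ε (y - y') = wPlus h E ε y - wPlus h
    E ε y' := by
  simp only [wPlus, Prod.fst_sub, Prod.snd_sub]; ring

theorem wMinus_sub (h E : ℂ) (ε : ℝ) (y y' : ℂ × ℂ) : wMinus h E ε (y - y') = wMinus h E ε y -
    wMinus h E ε y' := by
  simp only [wMinus, Prod.fst_sub, Prod.snd_sub]; ring

theorem wPlus_smul (h E : ℂ) (ε : ℝ) (c : ℂ) (y : ℂ × ℂ) : wPlus h E ε (c • y) = c * wPlus h E ε y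
    := by
  simp only [wPlus, Prod.smul_fst, Prod.smul_snd, smul_eq_mul]; ring

theorem wMinus_smul (h E : ℂ) (ε : ℝ) (c : ℂ) (y : ℂ × ℂ) : wMinus h E ε (c • y) = c * wMinus h E ε
    y := by
  simp only [wMinus, Prod.smul_fst, Prod.smul_snd, smul_eq_mul]; ring

theorem continuous_wPlus (h E : ℂ) (ε : ℝ) : Continuous (wPlus h E ε) := by
  unfold wPlus; fun_prop

theorem continuous_wMinus (h E : ℂ) (ε : ℝ) : Continuous (wMinus h E ε) := by
  unfold wMinus; fun_prop

include hΩ hΩ' hP hM in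
/-- The solutions with symbol `(1, 0)` at `-∞`, holomorphic in the spectral parameter. -/
theorem exists_tail_solution {V : Set ℂ} (hV : IsOpen V) (hVb : Bornology.IsBounded V) {T : ℝ}
    {ς : ℂ} {X : ℝ → ℂ} {E : ℂ → ℝ → ℂ} {κ B : ℝ → ℝ} {c K Hb : ℝ} (hX : ∀ t, X t ∈ Ω) (L : ∀ lam ∈
    V, IsTail P M lam T ς X (h lam) (E lam) κ B c K Hb) (hVne : V.Nonempty)
    (hh : ∀ t < T, DifferentiableOn ℂ (fun lam => h lam t) V)
    (hE : ∀ t < T, DifferentiableOn ℂ (fun lam => E lam t) V) (hε : 0 < ε) : ∃ y : ℂ → ℂ → ℂ × ℂ, (∀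
    lam ∈ V, IsSol P M ε lam Ω (y lam)) ∧ (∀ x ∈ Ω, DifferentiableOn ℂ (fun lam => y lam x) V) ∧ ∀
    lam ∈ V, Tendsto (fun t => wPlus (h lam t) (E lam t) ε (y lam (X t))) atBot (𝓝 1) ∧ Tendsto (fun
    t => wMinus (h lam t) (E lam t) ε (y lam (X t))) atBot (𝓝 0) ∧ (K * (1 / 2) * ε ≤ c → ∀ t < T,
    ‖wMinus (h lam t) (E lam t) ε (y lam (X t))‖ ≤ K / c * ε ∧ ‖wPlus (h lam t) (E lam t) ε (y lam
    (X t)) - 1‖ ≤ K / c * ε) := by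
  obtain ⟨μ, hμ⟩ := hVne
  have L0 := L μ hμ
  set b := T - 1 with hbd
  have hb : b < T := sub_one_lt T
  set a : ℕ → ℝ := fun n => b - n with had
  have ha : ∀ n, a n ≤ b := fun n => by simp [had]
  have haT : ∀ n, a n < T := fun n => (ha n).trans_lt hb
  have hamono : ∀ n m, n ≤ m → a m ≤ a n := fun n m hnm => by
    have : (n : ℝ) ≤ m := by exact_mod_cast hnm
    simp only [had]; linarith
  have halim : Tendsto a atTop atBot :=
    tendsto_atBot_add_const_left _ b (tendsto_neg_atTop_atBot.comp tendsto_natCast_atTop_atTop)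
  -- the approximations
  have hex : ∀ n, ∃ Y : ℂ → ℂ → ℂ × ℂ, (∀ lam, Y (X (a n)) lam =
      (exp (E lam (a n) / ε) * (1 + 0) / h lam (a n),
      -I * exp (E lam (a n) / ε) * (1 - 0) * h lam (a n))) ∧
      (∀ lam ∈ V, IsSol P M ε lam Ω (fun x => Y x lam)) ∧ ∀ x ∈ Ω, DifferentiableOn ℂ (Y x) V :=
    fun n => exists_fundamental hΩ hΩ' hV hVb hP hM ε (hX _) (by
      have h1 := hh _ (haT n)
      have h2 : DifferentiableOn ℂ (fun lam => exp (E lam (a n) / ε)) V :=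
        ((hE _ (haT n)).div_const _).cexp
      exact ((h2.mul_const _).div h1 fun lam hl => (L lam hl).h_ne _ (haT n)).prodMk
        (((h2.const_mul _).mul_const _).mul h1))
  choose Y hY0 hYs hYd using hex
  have hw0 : ∀ n, ∀ lam ∈ V, wPlus (h lam (a n)) (E lam (a n)) ε (Y n (X (a n)) lam) = 1 ∧
      wMinus (h lam (a n)) (E lam (a n)) ε (Y n (X (a n)) lam) = 0 := fun n lam hl => by
    rw [hY0]; exact wPlus_wkb ((L lam hl).h_ne _ (haT n)) ε 1 0
  have hest : ∀ n, ∀ lam ∈ V, ∀ t, a n ≤ t → t < T →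
      ‖wMinus (h lam t) (E lam t) ε (Y n (X t) lam)‖ ≤ 2 * B t ∧
      ‖wPlus (h lam t) (E lam t) ε (Y n (X t) lam) - 1‖ ≤ 2 * B t := fun n lam hl t h1 h2 => by
    have := (L lam hl).estimate hε hX (hYs n lam hl) h1 h2
    simpa [hw0 n lam hl] using this
  have hcau : ∀ n m, n ≤ m → ∀ lam ∈ V, ‖wMinus (h lam b) (E lam b) ε (Y m (X b) lam) -
        wMinus (h lam b) (E lam b) ε (Y n (X b) lam)‖ ≤ 6 * B (a n) ∧
      ‖wPlus (h lam b) (E lam b) ε (Y m (X b) lam) -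
        wPlus (h lam b) (E lam b) ε (Y n (X b) lam)‖ ≤ 6 * B (a n) := by
    intro n m hnm lam hl
    have hd : IsSol P M ε lam Ω (fun x => Y m x lam - Y n x lam) := fun x hx => by
      rw [map_sub]; exact (hYs m lam hl x hx).sub (hYs n lam hl x hx)
    have h1 := (L lam hl).estimate hε hX hd (ha n) hb
    simp only [wPlus_sub, wMinus_sub, hw0 n lam hl, sub_zero] at h1
    obtain ⟨h2, h3⟩ := hest m lam hl (a n) (hamono n m hnm) (haT n)
    obtain ⟨h4, h5⟩ := L0.B_nonneg (ha n) hb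
    have h6 := L0.B_le b hb
    have h7 : 2 * B b * (‖wPlus (h lam (a n)) (E lam (a n)) ε (Y m (X (a n)) lam) - 1‖ +
        ‖wMinus (h lam (a n)) (E lam (a n)) ε (Y m (X (a n)) lam)‖) ≤
        2 * (1 / 2) * (2 * B (a n) + 2 * B (a n)) := by gcongr
    refine ⟨by linarith [h1.1], ?_⟩
    have h8 := norm_add_le (wPlus (h lam (a n)) (E lam (a n)) ε (Y m (X (a n)) lam) - 1)
      (wPlus (h lam b) (E lam b) ε (Y m (X b) lam) - wPlus (h lam b) (E lam b) ε (Y n (X b) lam) -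
        (wPlus (h lam (a n)) (E lam (a n)) ε (Y m (X (a n)) lam) - 1))
    rw [add_sub_cancel] at h8
    linarith [h1.2]
  have hBa : Tendsto (fun n => 6 * B (a n)) atTop (𝓝 0) := by
    simpa using (L0.lim_B.comp halim).const_mul 6
  have hdw := fun n => differentiableOn_wPlus (ε := ε) (hh b hb) (fun lam hl => (L lam hl).h_ne b hb)
    (hE b hb) (hYd n (X b) (hX b))
  obtain ⟨u, hud, hu⟩ := exists_limit_of_cauchy hV (fun n => (hdw n).1) hBa
    fun n m hnm lam hl => (hcau n m hnm lam hl).2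
  obtain ⟨v, hvd, hv⟩ := exists_limit_of_cauchy hV (fun n => (hdw n).2) hBa
    fun n m hnm lam hl => (hcau n m hnm lam hl).1
  obtain ⟨y, hy0, hys, hyd⟩ := exists_fundamental hΩ hΩ' hV hVb hP hM ε (hX b)
    (e := fun lam => (exp (E lam b / ε) * (u lam + v lam) / h lam b,
      -I * exp (E lam b / ε) * (u lam - v lam) * h lam b)) (by
      have h1 := hh _ hb
      have h2 : DifferentiableOn ℂ (fun lam => exp (E lam b / ε)) V :=
        ((hE _ hb).div_const _).cexp
      exact ((h2.mul (hud.add hvd)).div h1 fun lam hl => (L lam hl).h_ne _ hb).prodMk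
        (((h2.const_mul _).mul (hud.sub hvd)).mul h1))
  have hlim : ∀ lam ∈ V, ∀ x ∈ Ω, Tendsto (fun n => Y n x lam) atTop (𝓝 (y x lam)) := by
    intro lam hl x hx
    obtain ⟨F1, F2, -, -, -, -, hF⟩ := exists_solution_basis hΩ hΩ' hP hM ε lam (hX b)
    have h1 : Tendsto (fun n => Y n (X b) lam) atTop (𝓝 (y (X b) lam)) := by
      rw [hy0]
      have h2 : Tendsto (fun n => (exp (E lam b / ε) *
          (wPlus (h lam b) (E lam b) ε (Y n (X b) lam) +
            wMinus (h lam b) (E lam b) ε (Y n (X b) lam)) / h lam b,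
          -I * exp (E lam b / ε) *
          (wPlus (h lam b) (E lam b) ε (Y n (X b) lam) -
            wMinus (h lam b) (E lam b) ε (Y n (X b) lam)) * h lam b)) atTop
          (𝓝 (exp (E lam b / ε) * (u lam + v lam) / h lam b,
            -I * exp (E lam b / ε) * (u lam - v lam) * h lam b)) :=
        Tendsto.prodMk_nhds ((((hu lam hl).add (hv lam hl)).const_mul _).div_const _)
          ((((hu lam hl).sub (hv lam hl)).const_mul _).mul_const _)
      exact h2.congr fun n => (wkb_expand ((L lam hl).h_ne b hb) _).symm
    rw [hF _ (hys lam hl) x hx]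
    have h3 := (((continuous_fst.tendsto _).comp h1).smul_const (F1 x)).add
      (((continuous_snd.tendsto _).comp h1).smul_const (F2 x))
    exact h3.congr fun n => (hF _ (hYs n lam hl) x hx).symm
  have hest' : ∀ lam ∈ V, ∀ t < T, ‖wMinus (h lam t) (E lam t) ε (y (X t) lam)‖ ≤ 2 * B t ∧
      ‖wPlus (h lam t) (E lam t) ε (y (X t) lam) - 1‖ ≤ 2 * B t := by
    intro lam hl t ht
    have hev : ∀ᶠ n in atTop, a n ≤ t := halim.eventually (eventually_le_atBot t)
    have h1 := hlim lam hl _ (hX t)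
    exact ⟨le_of_tendsto (((continuous_wMinus _ _ _).tendsto _).comp h1).norm
        (hev.mono fun n hn => (hest n lam hl t hn ht).1),
      le_of_tendsto ((((continuous_wPlus _ _ _).tendsto _).comp h1).sub_const 1).norm
        (hev.mono fun n hn => (hest n lam hl t hn ht).2)⟩
  have h2B : Tendsto (fun t => 2 * B t) atBot (𝓝 0) := by simpa using L0.lim_B.const_mul 2
  refine ⟨fun lam x => y x lam, hys, hyd, fun lam hl => ⟨?_, ?_, fun hsmall t ht => ?_⟩⟩
  · rw [tendsto_iff_norm_sub_tendsto_zero]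
    exact squeeze_zero' (Eventually.of_forall fun _ => norm_nonneg _)
      ((eventually_lt_atBot T).mono fun t ht => (hest' lam hl t ht).2) h2B
  · rw [tendsto_zero_iff_norm_tendsto_zero]
    exact squeeze_zero' (Eventually.of_forall fun _ => norm_nonneg _)
      ((eventually_lt_atBot T).mono fun t ht => (hest' lam hl t ht).1) h2B
  · have hev : ∀ᶠ n in atTop, a n ≤ t := halim.eventually (eventually_le_atBot t)
    have h1 := hlim lam hl _ (hX t)
    have h2 := fun n (hn : a n ≤ t) => (L lam hl).estimate_eps hε hX (hYs n lam hl) hn ht hsmall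
      (hw0 n lam hl).1 (hw0 n lam hl).2
    exact ⟨le_of_tendsto (((continuous_wMinus _ _ _).tendsto _).comp h1).norm
        (hev.mono fun n hn => (h2 n hn).1),
      le_of_tendsto ((((continuous_wPlus _ _ _).tendsto _).comp h1).sub_const 1).norm
        (hev.mono fun n hn => (h2 n hn).2)⟩

/-- The data of one half of an admissible contour: `γ` comes in from infinity along the real axis
with direction `ς`, reaches the turning point `α` at `s = 0` and continues to the turning point
`β` at `s = 1` along a Stokes line. Along the incoming part, `r = √(g₊ g₋) = g₊ h²`. -/
structure HalfContour (P M : ℂ → ℂ) (Ω : Set ℂ) (μ : ℂ) (γ : ℝ → ℂ) (α β : ℂ → ℂ) (U : Set ℂ)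
    (r h rC : ℂ → ℝ → ℂ) (x0 ς : ℝ) : Prop where
  isOpen : IsOpen Ω
  simplyConnected : IsSimplyConnected Ω
  diff_P : DifferentiableOn ℂ P Ω
  diff_M : DifferentiableOn ℂ M Ω
  nhds : U ∈ 𝓝 μ
  im_ne : μ.im ≠ 0
  sign : ς = 1 ∨ ς = -1
  ray : ∀ᶠ s : ℝ in atBot, γ s = (x0 + ς * s : ℝ)
  real_mem : ∀ x : ℝ, (x : ℂ) ∈ Ω
  lim_P : Tendsto (fun s : ℝ => P (x0 + ς * s : ℝ)) atBot (𝓝 0)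
  lim_M : Tendsto (fun s : ℝ => M (x0 + ς * s : ℝ)) atBot (𝓝 0)
  int_P : Integrable (fun x : ℝ => deriv P x)
  int_M : Integrable (fun x : ℝ => deriv M x)
  bounded : ∃ K : ℝ, ∀ x : ℝ, ‖deriv P x‖ ≤ K ∧ ‖deriv M x‖ ≤ K
  mem : ∀ s, γ s ∈ Ω
  continuous : Continuous γ
  smooth_left : ContDiffOn ℝ 1 γ (Iic 0)
  smooth_mid : ContDiffOn ℝ 1 γ (Icc 0 1)
  regular_left : ∀ s ∈ Iic (0 : ℝ), derivWithin γ (Iic 0) s ≠ 0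
  regular_mid : ∀ s ∈ Icc (0 : ℝ) 1, derivWithin γ (Icc 0 1) s ≠ 0
  base_α : α μ = γ 0
  cont_α : ContinuousAt α μ
  turn_α : ∀ᶠ lam in 𝓝 μ, (P (α lam) - lam) * (lam - M (α lam)) = 0
  base_β : β μ = γ 1
  cont_β : ContinuousAt β μ
  simple : deriv (fun x => (P x - μ) * (μ - M x)) (γ 0) ≠ 0
  turn_β : ∀ᶠ lam in 𝓝 μ, (P (β lam) - lam) * (lam - M (β lam)) = 0
  simple_β : deriv (fun x => (P x - μ) * (μ - M x)) (γ 1) ≠ 0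
  ne_left : ∀ s < 0, (P (γ s) - μ) * (μ - M (γ s)) ≠ 0
  ne_mid : ∀ s ∈ Ioo (0 : ℝ) 1, (P (γ s) - μ) * (μ - M (γ s)) ≠ 0
  cont_r : ContinuousOn (fun p : ℂ × ℝ => r p.1 p.2) (U ×ˢ Iio 0)
  cont_h : ContinuousOn (fun p : ℂ × ℝ => h p.1 p.2) (U ×ˢ Iio 0)
  cont_rC : ContinuousOn (fun p : ℂ × ℝ => rC p.1 p.2) (U ×ˢ Ioo 0 1)
  sq_r : ∀ lam ∈ U, ∀ s < 0, r lam s ^ 2 =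
    (P (deformed γ α β lam s) - lam) * (lam - M (deformed γ α β lam s))
  sq_rC : ∀ lam ∈ U, ∀ s ∈ Ioo (0 : ℝ) 1, rC lam s ^ 2 =
    (P (deformed γ α β lam s) - lam) * (lam - M (deformed γ α β lam s))
  root : ∀ lam ∈ U, ∀ s < 0, (P (deformed γ α β lam s) - lam) * h lam s ^ 2 = r lam s
  pos : ∀ lam ∈ U, ∀ᶠ s in atBot, 0 < (r lam s * ς).re
  progressive : ∃ q : ℝ → ℂ, ContinuousOn q (Iio 0) ∧
    (∀ s < 0, q s ^ 2 = (P (γ s) - μ) * (μ - M (γ s))) ∧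
    ∀ s t, s < t → t < 0 → 0 < (∫ x in s..t, q x * deriv γ x).re
  stokes_re : ∀ s ∈ Ioo (0 : ℝ) 1, (rC μ s * deriv γ s).re = 0
  stokes_im : ∀ s ∈ Ioo (0 : ℝ) 1, (rC μ s * deriv γ s).im < 0
  sector : 2 * Real.pi / 3 <
    InnerProductGeometry.angle (-derivWithin γ (Iic 0) 0) (derivWithin γ (Icc 0 1) 0)

variable (C : HalfContour P M Ω μ γ α β U r h rC x0 ς)

theorem deformed_eq_of_le (γ : ℝ → ℂ) (α β : ℂ → ℂ) (lam : ℂ) (hs : s ≤ -1 / 2) : deformed γ α β lam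
    s = γ s := by
  rw [deformed, bump_eq_zero (by rw [abs_of_neg (by linarith)]; linarith),
    bump_eq_zero (by rw [abs_of_neg (by linarith)]; linarith)]
  simp

/-- Bounds that hold when `P` and `M` are small and `lam` is close to `μ`. -/
theorem tail_bounds (h0 : μ.im ≠ 0) : ∃ η > 0, ∀ p m lam : ℂ, ‖p‖ < η → ‖m‖ < η → ‖lam - μ‖ < η → (∀
    r : ℂ, r ^ 2 = (p - lam) * (lam - m) → |μ.im| / 2 ≤ |r.re|) ∧ ‖μ‖ / 2 < ‖p - lam‖ ∧ ‖p - lam‖ <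
    2 * ‖μ‖ ∧ ‖μ‖ / 2 < ‖lam - m‖ ∧ ‖lam - m‖ < 2 * ‖μ‖ := by
  have hl : 0 < ‖μ‖ := norm_pos_iff.2 fun h => h0 (by simp [h])
  have hd : 0 < μ.im ^ 2 := by positivity
  set f : ℂ × ℂ × ℂ → ℂ := fun v => (v.1 - v.2.2) * (v.2.2 - v.2.1) with hf
  have hfc : Continuous f := by fun_prop
  have hre : (‖f (0, 0, μ)‖ + (f (0, 0, μ)).re) / 2 = μ.im ^ 2 := by
    have : f (0, 0, μ) = -(μ * μ) := by simp [hf]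
    rw [this, norm_neg, norm_mul, ← sq, ← Complex.normSq_eq_norm_sq, Complex.normSq_apply]
    simp
    ring
  have ev : ∀ᶠ v : ℂ × ℂ × ℂ in 𝓝 (0, 0, μ), μ.im ^ 2 / 4 < (‖f v‖ + (f v).re) / 2 ∧
      ‖μ‖ / 2 < ‖v.1 - v.2.2‖ ∧ ‖v.1 - v.2.2‖ < 2 * ‖μ‖ ∧
      ‖μ‖ / 2 < ‖v.2.2 - v.2.1‖ ∧ ‖v.2.2 - v.2.1‖ < 2 * ‖μ‖ := by
    have c1 : Continuous fun v : ℂ × ℂ × ℂ => (‖f v‖ + (f v).re) / 2 :=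
      (hfc.norm.add (Complex.continuous_re.comp hfc)).div_const 2
    have c2 : Continuous fun v : ℂ × ℂ × ℂ => ‖v.1 - v.2.2‖ := by fun_prop
    have c3 : Continuous fun v : ℂ × ℂ × ℂ => ‖v.2.2 - v.2.1‖ := by fun_prop
    refine (c1.continuousAt.eventually_const_lt (by
      simp only [hre]; linarith)).and
      ((c2.continuousAt.eventually_const_lt ?_).and ((c2.continuousAt.eventually_lt_const ?_).and
      ((c3.continuousAt.eventually_const_lt ?_).and (c3.continuousAt.eventually_lt_const ?_))))
    all_goals simp only [zero_sub, sub_zero, norm_neg]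
    all_goals linarith
  obtain ⟨η, hη, H⟩ := Metric.eventually_nhds_iff.1 ev
  refine ⟨η, hη, fun p m lam hp hm hlam => ?_⟩
  obtain ⟨h1, h2, h3, h4, h5⟩ := H (y := (p, m, lam)) (by
    simp [dist_eq_norm, hp, hm, hlam])
  refine ⟨fun r hr => ?_, h2, h3, h4, h5⟩
  have h6 : (‖r ^ 2‖ + (r ^ 2).re) / 2 = r.re ^ 2 := by
    rw [norm_pow, ← Complex.normSq_eq_norm_sq, Complex.normSq_apply, sq, Complex.mul_re]; ring
  simp only [hf, ← hr] at h1
  rw [h6] at h1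
  have h7 : (|μ.im| / 2) ^ 2 ≤ |r.re| ^ 2 := by rw [sq_abs, div_pow, sq_abs]; linarith
  exact (pow_le_pow_iff_left₀ (by positivity) (abs_nonneg _) two_ne_zero).1 h7

theorem exists_primitive_atBot {κ : ℝ → ℝ} (hc : Continuous κ) (hi : Integrable κ) : ∃ B : ℝ → ℝ, (∀
    t, HasDerivAt B (κ t) t) ∧ Tendsto B atBot (𝓝 0) := by
  refine ⟨fun t => (∫ s in Iic 0, κ s) - ∫ s in t..0, κ s, fun t => ?_, ?_⟩
  · have h1 := (intervalIntegral.integral_hasDerivAt_left (hc.intervalIntegrable t 0)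
      (hc.stronglyMeasurableAtFilter _ _) hc.continuousAt)
    simpa using h1.const_sub (∫ s in Iic 0, κ s)
  · have := (intervalIntegral_tendsto_integral_Iic 0 hi.integrableOn tendsto_id).const_sub
      (∫ s in Iic 0, κ s)
    simpa using this

/-- The integral over a bounded interval of a holomorphic family of bounded continuous functions is
holomorphic. -/
theorem differentiableOn_intervalIntegral {V : Set ℂ} (hV : IsOpen V) {F : ℂ → ℝ → ℂ} {C T : ℝ}
    (hc : ∀ lam ∈ V, ContinuousOn (F lam) (Iio T)) (hb : ∀ lam ∈ V, ∀ t < T, ‖F lam t‖ ≤ C)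
    (hd : ∀ t < T, DifferentiableOn ℂ (fun lam => F lam t) V) (ha : a < T) (hb' : b < T) :
    DifferentiableOn ℂ (fun lam => ∫ t in a..b, F lam t) V := by
  have key : ∀ a b, a < T → b < T → DifferentiableOn ℂ (fun lam => ∫ t in Ioc a b, F lam t) V := by
    intro a b ha hb'
    have hae : ∀ᵐ t ∂(volume.restrict (Ioc a b)), t < T := by
      filter_upwards [ae_restrict_mem measurableSet_Ioc] with t ht using ht.2.trans_lt hb'
    refine differentiableOn_integral_param hV (b := fun _ => C) (fun lam hl => ?_) ?_ ?_ ?_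
    · exact ((hc lam hl).mono fun t ht => ht.2.trans_lt hb').aestronglyMeasurable measurableSet_Ioc
    · filter_upwards [hae] with t ht lam hl using hb lam hl t ht
    · exact integrableOn_const (by simp)
    · filter_upwards [hae] with t ht using hd t ht
  exact (key a b ha hb').sub (key b a hb' ha)

theorem le_of_four_pow {a b : ℂ} {L : ℝ} (h : a * x ^ 4 = b) (ha : L / 2 < ‖a‖) (hb : ‖b‖ < 2 * L)
    (hL : 0 < L) : ‖x‖ ≤ 2 := by
  by_contra! hx
  have h1 : (16 : ℝ) ≤ ‖x‖ ^ 4 := by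
    calc (16 : ℝ) = 2 ^ 4 := by norm_num
      _ ≤ _ := by gcongr
  have h2 : ‖a‖ * ‖x‖ ^ 4 = ‖b‖ := by rw [← h]; simp
  nlinarith

include C in
/-- Near infinity the branches of a half contour satisfy the bounds of `IsTail`, uniformly for
`lam` near `μ`. -/
theorem HalfContour.exists_tail : ∃ V : Set ℂ, IsOpen V ∧ μ ∈ V ∧ V ⊆ U ∧ Bornology.IsBounded V ∧ ∃
    T < (-1 : ℝ), (∀ t < T, γ t = (x0 + ς * t : ℝ)) ∧ ∃ (κ B : ℝ → ℝ) (c K Hb : ℝ), ∀ E : ℂ → ℝ → ℂ,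
    (∀ lam ∈ V, ∀ t < T, E lam t = ∫ s in (T - 1)..t, r lam s * ς) → (∀ lam ∈ V, IsTail P M lam T ς
    (fun t => (x0 + ς * t : ℝ)) (h lam) (E lam) κ B c K Hb) ∧ (∀ t < T, DifferentiableOn ℂ (fun lam
    => h lam t) V) ∧ (∀ t < T, DifferentiableOn ℂ (fun lam => E lam t) V) := by
  obtain ⟨η, hη, hbd⟩ := tail_bounds C.im_ne
  have hL : 0 < ‖μ‖ := norm_pos_iff.2 fun h => C.im_ne (by simp [h])
  obtain ⟨V₀, hV0U, hV0o, hV0m⟩ := mem_nhds_iff.1 C.nhds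
  set V := V₀ ∩ ball μ η with hVd
  have hVo : IsOpen V := hV0o.inter isOpen_ball
  have hVU : V ⊆ U := inter_subset_left.trans hV0U
  have hVη : ∀ lam ∈ V, ‖lam - μ‖ < η := fun lam hl => by
    rw [← dist_eq_norm]; exact hl.2
  set X : ℝ → ℂ := fun t => (x0 + ς * t : ℝ) with hX
  obtain ⟨K0, hK₀⟩ := C.bounded
  set κ : ℝ → ℝ := fun t => (‖deriv P (X t)‖ + ‖deriv M (X t)‖) / ‖μ‖ with hκ
  have hςne : ς ≠ 0 := by rcases C.sign with h | h <;> rw [h] <;> norm_num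
  have hςn : ‖(ς : ℂ)‖ = 1 := by rcases C.sign with h | h <;> rw [h] <;> simp
  have hXc : Continuous X := by fun_prop
  have hderivc : ∀ {f : ℂ → ℂ}, DifferentiableOn ℂ f Ω → Continuous fun t => deriv f (X t) :=
    fun hf => (hf.deriv C.isOpen).continuousOn.comp_continuous hXc fun t => C.real_mem _
  have hκc : Continuous κ :=
    ((hderivc C.diff_P).norm.add (hderivc C.diff_M).norm).div_const _
  have hXi : ∀ {f : ℂ → ℂ}, Integrable (fun x : ℝ => f x) → Integrable (fun t : ℝ => f (X t)) := by
    intro f hf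
    have := (hf.comp_add_left x0).comp_mul_left' hςne
    simpa [hX] using this
  have hκi : Integrable κ := ((hXi C.int_P).norm.add (hXi C.int_M).norm).div_const _
  obtain ⟨B, hB, hBlim⟩ := exists_primitive_atBot hκc hκi
  have ev : ∀ᶠ T : ℝ in atBot, T < -1 ∧ ∀ t ≤ T, γ t = X t ∧ ‖P (X t)‖ < η ∧ ‖M (X t)‖ < η ∧
      B t < 1 / 2 := by
    have h1 : ∀ᶠ t in atBot, γ t = X t ∧ ‖P (X t)‖ < η ∧ ‖M (X t)‖ < η ∧ B t < 1 / 2 := by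
      have hz : ‖(0 : ℂ)‖ < η := by rwa [norm_zero]
      filter_upwards [C.ray, C.lim_P.norm.eventually_lt_const hz,
        C.lim_M.norm.eventually_lt_const hz, hBlim.eventually_lt_const one_half_pos]
        with t h1 h2 h3 h4 using ⟨h1, h2, h3, h4⟩
    filter_upwards [eventually_lt_atBot (-1), eventually_forall_le_atBot.2 h1]
      with T h2 h3 using ⟨h2, h3⟩
  obtain ⟨T, hT1, hT⟩ := ev.exists
  have hdef : ∀ lam, ∀ t < T, deformed γ α β lam t = X t := fun lam t ht => by
    rw [deformed_eq_of_le _ _ _ _ (by linarith), (hT t ht.le).1]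
  have hneg : ∀ t < T, t < 0 := fun t ht => by linarith
  have hsq : ∀ lam ∈ V, ∀ t < T, r lam t ^ 2 = (P (X t) - lam) * (lam - M (X t)) :=
    fun lam hl t ht => by
      have := C.sq_r lam (hVU hl) t (hneg t ht); rwa [hdef lam t ht] at this
  have hroot : ∀ lam ∈ V, ∀ t < T, (P (X t) - lam) * h lam t ^ 2 = r lam t :=
    fun lam hl t ht => by
      have := C.root lam (hVU hl) t (hneg t ht); rwa [hdef lam t ht] at this
  have hb := fun lam (hl : lam ∈ V) t (ht : t < T) =>
    hbd (P (X t)) (M (X t)) lam (hT t ht.le).2.1 (hT t ht.le).2.2.1 (hVη lam hl)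
  have hPne : ∀ lam ∈ V, ∀ t < T, P (X t) - lam ≠ 0 := fun lam hl t ht =>
    norm_pos_iff.1 (by linarith [(hb lam hl t ht).2.1])
  have hMne : ∀ lam ∈ V, ∀ t < T, lam - M (X t) ≠ 0 := fun lam hl t ht =>
    norm_pos_iff.1 (by linarith [(hb lam hl t ht).2.2.2.1])
  have hroot4 : ∀ lam ∈ V, ∀ t < T, (P (X t) - lam) * h lam t ^ 4 = lam - M (X t) := by
    intro lam hl t ht
    have h1 := hsq lam hl t ht
    rw [← hroot lam hl t ht] at h1
    exact mul_left_cancel₀ (hPne lam hl t ht) (by linear_combination h1)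
  have hhne : ∀ lam ∈ V, ∀ t < T, h lam t ≠ 0 := fun lam hl t ht h0 => by
    have := hroot4 lam hl t ht
    rw [h0] at this
    exact hMne lam hl t ht (by simpa using this.symm)
  have hcont : ∀ {f : ℂ → ℝ → ℂ}, ContinuousOn (fun p : ℂ × ℝ => f p.1 p.2) (U ×ˢ Iio 0) →
      ∀ lam ∈ V, ∀ t < T, ContinuousAt (fun p : ℂ × ℝ => f p.1 p.2) (lam, t) := by
    intro f hf lam hl t ht
    exact (hf.mono (prod_mono hVU le_rfl)).continuousAt
      ((hVo.prod isOpen_Iio).mem_nhds ⟨hl, hneg t ht⟩)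
  have hcontt : ∀ {f : ℂ → ℝ → ℂ}, ContinuousOn (fun p : ℂ × ℝ => f p.1 p.2) (U ×ˢ Iio 0) →
      ∀ lam ∈ V, ∀ t < T, ContinuousAt (f lam) t := by
    intro f hf lam hl t ht
    exact (hcont hf lam hl t ht).comp₂ continuousAt_const continuousAt_id
  have hcontl : ∀ {f : ℂ → ℝ → ℂ}, ContinuousOn (fun p : ℂ × ℝ => f p.1 p.2) (U ×ˢ Iio 0) →
      ∀ lam ∈ V, ∀ t < T, ContinuousAt (fun lam => f lam t) lam := by
    intro f hf lam hl t ht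
    exact (hcont hf lam hl t ht).comp₂ continuousAt_id continuousAt_const
  have hhd : ∀ t < T, DifferentiableOn ℂ (fun lam => h lam t) V := by
    intro t ht lam hl
    have hG : HasDerivAt (fun lam => (lam - M (X t)) / (P (X t) - lam)) _ lam :=
      ((hasDerivAt_id lam).sub_const (M (X t))).div ((hasDerivAt_id lam).const_sub (P (X t)))
        (hPne lam hl t ht)
    refine (hasDerivAt_of_pow_eq (n := 4) (by norm_num) (hcontl C.cont_h lam hl t ht) ?_ hG
      (hhne lam hl t ht)).differentiableAt.differentiableWithinAt
    filter_upwards [hVo.mem_nhds hl] with mu hm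
    rw [eq_div_iff (hPne mu hm t ht), mul_comm, hroot4 mu hm t ht]
  have hrd : ∀ t < T, DifferentiableOn ℂ (fun lam => r lam t) V := by
    intro t ht
    have h1 : DifferentiableOn ℂ (fun lam => (P (X t) - lam) * h lam t ^ 2) V :=
      ((differentiableOn_const _).sub differentiableOn_id).mul ((hhd t ht).pow 2)
    exact h1.congr fun lam hl => (hroot lam hl t ht).symm
  have hrb : ∀ lam ∈ V, ∀ t < T, ‖r lam t‖ ≤ 2 * ‖μ‖ := by
    intro lam hl t ht
    have h1 : ‖r lam t‖ ^ 2 = ‖P (X t) - lam‖ * ‖lam - M (X t)‖ := by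
      rw [← norm_pow, hsq lam hl t ht, norm_mul]
    obtain ⟨-, -, h2, -, h3⟩ := hb lam hl t ht
    refine (pow_le_pow_iff_left₀ (norm_nonneg _) (by positivity) two_ne_zero).1 ?_
    rw [h1, sq]
    gcongr
  have hposr : ∀ lam ∈ V, ∀ t < T, |μ.im| / 2 ≤ (r lam t * ς).re := by
    intro lam hl
    have habs : ∀ t < T, |μ.im| / 2 ≤ |(r lam t * ς).re| := fun t ht => by
      have h1 := (hb lam hl t ht).1 _ (hsq lam hl t ht)
      rcases C.sign with h | h <;> rw [h] <;> simpa using h1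
    have hd : 0 < |μ.im| / 2 := by have := abs_pos.2 C.im_ne; linarith
    have hpos : ∀ t < T, 0 < (r lam t * ς).re := by
      intro t ht
      by_contra! hneg'
      obtain ⟨s, hs, hsT⟩ := ((C.pos lam (hVU hl)).and (eventually_lt_atBot T)).exists
      have hc : ContinuousOn (fun t => (r lam t * ς).re) (Iio T) := fun u hu =>
        (Complex.continuous_re.continuousAt.comp
          ((hcontt C.cont_r lam hl u hu).mul_const (ς : ℂ))).continuousWithinAt
      obtain ⟨u, hu, hu0⟩ := isPreconnected_Iio.intermediate_value (mem_Iio.2 ht) (mem_Iio.2 hsT) hc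
        ⟨hneg', hs.le⟩
      have := habs u hu
      simp only at hu0
      rw [hu0, abs_zero] at this
      linarith
    intro t ht
    rw [← abs_of_pos (hpos t ht)]
    exact habs t ht
  have hderE : ∀ lam ∈ V, ∀ t < T,
      HasDerivAt (fun t => ∫ s in (T - 1)..t, r lam s * ς) (r lam t * ς) t := by
    intro lam hl t ht
    have hc : ContinuousOn (fun s => r lam s * (ς : ℂ)) (Iio T) := fun u hu =>
      ((hcontt C.cont_r lam hl u hu).mul_const (ς : ℂ)).continuousWithinAt
    refine intervalIntegral.integral_hasDerivAt_right ?_ ?_ ?_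
    · refine (hc.mono fun u hu => ?_).intervalIntegrable
      exact lt_of_le_of_lt hu.2 (max_lt (sub_one_lt T) ht)
    · exact hc.stronglyMeasurableAtFilter isOpen_Iio t ht
    · exact hc.continuousAt (Iio_mem_nhds ht)
  refine ⟨V, hVo, ⟨hV0m, mem_ball_self hη⟩, hVU, Metric.isBounded_ball.subset
    inter_subset_right, T, hT1, fun t ht => (hT t ht.le).1, κ, B, |μ.im| / 2,
    (K0 + K0) / ‖μ‖, 2, fun E hE => ⟨fun lam hl => ?_, hhd, fun t ht => ?_⟩⟩
  · exact
    { c_pos := by have := abs_pos.2 C.im_ne; linarith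
      deriv_X := fun t _ => by
        have h1 : HasDerivAt (fun t : ℝ => x0 + ς * t) ς t := by
          simpa using ((hasDerivAt_id t).const_mul ς).const_add x0
        exact h1.ofReal_comp
      diff_P := fun t _ => C.diff_P.differentiableAt (C.isOpen.mem_nhds (C.real_mem _))
      diff_M := fun t _ => C.diff_M.differentiableAt (C.isOpen.mem_nhds (C.real_mem _))
      cont_h := hcontt C.cont_h lam hl
      h_ne := hhne lam hl
      P_ne := hPne lam hl
      root := hroot4 lam hl
      deriv_E := fun t ht => by
        rw [hroot lam hl t ht]
        refine (hderE lam hl t ht).congr_of_eventuallyEq ?_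
        filter_upwards [Iio_mem_nhds ht] with s hs using hE lam hl s hs
      re_E := fun t ht => by rw [hroot lam hl t ht]; exact hposr lam hl t ht
      bound := fun t ht => by
        obtain ⟨-, h1, -, h2, -⟩ := hb lam hl t ht
        rw [norm_mul, hςn, mul_one, logDerivRoot, norm_div]
        have h3 : ‖(4 : ℂ)‖ = 4 := by simp
        rw [h3]
        have h4 : ‖-deriv M (X t) / (lam - M (X t))‖ ≤ ‖deriv M (X t)‖ / (‖μ‖ / 2) := by
          rw [norm_div, norm_neg]; gcongr
        have h5 : ‖deriv P (X t) / (P (X t) - lam)‖ ≤ ‖deriv P (X t)‖ / (‖μ‖ / 2) := by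
          rw [norm_div]; gcongr
        have h6 := norm_sub_le (-deriv M (X t) / (lam - M (X t)))
          (deriv P (X t) / (P (X t) - lam))
        have h7 : ‖deriv M (X t)‖ / (‖μ‖ / 2) + ‖deriv P (X t)‖ / (‖μ‖ / 2) = 2 * κ t := by
          simp only [hκ]; field_simp; ring
        have h8 : 0 ≤ κ t := by simp only [hκ]; positivity
        linarith
      bound' := fun t _ => by
        simp only [hκ]
        have := hK₀ (x0 + ς * t)
        gcongr
        exacts [this.1, this.2]
      deriv_B := fun t _ => hB t
      lim_B := hBlim
      B_le := fun t ht => (hT t ht.le).2.2.2.le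
      h_le := fun t ht => by
        obtain ⟨-, h1, h2, h3, h4⟩ := hb lam hl t ht
        refine ⟨le_of_four_pow (hroot4 lam hl t ht) h1 h4 hL,
          le_of_four_pow (a := lam - M (X t)) (b := P (X t) - lam) ?_ h3 h2 hL⟩
        rw [← hroot4 lam hl t ht, inv_pow, mul_assoc,
          mul_inv_cancel₀ (pow_ne_zero _ (hhne lam hl t ht)), mul_one] }
  · refine (differentiableOn_intervalIntegral hVo (F := fun lam s => r lam s * ς)
      (C := 2 * ‖μ‖) (T := T) (fun lam hl u hu =>
        ((hcontt C.cont_r lam hl u hu).mul_const (ς : ℂ)).continuousWithinAt) (fun lam hl u hu => ?_)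
      (fun u hu => (hrd u hu).mul_const _) (sub_one_lt T) ht).congr fun lam hl => hE lam hl t ht
    rw [norm_mul, hςn, mul_one]
    exact hrb lam hl u hu

/-! Turning points depending on the spectral parameter -/

theorem turning_cases (hP : DifferentiableAt ℂ P a₀) (hM : DifferentiableAt ℂ M a₀)
    (h0 : (P a₀ - μ) * (μ - M a₀) = 0) (h1 : deriv (fun x => (P x - μ) * (μ - M x)) a₀ ≠ 0) : ∃ (e :
    ℤ) (Λ Λ2 : ℂ → ℂ), ((e = -1 ∧ Λ = P ∧ Λ2 = M) ∨ (e = 1 ∧ Λ = M ∧ Λ2 = P)) ∧ Λ a₀ = μ ∧ deriv Λ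
    a₀ ≠ 0 ∧ Λ2 a₀ ≠ μ := by
  have hd : deriv (fun x => (P x - μ) * (μ - M x)) a₀ =
      deriv P a₀ * (μ - M a₀) + (P a₀ - μ) * -deriv M a₀ :=
    ((hP.hasDerivAt.sub_const μ).mul (hM.hasDerivAt.const_sub μ)).deriv
  rw [hd] at h1
  rcases mul_eq_zero.1 h0 with h | h
  · refine ⟨-1, P, M, Or.inl ⟨rfl, rfl, rfl⟩, sub_eq_zero.1 h, fun h2 => h1 ?_, fun h2 => h1 ?_⟩
    · rw [h, h2]; ring
    · rw [h, h2]; ring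
  · refine ⟨1, M, P, Or.inr ⟨rfl, rfl, rfl⟩, (sub_eq_zero.1 h).symm, fun h2 => h1 ?_,
      fun h2 => h1 ?_⟩
    · rw [h, h2]; ring
    · rw [h, h2]; ring

include hΩ hP hM in
theorem turning_family (ha : a₀ ∈ Ω) {Λ Λ2 : ℂ → ℂ} (hcase : (e = -1 ∧ Λ = P ∧ Λ2 = M) ∨ (e = 1 ∧ Λ
    = M ∧ Λ2 = P)) (h1 : Λ a₀ = μ) (h2 : deriv Λ a₀ ≠ 0) (h3 : Λ2 a₀ ≠ μ) (hα0 : α μ = a₀)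
    (hαc : ContinuousAt α μ) (hα : ∀ᶠ lam in 𝓝 μ, (P (α lam) - lam) * (lam - M (α lam)) = 0) : (∀ᶠ
    lam in 𝓝 μ, Λ (α lam) = lam) ∧ ∀ᶠ lam in 𝓝 μ, ContinuousAt α lam := by
  have hΛ : DifferentiableOn ℂ Λ Ω := by rcases hcase with h | h <;> rw [h.2.1] <;> assumption
  have hΛ2 : DifferentiableOn ℂ Λ2 Ω := by rcases hcase with h | h <;> rw [h.2.2] <;> assumption
  have hc2 : ∀ᶠ lam in 𝓝 μ, Λ2 (α lam) - lam ≠ 0 := by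
    have hc : ContinuousAt (fun lam => Λ2 (α lam) - lam) μ := by
      refine ContinuousAt.sub (ContinuousAt.comp (g := Λ2) ?_ hαc) continuousAt_id
      rw [hα0]; exact hΛ2.continuousOn.continuousAt (hΩ.mem_nhds ha)
    exact hc.eventually_ne (by rw [hα0]; exact sub_ne_zero.2 h3)
  have hΛα : ∀ᶠ lam in 𝓝 μ, Λ (α lam) = lam := by
    filter_upwards [hα, hc2] with lam h4 h5
    rcases hcase with ⟨-, rfl, rfl⟩ | ⟨-, rfl, rfl⟩
    · refine sub_eq_zero.1 ((mul_eq_zero.1 h4).resolve_right fun h6 => h5 ?_)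
      linear_combination -h6
    · exact (sub_eq_zero.1 ((mul_eq_zero.1 h4).resolve_left h5)).symm
  refine ⟨hΛα, ?_⟩
  have hs : HasStrictDerivAt Λ (deriv Λ a₀) a₀ :=
    (hΛ.analyticAt (hΩ.mem_nhds ha)).hasStrictDerivAt
  have hinv : ∀ᶠ lam in 𝓝 μ, α lam = hs.localInverse _ _ _ h2 lam := by
    have h4 : ∀ᶠ x in 𝓝 (α μ), hs.localInverse _ _ _ h2 (Λ x) = x := by
      rw [hα0]; exact hs.eventually_left_inverse h2
    filter_upwards [hαc.eventually h4, hΛα] with lam h5 h6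
    rw [h6] at h5; exact h5.symm
  have hcont : ∀ᶠ lam in 𝓝 μ, ContinuousAt (hs.localInverse _ _ _ h2) lam := by
    set ψ := HasStrictFDerivAt.toOpenPartialHomeomorph Λ (hs.hasStrictFDerivAt_equiv h2)
    have h5 : μ ∈ ψ.target := by
      rw [← h1]
      exact HasStrictFDerivAt.image_mem_toOpenPartialHomeomorph_target
        (hs.hasStrictFDerivAt_equiv h2)
    filter_upwards [ψ.open_target.mem_nhds h5] with lam hl
    exact ψ.continuousAt_symm hl
  filter_upwards [hinv.eventually_nhds, hcont] with lam h5 h6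
  exact h6.congr (h5.mono fun _ h => h.symm)

/-! The deformed contours -/

theorem hasDerivAt_max_zero_sq (x : ℝ) : HasDerivAt (fun x : ℝ => max 0 x ^ 2) (2 * max 0 x) x := by
  rcases lt_trichotomy x 0 with h | rfl | h
  · refine (hasDerivAt_const x (0 : ℝ)).congr_of_eventuallyEq ?_ |>.congr_deriv ?_
    · filter_upwards [Iio_mem_nhds h] with y hy
      rw [max_eq_left (le_of_lt hy)]; norm_num
    · rw [max_eq_left h.le]; norm_num
  · rw [hasDerivAt_iff_isLittleO_nhds_zero]
    simp only [zero_add, max_self, mul_zero, smul_zero, sub_zero]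
    have h1 : (fun h : ℝ => max 0 h ^ 2) =O[𝓝 0] fun h => h ^ 2 :=
      Asymptotics.IsBigO.of_bound 1 (Eventually.of_forall fun h => by
        rw [one_mul, norm_pow, norm_pow]
        gcongr
        rw [Real.norm_eq_abs, Real.norm_eq_abs, abs_of_nonneg (le_max_left _ _)]
        exact max_le (abs_nonneg _) (le_abs_self _))
    refine (h1.trans_isLittleO ?_).congr_left fun h => by norm_num
    exact (Asymptotics.isLittleO_pow_id one_lt_two)
  · refine ((hasDerivAt_id x).pow 2).congr_of_eventuallyEq ?_ |>.congr_deriv ?_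
    · filter_upwards [Ioi_mem_nhds h] with y hy
      rw [max_eq_right (le_of_lt hy)]; rfl
    · rw [max_eq_right h.le]; simp

/-- The derivative of `bump`. -/
def bumpDeriv (s : ℝ) : ℝ := 2 * max 0 (1 - 4 * s ^ 2) * (-(8 * s))

theorem hasDerivAt_bump (s : ℝ) : HasDerivAt bump (bumpDeriv s) s := by
  have h1 : HasDerivAt (fun s : ℝ => 1 - 4 * s ^ 2) (-(8 * s)) s :=
    (((hasDerivAt_pow 2 s).const_mul 4).const_sub 1).congr_deriv (by norm_num; ring)
  exact (hasDerivAt_max_zero_sq (1 - 4 * s ^ 2)).comp s h1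

theorem continuous_bumpDeriv : Continuous bumpDeriv := by unfold bumpDeriv; fun_prop

section

variable {K : Set ℝ}

/-- The derivative of the deformed contour over the parameter set `K`. -/
noncomputable def deformedDeriv (γ : ℝ → ℂ) (α β : ℂ → ℂ) (K : Set ℝ) (lam : ℂ) (s : ℝ) : ℂ :=
  derivWithin γ K s + bumpDeriv s * (α lam - γ 0) + bumpDeriv (s - 1) * (β lam - γ 1)

theorem hasDerivAt_deformed (hγ : ContDiffOn ℝ 1 γ K) (lam : ℂ) (hs : K ∈ 𝓝 s) : HasDerivAt
    (deformed γ α β lam) (deformedDeriv γ α β K lam s) s := by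
  have h1 : HasDerivAt γ (derivWithin γ K s) s :=
    ((hγ.differentiableOn one_ne_zero s (mem_of_mem_nhds hs)).hasDerivWithinAt).hasDerivAt hs
  have h2 : HasDerivAt (fun s : ℝ => bump (s - 1)) (bumpDeriv (s - 1)) s := by
    exact (hasDerivAt_bump (s - 1)).comp_sub_const s 1
  exact (h1.add ((hasDerivAt_bump s).ofReal_comp.mul_const _)).add
    (h2.ofReal_comp.mul_const _)

theorem continuousOn_deformedDeriv (hγ : ContDiffOn ℝ 1 γ K) (hK : UniqueDiffOn ℝ K) (lam : ℂ) :
    ContinuousOn (deformedDeriv γ α β K lam) K := by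
  have h1 := hγ.continuousOn_derivWithin hK le_rfl
  have h2 : Continuous fun s => (bumpDeriv s : ℂ) * (α lam - γ 0) +
      (bumpDeriv (s - 1) : ℂ) * (β lam - γ 1) := by
    have := continuous_bumpDeriv
    fun_prop
  refine (h1.add h2.continuousOn).congr fun s _ => ?_
  simp only [deformedDeriv, Pi.add_apply]; ring

theorem continuous_deformed (hγ : Continuous γ) (lam : ℂ) : Continuous (deformed γ α β lam) := by
  have := continuous_bump
  unfold deformed
  fun_prop

theorem continuousAt_deformed (hγ : Continuous γ) (hα : ContinuousAt α lam)
    (hβ : ContinuousAt β lam) (s : ℝ) : ContinuousAt (fun v : ℂ × ℝ => deformed γ α β v.1 v.2) (lam,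
    s) := by
  have hb := continuous_bump
  have h1 : ContinuousAt (fun v : ℂ × ℝ => α v.1) (lam, s) :=
    ContinuousAt.comp (x := (lam, s)) (f := Prod.fst) (g := α) hα continuousAt_fst
  have h2 : ContinuousAt (fun v : ℂ × ℝ => β v.1) (lam, s) :=
    ContinuousAt.comp (x := (lam, s)) (f := Prod.fst) (g := β) hβ continuousAt_fst
  have h3 : Continuous fun v : ℂ × ℝ => γ v.2 := by fun_prop
  have h4 : Continuous fun v : ℂ × ℝ => (bump v.2 : ℂ) := by fun_prop
  have h5 : Continuous fun v : ℂ × ℝ => (bump (v.2 - 1) : ℂ) := by fun_prop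
  exact (h3.continuousAt.add (h4.continuousAt.mul (h1.sub continuousAt_const))).add
    (h5.continuousAt.mul (h2.sub continuousAt_const))

theorem deformed_base (hα : α μ = γ 0) (hβ : β μ = γ 1) : deformed γ α β μ = γ := by
  funext s; simp [deformed, hα, hβ]

theorem deformed_zero (γ : ℝ → ℂ) (α β : ℂ → ℂ) (lam : ℂ) : deformed γ α β lam 0 = α lam := by
  rw [deformed, bump_zero, bump_eq_zero (by norm_num)]; simp

theorem deformed_one (γ : ℝ → ℂ) (α β : ℂ → ℂ) (lam : ℂ) : deformed γ α β lam 1 = β lam := by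
  rw [deformed, sub_self, bump_zero, bump_eq_zero (by norm_num)]; simp

end

/-! Integrals over open intervals -/

theorem intervalIntegrable_of_bounded_ends {f : ℝ → ℂ} (hab : a < b) (hc : ContinuousOn f (Ioo a b))
    {K1 K2 : ℝ} (ha : ∀ᶠ s in 𝓝[>] a, ‖f s‖ ≤ K1) (hb : ∀ᶠ s in 𝓝[<] b, ‖f s‖ ≤ K2) :
    IntervalIntegrable f volume a b := by
  obtain ⟨a', ha', ha''⟩ := (mem_nhdsGT_iff_exists_Ioo_subset' hab).1 ha
  obtain ⟨b', hb', hb''⟩ := (mem_nhdsLT_iff_exists_Ioo_subset' hab).1 hb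
  have hsub : Icc ((a + min a' b) / 2) ((b + max b' a) / 2) ⊆ Ioo a b := by
    intro s hs
    have h1 : a < min a' b := lt_min ha' hab
    have h2 : max b' a < b := max_lt hb' hab
    exact ⟨by linarith [hs.1], by linarith [hs.2]⟩
  obtain ⟨K3, hK3⟩ := isCompact_Icc.exists_bound_of_continuousOn (hc.mono hsub)
  rw [intervalIntegrable_iff_integrableOn_Ioo_of_le hab.le]
  have : IsFiniteMeasure (volume.restrict (Ioo a b)) := ⟨by simp⟩
  refine Integrable.of_bound (hc.aestronglyMeasurable measurableSet_Ioo) (max K1 (max K2 K3)) ?_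
  filter_upwards [ae_restrict_mem measurableSet_Ioo] with s hs
  by_cases h1 : s < a'
  · exact (ha'' ⟨hs.1, h1⟩).trans (le_max_left _ _)
  by_cases h2 : b' < s
  · exact (hb'' ⟨h2, hs.2⟩).trans ((le_max_left _ _).trans (le_max_right _ _))
  push Not at h1 h2
  refine (hK3 s ⟨?_, ?_⟩).trans ((le_max_right _ _).trans (le_max_right _ _))
  · have := min_le_left a' b
    linarith [hs.1]
  · have := le_max_left b' a
    linarith [hs.2]

/-- The integral of `r` along the deformed contour, based at `α`. -/
noncomputable def armPhase (γ : ℝ → ℂ) (α β : ℂ → ℂ) (r : ℂ → ℝ → ℂ) (lam : ℂ) (s : ℝ) : ℂ :=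
  ∫ t in (0 : ℝ)..s, r lam t * deriv (deformed γ α β lam) t

include hΩ hP hM in
theorem exists_bound_of_sq (hp : p ∈ Ω) {l : Filter ℝ} {q D G : ℝ → ℂ} {d : ℂ}
    (hD : Tendsto D l (𝓝 p)) (hq : ∀ᶠ s in l, q s ^ 2 = (P (D s) - lam) * (lam - M (D s)))
    (hG : Tendsto G l (𝓝 d)) : ∃ K, ∀ᶠ s in l, ‖q s * G s‖ ≤ K := by
  have h1 : Tendsto (fun s => (P (D s) - lam) * (lam - M (D s))) l
      (𝓝 ((P p - lam) * (lam - M p))) :=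
    (((hP.continuousOn.continuousAt (hΩ.mem_nhds hp)).tendsto.comp hD).sub_const lam).mul
      (((hM.continuousOn.continuousAt (hΩ.mem_nhds hp)).tendsto.comp hD).const_sub lam)
  set N := ‖(P p - lam) * (lam - M p)‖ + 1
  refine ⟨(N + 1) * (‖d‖ + 1), ?_⟩
  filter_upwards [h1.norm.eventually_lt_const (lt_add_one _), hq,
    hG.norm.eventually_lt_const (lt_add_one _)] with s h2 h3 h4
  rw [← h3, norm_pow] at h2
  have hN : 1 ≤ N := le_add_of_nonneg_left (norm_nonneg _)
  have h5 : ‖q s‖ ≤ N + 1 := by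
    by_contra! h6
    have h7 : (N + 1) * 1 ≤ ‖q s‖ * ‖q s‖ := by
      gcongr
      linarith
    rw [← sq] at h7
    have : ‖q s‖ ^ 2 < N := h2
    linarith
  rw [norm_mul]
  gcongr

theorem HalfContour.cont_left {f : ℂ → ℝ → ℂ} (hf : ContinuousOn (fun p : ℂ × ℝ => f p.1 p.2) (U ×ˢ Iio 0))
    (hl : U ∈ 𝓝 lam) (hs : s < 0) : ContinuousAt (fun p : ℂ × ℝ => f p.1 p.2) (lam, s) ∧
    ContinuousAt (f lam) s ∧ ContinuousAt (fun lam => f lam s) lam := by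
  have h1 := hf.continuousAt (prod_mem_nhds hl (Iio_mem_nhds hs))
  exact ⟨h1, h1.comp₂ continuousAt_const continuousAt_id,
    h1.comp₂ continuousAt_id continuousAt_const⟩

theorem HalfContour.cont_mid {f : ℂ → ℝ → ℂ} (hf : ContinuousOn (fun p : ℂ × ℝ => f p.1 p.2) (U ×ˢ Ioo 0 1))
    (hl : U ∈ 𝓝 lam) (hs : s ∈ Ioo (0 : ℝ) 1) : ContinuousAt (fun p : ℂ × ℝ => f p.1 p.2) (lam, s) ∧
    ContinuousAt (f lam) s ∧ ContinuousAt (fun lam => f lam s) lam := by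
  have h1 := hf.continuousAt (prod_mem_nhds hl (Ioo_mem_nhds hs.1 hs.2))
  exact ⟨h1, h1.comp₂ continuousAt_const continuousAt_id,
    h1.comp₂ continuousAt_id continuousAt_const⟩

namespace HalfContour

include C

theorem turning_left : (P (γ 0) - μ) * (μ - M (γ 0)) = 0 := by
  have := C.turn_α.self_of_nhds; rwa [C.base_α] at this

theorem turning_right : (P (γ 1) - μ) * (μ - M (γ 1)) = 0 := by
  have := C.turn_β.self_of_nhds; rwa [C.base_β] at this

theorem regular_near : ∀ᶠ lam in 𝓝 μ, ContinuousAt α lam ∧ ContinuousAt β lam ∧ α lam ∈ Ω ∧ β lam ∈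
    Ω ∧ U ∈ 𝓝 lam := by
  have hd : ∀ {f : ℂ → ℂ}, DifferentiableOn ℂ f Ω → ∀ s, DifferentiableAt ℂ f (γ s) :=
    fun hf s => hf.differentiableAt (C.isOpen.mem_nhds (C.mem s))
  obtain ⟨e, Λ, Λ2, h1, h2, h3, h4⟩ := turning_cases (hd C.diff_P 0) (hd C.diff_M 0)
    C.turning_left C.simple
  obtain ⟨e', Λ', Λ2', h1', h2', h3', h4'⟩ := turning_cases (hd C.diff_P 1) (hd C.diff_M 1)
    C.turning_right C.simple_β
  filter_upwards [(turning_family C.isOpen C.diff_P C.diff_M (C.mem 0) h1 h2 h3 h4 C.base_α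
    C.cont_α C.turn_α).2, (turning_family C.isOpen C.diff_P C.diff_M (C.mem 1) h1' h2' h3' h4'
    C.base_β C.cont_β C.turn_β).2,
    C.cont_α.eventually (C.isOpen.mem_nhds (by rw [C.base_α]; exact C.mem 0)),
    C.cont_β.eventually (C.isOpen.mem_nhds (by rw [C.base_β]; exact C.mem 1)),
    eventually_mem_nhds_iff.2 C.nhds] with lam a1 a2 a3 a4 a5 using ⟨a1, a2, a3, a4, a5⟩

theorem deriv_left (lam : ℂ) (hs : s < 0) : HasDerivAt (deformed γ α β lam) (deformedDeriv γ α β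
    (Iic 0) lam s) s :=
  hasDerivAt_deformed C.smooth_left lam (Iic_mem_nhds hs)

theorem deriv_mid (lam : ℂ) (hs : s ∈ Ioo (0 : ℝ) 1) : HasDerivAt (deformed γ α β lam)
    (deformedDeriv γ α β (Icc 0 1) lam s) s :=
  hasDerivAt_deformed C.smooth_mid lam (Icc_mem_nhds hs.1 hs.2)

theorem cont_integrand_left (hl : U ∈ 𝓝 lam) : ContinuousOn (fun t => r lam t * deriv (deformed γ α
    β lam) t) (Iio 0) := by
  have h1 : ContinuousOn (fun t => r lam t * deformedDeriv γ α β (Iic 0) lam t) (Iio 0) :=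
    fun s hs => (cont_left C.cont_r hl hs).2.1.continuousWithinAt.mul
      ((continuousOn_deformedDeriv C.smooth_left (uniqueDiffOn_Iic 0) lam).mono
        Iio_subset_Iic_self s hs)
  exact h1.congr fun s hs => by simp only [(C.deriv_left lam hs).deriv]

theorem cont_integrand_mid (hl : U ∈ 𝓝 lam) : ContinuousOn (fun t => rC lam t * deriv (deformed γ α
    β lam) t) (Ioo 0 1) := by
  have h1 : ContinuousOn (fun t => rC lam t * deformedDeriv γ α β (Icc 0 1) lam t) (Ioo 0 1) :=
    fun s hs => (cont_mid C.cont_rC hl hs).2.1.continuousWithinAt.mul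
      ((continuousOn_deformedDeriv C.smooth_mid (uniqueDiffOn_Icc one_pos) lam).mono
        Ioo_subset_Icc_self s hs)
  exact h1.congr fun s hs => by simp only [(C.deriv_mid lam hs).deriv]

theorem integrable_left (hl : U ∈ 𝓝 lam) (hα : α lam ∈ Ω) (ha : a < 0) : IntervalIntegrable (fun t
    => r lam t * deriv (deformed γ α β lam) t) volume a 0 := by
  have hc := C.cont_integrand_left hl
  obtain ⟨K, hK⟩ := exists_bound_of_sq C.isOpen C.diff_P C.diff_M hα (l := 𝓝[<] 0)
    (lam := lam) (q := r lam) (D := deformed γ α β lam) (G := deriv (deformed γ α β lam))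
    (d := deformedDeriv γ α β (Iic 0) lam 0)
    (by rw [← deformed_zero γ α β lam]
        exact (continuous_deformed C.continuous lam).continuousAt.continuousWithinAt)
    (by filter_upwards [self_mem_nhdsWithin] with s hs using C.sq_r lam (mem_of_mem_nhds hl) s hs)
    (by refine ((((continuousOn_deformedDeriv C.smooth_left (uniqueDiffOn_Iic 0) lam) 0
          self_mem_Iic).mono Iio_subset_Iic_self).tendsto).congr' ?_
        filter_upwards [self_mem_nhdsWithin] with s hs using ((C.deriv_left lam hs).deriv).symm)
  exact intervalIntegrable_of_bounded_ends ha (hc.mono Ioo_subset_Iio_self)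
    (((hc.continuousAt (Iio_mem_nhds ha)).norm.eventually_lt_const
      (lt_add_one _)).filter_mono nhdsWithin_le_nhds |>.mono fun _ h => h.le) hK

theorem integrable_mid (hl : U ∈ 𝓝 lam) (hα : α lam ∈ Ω) (hβ : β lam ∈ Ω) : IntervalIntegrable (fun
    t => rC lam t * deriv (deformed γ α β lam) t) volume 0 1 := by
  have hd := continuousOn_deformedDeriv (α := α) (β := β) C.smooth_mid (uniqueDiffOn_Icc one_pos) lam
  have h01 : Ioo (0 : ℝ) 1 ⊆ Icc 0 1 := Ioo_subset_Icc_self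
  obtain ⟨K, hK⟩ := exists_bound_of_sq C.isOpen C.diff_P C.diff_M hα (l := 𝓝[>] 0)
    (lam := lam) (q := rC lam) (D := deformed γ α β lam) (G := deriv (deformed γ α β lam))
    (d := deformedDeriv γ α β (Icc 0 1) lam 0)
    (by rw [← deformed_zero γ α β lam]
        exact (continuous_deformed C.continuous lam).continuousAt.continuousWithinAt)
    (by filter_upwards [Ioo_mem_nhdsGT one_pos] with s hs
          using C.sq_rC lam (mem_of_mem_nhds hl) s hs)
    (by rw [← nhdsWithin_Ioo_eq_nhdsGT one_pos]
        refine (((hd 0 (left_mem_Icc.2 zero_le_one)).mono h01).tendsto).congr' ?_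
        filter_upwards [self_mem_nhdsWithin] with s hs using ((C.deriv_mid lam hs).deriv).symm)
  obtain ⟨K', hK'⟩ := exists_bound_of_sq C.isOpen C.diff_P C.diff_M hβ (l := 𝓝[<] 1)
    (lam := lam) (q := rC lam) (D := deformed γ α β lam) (G := deriv (deformed γ α β lam))
    (d := deformedDeriv γ α β (Icc 0 1) lam 1)
    (by rw [← deformed_one γ α β lam]
        exact (continuous_deformed C.continuous lam).continuousAt.continuousWithinAt)
    (by filter_upwards [Ioo_mem_nhdsLT one_pos] with s hs
          using C.sq_rC lam (mem_of_mem_nhds hl) s hs)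
    (by rw [← nhdsWithin_Ioo_eq_nhdsLT one_pos]
        refine (((hd 1 (right_mem_Icc.2 zero_le_one)).mono h01).tendsto).congr' ?_
        filter_upwards [self_mem_nhdsWithin] with s hs using ((C.deriv_mid lam hs).deriv).symm)
  exact intervalIntegrable_of_bounded_ends one_pos (C.cont_integrand_mid hl) hK hK'

theorem deriv_armPhase_left (hl : U ∈ 𝓝 lam) (hα : α lam ∈ Ω) (hs : s < 0) : HasDerivAt (armPhase γ
    α β r lam) (r lam s * deformedDeriv γ α β (Iic 0) lam s) s := by
  have hc := C.cont_integrand_left hl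
  refine (intervalIntegral.integral_hasDerivAt_right (C.integrable_left hl hα hs).symm
    (hc.stronglyMeasurableAtFilter isOpen_Iio s hs)
    (hc.continuousAt (Iio_mem_nhds hs))).congr_deriv ?_
  rw [(C.deriv_left lam hs).deriv]

theorem deriv_armPhase_mid (hl : U ∈ 𝓝 lam) (hα : α lam ∈ Ω) (hβ : β lam ∈ Ω)
    (hs : s ∈ Ioo (0 : ℝ) 1) : HasDerivAt (armPhase γ α β rC lam) (rC lam s * deformedDeriv γ α β
    (Icc 0 1) lam s) s := by
  have hc := C.cont_integrand_mid hl
  refine (intervalIntegral.integral_hasDerivAt_right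
    ((C.integrable_mid hl hα hβ).mono_set ?_)
    (hc.stronglyMeasurableAtFilter isOpen_Ioo s hs)
    (hc.continuousAt (Ioo_mem_nhds hs.1 hs.2))).congr_deriv ?_
  · rw [uIcc_of_le hs.1.le, uIcc_of_le zero_le_one]; exact Icc_subset_Icc_right hs.2.le
  · rw [(C.deriv_mid lam hs).deriv]

theorem tendsto_armPhase_left (hl : U ∈ 𝓝 lam) (hα : α lam ∈ Ω) : Tendsto (armPhase γ α β r lam)
    (𝓝[<] 0) (𝓝 0) := by
  have hi := C.integrable_left hl hα (a := -1) (by norm_num)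
  have h1 := intervalIntegral.continuousOn_primitive_interval' hi.symm left_mem_uIcc
  have h2 := (h1 0 left_mem_uIcc).mono (s := Ioo (-1 : ℝ) 0) (by
    rw [uIcc_of_ge (by norm_num)]; exact Ioo_subset_Icc_self)
  have h3 := h2.tendsto
  rw [nhdsWithin_Ioo_eq_nhdsLT (by norm_num), intervalIntegral.integral_same] at h3
  exact h3

theorem tendsto_armPhase_mid (hl : U ∈ 𝓝 lam) (hα : α lam ∈ Ω) (hβ : β lam ∈ Ω) : Tendsto (armPhase
    γ α β rC lam) (𝓝[>] 0) (𝓝 0) := by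
  have hi := C.integrable_mid hl hα hβ
  have h1 := intervalIntegral.continuousOn_primitive_interval' hi left_mem_uIcc
  have h2 := (h1 0 left_mem_uIcc).mono (s := Ioo (0 : ℝ) 1) (by
    rw [uIcc_of_le (by norm_num)]; exact Ioo_subset_Icc_self)
  have h3 := h2.tendsto
  rw [nhdsWithin_Ioo_eq_nhdsGT (by norm_num), intervalIntegral.integral_same] at h3
  exact h3

theorem isArmAt_left (hs : s < 0) : IsArmAt P M μ (deformed γ α β) r (armPhase γ α β r) s := by
  refine ⟨deformedDeriv γ α β (Iic 0), ?_⟩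
  filter_upwards [continuousAt_fst.eventually C.regular_near,
    continuousAt_snd.eventually (Iio_mem_nhds hs)] with v ⟨hα, hβ, hαΩ, hβΩ, hU⟩ hv
  exact ⟨continuousAt_deformed C.continuous hα hβ v.2, (cont_left C.cont_r hU hv).1,
    C.sq_r _ (mem_of_mem_nhds hU) _ hv, C.deriv_left _ hv, C.deriv_armPhase_left hU hαΩ hv⟩

theorem isArmAt_mid (hs : s ∈ Ioo (0 : ℝ) 1) : IsArmAt P M μ (deformed γ α β) rC (armPhase γ α β rC)
    s := by
  refine ⟨deformedDeriv γ α β (Icc 0 1), ?_⟩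
  filter_upwards [continuousAt_fst.eventually C.regular_near,
    continuousAt_snd.eventually (Ioo_mem_nhds hs.1 hs.2)] with v ⟨hα, hβ, hαΩ, hβΩ, hU⟩ hv
  exact ⟨continuousAt_deformed C.continuous hα hβ v.2, (cont_mid C.cont_rC hU hv).1,
    C.sq_rC _ (mem_of_mem_nhds hU) _ hv, C.deriv_mid _ hv, C.deriv_armPhase_mid hU hαΩ hβΩ hv⟩

theorem isArmEnd_left : IsArmEnd P M μ α (-derivWithin γ (Iic 0) 0) (fun lam t => deformed γ α β lam
    (-t)) (fun lam t => r lam (-t)) (fun lam t => armPhase γ α β r lam (-t)) (1 / 2) where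
  pos := by norm_num
  tangent := neg_ne_zero.2 (C.regular_left 0 self_mem_Iic)
  shape := by
    refine ⟨fun t => γ (-t), ?_, by simp [C.base_α], Eventually.of_forall fun lam t ht => ?_⟩
    · have h1 : HasDerivWithinAt γ (derivWithin γ (Iic 0) 0) (Iic 0) (-0) := by
        rw [neg_zero]
        exact (C.smooth_left.differentiableOn one_ne_zero 0 self_mem_Iic).hasDerivWithinAt
      have h2 := h1.scomp (0 : ℝ) ((hasDerivAt_neg (0 : ℝ)).hasDerivWithinAt (s := Ici 0))
        (fun t ht => by simpa using ht)
      exact h2.congr_deriv (by simp)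
    · rw [deformed, bump_eq_zero (t := -t - 1) (by rw [abs_of_neg] <;> linarith [ht.1, ht.2]),
        C.base_α]
      simp [bump]
  ode := by
    filter_upwards [C.regular_near] with lam ⟨_, _, hαΩ, _, hU⟩ t ht
    have ht' : -t < 0 := by linarith [ht.1]
    refine ⟨ContinuousAt.comp (f := fun t : ℝ => -t) (g := r lam)
      (cont_left C.cont_r hU ht').2.1 continuous_neg.continuousAt,
      C.sq_r _ (mem_of_mem_nhds hU) _ ht', -deformedDeriv γ α β (Iic 0) lam (-t), ?_, ?_⟩
    · exact ((C.deriv_left lam ht').scomp t (hasDerivAt_neg t)).congr_deriv (by simp)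
    · exact ((C.deriv_armPhase_left hU hαΩ ht').scomp t (hasDerivAt_neg t)).congr_deriv (by simp)
  lim := by
    filter_upwards [C.regular_near] with lam ⟨_, _, hαΩ, _, hU⟩
    refine (C.tendsto_armPhase_left hU hαΩ).comp ?_
    have : Tendsto (fun t : ℝ => -t) (𝓝[>] 0) (𝓝[<] (-0)) := tendsto_neg_nhdsGT
    rwa [neg_zero] at this

theorem isArmEnd_mid : IsArmEnd P M μ α (derivWithin γ (Icc 0 1) 0) (deformed γ α β) rC (armPhase γ
    α β rC) (1 / 2) where
  pos := by norm_num
  tangent := C.regular_mid 0 (left_mem_Icc.2 zero_le_one)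
  shape := by
    refine ⟨γ, ?_, C.base_α.symm, Eventually.of_forall fun lam t ht => ?_⟩
    · have h1 := (C.smooth_mid.differentiableOn one_ne_zero 0
        (left_mem_Icc.2 zero_le_one)).hasDerivWithinAt
      exact h1.mono_of_mem_nhdsWithin (Icc_mem_nhdsGE one_pos)
    · rw [deformed, bump_eq_zero (t := t - 1) (by rw [abs_of_neg] <;> linarith [ht.1, ht.2]),
        C.base_α]
      simp
  ode := by
    filter_upwards [C.regular_near] with lam ⟨_, _, hαΩ, hβΩ, hU⟩ t ht
    have ht' : t ∈ Ioo (0 : ℝ) 1 := ⟨ht.1, by linarith [ht.2]⟩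
    exact ⟨(cont_mid C.cont_rC hU ht').2.1, C.sq_rC _ (mem_of_mem_nhds hU) _ ht',
      deformedDeriv γ α β (Icc 0 1) lam t, C.deriv_mid lam ht', C.deriv_armPhase_mid hU hαΩ hβΩ ht'⟩
  lim := by
    filter_upwards [C.regular_near] with lam ⟨_, _, hαΩ, hβΩ, hU⟩
    exact C.tendsto_armPhase_mid hU hαΩ hβΩ

end HalfContour

/-! Asymptotics along the incoming part of the contour -/

namespace HalfContour

include C

theorem base : deformed γ α β μ = γ :=
  deformed_base C.base_α C.base_β

theorem armPhase_sub (hl : U ∈ 𝓝 lam) (hα : α lam ∈ Ω) (hs : s < 0) (ht : t < 0) : armPhase γ α β r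
    lam t - armPhase γ α β r lam s = ∫ x in s..t, r lam x * deriv (deformed γ α β lam) x :=
  intervalIntegral.integral_interval_sub_left (C.integrable_left hl hα ht).symm
    (C.integrable_left hl hα hs).symm

theorem deriv_left_ray {T : ℝ} (hT : T < -1) (hγ : ∀ t < T, γ t = (x0 + ς * t : ℝ)) (lam : ℂ)
    (hs : s < T) : deformedDeriv γ α β (Iic 0) lam s = ς := by
  have h1 : HasDerivAt (fun t : ℝ => ((x0 + ς * t : ℝ) : ℂ)) ς s := by
    have : HasDerivAt (fun t : ℝ => x0 + ς * t) ς s := by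
      simpa using ((hasDerivAt_id s).const_mul ς).const_add x0
    exact this.ofReal_comp
  refine (C.deriv_left lam (by linarith)).unique (h1.congr_of_eventuallyEq ?_)
  filter_upwards [Iio_mem_nhds hs] with t ht
  rw [deformed_eq_of_le _ _ _ _ (by linarith [mem_Iio.1 ht]), hγ t ht]

theorem strictMonoOn : StrictMonoOn (fun s => (armPhase γ α β r μ s).re) (Iio 0) := by
  obtain ⟨q, hqc, hq, hpos⟩ := C.progressive
  have hl := C.nhds
  have hα : α μ ∈ Ω := by rw [C.base_α]; exact C.mem 0
  have hrc : ContinuousOn (r μ) (Iio 0) := fun s hs =>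
    (cont_left C.cont_r hl hs).2.1.continuousWithinAt
  have hsq : EqOn (q ^ 2) (r μ ^ 2) (Iio 0) := fun s hs => by
    have h1 := C.sq_r μ (mem_of_mem_nhds hl) s hs
    rw [C.base] at h1
    rw [Pi.pow_apply, Pi.pow_apply, hq s hs, h1]
  have hr0 : ∀ {s : ℝ}, s ∈ Iio 0 → r μ s ≠ 0 := fun {s} hs h0 => by
    have h1 := C.sq_r μ (mem_of_mem_nhds hl) s hs
    rw [C.base, h0] at h1
    exact C.ne_left s hs (by simpa using h1.symm)
  have hsub : ∀ s t, s < t → t < 0 → (armPhase γ α β r μ t).re - (armPhase γ α β r μ s).re =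
      (∫ x in s..t, r μ x * deriv γ x).re := fun s t hst ht => by
    rw [← Complex.sub_re, C.armPhase_sub hl hα (hst.trans ht) ht, C.base]
  rcases isPreconnected_Iio.eq_or_eq_neg_of_sq_eq hqc hrc hsq hr0 with heq | heq
  · intro s hs t ht hst
    have h1 := hpos s t hst ht
    rw [intervalIntegral.integral_congr (g := fun x => r μ x * deriv γ x) fun x hx => by
      simp only; rw [heq (lt_of_le_of_lt hx.2 (max_lt (hst.trans ht) ht))],
      ← hsub s t hst ht] at h1
    simp only
    linarith
  · exfalso
    obtain ⟨-, -, -, -, -, T, hT, hγ, -⟩ := C.exists_tail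
    have h1 := (C.pos μ (mem_of_mem_nhds hl)).and (eventually_lt_atBot T)
    obtain ⟨s, hs⟩ := eventually_atBot.1 h1
    have hd : ∀ u ≤ s, HasDerivAt (fun s => (armPhase γ α β r μ s).re) (r μ u * ς).re u := by
      intro u hu
      have hu0 := (hs u hu).2
      have h2 := C.deriv_armPhase_left hl hα (s := u) (by linarith)
      rw [C.deriv_left_ray hT hγ μ hu0] at h2
      exact hasDerivAt_re_of_hasDerivAt h2
    have hmono := monotoneOn_of_deriv_nonneg (convex_Icc (s - 1) s)
      (fun u hu => (hd u hu.2).continuousAt.continuousWithinAt)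
      (fun u hu => (hd u (interior_subset hu).2).differentiableAt.differentiableWithinAt)
      (fun u hu => by
        rw [(hd u (interior_subset hu).2).deriv]
        exact (hs u (interior_subset hu).2).1.le)
      (left_mem_Icc.2 (sub_one_lt s).le) (right_mem_Icc.2 (sub_one_lt s).le) (sub_one_lt s).le
    have hs0 : s < 0 := by linarith [(hs s le_rfl).2]
    have h2 := hpos (s - 1) s (sub_one_lt s) hs0
    rw [intervalIntegral.integral_congr (g := fun x => -(r μ x * deriv γ x)) fun x hx => by
      have hx0 : x < 0 := lt_of_le_of_lt hx.2 (max_lt (by linarith) hs0)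
      simp only; rw [heq hx0]; simp, intervalIntegral.integral_neg, Complex.neg_re,
      ← hsub (s - 1) s (sub_one_lt s) hs0] at h2
    simp only at hmono
    linarith

theorem re_armPhase_neg (hs : s < 0) : (armPhase γ α β r μ s).re < 0 := by
  have hα : α μ ∈ Ω := by rw [C.base_α]; exact C.mem 0
  have h1 := (Complex.continuous_re.tendsto _).comp (C.tendsto_armPhase_left C.nhds hα)
  have h2 : (armPhase γ α β r μ (s / 2)).re ≤ 0 := by
    refine ge_of_tendsto h1 ?_
    filter_upwards [Ioo_mem_nhdsLT (show s / 2 < 0 by linarith)] with t ht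
    exact (C.strictMonoOn.lt_iff_lt (show s / 2 < 0 by linarith) ht.2 |>.2 ht.1).le
  have h3 := C.strictMonoOn (show s < 0 from hs) (show s / 2 < 0 by linarith) (by linarith)
  exact h3.trans_le h2

/-- On the Stokes line the phase is purely imaginary with negative imaginary part. -/
theorem armPhase_mid (hs : s ∈ Ioo (0 : ℝ) 1) : (armPhase γ α β rC μ s).re = 0 ∧ (armPhase γ α β rC
    μ s).im < 0 := by
  have hα : α μ ∈ Ω := by rw [C.base_α]; exact C.mem 0
  have hβ : β μ ∈ Ω := by rw [C.base_β]; exact C.mem 1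
  have hd : ∀ t ∈ Ioo (0 : ℝ) 1,
      HasDerivAt (armPhase γ α β rC μ) (rC μ t * deriv γ t) t := fun t ht => by
    have h1 := C.deriv_armPhase_mid C.nhds hα hβ ht
    rwa [← (C.deriv_mid μ ht).deriv, C.base] at h1
  have hc : ContinuousOn (armPhase γ α β rC μ) (Icc 0 s) := by
    refine (intervalIntegral.continuousOn_primitive_interval'
      (C.integrable_mid C.nhds hα hβ) left_mem_uIcc).mono ?_
    rw [uIcc_of_le zero_le_one]; exact Icc_subset_Icc_right hs.2.le
  have hsub : ∀ t ∈ interior (Icc 0 s), t ∈ Ioo (0 : ℝ) 1 := fun t ht => by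
    rw [interior_Icc] at ht; exact ⟨ht.1, ht.2.trans hs.2⟩
  have h0 : armPhase γ α β rC μ 0 = 0 := intervalIntegral.integral_same
  have hre : ∀ t ∈ Ioo (0 : ℝ) 1, HasDerivAt (fun t => (armPhase γ α β rC μ t).re) 0 t :=
    fun t ht => by rw [← C.stokes_re t ht]; exact hasDerivAt_re_of_hasDerivAt (hd t ht)
  have him : ∀ t ∈ Ioo (0 : ℝ) 1,
      HasDerivAt (fun t => (armPhase γ α β rC μ t).im) (rC μ t * deriv γ t).im t :=
    fun t ht => Complex.imCLM.hasFDerivAt.comp_hasDerivAt t (hd t ht)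
  have hcre := Complex.continuous_re.comp_continuousOn hc
  have hcim := Complex.continuous_im.comp_continuousOn hc
  have l := left_mem_Icc.2 hs.1.le
  have u := right_mem_Icc.2 hs.1.le
  refine ⟨?_, ?_⟩
  · have h1 := monotoneOn_of_deriv_nonneg (convex_Icc 0 s) hcre
      (fun t ht => (hre t (hsub t ht)).differentiableAt.differentiableWithinAt)
      (fun t ht => (hre t (hsub t ht)).deriv.ge) l u hs.1.le
    have h2 := antitoneOn_of_deriv_nonpos (convex_Icc 0 s) hcre
      (fun t ht => (hre t (hsub t ht)).differentiableAt.differentiableWithinAt)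
      (fun t ht => (hre t (hsub t ht)).deriv.le) l u hs.1.le
    simp only [Function.comp_apply, h0, Complex.zero_re] at h1 h2
    linarith
  · have h1 := strictAntiOn_of_deriv_neg (convex_Icc 0 s) hcim (fun t ht => by
        have := (him t (hsub t ht)).deriv
        exact this.trans_lt (C.stokes_im t (hsub t ht))) l u hs.1
    simpa [h0] using h1

theorem wkb_left (hy : IsSolFamily P M Ω μ y) (hab : a ≤ b) (hb : b < 0) (ha : HasWKB μ y (fun lam
    => deformed γ α β lam a) (fun lam => armPhase γ α β r lam a) (fun lam => h lam a)) : HasWKB μ y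
    (fun lam => deformed γ α β lam b) (fun lam => armPhase γ α β r lam b) (fun lam => h lam b) := by
  have hneg : ∀ t ∈ Icc a b, t < 0 := fun t ht => ht.2.trans_lt hb
  refine HasWKB.chain C.isOpen C.diff_P C.diff_M hab (fun t _ => by rw [C.base]; exact C.mem t)
    (fun t ht => ?_) (C.strictMonoOn.mono fun t ht => hneg t ht) hy ha
  have ht0 := hneg t ht
  refine (C.isArmAt_left ht0).localBranch C.isOpen C.diff_P C.diff_M
    (by rw [C.base]; exact C.mem t) (fun h0 => ?_) (cont_left C.cont_h C.nhds ht0).1 ?_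
  · have h1 := C.sq_r μ (mem_of_mem_nhds C.nhds) t ht0
    rw [C.base, h0] at h1
    exact C.ne_left t ht0 (by simpa using h1.symm)
  · filter_upwards [continuousAt_fst.eventually C.nhds,
      continuousAt_snd.eventually (Iio_mem_nhds ht0)] with v hv hv' using C.root _ hv _ hv'

theorem angle_cond : (-derivWithin γ (Iic 0) 0 * conj (derivWithin γ (Icc 0 1) 0)).re < -(1 / 2) *
    (‖-derivWithin γ (Iic 0) 0‖ * ‖derivWithin γ (Icc 0 1) 0‖) := by
  set u := -derivWithin γ (Iic 0) 0
  set v := derivWithin γ (Icc 0 1) 0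
  have hu : 0 < ‖u‖ := norm_pos_iff.2 (neg_ne_zero.2 (C.regular_left 0 self_mem_Iic))
  have hv : 0 < ‖v‖ := norm_pos_iff.2 (C.regular_mid 0 (left_mem_Icc.2 zero_le_one))
  have h1 : Real.cos (InnerProductGeometry.angle u v) < Real.cos (2 * Real.pi / 3) :=
    Real.cos_lt_cos_of_nonneg_of_le_pi (by positivity) (InnerProductGeometry.angle_le_pi _ _)
      C.sector
  have h2 : Real.cos (2 * Real.pi / 3) = -(1 / 2) := by
    rw [show 2 * Real.pi / 3 = Real.pi - Real.pi / 3 by ring, Real.cos_pi_sub, Real.cos_pi_div_three]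
  have h3 : (u * conj v).re = inner ℝ u v := by
    rw [Complex.inner, ← Complex.conj_re, map_mul, Complex.conj_conj, mul_comm]
  rw [h3, ← InnerProductGeometry.cos_angle_mul_norm_mul_norm, ← h2]
  have : 0 < ‖u‖ * ‖v‖ := by positivity
  nlinarith

end HalfContour

/-! Propagation along the Stokes line -/

section

variable {c : ℂ}

theorem SideWKB.congr (hs : SideWKB μ y p H Z c) (hHZ : ∀ᶠ v : ℂ × ℂ in 𝓝 (p, μ), H v.1 v.2 = H' v.1
    v.2 ∧ Z v.1 v.2 = Z' v.1 v.2) : SideWKB μ y p H' Z' c := by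
  have h1 : ∀ᶠ x in 𝓝 p, ∀ᶠ lam in 𝓝 μ, H x lam = H' x lam ∧ Z x lam = Z' x lam :=
    hHZ.curry_nhds
  filter_upwards [hs, h1] with x ⟨h2, h3⟩ h4
  have h5 := h4.self_of_nhds.2
  rw [← h5]
  refine ⟨fun h6 => (h2 h6).congr EventuallyEq.rfl (h4.mono fun _ h => h.2)
    (h4.mono fun _ h => h.1), fun h6 => (h3 h6).congr EventuallyEq.rfl
    (h4.mono fun _ h => by simp only [h.2]) (h4.mono fun _ h => by simp only [h.1])⟩

theorem HasWKB.smul {X E h : ℂ → ℂ} {b : ℂ} (hb : b = 1 ∨ b = -1)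
    (hw : HasWKB μ y X E (fun lam => b * h lam)) : HasWKB μ (fun ε lam x => b • y ε lam x) X E h :=
    by
  obtain ⟨C, hC, ε0, hε0, H⟩ := hw
  refine ⟨C, hC, ε0, hε0, ?_⟩
  filter_upwards [H] with lam H ε h1 h2
  obtain ⟨h3, h4⟩ := H ε h1 h2
  rw [wPlus_smul, wMinus_smul]
  have h5 : ∀ v : ℂ × ℂ, wPlus (b * h lam) (E lam) ε v = b * wPlus (h lam) (E lam) ε v ∧
      wMinus (b * h lam) (E lam) ε v = b * wMinus (h lam) (E lam) ε v := fun v => by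
    rcases hb with rfl | rfl
    · simp
    · simp only [wPlus, wMinus, neg_mul, one_mul, div_neg]; constructor <;> ring
  rw [(h5 _).1] at h3
  rw [(h5 _).2] at h4
  exact ⟨h3, h4⟩

theorem SideWKB.smul {b : ℂ} (hb : b = 1 ∨ b = -1)
    (hs : SideWKB μ y p (fun x lam => b * H x lam) Z c) : SideWKB μ (fun ε lam x => b • y ε lam x) p
    H Z c := by
  filter_upwards [hs] with x ⟨h1, h2⟩
  refine ⟨fun h3 => (h1 h3).smul hb, fun h3 => HasWKB.smul hb ?_⟩
  simpa only [mul_left_comm] using h2 h3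

theorem IsSolFamily.smul (hy : IsSolFamily P M Ω μ y) (b : ℂ) : IsSolFamily P M Ω μ (fun ε lam x =>
    b • y ε lam x) := by
  obtain ⟨ε0, hε0, H⟩ := hy
  refine ⟨ε0, hε0, ?_⟩
  filter_upwards [H] with lam H ε h1 h2 using (H ε h1 h2).smul b

end

theorem IsGerm.exists_re (hg : IsGerm P M μ p H Z) (h0 : (Z p μ).re = 0) {Q : ℂ → Prop}
    (hQ : ∀ᶠ x in 𝓝 p, Q x) : ∃ η > 0, ∀ v : ℝ, |v| < η → ∃ x, Q x ∧ (Z x μ).re = v := by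
  obtain ⟨hd, hne⟩ := hg.hasDerivAt_phase
  obtain ⟨φ, hpφ, hφ, -⟩ := exists_localHomeomorph (f := fun x => Z x μ) (p := p)
    (hg.eventually.mono fun x hx => hx.hasDerivAt_phase.1.differentiableAt)
    (by rw [hd.deriv]; exact hne) univ_mem
  have h1 := φ.map_nhds_eq hpφ
  have h2 : φ '' {x | Q x} ∈ 𝓝 (φ p) := by rw [← h1]; exact image_mem_map hQ
  obtain ⟨η, hη, hb⟩ := Metric.mem_nhds_iff.1 h2
  refine ⟨η, hη, fun v hv => ?_⟩
  obtain ⟨x, hx, hxv⟩ := hb (show φ p + v ∈ ball (φ p) η by simpa using hv)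
  rw [hφ] at hxv
  simp only at hxv
  exact ⟨x, hx, by rw [hxv]; simp [h0]⟩

/-- Near a point of the Stokes line the two-sided asymptotics propagate along the line. -/
theorem IsGerm.sideWKB (hg : IsGerm P M μ p H Z) (hΩ : IsOpen Ω) (hP : DifferentiableOn ℂ P Ω)
    (hM : DifferentiableOn ℂ M Ω) (hp : p ∈ Ω) {c : ℂ} (hc : c ^ 2 = -1) : ∃ B ∈ 𝓝 p, ∀ x x', x ∈ B
    → x' ∈ B → (Z x μ).re = 0 → (Z x' μ).re = 0 → ∀ y, IsSolFamily P M Ω μ y → SideWKB μ y x H Z c →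
    SideWKB μ y x' H Z c := by
  obtain ⟨B1, hB1, htr1⟩ := hg.transfer hΩ hP hM hp
  have hg' := hg.mul_const hc (by norm_num) (fun _ => 0)
  simp only [neg_mul, one_mul, add_zero] at hg'
  obtain ⟨B2, hB2, htr2⟩ := hg'.transfer hΩ hP hM hp
  have h1 : interior (B1 ∩ B2) ∩ {x | IsGerm P M μ x H Z} ∈ 𝓝 p :=
    Filter.inter_mem (interior_mem_nhds.2 (Filter.inter_mem hB1 hB2)) hg.eventually
  refine ⟨_, h1, fun x x' hx hx' h0 h0' y hy hs => ?_⟩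
  have hxB : ∀ᶠ u in 𝓝 x, u ∈ B1 ∩ B2 := mem_interior_iff_mem_nhds.1 hx.1
  obtain ⟨η, hη, hex⟩ := IsGerm.exists_re hx.2 h0 (hs.and hxB)
  filter_upwards [mem_interior_iff_mem_nhds.1 hx'.1] with u hu
  constructor
  · intro hpos
    obtain ⟨w, ⟨hw, hwB⟩, hwv⟩ := hex (min η (Z u μ).re / 2) (by
      rw [abs_of_pos (by positivity)]
      linarith [min_le_left η (Z u μ).re])
    have hm : 0 < min η (Z u μ).re := lt_min hη hpos
    refine htr1 (fun _ => w) (fun _ => u) continuousAt_const continuousAt_const hwB.1 hu.1 ?_ y hy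
      (hw.1 (by rw [hwv]; linarith))
    simp only [hwv]
    linarith [min_le_right η (Z u μ).re]
  · intro hneg
    have hm : 0 < min η (-(Z u μ).re) := lt_min hη (by linarith)
    obtain ⟨w, ⟨hw, hwB⟩, hwv⟩ := hex (-(min η (-(Z u μ).re) / 2)) (by
      rw [abs_neg, abs_of_pos (by positivity)]
      linarith [min_le_left η (-(Z u μ).re)])
    refine htr2 (fun _ => w) (fun _ => u) continuousAt_const continuousAt_const hwB.2 hu.2 ?_ y hy
      (hw.2 (by rw [hwv]; linarith))
    simp only [Complex.neg_re, hwv]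
    linarith [min_le_right η (-(Z u μ).re)]

namespace HalfContour

include C

theorem propagate {c : ℂ} (hc : c ^ 2 = -1) (hy : IsSolFamily P M Ω μ y) {s0 s1 : ℝ} (hs₀ : 0 < s0)
    (hs₁ : s1 < 1) (hs : s0 ≤ s1) (hg : IsGerm P M μ (γ s0) H Z)
    (hH : (P (γ s0) - μ) * H (γ s0) μ ^ 2 = rC μ s0) (hZ : ∀ᶠ lam in 𝓝 μ, Z (deformed γ α β lam s0)
    lam = armPhase γ α β rC lam s0) (hw : SideWKB μ y (γ s0) H Z c) : ∃ a : ℂ, (a = 1 ∨ a = -1) ∧ ∃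
    H' Z', IsGerm P M μ (γ s1) H' Z' ∧ (P (γ s1) - μ) * H' (γ s1) μ ^ 2 = rC μ s1 ∧ (∀ᶠ lam in 𝓝 μ,
    Z' (deformed γ α β lam s1) lam = armPhase γ α β rC lam s1) ∧ SideWKB μ (fun ε lam x => a • y ε
    lam x) (γ s1) H' Z' c := by
  refine interval_chain (G := fun s => ∃ a : ℂ, (a = 1 ∨ a = -1) ∧ ∃ H' Z',
    IsGerm P M μ (γ s) H' Z' ∧ (P (γ s) - μ) * H' (γ s) μ ^ 2 = rC μ s ∧
      (∀ᶠ lam in 𝓝 μ, Z' (deformed γ α β lam s) lam = armPhase γ α β rC lam s) ∧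
      SideWKB μ (fun ε lam x => a • y ε lam x) (γ s) H' Z' c) hs (fun t ht => ?_)
    ⟨1, Or.inl rfl, H, Z, hg, hH, hZ, by simpa using hw⟩
  have ht' : t ∈ Ioo (0 : ℝ) 1 := ⟨hs₀.trans_le ht.1, ht.2.trans_lt hs₁⟩
  have hr0 : rC μ t ≠ 0 := fun h0 => by
    have h1 := C.sq_rC μ (mem_of_mem_nhds C.nhds) t ht'
    rw [C.base, h0] at h1
    exact C.ne_mid t ht' (by simpa using h1.symm)
  have hPne : P (γ t) - μ ≠ 0 := left_ne_zero_of_mul (C.ne_mid t ht')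
  obtain ⟨h₀, hh₀⟩ := IsAlgClosed.exists_pow_nat_eq (rC μ t / (P (γ t) - μ)) two_pos
  obtain ⟨K, W, hK, -, hKW⟩ := (C.isArmAt_mid ht').exists_germ C.isOpen C.diff_P C.diff_M
    (by rw [C.base]; exact C.mem t) hr0 (h₀ := h₀) (by rw [C.base, hh₀]; field_simp)
  rw [C.base] at hK
  obtain ⟨B, hB, htr⟩ := hK.sideWKB C.isOpen C.diff_P C.diff_M (C.mem t) hc
  have hev : ∀ᶠ s in 𝓝 t, γ s ∈ B ∧ IsGerm P M μ (γ s) K W ∧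
      ∀ᶠ lam in 𝓝 μ, (P (deformed γ α β lam s) - lam) * K (deformed γ α β lam s) lam ^ 2 =
        rC lam s ∧ W (deformed γ α β lam s) lam = armPhase γ α β rC lam s := by
    have h1 : ∀ᶠ s in 𝓝 t, ∀ᶠ lam in 𝓝 μ,
        (P (deformed γ α β lam s) - lam) * K (deformed γ α β lam s) lam ^ 2 =
        rC lam s ∧ W (deformed γ α β lam s) lam = armPhase γ α β rC lam s := by
      have h2 : ∀ᶠ v : ℝ × ℂ in 𝓝 (t, μ),
          (P (deformed γ α β v.2 v.1) - v.2) * K (deformed γ α β v.2 v.1) v.2 ^ 2 =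
          rC v.2 v.1 ∧ W (deformed γ α β v.2 v.1) v.2 = armPhase γ α β rC v.2 v.1 :=
        (continuous_swap.tendsto (t, μ)).eventually hKW
      exact h2.curry_nhds
    have h3 := C.continuous.continuousAt (x := t)
    exact (h3.eventually hB).and ((h3.eventually hK.eventually).and h1)
  obtain ⟨δ, hδ, hb⟩ := Metric.eventually_nhds_iff.1 hev
  refine ⟨δ, hδ, fun s hs s' hs' h1 h2 hlt ⟨a, ha, H', Z', hg', hH', hZ', hw'⟩ => ?_⟩
  obtain ⟨hsB, hsK, hsW⟩ := hb (by rwa [Real.dist_eq] : dist s t < δ)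
  obtain ⟨hsB', hsK', hsW'⟩ := hb (by rwa [Real.dist_eq] : dist s' t < δ)
  have hs01 : s ∈ Ioo (0 : ℝ) 1 := ⟨hs₀.trans_le hs.1, hs.2.trans_lt hs₁⟩
  have hs01' : s' ∈ Ioo (0 : ℝ) 1 := ⟨hs₀.trans_le hs'.1, hs'.2.trans_lt hs₁⟩
  have hKs : (P (γ s) - μ) * K (γ s) μ ^ 2 = rC μ s := by
    have := hsW.self_of_nhds.1; rwa [C.base] at this
  have hWs : W (γ s) μ = armPhase γ α β rC μ s := by
    have := hsW.self_of_nhds.2; rwa [C.base] at this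
  have hKs' : (P (γ s') - μ) * K (γ s') μ ^ 2 = rC μ s' := by
    have := hsW'.self_of_nhds.1; rwa [C.base] at this
  have hWs' : W (γ s') μ = armPhase γ α β rC μ s' := by
    have := hsW'.self_of_nhds.2; rwa [C.base] at this
  have hb' : ∃ b : ℂ, (b = 1 ∨ b = -1) ∧ H' (γ s) μ = b * K (γ s) μ := by
    have h3 : H' (γ s) μ ^ 2 = K (γ s) μ ^ 2 :=
      mul_left_cancel₀ (left_ne_zero_of_mul (C.ne_mid s hs01)) (hH'.trans hKs.symm)
    rcases sq_eq_sq_iff_eq_or_eq_neg.1 h3 with h | h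
    · exact ⟨1, Or.inl rfl, by rw [h, one_mul]⟩
    · exact ⟨-1, Or.inr rfl, by rw [h, neg_one_mul]⟩
  obtain ⟨b, hb1, hbK⟩ := hb'
  have hb2 : b ^ 2 = 1 := by rcases hb1 with rfl | rfl <;> norm_num
  have hbg := hsK.mul_const hb2 (by norm_num) (fun _ => 0)
  simp only [one_mul, add_zero] at hbg
  have hDc : ContinuousAt (fun lam => deformed γ α β lam s) μ := by
    have := continuousAt_deformed C.continuous C.cont_α C.cont_β s
    exact this.comp₂ continuousAt_id continuousAt_const
  have heq := hg'.eventuallyEq hbg hbK (D := fun lam => deformed γ α β lam s) hDc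
    (by rw [C.base]) (by
      filter_upwards [hZ', hsW] with lam h3 h4
      rw [h3, h4.2])
  have hw2 := (hw'.congr heq).smul hb1
  have hfam := (hy.smul a).smul b
  have hw3 := htr (γ s) (γ s') hsB hsB' (by rw [hWs]; exact (C.armPhase_mid hs01).1)
    (by rw [hWs']; exact (C.armPhase_mid hs01').1) _ hfam hw2
  refine ⟨b * a, ?_, K, W, hsK', hKs', hsW'.mono fun _ h => h.2, ?_⟩
  · rcases hb1 with rfl | rfl <;> rcases ha with rfl | rfl <;> simp
  · simpa only [smul_smul] using hw3

theorem wkb_mid (he : (e = -1 ∧ P (γ 0) = μ) ∨ (e = 1 ∧ M (γ 0) = μ)) (hy : IsSolFamily P M Ω μ y)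
    {T : ℝ} (hT : T < -1) (hw : HasWKB μ y (fun lam => deformed γ α β lam T) (fun lam => armPhase γ
    α β r lam T) (fun lam => h lam T)) : ∃ a : ℂ, (a = 1 ∨ a = -1) ∧ ∃ H Z, IsGerm P M μ (γ (1 / 2))
    H Z ∧ (P (γ (1 / 2)) - μ) * H (γ (1 / 2)) μ ^ 2 = rC μ (1 / 2) ∧ (∀ᶠ lam in 𝓝 μ, Z (deformed γ α
    β lam (1 / 2)) lam = armPhase γ α β rC lam (1 / 2)) ∧ SideWKB μ (fun ε lam x => a • y ε lam x)
    (γ (1 / 2)) H Z (I ^ e) := by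
  have hd : ∀ {f : ℂ → ℂ}, DifferentiableOn ℂ f Ω → ∀ s, DifferentiableAt ℂ f (γ s) :=
    fun hf s => hf.differentiableAt (C.isOpen.mem_nhds (C.mem s))
  obtain ⟨e', Λ, Λ2, h1, h2, h3, h4⟩ := turning_cases (hd C.diff_P 0) (hd C.diff_M 0)
    C.turning_left C.simple
  obtain rfl : e' = e := by
    rcases h1 with ⟨rfl, rfl, rfl⟩ | ⟨rfl, rfl, rfl⟩ <;>
      rcases he with ⟨rfl, h5⟩ | ⟨rfl, h5⟩ <;> first | rfl | exact absurd h5 h4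
  have hΛ : DifferentiableOn ℂ Λ Ω := by
    rcases h1 with h | h <;> rw [h.2.1]; exacts [C.diff_P, C.diff_M]
  have hΛ2 : DifferentiableOn ℂ Λ2 Ω := by
    rcases h1 with h | h <;> rw [h.2.2]; exacts [C.diff_M, C.diff_P]
  obtain ⟨N, ρ, ξ, ξ', ν, hN, TC⟩ := exists_turningCoord C.isOpen hΛ hΛ2 h1 (C.mem 0) h2 h3 h4
  have hfam := (turning_family C.isOpen C.diff_P C.diff_M (C.mem 0) h1 h2 h3 h4 C.base_α C.cont_α
    C.turn_α).1
  have hDc : ∀ s, ContinuousAt (fun lam => deformed γ α β lam s) μ := fun s => by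
    have := continuousAt_deformed C.continuous C.cont_α C.cont_β s
    exact this.comp₂ continuousAt_id continuousAt_const
  obtain ⟨δ, hδ, hside⟩ := TC.sideWKB C.isOpen C.diff_P C.diff_M hN hy C.base_α C.cont_α
    (by filter_upwards [hfam] with lam h; rw [h]; simp) C.isArmEnd_left C.isArmEnd_mid C.angle_cond
    (h := fun lam t => h lam (-t)) (fun t ht => by
      have ht' : -t < 0 := by linarith [ht.1]
      refine ⟨hDc _, (cont_left C.cont_h C.nhds ht').2.2, ?_⟩
      filter_upwards [C.nhds] with lam hl using C.root lam hl _ ht')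
    (fun t ht => C.re_armPhase_neg (by linarith [ht.1]))
    (fun t ht => C.wkb_left hy (by linarith [ht.2]) (by linarith [ht.1]) hw)
    (fun t ht => ⟨hDc _, (cont_mid C.cont_rC C.nhds ⟨ht.1, by linarith [ht.2]⟩).2.2⟩)
    (fun t ht => C.armPhase_mid ⟨ht.1, by linarith [ht.2]⟩)
  obtain ⟨H, Z, hg, hH, hZ, hs⟩ := hside (δ / 2) ⟨by linarith [hδ.1], by linarith [hδ.1]⟩
  rw [C.base] at hg hH hs
  refine C.propagate ?_ hy (by linarith [hδ.1]) (by norm_num) (by linarith [hδ.1, hδ.2]) hg hH hZ hs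
  rcases he with ⟨rfl, -⟩ | ⟨rfl, -⟩ <;> simp [Complex.inv_I]

end HalfContour

theorem wkb_shift (h E0 E : ℂ) (ε : ℝ) (y : ℂ × ℂ) : wPlus h (E0 + E) ε (exp (E0 / ε) • y) = wPlus h
    E ε y ∧ wMinus h (E0 + E) ε (exp (E0 / ε) • y) = wMinus h E ε y := by
  have he : exp (-((E0 + E) / ε)) * exp (E0 / ε) = exp (-(E / ε)) := by
    rw [← exp_add]; congr 1; ring
  rw [wPlus_smul, wMinus_smul]
  simp only [wPlus, wMinus, ← he]
  constructor <;> ring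

/-- The solutions `Y` decaying at the infinite end of a half contour: `y` is holomorphic in
`lam`, and `Y = e^{E0/ε} y` has WKB asymptotics on both sides of the Stokes line. -/
structure HalfSolution (P M : ℂ → ℂ) (Ω : Set ℂ) (μ : ℂ) (γ : ℝ → ℂ) (α β : ℂ → ℂ)
    (r h rC : ℂ → ℝ → ℂ) (x0 ς : ℝ) (e : ℤ) (V : Set ℂ) (E0 : ℂ → ℂ)
    (y : ℝ → ℂ → ℂ → ℂ × ℂ) (H Z : ℂ → ℂ → ℂ) (a : ℂ) : Prop where
  isOpen : IsOpen V
  mem : μ ∈ V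
  sol : ∀ ε > 0, ∀ lam ∈ V, IsSol P M ε lam Ω (y ε lam)
  diff : ∀ ε > 0, ∀ x ∈ Ω, DifferentiableOn ℂ (fun lam => y ε lam x) V
  lim_plus : ∀ ε > 0, ∀ lam ∈ V, Tendsto (fun t : ℝ => wPlus (h lam t) (armPhase γ α β r lam t) ε
    (exp (E0 lam / ε) • y ε lam (x0 + ς * t : ℝ))) atBot (𝓝 1)
  lim_minus : ∀ ε > 0, ∀ lam ∈ V, Tendsto (fun t : ℝ => wMinus (h lam t) (armPhase γ α β r lam t) ε
    (exp (E0 lam / ε) • y ε lam (x0 + ς * t : ℝ))) atBot (𝓝 0)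
  decay : ∀ ε > 0, ∀ lam ∈ V, ∃ c > 0, ∃ C > 0, ∀ᶠ t : ℝ in atBot,
    ‖y ε lam (x0 + ς * t : ℝ)‖ ≤ C * Real.exp (c * t)
  unique : ∀ ε > 0, ∀ lam ∈ V, ∀ y' : ℂ → ℂ × ℂ, IsSol P M ε lam Ω y' →
    Tendsto (fun t : ℝ => wPlus (h lam t) (armPhase γ α β r lam t) ε
      (y' (x0 + ς * t : ℝ))) atBot (𝓝 1) →
    Tendsto (fun t : ℝ => wMinus (h lam t) (armPhase γ α β r lam t) ε
      (y' (x0 + ς * t : ℝ))) atBot (𝓝 0) →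
    ∀ x ∈ Ω, y' x = exp (E0 lam / ε) • y ε lam x
  sign : a = 1 ∨ a = -1
  germ : IsGerm P M μ (γ (1 / 2)) H Z
  root : (P (γ (1 / 2)) - μ) * H (γ (1 / 2)) μ ^ 2 = rC μ (1 / 2)
  phase : ∀ᶠ lam in 𝓝 μ, Z (deformed γ α β lam (1 / 2)) lam = armPhase γ α β rC lam (1 / 2)
  side : SideWKB μ (fun ε lam x => a • exp (E0 lam / ε) • y ε lam x) (γ (1 / 2)) H Z
    (I ^ e)

include C in
theorem HalfContour.exists_halfSolution (he : (e = -1 ∧ P (γ 0) = μ) ∨ (e = 1 ∧ M (γ 0) = μ)) : ∃ V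
    E0 y H Z a, V ⊆ U ∧ HalfSolution P M Ω μ γ α β r h rC x0 ς e V E0 y H Z a := by
  obtain ⟨V₀, hV0o, hV0m, hV0U, hV0b, T, hT, hray, κ, B, c, K, Hb, htail⟩ := C.exists_tail
  obtain ⟨V1, hV1, hV1o, hV1m⟩ := mem_nhds_iff.1 C.regular_near
  set V := V₀ ∩ V1 with hVd
  have hVo : IsOpen V := hV0o.inter hV1o
  have hVm : μ ∈ V := ⟨hV0m, hV1m⟩
  set X : ℝ → ℂ := fun t => (x0 + ς * t : ℝ) with hXd
  have hX : ∀ t, X t ∈ Ω := fun t => C.real_mem _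
  set E : ℂ → ℝ → ℂ := fun lam t => ∫ s in (T - 1)..t, r lam s * ς with hE
  obtain ⟨hL, hhd, hEd⟩ := htail E fun lam _ t _ => rfl
  set E0 : ℂ → ℂ := fun lam => armPhase γ α β r lam (T - 1) with hE₀
  have hphase : ∀ lam ∈ V, ∀ t < T, armPhase γ α β r lam t = E0 lam + E lam t := by
    intro lam hl t ht
    obtain ⟨-, -, hαΩ, -, hU⟩ := hV1 hl.2
    have h1 := C.armPhase_sub hU hαΩ (s := T - 1) (t := t) (by linarith) (by linarith)
    have h2 : ∫ x in (T - 1)..t, r lam x * deriv (deformed γ α β lam) x = E lam t := by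
      refine intervalIntegral.integral_congr fun x hx => ?_
      have hxT : x < T := lt_of_le_of_lt hx.2 (max_lt (sub_one_lt T) ht)
      rw [(C.deriv_left lam (by linarith)).deriv, C.deriv_left_ray hT hray lam hxT]
    rw [h2] at h1
    simp only [hE₀]
    linear_combination h1
  have hex : ∀ ε : ℝ, ∃ y : ℂ → ℂ → ℂ × ℂ, 0 < ε → (∀ lam ∈ V, IsSol P M ε lam Ω (y lam)) ∧
      (∀ x ∈ Ω, DifferentiableOn ℂ (fun lam => y lam x) V) ∧
      ∀ lam ∈ V,
        Tendsto (fun t => wPlus (h lam t) (E lam t) ε (y lam (X t))) atBot (𝓝 1) ∧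
        Tendsto (fun t => wMinus (h lam t) (E lam t) ε (y lam (X t))) atBot (𝓝 0) ∧
        (K * (1 / 2) * ε ≤ c → ∀ t < T,
          ‖wMinus (h lam t) (E lam t) ε (y lam (X t))‖ ≤ K / c * ε ∧
          ‖wPlus (h lam t) (E lam t) ε (y lam (X t)) - 1‖ ≤ K / c * ε) := by
    intro ε
    by_cases hε : 0 < ε
    · obtain ⟨y, hy⟩ := exists_tail_solution C.isOpen C.simplyConnected C.diff_P C.diff_M hVo
        (hV0b.subset inter_subset_left) hX (fun lam hl => hL lam hl.1) ⟨μ, hVm⟩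
        (fun t ht => (hhd t ht).mono inter_subset_left)
        (fun t ht => (hEd t ht).mono inter_subset_left) hε
      exact ⟨y, fun _ => hy⟩
    · exact ⟨fun _ _ => 0, fun h => absurd h hε⟩
  choose y hy using hex
  have hshift : ∀ ε : ℝ, ∀ lam ∈ V, ∀ t < T, ∀ v : ℂ × ℂ,
      wPlus (h lam t) (armPhase γ α β r lam t) ε (exp (E0 lam / ε) • v) =
        wPlus (h lam t) (E lam t) ε v ∧
      wMinus (h lam t) (armPhase γ α β r lam t) ε (exp (E0 lam / ε) • v) =
        wMinus (h lam t) (E lam t) ε v := fun ε lam hl t ht v => by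
    rw [hphase lam hl t ht]; exact wkb_shift _ _ _ _ _
  have hc0 := (hL μ hV0m).c_pos
  have hfam : IsSolFamily P M Ω μ (fun ε lam x => exp (E0 lam / ε) • y ε lam x) := by
    refine ⟨1, one_pos, ?_⟩
    filter_upwards [hVo.mem_nhds hVm] with lam hl ε hε _ using ((hy ε hε).1 lam hl).smul _
  have hwkb : HasWKB μ (fun ε lam x => exp (E0 lam / ε) • y ε lam x)
      (fun lam => deformed γ α β lam (T - 1)) (fun lam => armPhase γ α β r lam (T - 1))
      (fun lam => h lam (T - 1)) := by
    refine ⟨|K| / c + 1, by positivity, c / (|K| + 1), by positivity, ?_⟩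
    filter_upwards [hVo.mem_nhds hVm] with lam hl ε hε hε'
    have hsmall : K * (1 / 2) * ε ≤ c := by
      rw [lt_div_iff₀ (by positivity)] at hε'
      have := le_abs_self K
      nlinarith
    obtain ⟨h1, h2⟩ := ((hy ε hε).2.2 lam hl).2.2 hsmall (T - 1) (sub_one_lt T)
    rw [deformed_eq_of_le _ _ _ _ (by linarith), hray _ (sub_one_lt T)]
    rw [(hshift ε lam hl _ (sub_one_lt T) _).1, (hshift ε lam hl _ (sub_one_lt T) _).2]
    have h3 : K / c * ε ≤ (|K| / c + 1) * ε := by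
      gcongr
      have : K / c ≤ |K| / c := by gcongr; exact le_abs_self K
      linarith
    exact ⟨h2.trans h3, h1.trans h3⟩
  obtain ⟨a, ha, H, Z, hg, hH, hZ, hs⟩ := C.wkb_mid he hfam (T := T - 1) (by linarith) hwkb
  refine ⟨V, E0, y, H, Z, a, inter_subset_left.trans hV0U, ?_⟩
  have lim1 : ∀ ε > 0, ∀ lam ∈ V, Tendsto (fun t : ℝ => wPlus (h lam t) (armPhase γ α β r lam t) ε
      (exp (E0 lam / ε) • y ε lam (x0 + ς * t : ℝ))) atBot (𝓝 1) := fun ε hε lam hl => by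
    refine ((hy ε hε).2.2 lam hl).1.congr' ?_
    filter_upwards [eventually_lt_atBot T] with t ht using (hshift ε lam hl t ht _).1.symm
  have lim2 : ∀ ε > 0, ∀ lam ∈ V, Tendsto (fun t : ℝ => wMinus (h lam t) (armPhase γ α β r lam t) ε
      (exp (E0 lam / ε) • y ε lam (x0 + ς * t : ℝ))) atBot (𝓝 0) := fun ε hε lam hl => by
    refine ((hy ε hε).2.2 lam hl).2.1.congr' ?_
    filter_upwards [eventually_lt_atBot T] with t ht using (hshift ε lam hl t ht _).2.symm
  exact
  { isOpen := hVo
    mem := hVm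
    sol := fun ε hε => (hy ε hε).1
    diff := fun ε hε => (hy ε hε).2.1
    lim_plus := lim1
    lim_minus := lim2
    decay := fun ε hε lam hl => by
      obtain ⟨h1, h2, -⟩ := (hy ε hε).2.2 lam hl
      obtain ⟨C', hC', h3⟩ := (hL lam hl.1).norm_le hε h1 h2
      exact ⟨c / ε, div_pos hc0 hε, C', hC', h3⟩
    unique := fun ε hε lam hl y' hy' h1 h2 x hx => by
      have hd : IsSol P M ε lam Ω
          (fun x => exp (-(E0 lam / ε)) • (y' x - exp (E0 lam / ε) • y ε lam x)) :=
        IsSol.smul _ fun x hx => by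
          rw [map_sub]; exact (hy' x hx).sub (((hy ε hε).1 lam hl).smul _ x hx)
      have he1 : ∀ v : ℂ × ℂ, exp (E0 lam / ε) • exp (-(E0 lam / ε)) • v = v :=
        fun v => by rw [smul_smul, ← exp_add]; simp
      have h3 := h1.sub (lim1 ε hε lam hl)
      have h4 := h2.sub (lim2 ε hε lam hl)
      rw [sub_self] at h3
      rw [sub_self] at h4
      have ht : T - 1 < T := sub_one_lt T
      have h0 := (hL lam hl.1).eq_zero hε hX hd (h3.congr' (by
          filter_upwards [eventually_lt_atBot T] with t ht
          rw [← wPlus_sub, ← (hshift ε lam hl t ht _).1, he1])) (h4.congr' (by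
          filter_upwards [eventually_lt_atBot T] with t ht
          rw [← wMinus_sub, ← (hshift ε lam hl t ht _).2, he1])) ht
      have h5 := hd.eq_zero C.isOpen C.simplyConnected C.diff_P C.diff_M (hX (T - 1)) h0 hx
      have h6 := he1 (y' x - exp (E0 lam / ε) • y ε lam x)
      rw [h5, smul_zero] at h6
      exact sub_eq_zero.1 h6.symm
    sign := ha
    germ := hg
    root := hH
    phase := hZ
    side := hs }

/-! Quantization -/

/-- A continuous logarithm of a holomorphic function is holomorphic. -/
theorem differentiableAt_of_exp {f g : ℂ → ℂ} {z : ℂ} (hf : ContinuousAt f z)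
    (hg : DifferentiableAt ℂ g z) (hfg : ∀ᶠ w in 𝓝 z, exp (f w) = g w) : DifferentiableAt ℂ f z :=
    by
  have hs := Complex.hasStrictDerivAt_exp (f z)
  have hne := exp_ne_zero (f z)
  have h1 : ∀ᶠ w in 𝓝 z, hs.localInverse _ _ _ hne (exp (f w)) = f w :=
    hf.eventually (hs.eventually_left_inverse hne)
  have h2 := (hs.to_localInverse hne).hasDerivAt.differentiableAt
  generalize hs.localInverse _ _ _ hne = ψ at h1 h2
  rw [hfg.self_of_nhds] at h2
  refine (h2.comp z hg).congr_of_eventuallyEq ?_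
  filter_upwards [h1, hfg] with w h3 h4
  rw [Function.comp_apply, ← h4, h3]

/-- A holomorphic approximation of `J`, whose values determine `T`. -/
theorem exists_quantization (hB : IsOpen B) {J T : ℂ → ℂ} {C : ℝ} (hε : 0 < ε)
    (hJ : ContinuousOn J B) (hT : DifferentiableOn ℂ T B) (hCε : C * ε ≤ 1 / 2)
    (hTJ : ∀ lam ∈ B, ‖T lam * exp (2 * J lam / ε) + 1‖ ≤ C * ε) : ∃ f : ℂ → ℂ, DifferentiableOn ℂ f
    B ∧ (∀ lam ∈ B, ‖f lam - J lam‖ ≤ C * ε ^ 2) ∧ ∀ lam ∈ B, T lam = -exp (-(2 * f lam / ε)) := by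
  have hε' : (ε : ℂ) ≠ 0 := by exact_mod_cast hε.ne'
  set u : ℂ → ℂ := fun lam => -(T lam * exp (2 * J lam / ε)) - 1 with hu
  have hub : ∀ lam ∈ B, ‖u lam‖ ≤ C * ε := fun lam hl => by
    have h1 : u lam = -(T lam * exp (2 * J lam / ε) + 1) := by simp only [hu]; ring
    rw [h1, norm_neg]; exact hTJ lam hl
  have hslit : ∀ lam ∈ B, 1 + u lam ∈ Complex.slitPlane := fun lam hl =>
    Complex.mem_slitPlane_of_norm_lt_one (by linarith [hub lam hl])
  set f : ℂ → ℂ := fun lam => J lam - ε / 2 * Complex.log (1 + u lam) with hf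
  have hexp : ∀ lam ∈ B, exp (-(2 * f lam / ε)) = -T lam := fun lam hl => by
    have h1 : -(2 * f lam / ε) = Complex.log (1 + u lam) + -(2 * J lam / ε) := by
      simp only [hf]; field_simp; ring
    rw [h1, exp_add, Complex.exp_log (Complex.slitPlane_ne_zero (hslit lam hl)),
      Complex.exp_neg]
    simp only [hu]
    field_simp [exp_ne_zero]
    ring
  have huc : ContinuousOn u B := by
    have h1 : ContinuousOn (fun lam => exp (2 * J lam / ε)) B :=
      Complex.continuous_exp.comp_continuousOn ((hJ.const_mul 2).div_const _)
    exact ((hT.continuousOn.mul h1).neg).sub continuousOn_const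
  have hfc : ContinuousOn f B :=
    hJ.sub (((continuousOn_const.add huc).clog hslit).const_mul _)
  refine ⟨f, fun lam hl => ?_, fun lam hl => ?_, fun lam hl => by rw [hexp lam hl, neg_neg]⟩
  · have h1 : DifferentiableAt ℂ (fun lam => -(2 * f lam / ε)) lam := by
      refine differentiableAt_of_exp (g := fun lam => -T lam)
        ((((hfc.const_mul 2).div_const _).neg).continuousAt (hB.mem_nhds hl))
        (hT.differentiableAt (hB.mem_nhds hl)).neg ?_
      filter_upwards [hB.mem_nhds hl] with mu hm using hexp mu hm
    have h2 : f = fun lam => -(2 * f lam / ε) * (-(ε / 2)) := by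
      funext mu; field_simp
    rw [h2]
    exact (h1.mul_const _).differentiableWithinAt
  · have h1 : f lam - J lam = -(ε / 2 * Complex.log (1 + u lam)) := by simp only [hf]; ring
    have h2 := Complex.norm_log_one_add_half_le_self (z := u lam) (by linarith [hub lam hl])
    rw [h1, norm_neg, norm_mul, norm_div, norm_real, Real.norm_of_nonneg hε.le]
    have h3 : ‖(2 : ℂ)‖ = 2 := by simp
    rw [h3]
    calc ε / 2 * ‖Complex.log (1 + u lam)‖ ≤ ε / 2 * (3 / 2 * (C * ε)) := by
          gcongr; exact h2.trans (by gcongr; exact hub lam hl)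
      _ ≤ C * ε ^ 2 := by
          have : 0 ≤ C * ε := (norm_nonneg _).trans (hub lam hl)
          nlinarith

theorem eq_one_iff_of_quantization {T f : ℂ} (hε : 0 < ε) (hT : T = -exp (-(2 * f / ε))) : T = 1 ↔ ∃
    k : ℤ, f = I * Real.pi * ε * (k + 1 / 2) := by
  have hε' : (ε : ℂ) ≠ 0 := by exact_mod_cast hε.ne'
  have hpi : exp (-(2 * f / ε)) = -T := by rw [hT, neg_neg]
  have h1 : T = 1 ↔ exp (-(2 * f / ε) + Real.pi * I) = 1 := by
    rw [exp_add, Complex.exp_pi_mul_I, hpi]; simp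
  rw [h1, Complex.exp_eq_one_iff]
  constructor
  · rintro ⟨n, hn⟩
    refine ⟨-n, ?_⟩
    field_simp at hn
    push_cast
    linear_combination (-1 / 2) * hn
  · rintro ⟨k, hk⟩
    refine ⟨-k, ?_⟩
    rw [hk]; field_simp; push_cast; ring

theorem differentiableOn_of_quantization (hB : IsOpen B) {J : ℂ → ℂ} {f : ℝ → ℂ → ℂ} {C ε0 : ℝ}
    (hε0 : 0 < ε0) (hf : ∀ ε, 0 < ε → ε < ε0 → DifferentiableOn ℂ (f ε) B) (hfJ : ∀ ε, 0 < ε → ε <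
    ε0 → ∀ lam ∈ B, ‖f ε lam - J lam‖ ≤ C * ε ^ 2) : DifferentiableOn ℂ J B := by
  have h1 : TendstoUniformlyOn f J (𝓝[>] 0) B := by
    rw [Metric.tendstoUniformlyOn_iff]
    intro η hη
    have h2 : Tendsto (fun ε : ℝ => C * ε ^ 2) (𝓝[>] 0) (𝓝 0) := by
      have : Continuous fun ε : ℝ => C * ε ^ 2 := by fun_prop
      simpa using (this.tendsto 0).mono_left nhdsWithin_le_nhds
    filter_upwards [h2.eventually_lt_const hη, Ioo_mem_nhdsGT hε0] with ε h3 h4 lam hl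
    rw [dist_comm, dist_eq_norm]
    exact (hfJ ε h4.1 h4.2 lam hl).trans_lt h3
  refine h1.tendstoLocallyUniformlyOn.differentiableOn ?_ hB
  filter_upwards [Ioo_mem_nhdsGT hε0] with ε h using hf ε h.1 h.2

/-- If `J' ≠ 0`, the approximations of `J` are uniformly injective near `μ` and cover a fixed
neighbourhood of `J μ`. -/
theorem exists_univalent (hR : 0 < R) {J : ℂ → ℂ} {f : ℝ → ℂ → ℂ} {C ε0 : ℝ} (hε0 : 0 < ε0)
    (hC : 0 < C) (hf : ∀ ε, 0 < ε → ε < ε0 → DifferentiableOn ℂ (f ε) (ball μ R)) (hfJ : ∀ ε, 0 < ε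
    → ε < ε0 → ∀ lam ∈ ball μ R, ‖f ε lam - J lam‖ ≤ C * ε ^ 2) (hd : deriv J μ ≠ 0) : ∃ R1 > 0, ∃ ρ
    > 0, ∃ ε1 > 0, R1 ≤ R ∧ ε1 ≤ ε0 ∧ ∀ ε, 0 < ε → ε < ε1 → InjOn (f ε) (ball μ R1) ∧ ball (J μ) ρ ⊆
    f ε '' ball μ R1 := by
  have hJ := differentiableOn_of_quantization isOpen_ball hε0 hf hfJ
  set d := deriv J μ with hdd
  have hd0 : 0 < ‖d‖ := norm_pos_iff.2 hd
  have hJc : ContinuousAt (deriv J) μ :=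
    (hJ.deriv isOpen_ball).continuousOn.continuousAt (ball_mem_nhds _ hR)
  obtain ⟨R', hR', hR'd⟩ := Metric.eventually_nhds_iff_ball.1
    (Metric.continuousAt_iff'.1 hJc (‖d‖ / 4) (by positivity))
  set R1 := min R' (R / 2) with hR1
  have hR10 : 0 < R1 := lt_min hR' (by positivity)
  set ρ := ‖d‖ * (R1 / 2) / 8 with hρ
  have hρ0 : 0 < ρ := by positivity
  set ε1 := min ε0 (min 1 (min (‖d‖ / 4 * (R / 4) / (2 * C)) (ρ / (2 * C)))) with hε₁
  have hε10 : 0 < ε1 := by positivity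
  refine ⟨R1, hR10, ρ, hρ0, ε1, hε10, (min_le_right _ _).trans (by linarith), min_le_left _ _,
    fun ε hε hε' => ?_⟩
  have hεε0 : ε < ε0 := hε'.trans_le (min_le_left _ _)
  have hε1 : ε < 1 := hε'.trans_le ((min_le_right _ _).trans (min_le_left _ _))
  have hε2 : ε < ‖d‖ / 4 * (R / 4) / (2 * C) :=
    hε'.trans_le ((min_le_right _ _).trans ((min_le_right _ _).trans (min_le_left _ _)))
  have hε3 : ε < ρ / (2 * C) :=
    hε'.trans_le ((min_le_right _ _).trans ((min_le_right _ _).trans (min_le_right _ _)))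
  rw [lt_div_iff₀ (by positivity)] at hε2 hε3
  have hsq : C * ε ^ 2 ≤ C * ε := by
    have : ε ^ 2 ≤ ε := by nlinarith
    gcongr
  have hF := hf ε hε hεε0
  have hsub : ∀ z ∈ ball μ R1, Metric.closedBall z (R / 4) ⊆ ball μ R := by
    intro z hz w hw
    have h1 : dist z μ < R / 2 := (Metric.mem_ball.1 hz).trans_le (min_le_right _ _)
    have h2 := Metric.mem_closedBall.1 hw
    have h3 := dist_triangle w z μ
    exact Metric.mem_ball.2 (by linarith)
  have hzB : ∀ z ∈ ball μ R1, z ∈ ball μ R := fun z hz =>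
    hsub z hz (Metric.mem_closedBall_self (by positivity))
  have hderiv : ∀ z ∈ ball μ R1, ‖deriv (f ε) z - d‖ ≤ ‖d‖ / 2 := by
    intro z hz
    have hzm := isOpen_ball.mem_nhds (hzB z hz)
    have h1 : ‖deriv (fun w => f ε w - J w) z‖ ≤ C * ε ^ 2 / (R / 4) := by
      refine Complex.norm_deriv_le_of_forall_mem_sphere_norm_le (by positivity) ?_ fun w hw =>
        hfJ ε hε hεε0 w (hsub z hz (Metric.sphere_subset_closedBall hw))
      exact ((hF.sub hJ).mono (hsub z hz)).diffContOnCl_ball le_rfl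
    rw [deriv_fun_sub (hF.differentiableAt hzm) (hJ.differentiableAt hzm)] at h1
    have h2 : C * ε ^ 2 / (R / 4) ≤ ‖d‖ / 4 := by
      rw [div_le_iff₀ (by positivity)]
      have : 0 < C * ε := by positivity
      linarith
    have h3 : ‖deriv J z - d‖ < ‖d‖ / 4 := by
      have := hR'd z (ball_subset_ball (min_le_left _ _) hz)
      rwa [dist_eq_norm] at this
    have h4 := norm_add_le (deriv (f ε) z - deriv J z) (deriv J z - d)
    rw [sub_add_sub_cancel] at h4
    linarith
  have hlip : ∀ z ∈ ball μ R1, ∀ w ∈ ball μ R1, ‖d‖ / 2 * ‖w - z‖ ≤ ‖f ε w - f ε z‖ := by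
    intro z hz w hw
    have h1 := (convex_ball μ R1).norm_image_sub_le_of_norm_hasDerivWithin_le
      (f := fun x => f ε x - d * x) (f' := fun x => deriv (f ε) x - d * 1) (C := ‖d‖ / 2)
      (fun x hx => ((hF.differentiableAt
        (isOpen_ball.mem_nhds (hzB x hx))).hasDerivAt.sub
          ((hasDerivAt_id x).const_mul d)).hasDerivWithinAt)
      (fun x hx => by rw [mul_one]; exact hderiv x hx) hz hw
    have h2 := norm_sub_norm_le (d * (w - z)) (d * (w - z) - (f ε w - f ε z))
    rw [sub_sub_cancel, norm_mul] at h2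
    have h3 : ‖d * (w - z) - (f ε w - f ε z)‖ = ‖f ε w - d * w - (f ε z - d * z)‖ := by
      rw [← norm_neg]; congr 1; ring
    linarith
  refine ⟨fun z hz w hw hzw => ?_, ?_⟩
  · have h1 := hlip z hz w hw
    rw [hzw, sub_self, norm_zero] at h1
    have h2 : ‖w - z‖ ≤ 0 := by
      by_contra! h3
      have : 0 < ‖d‖ / 2 * ‖w - z‖ := by positivity
      linarith
    exact (sub_eq_zero.1 (norm_le_zero_iff.1 h2)).symm
  · have hl0 := mem_ball_self (x := μ) hR10
    have hcl : Metric.closedBall μ (R1 / 2) ⊆ ball μ R1 :=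
      Metric.closedBall_subset_ball (by linarith)
    have hdc : DiffContOnCl ℂ (f ε) (ball μ (R1 / 2)) :=
      (hF.mono fun z hz => hzB z (hcl hz)).diffContOnCl_ball le_rfl
    have h1 := hdc.ball_subset_image_closedBall (ε := ‖d‖ / 2 * (R1 / 2)) (by positivity)
      (fun z hz => by
        have := hlip μ hl0 z (hcl (Metric.sphere_subset_closedBall hz))
        rwa [← dist_eq_norm, Metric.mem_sphere.1 hz] at this) (by
        refine Filter.Eventually.frequently (f := 𝓝[≠] μ) ?_ |>.filter_mono nhdsWithin_le_nhds
        filter_upwards [self_mem_nhdsWithin,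
          nhdsWithin_le_nhds (ball_mem_nhds μ hR10)] with z hz hz' heq
        have h2 := hlip μ hl0 z hz'
        rw [heq, sub_self, norm_zero] at h2
        have h3 : 0 < ‖z - μ‖ := norm_pos_iff.2 (sub_ne_zero.2 hz)
        have : 0 < ‖d‖ / 2 * ‖z - μ‖ := by positivity
        linarith)
    refine fun w hw => image_mono hcl (h1 ?_)
    have h2 := hfJ ε hε hεε0 μ (mem_ball_self hR)
    rw [← dist_eq_norm, dist_comm] at h2
    have h3 := dist_triangle w (J μ) (f ε μ)
    have h4 := Metric.mem_ball.1 hw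
    refine Metric.mem_ball.2 ?_
    have h5 : ‖d‖ / 2 * (R1 / 2) / 2 = 2 * ρ := by rw [hρ]; ring
    rw [h5]
    linarith

/-- Alternation: consecutive solutions of `T = 1` have consecutive quantum numbers. -/
theorem exists_alternation (hR : 0 < R) {J : ℂ → ℂ} {T : ℝ → ℂ → ℂ} {C ε0 : ℝ} (hε0 : 0 < ε0)
    (hC : 0 < C) (hJ : ContinuousOn J (ball μ R)) (hJ0 : (J μ).re = 0) (hT : ∀ ε, 0 < ε → ε < ε0 →
    DifferentiableOn ℂ (T ε) (ball μ R)) (hTJ : ∀ ε, 0 < ε → ε < ε0 → ∀ lam ∈ ball μ R, ‖T ε lam *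
    exp (2 * J lam / ε) + 1‖ ≤ C * ε) (hd : deriv J μ ≠ 0) : ∃ V ⊆ ball μ R, IsOpen V ∧ μ ∈ V ∧ ∃ ε1
    > 0, ∀ ε, 0 < ε → ε < ε1 → ∀ lam1 ∈ V, ∀ lam2 ∈ V, T ε lam1 = 1 → T ε lam2 = 1 → (J lam1).im <
    (J lam2).im → (∀ mu ∈ V, T ε mu = 1 → ¬ ((J lam1).im < (J mu).im ∧ (J mu).im < (J lam2).im)) → ∃
    k : ℤ, ‖J lam1 - I * Real.pi * ε * (k + 1 / 2)‖ ≤ C * ε ^ 2 ∧ ‖J lam2 - I * Real.pi * ε * (k + 1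
    + 1 / 2)‖ ≤ C * ε ^ 2 := by
  set ε2 := min ε0 (1 / (2 * C)) with hε₂
  have hε20 : 0 < ε2 := by positivity
  have hex : ∀ ε : ℝ, ∃ f : ℂ → ℂ, 0 < ε → ε < ε2 → DifferentiableOn ℂ f (ball μ R) ∧
      (∀ lam ∈ ball μ R, ‖f lam - J lam‖ ≤ C * ε ^ 2) ∧
      ∀ lam ∈ ball μ R, T ε lam = -exp (-(2 * f lam / ε)) := by
    intro ε
    by_cases h : 0 < ε ∧ ε < ε2
    · have h1 : ε < ε0 := h.2.trans_le (min_le_left _ _)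
      have h2 : ε < 1 / (2 * C) := h.2.trans_le (min_le_right _ _)
      rw [lt_div_iff₀ (by positivity)] at h2
      obtain ⟨f, hf⟩ := exists_quantization isOpen_ball h.1 hJ (hT ε h.1 h1)
        (C := C) (by linarith) (hTJ ε h.1 h1)
      exact ⟨f, fun _ _ => hf⟩
    · exact ⟨0, fun h1 h2 => absurd ⟨h1, h2⟩ h⟩
  choose f hf using hex
  obtain ⟨R1, hR1, ρ, hρ, ε1, hε₁, hR1R, hε12, hinj⟩ := exists_univalent hR hε20 hC
    (fun ε h1 h2 => (hf ε h1 h2).1) (fun ε h1 h2 => (hf ε h1 h2).2.1) hd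
  have hsub : ball μ R1 ⊆ ball μ R := ball_subset_ball hR1R
  set Q : Set ℂ := {z | |z.re| < ρ ∧ |z.im - (J μ).im| < ρ} with hQ
  have hQo : IsOpen Q := by
    have h1 : IsOpen {z : ℂ | |z.re| < ρ} := isOpen_lt Complex.continuous_re.abs continuous_const
    have h2 : IsOpen {z : ℂ | |z.im - (J μ).im| < ρ} :=
      isOpen_lt (Complex.continuous_im.sub continuous_const).abs continuous_const
    exact h1.and h2
  refine ⟨ball μ R1 ∩ J ⁻¹' Q, inter_subset_left.trans hsub,
    (hJ.mono hsub).isOpen_inter_preimage isOpen_ball hQo,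
    ⟨mem_ball_self hR1, by simp [hQ, hJ0, hρ]⟩,
    min ε1 (min 1 (min (1 / C) (ρ / C))), by positivity, ?_⟩
  intro ε hε hε' lam1 h₁ lam2 h₂ hT₁ hT2 him hno
  have hεε1 : ε < ε1 := hε'.trans_le (min_le_left _ _)
  have hεC : ε < 1 / C :=
    hε'.trans_le ((min_le_right _ _).trans ((min_le_right _ _).trans (min_le_left _ _)))
  have hερ : ε < ρ / C :=
    hε'.trans_le ((min_le_right _ _).trans ((min_le_right _ _).trans (min_le_right _ _)))
  have hε1 : ε < 1 := hε'.trans_le ((min_le_right _ _).trans (min_le_left _ _))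
  rw [lt_div_iff₀ hC] at hεC hερ
  have hsmall : C * ε ^ 2 < ε := by nlinarith
  have hsmall' : C * ε ^ 2 < ρ := by nlinarith [mul_pos hC hε]
  have hπ : 3 * ε < Real.pi * ε := mul_lt_mul_of_pos_right Real.pi_gt_three hε
  obtain ⟨-, hfJ, hfT⟩ := hf ε hε (hεε1.trans_le hε12)
  obtain ⟨hi, hs⟩ := hinj ε hε hεε1
  obtain ⟨k₁, hk1⟩ := (eq_one_iff_of_quantization hε (hfT _ (hsub h₁.1))).1 hT₁
  obtain ⟨k₂, hk₂⟩ := (eq_one_iff_of_quantization hε (hfT _ (hsub h₂.1))).1 hT2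
  have himk : ∀ k : ℤ, (I * Real.pi * ε * (k + 1 / 2)).im = Real.pi * ε * (k + 1 / 2) ∧
      (I * Real.pi * ε * (k + 1 / 2)).re = 0 := fun k => by
    have : I * Real.pi * ε * (k + 1 / 2) =
        ((Real.pi * ε * (k + 1 / 2) : ℝ) : ℂ) * I := by push_cast; ring
    rw [this]
    exact ⟨by simp, by simp⟩
  have hest : ∀ lam ∈ ball μ R1, ∀ k : ℤ, f ε lam = I * Real.pi * ε * (k + 1 / 2) →
      |Real.pi * ε * (k + 1 / 2) - (J lam).im| ≤ C * ε ^ 2 ∧ |(J lam).re| ≤ C * ε ^ 2 := by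
    intro lam hl k hk
    have h3 := hfJ lam (hsub hl)
    rw [hk] at h3
    have h4 := (Complex.abs_im_le_norm _).trans h3
    have h5 := (Complex.abs_re_le_norm _).trans h3
    rw [Complex.sub_im, (himk k).1] at h4
    rw [Complex.sub_re, (himk k).2, zero_sub, abs_neg] at h5
    exact ⟨h4, h5⟩
  have e₁ := abs_le.1 (hest lam1 h₁.1 k₁ hk1).1
  have e₂ := abs_le.1 (hest lam2 h₂.1 k₂ hk₂).1
  have hk12 : k₁ < k₂ := by
    by_contra! hle
    rcases hle.lt_or_eq with hlt | heq
    · have h3 : (k₂ : ℝ) + 1 ≤ k₁ := by exact_mod_cast hlt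
      have h4 : Real.pi * ε * (k₂ + 1) ≤ Real.pi * ε * k₁ := by gcongr
      linarith [e₁.1, e₁.2, e₂.1, e₂.2]
    · rw [heq, ← hk1] at hk₂
      rw [hi h₂.1 h₁.1 hk₂] at him
      exact lt_irrefl _ him
  have hk : k₂ = k₁ + 1 := by
    by_contra hne
    have h3 : (k₁ : ℝ) + 2 ≤ k₂ := by
      have : k₁ + 2 ≤ k₂ := by omega
      exact_mod_cast this
    have h4 : Real.pi * ε * (k₁ + 2) ≤ Real.pi * ε * k₂ := by gcongr
    have b₁ := abs_lt.1 h₁.2.2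
    have b₂ := abs_lt.1 h₂.2.2
    have hw : I * Real.pi * ε * ((k₁ + 1 : ℤ) + 1 / 2) ∈ ball (J μ) ρ := by
      obtain ⟨i1, i2⟩ := himk (k₁ + 1)
      rw [Metric.mem_ball, Complex.dist_of_re_eq (by rw [i2, hJ0]), i1, Real.dist_eq, abs_lt]
      push_cast
      constructor <;> linarith [e₁.1, e₁.2, e₂.1, e₂.2]
    obtain ⟨mu, hmu, hmuw⟩ := hs hw
    have e₃ := hest mu hmu (k₁ + 1) hmuw
    have e₄ := abs_le.1 e₃.1
    push_cast at e₄
    have h5 : (J lam1).im < (J mu).im ∧ (J mu).im < (J lam2).im := by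
      constructor <;> linarith [e₁.1, e₁.2, e₂.1, e₂.2, e₄.1, e₄.2]
    refine hno mu ⟨hmu, ?_, ?_⟩ ((eq_one_iff_of_quantization hε (hfT _ (hsub hmu))).2
      ⟨_, hmuw⟩) h5
    · exact e₃.2.trans_lt hsmall'
    · rw [abs_lt]; constructor <;> linarith [h5.1, h5.2]
  refine ⟨k₁, ?_, ?_⟩
  · rw [← hk1, ← norm_neg, neg_sub]; exact hfJ _ (hsub h₁.1)
  · rw [← norm_neg, neg_sub]
    have h3 := hfJ _ (hsub h₂.1)
    rw [hk₂, hk] at h3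
    push_cast at h3
    exact h3

/-! Comparison of the two decaying solutions -/

theorem wPlus_phase (h E : ℂ) (ε : ℝ) (y : ℂ × ℂ) : wPlus h E ε y = exp (-(E / ε)) * wPlus h 0 ε y
    := by
  simp [wPlus, mul_div_assoc]

theorem wPlus_sign {b : ℂ} (hb : b = 1 ∨ b = -1) (h E : ℂ) (ε : ℝ) (y : ℂ × ℂ) : wPlus (b * h) E ε y
    = b * wPlus h E ε y := by
  rcases hb with rfl | rfl
  · simp
  · simp only [wPlus, neg_mul, one_mul, div_neg]; ring

theorem IsGerm.differentiableAt (hg : IsGerm P M μ p H Z) : ∀ᶠ lam in 𝓝 μ, DifferentiableAt ℂ (H p)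
    lam ∧ H p lam ≠ 0 := by
  have c : ContinuousAt (fun lam : ℂ => (p, lam)) μ := by fun_prop
  have h1 := c.eventually hg
  filter_upwards [h1.eventually_nhds] with lam h2
  obtain ⟨hc, h0, -, hP, -⟩ := h2.self_of_nhds
  have hG : HasDerivAt (fun lam => (lam - M p) / (P p - lam)) _ lam :=
    ((hasDerivAt_id lam).sub_const (M p)).div ((hasDerivAt_id lam).const_sub (P p)) hP
  refine ⟨(hasDerivAt_of_pow_eq (n := 4) (by norm_num) ?_ ?_ hG h0).differentiableAt, h0⟩
  · exact hc.comp₂ continuousAt_const continuousAt_id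
  · filter_upwards [h2] with mu h3
    rw [eq_div_iff h3.2.2.2.1, mul_comm, h3.2.2.1]

theorem ratio_bound {a b : ℂ} {δ : ℝ} (hδ : δ ≤ 1 / 4) (ha : ‖a - 1‖ ≤ δ) (hb : ‖b - 1‖ ≤ δ) : ‖b /
    a - 1‖ ≤ 4 * δ ∧ a ≠ 0 := by
  have h1 : 3 / 4 ≤ ‖a‖ := by
    have := norm_sub_norm_le (1 : ℂ) (1 - a)
    rw [sub_sub_cancel, norm_one, norm_sub_rev] at this
    linarith
  have h0 : a ≠ 0 := norm_pos_iff.1 (by linarith)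
  refine ⟨?_, h0⟩
  rw [div_sub_one h0, norm_div, div_le_iff₀ (by linarith)]
  have h2 : ‖b - a‖ ≤ 2 * δ := by
    have := norm_sub_le (b - 1) (a - 1)
    rw [sub_sub_sub_cancel_right] at this
    linarith
  have : 0 ≤ δ := (norm_nonneg _).trans ha
  nlinarith

theorem cross_ratio_bound {a₁ a₂ b₁ b₂ : ℂ} {δ : ℝ} (hδ : δ ≤ 1 / 4) (ha₁ : ‖a₁ - 1‖ ≤ δ)
    (ha₂ : ‖a₂ - 1‖ ≤ δ) (hb₁ : ‖b₁ - 1‖ ≤ δ) (hb₂ : ‖b₂ - 1‖ ≤ δ) : ‖1 - a₂ * b₁ / (a₁ * b₂)‖ ≤ 16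
    * δ := by
  obtain ⟨h1, -⟩ := ratio_bound hδ ha₁ ha₂
  obtain ⟨h2, -⟩ := ratio_bound hδ hb₂ hb₁
  have h3 : 1 - a₂ * b₁ / (a₁ * b₂) =
      -((a₂ / a₁ - 1) * (b₁ / b₂ - 1) + (a₂ / a₁ - 1) + (b₁ / b₂ - 1)) := by ring
  rw [h3, norm_neg]
  refine (norm_add₃_le).trans ?_
  rw [norm_mul]
  have h4 : 0 ≤ δ := (norm_nonneg _).trans ha₁
  have h5 : ‖a₂ / a₁ - 1‖ * ‖b₁ / b₂ - 1‖ ≤ 4 * δ * 1 := by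
    gcongr
    linarith
  linarith

include hΩ hΩ' hP hM in
theorem exists_solution_through (ε : ℝ) (lam : ℂ) (hp : p ∈ Ω) (v : ℂ × ℂ) : ∃ y, IsSol P M ε lam Ω
    y ∧ y p = v := by
  obtain ⟨F1, F2, h1, h2, h3, h4, -⟩ := exists_solution_basis hΩ hΩ' hP hM ε lam hp
  exact ⟨_, (h1.smul v.1).add (h2.smul v.2), by simp [h3, h4]⟩

include hΩ hΩ' hP hM in
/-- On two sides of the Stokes line the functionals `wPlus` are independent. -/
theorem IsGerm.exists_independent {d : ℂ} (hp : p ∈ Ω) (hg : IsGerm P M μ p H Z)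
    (hd : d = 1 ∨ d = -1) : ∃ B ∈ 𝓝 p, ∀ x1 ∈ B, ∀ x2 ∈ B, (Z x2 μ).re < (Z x1 μ).re → ∃ ε0 > 0, ∀ᶠ
    lam in 𝓝 μ, ∀ ε : ℝ, 0 < ε → ε < ε0 → ∀ v, IsSol P M ε lam Ω v → wPlus (H x1 lam) 0 ε (v x1) = 0
    → wPlus (d * I * H x2 lam) 0 ε (v x2) = 0 → ∀ x ∈ Ω, v x = 0 := by
  obtain ⟨B, hB, htr⟩ := hg.transfer hΩ hP hM hp
  refine ⟨B ∩ (Ω ∩ {x | IsGerm P M μ x H Z}), Filter.inter_mem hB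
    (Filter.inter_mem (hΩ.mem_nhds hp) hg.eventually), fun x1 hx₁ x2 hx₂ hre => ?_⟩
  have hH : ∀ᶠ lam in 𝓝 μ, H x2 lam ≠ 0 := (IsGerm.differentiableAt hx₂.2.2).mono fun _ h => h.2
  choose y hy hy2 using fun (ε : ℝ) (lam : ℂ) => exists_solution_through hΩ hΩ' hP hM ε lam hx₂.2.1
    (exp (Z x2 lam / ε) * (1 + 0) / H x2 lam,
      -I * exp (Z x2 lam / ε) * (1 - 0) * H x2 lam)
  have hw := htr (fun _ => x2) (fun _ => x1) continuousAt_const continuousAt_const hx₂.1 hx₁.1 hre y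
    ⟨1, one_pos, Eventually.of_forall fun lam ε _ _ => hy ε lam⟩ (by
      refine ⟨1, one_pos, 1, one_pos, ?_⟩
      filter_upwards [hH] with lam hl ε hε _
      obtain ⟨h1, h2⟩ := wPlus_wkb (E := Z x2 lam) hl ε 1 0
      rw [hy2, h1, h2]
      simp [hε.le])
  obtain ⟨C, hC, ε0, hε0, hw⟩ := hw
  refine ⟨min ε0 (1 / (2 * C)), by positivity, ?_⟩
  filter_upwards [hw, hH] with lam hw hl ε hε hε' v hv h1 h2
  have hne : wPlus (H x1 lam) 0 ε (y ε lam x1) ≠ 0 := fun h0 => by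
    have h3 := (hw ε hε (hε'.trans_le (min_le_left _ _))).1
    rw [wPlus_phase, h0, mul_zero, zero_sub, norm_neg, norm_one] at h3
    have h4 := hε'.trans_le (min_le_right _ _)
    rw [lt_div_iff₀ (by positivity)] at h4
    linarith
  set m := H x2 lam * (v x2).1 * exp (-(Z x2 lam / ε)) with hm
  have he : exp (-(Z x2 lam / ε)) * exp (Z x2 lam / ε) = 1 := by
    rw [← exp_add]; simp
  have hv2 : (v x2).2 = -I * H x2 lam ^ 2 * (v x2).1 := by
    rw [mul_assoc, wPlus_sign hd, mul_eq_zero] at h2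
    have h3 := h2.resolve_left (by rcases hd with rfl | rfl <;> norm_num)
    simp only [wPlus, zero_div, neg_zero, Complex.exp_zero, one_mul, div_eq_zero_iff] at h3
    have h4 := h3.resolve_right (by norm_num)
    have h5 : I * (v x2).2 / (I * H x2 lam) = (v x2).2 / H x2 lam := by
      rw [mul_div_mul_left _ _ I_ne_zero]
    rw [h5] at h4
    field_simp at h4
    linear_combination h4
  have hsub : IsSol P M ε lam Ω (fun x => v x - m • y ε lam x) := fun x hx => by
    rw [map_sub]; exact (hv x hx).sub (((hy ε lam).smul m) x hx)
  have hzero := fun x hx => hsub.eq_zero hΩ hΩ' hP hM hx₂.2.1 (by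
    rw [hy2, hm]
    ext
    · simp only [Prod.fst_sub, Prod.smul_fst, smul_eq_mul, Prod.fst_zero]
      field_simp
      linear_combination -(v x2).1 * he
    · simp only [Prod.snd_sub, Prod.smul_snd, smul_eq_mul, Prod.snd_zero, hv2]
      linear_combination I * H x2 lam ^ 2 * (v x2).1 * he) (x := x) hx
  have hvm : ∀ x ∈ Ω, v x = m • y ε lam x := fun x hx => sub_eq_zero.1 (hzero x hx)
  have hm0 : m = 0 := by
    rw [hvm x1 hx₁.2.1, wPlus_smul] at h1
    exact (mul_eq_zero.1 h1).resolve_right hne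
  intro x hx
  rw [hvm x hx, hm0, zero_smul]

include hΩ hΩ' hP hM in
theorem exists_comparison {d : ℂ} (hp : p ∈ Ω) (hg : IsGerm P M μ p H Z)
    (hg' : IsGerm P M μ p H' Z') (hH : H' p μ ^ 2 = -H p μ ^ 2) (hZp : (Z p μ).re = 0) {D J : ℂ → ℂ}
    (hD : ContinuousAt D μ) (hDp : D μ = p) (hJ : (J μ).re = 0)
    (hZ : ∀ᶠ lam in 𝓝 μ, Z' (D lam) lam = J lam - Z (D lam) lam) (hd : d = 1 ∨ d = -1) {V : Set ℂ}
    (hV : V ∈ 𝓝 μ) {yL yR : ℝ → ℂ → ℂ → ℂ × ℂ} {mL mR : ℝ → ℂ → ℂ} (hmL : ∀ ε lam, mL ε lam ≠ 0)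
    (hmR : ∀ ε lam, mR ε lam ≠ 0) (hLs : ∀ ε > 0, ∀ lam ∈ V, IsSol P M ε lam Ω (yL ε lam))
    (hRs : ∀ ε > 0, ∀ lam ∈ V, IsSol P M ε lam Ω (yR ε lam)) (hLd : ∀ ε > 0, ∀ x ∈ Ω,
    DifferentiableOn ℂ (fun lam => yL ε lam x) V) (hRd : ∀ ε > 0, ∀ x ∈ Ω, DifferentiableOn ℂ (fun
    lam => yR ε lam x) V) (hL : SideWKB μ (fun ε lam x => mL ε lam • yL ε lam x) p H Z (d * I)) (hR
    : SideWKB μ (fun ε lam x => mR ε lam • yR ε lam x) p H' Z' (d * I)) : ∃ s : ℂ, (s = 1 ∨ s = -1)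
    ∧ ∃ R > 0, ∃ C > 0, ∃ ε0 > 0, ball μ R ⊆ V ∧ ∃ T : ℝ → ℂ → ℂ, ∀ ε, 0 < ε → ε < ε0 →
    DifferentiableOn ℂ (T ε) (ball μ R) ∧ ∀ lam ∈ ball μ R, ‖T ε lam * exp (2 * J lam / ε) + 1‖ ≤ C
    * ε ∧ (T ε lam = 1 ↔ ∃ k : ℂ, ∀ x ∈ Ω, yR ε lam x = k • yL ε lam x) ∧ ∀ k : ℂ, (∀ x ∈ Ω, mR ε
    lam • yR ε lam x = k • mL ε lam • yL ε lam x) → ‖k * exp (J lam / ε) - s‖ ≤ C * ε ∧ ‖k * exp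
    (-(J lam / ε)) + s‖ ≤ C * ε := by
  obtain ⟨b, hb, hbH⟩ : ∃ b : ℂ, (b = 1 ∨ b = -1) ∧ H' p μ = b * I * H p μ := by
    have h1 : H' p μ ^ 2 = (I * H p μ) ^ 2 := by
      rw [hH, mul_pow, I_sq]; ring
    rcases sq_eq_sq_iff_eq_or_eq_neg.1 h1 with h | h
    · exact ⟨1, Or.inl rfl, by rw [h, one_mul]⟩
    · exact ⟨-1, Or.inr rfl, by rw [h]; ring⟩
  have hb2 : b ^ 2 = 1 := by rcases hb with rfl | rfl <;> norm_num
  have hd2 : d ^ 2 = 1 := by rcases hd with rfl | rfl <;> norm_num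
  have hgb := hg.mul_const (c := b * I) (e := -1)
    (by rw [mul_pow, hb2, I_sq]; ring) (by norm_num) J
  have hR' := hR.congr (hg'.eventuallyEq hgb hbH hD hDp (by
    filter_upwards [hZ] with lam h
    rw [h]; ring))
  set s : ℂ := -(d * b) with hs
  have hs1 : s = 1 ∨ s = -1 := by
    rcases hd with rfl | rfl <;> rcases hb with rfl | rfl <;> simp [hs]
  have hs2 : s * s = 1 := by rw [hs]; linear_combination d ^ 2 * hb2 + hd2
  have hs1' : -s = 1 ∨ -s = -1 := by rcases hs1 with h | h <;> simp [h]
  obtain ⟨B, hB, hind⟩ := hg.exists_independent hΩ hΩ' hP hM hp hd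
  obtain ⟨η, hη, hex⟩ := hg.exists_re hZp (hL.and (hR'.and
    ((eventually_of_mem hB fun x hx => hx).and
      (hg.eventually.and (hΩ.mem_nhds hp)))))
  obtain ⟨x1, ⟨hL1, hR1, hB1, hg1, hΩ1⟩, hx₁⟩ := hex (η / 2) (by rw [abs_of_pos] <;> linarith)
  obtain ⟨x2, ⟨hL2, hR2, hB2, hg2, hΩ2⟩, hx₂⟩ := hex (-(η / 2))
    (by rw [abs_neg, abs_of_pos] <;> linarith)
  obtain ⟨ε5, hε₅, W5⟩ := hind x1 hB1 x2 hB2 (by rw [hx₁, hx₂]; linarith)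
  have hL1 := hL1.1 (by rw [hx₁]; linarith)
  have hL2 := hL2.2 (by rw [hx₂]; linarith)
  have hR1 := hR1.2 (by simp only [neg_mul, one_mul, Complex.add_re, Complex.neg_re, hJ, hx₁]
                        linarith)
  have hR2 := hR2.1 (by simp only [neg_mul, one_mul, Complex.add_re, Complex.neg_re, hJ, hx₂]
                        linarith)
  have hR1 := HasWKB.smul hs1 (h := H x1) (hR1.congr (h' := fun lam => s * H x1 lam)
    EventuallyEq.rfl EventuallyEq.rfl (Eventually.of_forall fun lam => by
      simp only [hs]; linear_combination (d * b * H x1 lam) * I_sq))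
  have hR2 := HasWKB.smul hs1' (h := fun lam => d * I * H x2 lam)
    (hR2.congr (h' := fun lam => -s * (d * I * H x2 lam))
    EventuallyEq.rfl EventuallyEq.rfl (Eventually.of_forall fun lam => by
      simp only [hs]; linear_combination (-b * I * H x2 lam) * hd2))
  obtain ⟨C1, hC1, ε1, hε₁, W1⟩ := hL1
  obtain ⟨C2, hC2, ε2, hε₂, W2⟩ := hL2
  obtain ⟨C3, hC3, ε3, hε₃, W3⟩ := hR1
  obtain ⟨C4, hC4, ε4, hε4, W4⟩ := hR2
  obtain ⟨R, hR0, hball⟩ := Metric.eventually_nhds_iff_ball.1 (W1.and (W2.and (W3.and (W4.and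
    (W5.and (hg1.differentiableAt.and (hg2.differentiableAt.and hV)))))))
  set C := C1 + C2 + C3 + C4 with hC
  have hC0 : 0 < C := by positivity
  set ε0 := min (min ε1 ε2) (min (min ε3 ε4) (min ε5 (1 / (4 * C)))) with hε0
  have hε00 : 0 < ε0 := by positivity
  have hd0 : d ≠ 0 := by rcases hd with rfl | rfl <;> norm_num
  set f₁ : ℝ → ℂ → (ℂ → ℂ × ℂ) → ℂ := fun ε lam v => wPlus (H x1 lam) 0 ε (v x1) with hf1
  set f₂ : ℝ → ℂ → (ℂ → ℂ × ℂ) → ℂ :=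
    fun ε lam v => wPlus (d * I * H x2 lam) 0 ε (v x2) with hf2
  have hmain : ∀ ε : ℝ, 0 < ε → ε < ε0 → ∀ lam ∈ ball μ R, ∃ a₁ a₂ b₁ b₂ u1 u2 j : ℂ,
      C * ε ≤ 1 / 4 ∧ ‖a₁ - 1‖ ≤ C * ε ∧ ‖a₂ - 1‖ ≤ C * ε ∧ ‖b₁ - 1‖ ≤ C * ε ∧
      ‖b₂ - 1‖ ≤ C * ε ∧ u1 ≠ 0 ∧ u2 ≠ 0 ∧ j = exp (J lam / ε) ∧
      mL ε lam * f₁ ε lam (yL ε lam) = u1 * a₁ ∧ mL ε lam * f₂ ε lam (yL ε lam) = u2 * a₂ ∧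
      mR ε lam * f₁ ε lam (yR ε lam) * j = s * u1 * b₁ ∧
      mR ε lam * f₂ ε lam (yR ε lam) = -s * u2 * b₂ * j := by
    intro ε hε hε' lam hl
    obtain ⟨w₁, w2, w3, w4, -⟩ := hball lam hl
    simp only [lt_min_iff, hε0] at hε'
    obtain ⟨⟨e1, e2⟩, ⟨e3, e4⟩, e5, e6⟩ := hε'
    rw [lt_div_iff₀ (by positivity)] at e6
    have w₁ := (w₁ ε hε e1).1
    have w2 := (w2 ε hε e2).1
    have w3 := (w3 ε hε e3).1
    have w4 := (w4 ε hε e4).1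
    have hexp : ∀ z : ℂ, exp z * exp (-z) = 1 := fun z => by
      rw [← exp_add]; simp
    have hsplit : ∀ z w : ℂ, exp (-((z + w) / ε)) = exp (-(z / ε)) * exp (-(w / ε)) := fun z w => by
      rw [← exp_add]; congr 1; ring
    refine ⟨_, _, _, _, exp (Z x1 lam / ε), exp (-(Z x2 lam / ε)),
      exp (J lam / ε), by linarith, w₁.trans ?_, w2.trans ?_, w3.trans ?_, w4.trans ?_,
      exp_ne_zero _, exp_ne_zero _, rfl, ?_, ?_, ?_, ?_⟩
    iterate 4 exact mul_le_mul_of_nonneg_right (by linarith) hε.le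
    · rw [wPlus_phase, wPlus_smul, ← mul_assoc, hexp, one_mul]
    · rw [wPlus_phase, wPlus_smul, neg_div, neg_neg, ← mul_assoc, mul_comm (exp _), hexp, one_mul]
    · have h1 : -((-(-1 * Z x1 lam + J lam)) / ε) = -(Z x1 lam / ε) + J lam / ε := by ring
      rw [wPlus_phase, wPlus_smul, wPlus_smul, h1, exp_add]
      simp only [hf1]
      linear_combination (-(mR ε lam * wPlus (H x1 lam) 0 ε (yR ε lam x1) *
        exp (J lam / ε))) * (s * s * hexp (Z x1 lam / ε) + hs2)
    · have h1 : -((-1 * Z x2 lam + J lam) / ε) = Z x2 lam / ε + -(J lam / ε) := by ring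
      rw [wPlus_phase, wPlus_smul, wPlus_smul, h1, exp_add]
      simp only [hf2]
      linear_combination (-(mR ε lam * wPlus (d * I * H x2 lam) 0 ε (yR ε lam x2))) *
        (hs2 + s * s * hexp (Z x2 lam / ε) + s * s * exp (Z x2 lam / ε) *
          exp (-(Z x2 lam / ε)) * hexp (J lam / ε))
  refine ⟨s, hs1, R, hR0, 16 * C, by positivity, ε0, hε00, fun lam hl => (hball lam hl).2.2.2.2.2.2.2,
    fun ε lam => f₁ ε lam (yR ε lam) * f₂ ε lam (yL ε lam) /
      (f₁ ε lam (yL ε lam) * f₂ ε lam (yR ε lam)), fun ε hε hε' => ?_⟩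
  have hne : ∀ lam ∈ ball μ R, f₁ ε lam (yL ε lam) ≠ 0 ∧ f₂ ε lam (yL ε lam) ≠ 0 ∧
      f₁ ε lam (yR ε lam) ≠ 0 ∧ f₂ ε lam (yR ε lam) ≠ 0 := by
    intro lam hl
    obtain ⟨a₁, a₂, b₁, b₂, u1, u2, j, h4, k1, k2, k3, k4, hu1, hu2, hj, q1, q2, q3, q4⟩ :=
      hmain ε hε hε' lam hl
    have hj0 : j ≠ 0 := by rw [hj]; exact exp_ne_zero _
    have hs0 : s ≠ 0 := left_ne_zero_of_mul_eq_one hs2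
    have n1 := (ratio_bound h4 k1 k1).2
    have n2 := (ratio_bound h4 k2 k1).2
    have n3 := (ratio_bound h4 k3 k1).2
    have n4 := (ratio_bound h4 k4 k1).2
    refine ⟨fun h => ?_, fun h => ?_, fun h => ?_, fun h => ?_⟩
    · rw [h, mul_zero] at q1; exact mul_ne_zero hu1 n1 q1.symm
    · rw [h, mul_zero] at q2; exact mul_ne_zero hu2 n2 q2.symm
    · rw [h, mul_zero, zero_mul] at q3; exact mul_ne_zero (mul_ne_zero hs0 hu1) n3 q3.symm
    · rw [h, mul_zero] at q4
      exact mul_ne_zero (mul_ne_zero (mul_ne_zero (neg_ne_zero.2 hs0) hu2) n4) hj0 q4.symm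
  have hsub : ball μ R ⊆ V := fun lam hl => (hball lam hl).2.2.2.2.2.2.2
  constructor
  · have hd1 : DifferentiableOn ℂ (H x1) (ball μ R) := fun lam hl =>
      (hball lam hl).2.2.2.2.2.1.1.differentiableWithinAt
    have hd2 : DifferentiableOn ℂ (fun lam => d * I * H x2 lam) (ball μ R) :=
      fun lam hl => ((hball lam hl).2.2.2.2.2.2.1.1.const_mul _).differentiableWithinAt
    have hn1 : ∀ lam ∈ ball μ R, H x1 lam ≠ 0 := fun lam hl =>
      (hball lam hl).2.2.2.2.2.1.2
    have hn2 : ∀ lam ∈ ball μ R, d * I * H x2 lam ≠ 0 := fun lam hl =>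
      mul_ne_zero (mul_ne_zero hd0 I_ne_zero) (hball lam hl).2.2.2.2.2.2.1.2
    have hc := differentiableOn_const (𝕜 := ℂ) (s := ball μ R) (0 : ℂ)
    exact (((differentiableOn_wPlus hd1 hn1 hc ((hRd ε hε x1 hΩ1).mono hsub)).1.mul
      (differentiableOn_wPlus hd2 hn2 hc ((hLd ε hε x2 hΩ2).mono hsub)).1).div
      ((differentiableOn_wPlus hd1 hn1 hc ((hLd ε hε x1 hΩ1).mono hsub)).1.mul
      (differentiableOn_wPlus hd2 hn2 hc ((hRd ε hε x2 hΩ2).mono hsub)).1))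
      fun lam hl => mul_ne_zero (hne lam hl).1 (hne lam hl).2.2.2
  intro lam hl
  obtain ⟨n1, n2, n3, n4⟩ := hne lam hl
  obtain ⟨a₁, a₂, b₁, b₂, u1, u2, j, h4, k1, k2, k3, k4, hu1, hu2, hj, q1, q2, q3, q4⟩ :=
    hmain ε hε hε' lam hl
  have hj0 : j ≠ 0 := by rw [hj]; exact exp_ne_zero _
  have hmL0 := hmL ε lam
  have hmR0 := hmR ε lam
  have m1 := (ratio_bound h4 k1 k1).2
  have m2 := (ratio_bound h4 k2 k1).2
  have m4 := (ratio_bound h4 k4 k1).2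
  refine ⟨?_, ⟨fun hT => ?_, fun ⟨k, hk⟩ => ?_⟩, fun k hk => ?_⟩
  · have h5 : f₁ ε lam (yR ε lam) * f₂ ε lam (yL ε lam) /
        (f₁ ε lam (yL ε lam) * f₂ ε lam (yR ε lam)) * exp (2 * J lam / ε) + 1 =
        1 - a₂ * b₁ / (a₁ * b₂) := by
      have h6 : exp (2 * J lam / ε) = j * j := by
        rw [hj, ← exp_add]; congr 1; ring
      rw [h6, sub_eq_add_neg, add_comm]
      congr 1
      rw [div_mul_eq_mul_div, ← neg_div, div_eq_div_iff (mul_ne_zero n1 n4) (mul_ne_zero m1 m4)]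
      have h7 : mL ε lam * mR ε lam * u1 * u2 * s * j ≠ 0 := by
        have hs0 : s ≠ 0 := left_ne_zero_of_mul_eq_one hs2
        simp only [ne_eq, mul_eq_zero, not_or]
        exact ⟨⟨⟨⟨⟨hmL0, hmR0⟩, hu1⟩, hu2⟩, hs0⟩, hj0⟩
      apply mul_left_cancel₀ h7
      linear_combination
        (u1 * u2 * s * j * j * a₁ * b₂ * mR ε lam * f₁ ε lam (yR ε lam) * j) * q2 +
        (u1 * u2 * s * j * j * a₁ * b₂ * u2 * a₂) * q3 +
        (a₂ * b₁ * u1 * u2 * s * j * mR ε lam * f₂ ε lam (yR ε lam)) * q1 +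
        (a₂ * b₁ * u1 * u2 * s * j * u1 * a₁) * q4
    rw [h5]
    calc _ ≤ 16 * (C * ε) := cross_ratio_bound h4 k1 k2 k3 k4
      _ = 16 * C * ε := by ring
  · rw [div_eq_one_iff_eq (mul_ne_zero n1 n4)] at hT
    refine ⟨f₂ ε lam (yR ε lam) / f₂ ε lam (yL ε lam), ?_⟩
    set k := f₂ ε lam (yR ε lam) / f₂ ε lam (yL ε lam) with hk
    have hkf : k * f₂ ε lam (yL ε lam) = f₂ ε lam (yR ε lam) := div_mul_cancel₀ _ n2
    have hv : IsSol P M ε lam Ω (fun x => yR ε lam x - k • yL ε lam x) := fun x hx => by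
      rw [map_sub]
      exact (hRs ε hε lam (hsub hl) x hx).sub (((hLs ε hε lam (hsub hl)).smul k) x hx)
    have hε5 : ε < ε5 := by
      simp only [lt_min_iff, hε0] at hε'
      exact hε'.2.2.1
    have h0 := (hball lam hl).2.2.2.2.1 ε hε hε5 _ hv (by
      rw [wPlus_sub, wPlus_smul]
      apply mul_right_cancel₀ n2
      simp only [hf1] at hT ⊢
      linear_combination hT - wPlus (H x1 lam) 0 ε (yL ε lam x1) * hkf) (by
      rw [wPlus_sub, wPlus_smul]
      exact sub_eq_zero.2 hkf.symm)
    exact fun x hx => sub_eq_zero.1 (h0 x hx)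
  · have g1 : f₁ ε lam (yR ε lam) = k * f₁ ε lam (yL ε lam) := by
      simp only [hf1]; rw [hk x1 hΩ1, wPlus_smul]
    have g2 : f₂ ε lam (yR ε lam) = k * f₂ ε lam (yL ε lam) := by
      simp only [hf2]; rw [hk x2 hΩ2, wPlus_smul]
    rw [div_eq_one_iff_eq (mul_ne_zero n1 n4), g1, g2]
    ring
  · have g1 : mR ε lam * f₁ ε lam (yR ε lam) = k * (mL ε lam * f₁ ε lam (yL ε lam)) := by
      have := congrArg (wPlus (H x1 lam) 0 ε) (hk x1 hΩ1)
      simpa only [wPlus_smul] using this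
    have g2 : mR ε lam * f₂ ε lam (yR ε lam) = k * (mL ε lam * f₂ ε lam (yL ε lam)) := by
      have := congrArg (wPlus (d * I * H x2 lam) 0 ε) (hk x2 hΩ2)
      simpa only [wPlus_smul] using this
    rw [q1] at g1
    rw [q2] at g2
    rw [g1] at q3
    rw [g2] at q4
    have r1 : k * j = s * (b₁ / a₁) := by
      rw [mul_div_assoc', eq_div_iff m1]
      apply mul_left_cancel₀ hu1
      linear_combination q3
    have r2 : k * exp (-(J lam / ε)) = -s * (b₂ / a₂) := by
      rw [Complex.exp_neg, ← hj, ← div_eq_mul_inv, mul_div_assoc', div_eq_div_iff hj0 m2]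
      apply mul_left_cancel₀ hu2
      linear_combination q4
    have hsn : ‖s‖ = 1 := by rcases hs1 with h | h <;> simp [h]
    have c1 := (ratio_bound h4 k1 k3).1
    have c2 := (ratio_bound h4 k2 k4).1
    have hCε : 0 < C * ε := by positivity
    rw [← hj, r1, r2]
    constructor
    · rw [show s * (b₁ / a₁) - s = s * (b₁ / a₁ - 1) by ring, norm_mul, hsn]
      linarith
    · rw [show -s * (b₂ / a₂) + s = -s * (b₂ / a₂ - 1) by ring, norm_mul, norm_neg, hsn]
      linarith

/-- `-S'/2 + c A`; for `c = -i` this is `g₊ + lam`, for `c = i` it is `lam - g₋`. -/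
noncomputable def pot (A S : ℂ → ℂ) (c x : ℂ) : ℂ := -(deriv S x / 2) + c * A x

theorem V0_eq (A S : ℂ → ℂ) (lam x : ℂ) : V0 A S lam x = (pot A S (-I) x - lam) * (lam - pot A S I
    x) := by
  simp only [V0, pot]
  linear_combination -(A x ^ 2) * I_sq

theorem gPlus_eq (A S : ℂ → ℂ) (lam x : ℂ) : gPlus A S lam x = pot A S (-I) x - lam := by
  simp only [gPlus, pot]; ring

theorem gMinus_eq (A S : ℂ → ℂ) (lam x : ℂ) : gMinus A S lam x = lam - pot A S I x := by
  simp only [gMinus, pot]; ring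

include hΩ in
theorem tendsto_zero_of_holomorphic {f : ℂ → ℂ} (hr : ∀ x : ℝ, (x : ℂ) ∈ Ω)
    (hf : DifferentiableOn ℂ f Ω) (hi : Integrable (fun x : ℝ => f x))
    (hi' : Integrable (fun x : ℝ => deriv f x)) : Tendsto (fun x : ℝ => f x) atBot (𝓝 0) ∧ Tendsto
    (fun x : ℝ => f x) atTop (𝓝 0) := by
  have hd : ∀ x : ℝ, HasDerivAt (fun x : ℝ => f x) (deriv f x) x := fun x =>
    (hf.differentiableAt (hΩ.mem_nhds (hr x))).hasDerivAt.comp_ofReal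
  exact ⟨tendsto_zero_of_hasDerivAt_of_integrableOn_Iic (a := 0) (fun x _ => hd x)
    hi'.integrableOn hi.integrableOn,
    tendsto_zero_of_hasDerivAt_of_integrableOn_Ioi (a := 0) (fun x _ => hd x)
    hi'.integrableOn hi.integrableOn⟩

theorem AdmissiblePotentials.pot_facts (h : AdmissiblePotentials Ω A S) (c : ℂ) : DifferentiableOn ℂ
    (pot A S c) Ω ∧ Tendsto (fun x : ℝ => pot A S c x) atBot (𝓝 0) ∧ Tendsto (fun x : ℝ => pot A S c
    x) atTop (𝓝 0) ∧ Integrable (fun x : ℝ => deriv (pot A S c) x) ∧ ∃ K : ℝ, ∀ x : ℝ, ‖deriv (pot A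
    S c) x‖ ≤ K := by
  have hS' : DifferentiableOn ℂ (deriv S) Ω := h.holomorphic_S.deriv h.isOpen
  have hder : ∀ x : ℝ, deriv (pot A S c) x = -(deriv (deriv S) x / 2) + c * deriv A x := fun x =>
    have hx := h.isOpen.mem_nhds (h.real_mem x)
    ((((hS'.differentiableAt hx).hasDerivAt.div_const 2).neg).add
      ((h.holomorphic_A.differentiableAt hx).hasDerivAt.const_mul c)).deriv
  obtain ⟨a1, a2⟩ := tendsto_zero_of_holomorphic h.isOpen h.real_mem h.holomorphic_A
    h.integrable_A h.integrable_A'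
  obtain ⟨b1, b2⟩ := tendsto_zero_of_holomorphic h.isOpen h.real_mem hS'
    h.integrable_S' h.integrable_S''
  refine ⟨((hS'.div_const 2).neg).add (h.holomorphic_A.const_mul c), ?_, ?_, ?_, ?_⟩
  · simpa [pot] using ((b1.div_const 2).neg).add (a1.const_mul c)
  · simpa [pot] using ((b2.div_const 2).neg).add (a2.const_mul c)
  · simp only [hder]
    exact ((h.integrable_S''.div_const 2).neg).add (h.integrable_A'.const_mul c)
  · obtain ⟨K, hK⟩ := h.bounded
    refine ⟨K / 2 + ‖c‖ * K, fun x => ?_⟩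
    rw [hder]
    refine (norm_add_le _ _).trans (add_le_add ?_ ?_)
    · rw [norm_neg, norm_div, RCLike.norm_ofNat]
      exact div_le_div_of_nonneg_right (hK x).2 zero_le_two
    · rw [norm_mul]; exact mul_le_mul_of_nonneg_left (hK x).1 (norm_nonneg _)

theorem bump_neg (s : ℝ) : bump (-s) = bump s := by simp [bump]

theorem deformed_reflect (γ : ℝ → ℂ) (α β : ℂ → ℂ) (lam : ℂ) (s : ℝ) : deformed (fun s => γ (1 - s))
    β α lam s = deformed γ α β lam (1 - s) := by
  have h1 : bump (1 - s) = bump (s - 1) := by rw [← bump_neg]; ring_nf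
  have h2 : bump (1 - s - 1) = bump s := by rw [← bump_neg]; ring_nf
  simp only [deformed, h1, h2, sub_zero, sub_self]
  ring

theorem derivWithin_reflect (γ : ℝ → ℂ) {K K' : Set ℝ} (h : ∀ x, x ∈ K ↔ 1 - x ∈ K') (s : ℝ) :
    derivWithin (fun s => γ (1 - s)) K s = -derivWithin γ K' (1 - s) := by
  rw [derivWithin_comp_const_sub]
  congr 2
  ext x
  rw [Set.mem_vadd_set_iff_neg_vadd_mem, Set.mem_neg, h]
  simp

theorem armPhase_reflect (γ : ℝ → ℂ) (α β : ℂ → ℂ) (r : ℂ → ℝ → ℂ) (lam : ℂ) (s : ℝ) : armPhase (fun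
    s => γ (1 - s)) β α (fun lam s => -r lam (1 - s)) lam s = ∫ t in (1 - s)..1, r lam t * deriv
    (deformed γ α β lam) t := by
  have h : ∀ t, -r lam (1 - t) * deriv (deformed (fun s => γ (1 - s)) β α lam) t =
      (fun t => r lam t * deriv (deformed γ α β lam) t) (1 - t) := fun t => by
    have : deformed (fun s => γ (1 - s)) β α lam = fun t => deformed γ α β lam (1 - t) :=
      funext (deformed_reflect γ α β lam)
    rw [this, deriv_comp_const_sub]
    simp
  simp only [armPhase, h]
  rw [intervalIntegral.integral_comp_sub_left (fun t => r lam t * deriv (deformed γ α β lam) t) 1]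
  simp

/-- A branch along a Stokes line can be normalized so that `Im z` decreases. -/
theorem exists_stokes_sign {f : ℝ → ℂ} (hc : ContinuousOn f (Ioo 0 1))
    (h0 : ∀ s ∈ Ioo (0 : ℝ) 1, f s ≠ 0) (hre : ∀ s ∈ Ioo (0 : ℝ) 1, (f s).re = 0) : ∃ σ : ℂ, (σ = 1
    ∨ σ = -1) ∧ ∀ s ∈ Ioo (0 : ℝ) 1, (σ * f s).re = 0 ∧ (σ * f s).im < 0 := by
  have him : ∀ s ∈ Ioo (0 : ℝ) 1, (f s).im ≠ 0 := fun s hs h =>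
    h0 s hs (Complex.ext (hre s hs) h)
  have hci : ContinuousOn (fun s => (f s).im) (Ioo 0 1) := Complex.continuous_im.comp_continuousOn hc
  have hord := (isPreconnected_Ioo (a := (0 : ℝ)) (b := 1)).image _ hci |>.ordConnected
  have hm : (1 / 2 : ℝ) ∈ Ioo (0 : ℝ) 1 := by norm_num
  have key : ∀ s ∈ Ioo (0 : ℝ) 1, ∀ t ∈ Ioo (0 : ℝ) 1, (f s).im < 0 → (f t).im < 0 := by
    intro s hs t ht h1
    by_contra h2
    obtain ⟨u, hu, hu'⟩ := hord.out (mem_image_of_mem _ hs) (mem_image_of_mem _ ht)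
      (show (0 : ℝ) ∈ Icc _ _ from ⟨h1.le, not_lt.1 h2⟩)
    exact him u hu hu'
  by_cases h : (f (1 / 2)).im < 0
  · exact ⟨1, Or.inl rfl, fun s hs => by simpa using ⟨hre s hs, key _ hm s hs h⟩⟩
  · refine ⟨-1, Or.inr rfl, fun s hs => ?_⟩
    have h1 : ¬ (f s).im < 0 := fun h1 => h (key s hs _ hm h1)
    have h2 := lt_of_le_of_ne (not_lt.1 h1) (him s hs).symm
    simpa using ⟨hre s hs, h2⟩

theorem IsStokes.re_eq_zero {J : Set ℝ} (hJ : IsOpen J) (hJ' : J.OrdConnected)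
    (h : IsStokes A S μ γ J) (hγ : ContinuousOn (deriv γ) J) {q : ℝ → ℂ}
    (hq : IsSqrtBranch A S μ γ q J) : ∀ s ∈ J, (I * q s * deriv γ s).re = 0 := by
  obtain ⟨p, hp, hph⟩ := h
  intro s hs
  have hc : ContinuousOn (fun t => p t * deriv γ t) J := hp.1.mul hγ
  have key : (I * p s * deriv γ s).re = 0 := by
    obtain ⟨u, hu⟩ := Metric.isOpen_iff.1 hJ s hs
    have hsm : s - u / 2 ∈ J := hu.2 (by
      have := hu.1
      rw [Metric.mem_ball, Real.dist_eq, sub_sub_cancel_left, abs_neg, abs_of_pos] <;> linarith)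
    have hsu : s - u / 2 < s := by have := hu.1; linarith
    have hint : IntervalIntegrable (fun t => p t * deriv γ t) volume (s - u / 2) s :=
      ContinuousOn.intervalIntegrable (hc.mono (by
        rw [uIcc_of_le hsu.le]; exact hJ'.out hsm hs))
    have h1 : HasDerivAt (fun t => phase γ p (s - u / 2) t) (I * (p s * deriv γ s)) s :=
      (intervalIntegral.integral_hasDerivAt_right hint
        (hc.stronglyMeasurableAtFilter hJ s hs) (hc.continuousAt (hJ.mem_nhds hs))).const_mul _
    have h2 : HasDerivAt (fun t => (phase γ p (s - u / 2) t).re) (I * (p s * deriv γ s)).re s :=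
      (Complex.reCLM.hasFDerivAt.comp_hasDerivAt s h1)
    have h3 : (fun t => (phase γ p (s - u / 2) t).re) =ᶠ[𝓝 s] fun _ => 0 := by
      filter_upwards [hJ.mem_nhds hs, Ioi_mem_nhds hsu] with t ht ht' using hph _ hsm t ht ht'
    rw [mul_assoc]
    exact h2.unique ((hasDerivAt_const s (0 : ℝ)).congr_of_eventuallyEq h3)
  rcases sq_eq_sq_iff_eq_or_eq_neg.1 ((hq.2 s hs).trans (hp.2 s hs).symm) with h | h
  · rw [h]; exact key
  · rw [h, mul_neg, neg_mul, Complex.neg_re, key, neg_zero]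

/-- The two halves of an admissible contour. -/
theorem IsAdmissibleContour.exists_halfContours (hAS : AdmissiblePotentials Ω A S) (hlam : μ.im ≠ 0)
    (hγ : IsAdmissibleContour A S Ω μ γ) (H1 : ∀ s ∈ Ioo (0 : ℝ) 1, V0 A S μ (γ s) ≠ 0)
    (hα : IsTurningPointFamily A S μ (γ 0) α) (hβ : IsTurningPointFamily A S μ (γ 1) β)
    (hU : U ∈ 𝓝 μ) (W : Branches A S γ α β U) : ∃ σ : ℂ, (σ = 1 ∨ σ = -1) ∧ HalfContour (pot A S
    (-I)) (pot A S I) Ω μ γ α β U (fun lam s => I * W.qL lam s) W.HL (fun lam s => σ * I * W.qC lam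
    s) 0 1 ∧ HalfContour (pot A S (-I)) (pot A S I) Ω μ (fun s => γ (1 - s)) β α U (fun lam s => -(I
    * W.qR lam (1 - s))) (fun lam s => I * W.HR lam (1 - s)) (fun lam s => -(σ * I * W.qC lam (1 -
    s))) 1 (-1) := by
  obtain ⟨p1, p2, p3, p4, K, hK⟩ := hAS.pot_facts (-I)
  obtain ⟨m1, m2, m3, m4, K', hK'⟩ := hAS.pot_facts I
  have hU0 := mem_of_mem_nhds hU
  have hbase : deformed γ α β μ = γ := deformed_base hα.1 hβ.1
  have hsq : ∀ c : ℂ, c ^ 2 = -1 → ∀ lam x q, q ^ 2 = -V0 A S lam x → (c * q) ^ 2 =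
      (pot A S (-I) x - lam) * (lam - pot A S I x) := fun c hc lam x q h => by
    rw [mul_pow, h, hc, V0_eq]; ring
  have hI : I ^ 2 = -1 := I_sq
  have hnI : (-I) ^ 2 = -1 := by rw [neg_sq, I_sq]
  have hdγ : ∀ s ∈ Ioo (0 : ℝ) 1, deriv γ s = derivWithin γ (Icc 0 1) s := fun s hs =>
    (derivWithin_of_mem_nhds (Icc_mem_nhds hs.1 hs.2)).symm
  have hcγ : ContinuousOn (deriv γ) (Ioo 0 1) :=
    ((hγ.smooth_mid.continuousOn_derivWithin (uniqueDiffOn_Icc one_pos) le_rfl).mono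
      Ioo_subset_Icc_self).congr hdγ
  have hqC := W.sqrt_C μ hU0
  rw [hbase] at hqC
  obtain ⟨σ, hσ, hst⟩ := exists_stokes_sign (f := fun s => I * W.qC μ s * deriv γ s)
    ((continuousOn_const.mul hqC.1).mul hcγ)
    (fun s hs => mul_ne_zero (mul_ne_zero I_ne_zero fun h => H1 s hs (by
        have := hqC.2 s hs
        rw [h] at this
        linear_combination this))
      (by rw [hdγ s hs]; exact hγ.regular_mid s (Ioo_subset_Icc_self hs)))
    (hγ.stokes.re_eq_zero isOpen_Ioo ordConnected_Ioo hcγ hqC)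
  have hσ2 : σ ^ 2 = 1 := by rcases hσ with rfl | rfl <;> norm_num
  have hsI : (σ * I) ^ 2 = -1 := by rw [mul_pow, hσ2, hI, one_mul]
  have hnsI : (-(σ * I)) ^ 2 = -1 := by rw [neg_sq, hsI]
  have hfl : Continuous fun v : ℂ × ℝ => (v.1, 1 - v.2) := by fun_prop
  have mfl : MapsTo (fun v : ℂ × ℝ => (v.1, 1 - v.2)) (U ×ˢ Ioo 0 1) (U ×ˢ Ioo 0 1) :=
    fun v hv => ⟨hv.1, by have := hv.2.1; have := hv.2.2; constructor <;> simp only <;> linarith⟩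
  have mfr : MapsTo (fun v : ℂ × ℝ => (v.1, 1 - v.2)) (U ×ˢ Iio 0) (U ×ˢ Ioi 1) :=
    fun v hv => ⟨hv.1, by have : v.2 < 0 := hv.2; simp only [mem_Ioi]; linarith⟩
  have hmid : ∀ s ∈ Ioo (0 : ℝ) 1, 1 - s ∈ Ioo (0 : ℝ) 1 := fun s hs =>
    ⟨by linarith [hs.2], by linarith [hs.1]⟩
  have hrt : ∀ s : ℝ, s < 0 → 1 < 1 - s := fun s hs => by linarith
  have htop : Tendsto (fun s : ℝ => 1 - s) atBot atTop := tendsto_atTop_add_const_left _ 1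
    tendsto_neg_atBot_atTop
  have hVe : V0 A S μ = fun x => (pot A S (-I) x - μ) * (μ - pot A S I x) :=
    funext (V0_eq A S μ)
  have hb : ∃ K : ℝ, ∀ x : ℝ, ‖deriv (pot A S (-I)) x‖ ≤ K ∧ ‖deriv (pot A S I) x‖ ≤ K :=
    ⟨max K K', fun x => ⟨(hK x).trans (le_max_left _ _), (hK' x).trans (le_max_right _ _)⟩⟩
  have ta : ∀ {a : ℂ → ℂ} {a₀ : ℂ}, IsTurningPointFamily A S μ a₀ a → ∀ᶠ lam in 𝓝 μ,
      (pot A S (-I) (a lam) - lam) * (lam - pot A S I (a lam)) = 0 := fun h => by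
    filter_upwards [h.2.2] with lam h1
    rwa [← V0_eq]
  have dW0 : ∀ s, derivWithin (fun s => γ (1 - s)) (Iic 0) s = -derivWithin γ (Ici 1) (1 - s) :=
    derivWithin_reflect γ fun x => by simp
  have dW1 : ∀ s, derivWithin (fun s => γ (1 - s)) (Icc 0 1) s = -derivWithin γ (Icc 0 1) (1 - s) :=
    derivWithin_reflect γ fun x => by simp only [mem_Icc]; constructor <;> intro h <;>
      constructor <;> linarith [h.1, h.2]
  have sm : ContDiff ℝ 1 fun s : ℝ => 1 - s := contDiff_const.sub contDiff_id
  refine ⟨σ, hσ, ⟨hAS.isOpen, hAS.simplyConnected, p1, m1, hU, hlam, Or.inl rfl, ?_, hAS.real_mem,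
    by simpa using p2, by simpa using m2, p4, m4, hb, hγ.mem, hγ.continuous, hγ.smooth_left,
    hγ.smooth_mid, hγ.regular_left, hγ.regular_mid, hα.1, hα.2.1, ta hα, hβ.1, hβ.2.1, ?_, ta hβ, ?_,
    fun s hs => ?_, fun s hs => ?_, ?_, W.continuous_HL, ?_, fun lam hl s hs => ?_,
    fun lam hl s hs => ?_, fun lam hl s hs => ?_, fun lam hl => ?_, ?_, fun s hs => ?_,
    fun s hs => ?_, hγ.sector_left⟩,
    ⟨hAS.isOpen, hAS.simplyConnected, p1, m1, hU, hlam, Or.inr rfl, ?_, hAS.real_mem,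
    ?_, ?_, p4, m4, hb, fun s => hγ.mem _, hγ.continuous.comp (by fun_prop), ?_,
    ?_, ?_, ?_, ?_, hβ.2.1, ta hβ, ?_, hα.2.1, ?_, ta hα, ?_,
    fun s hs => ?_, fun s hs => ?_, ?_, ?_, ?_, fun lam hl s hs => ?_,
    fun lam hl s hs => ?_, fun lam hl s hs => ?_, fun lam hl => ?_, ?_, fun s hs => ?_,
    fun s hs => ?_, ?_⟩⟩
  · simpa using hγ.real_left
  · rw [← hVe]; exact hγ.turning_left.2
  · rw [← hVe]; exact hγ.turning_right.2
  · rw [← V0_eq]; exact hγ.progressive_left.1 s hs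
  · rw [← V0_eq]; exact H1 s hs
  · exact continuousOn_const.mul W.continuous_qL
  · exact continuousOn_const.mul W.continuous_qC
  · exact hsq _ hI _ _ _ ((W.sqrt_L lam hl).2 s hs)
  · exact hsq _ hsI _ _ _ ((W.sqrt_C lam hl).2 s hs)
  · rw [W.root_L lam hl s hs, gPlus_eq]
    linear_combination ((pot A S (-I) (deformed γ α β lam s) - lam) *
      W.HL lam s ^ 2) * I_sq
  · simpa using W.sign_L lam hl
  · obtain ⟨q, hq, hph⟩ := hγ.progressive_left.2
    refine ⟨fun s => I * q s, continuousOn_const.mul hq.1,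
      fun s hs => hsq _ hI _ _ _ (hq.2 s hs), fun s t hst ht => ?_⟩
    have := hph s (hst.trans ht) t ht hst
    rw [phase, ← intervalIntegral.integral_const_mul] at this
    simpa only [mul_assoc] using this
  · simpa only [mul_assoc] using (hst s hs).1
  · simpa only [mul_assoc] using (hst s hs).2
  · filter_upwards [htop.eventually hγ.real_right] with s hs
    rw [hs]; push_cast; ring
  · exact (p3.comp htop).congr fun s => by simp [sub_eq_add_neg]
  · exact (m3.comp htop).congr fun s => by simp [sub_eq_add_neg]
  · exact hγ.smooth_right.comp sm.contDiffOn fun s hs => by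
      have : s ≤ 0 := hs
      simp only [mem_Ici]; linarith
  · exact hγ.smooth_mid.comp sm.contDiffOn fun s hs => by
      have := hs.1; have := hs.2
      constructor <;> linarith
  · intro s hs
    rw [dW0]
    exact neg_ne_zero.2 (hγ.regular_right _ (by have : s ≤ 0 := hs; simp only [mem_Ici]; linarith))
  · intro s hs
    rw [dW1]
    exact neg_ne_zero.2 (hγ.regular_mid _ ⟨by linarith [hs.2], by linarith [hs.1]⟩)
  · simpa using hβ.1
  · simpa using hα.1
  · rw [← hVe]; simpa using hγ.turning_right.2
  · rw [← hVe]; simpa using hγ.turning_left.2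
  · rw [← V0_eq]; exact hγ.progressive_right.1 _ (hrt s hs)
  · rw [← V0_eq]; exact H1 _ (hmid s hs)
  · exact (continuousOn_const.mul (W.continuous_qR.comp hfl.continuousOn mfr)).neg
  · exact continuousOn_const.mul (W.continuous_HR.comp hfl.continuousOn mfr)
  · exact (continuousOn_const.mul (W.continuous_qC.comp hfl.continuousOn mfl)).neg
  · rw [deformed_reflect, ← neg_mul]; exact hsq _ hnI _ _ _ ((W.sqrt_R lam hl).2 _ (hrt s hs))
  · rw [deformed_reflect, ← neg_mul]; exact hsq _ hnsI _ _ _ ((W.sqrt_C lam hl).2 _ (hmid s hs))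
  · rw [deformed_reflect, W.root_R lam hl _ (hrt s hs), gPlus_eq]
    ring
  · filter_upwards [htop.eventually (W.sign_R lam hl)] with s hs
    simpa using hs
  · obtain ⟨q, hq, hph⟩ := hγ.progressive_right.2
    refine ⟨fun s => -I * q (1 - s), continuousOn_const.mul (hq.1.comp
      (by fun_prop) fun s hs => hrt s hs),
      fun s hs => hsq _ hnI _ _ _ (hq.2 _ (hrt s hs)), fun s t hst ht => ?_⟩
    have := hph (1 - t) (hrt t ht) (1 - s) (hrt s (hst.trans ht)) (by linarith)
    rw [phase, ← intervalIntegral.integral_comp_sub_left (fun x => q x * deriv γ x),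
      ← intervalIntegral.integral_const_mul] at this
    simp only [deriv_comp_const_sub]
    refine this.trans_eq (congrArg Complex.re (intervalIntegral.integral_congr fun x _ => ?_))
    ring
  · have := (hst _ (hmid s hs)).1
    simp only [deriv_comp_const_sub]
    rw [neg_mul_neg]
    simpa only [mul_assoc] using this
  · have := (hst _ (hmid s hs)).2
    simp only [deriv_comp_const_sub]
    rw [neg_mul_neg]
    simpa only [mul_assoc] using this
  · rw [dW0, dW1, neg_neg, sub_zero]; exact hγ.sector_right

namespace HalfContour

include C

theorem re_armPhase_one : (armPhase γ α β rC μ 1).re = 0 := by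
  obtain ⟨-, -, hα, hβ, hU⟩ := C.regular_near.self_of_nhds
  have h1 := ((intervalIntegral.continuousOn_primitive_interval'
    (C.integrable_mid hU hα hβ) left_mem_uIcc) 1 right_mem_uIcc).mono
    (s := Ioo 0 1) (by rw [uIcc_of_le zero_le_one]; exact Ioo_subset_Icc_self)
  have h2 := Complex.continuous_re.continuousAt.tendsto.comp h1.tendsto
  rw [nhdsWithin_Ioo_eq_nhdsLT one_pos] at h2
  refine tendsto_nhds_unique (h2.congr' (f₂ := fun _ => 0) ?_) tendsto_const_nhds
  filter_upwards [Ioo_mem_nhdsLT one_pos] with s hs using (C.armPhase_mid hs).1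

theorem continuousAt_armPhase_one : ∀ᶠ lam in 𝓝 μ, ContinuousAt (fun lam => armPhase γ α β rC lam 1)
    lam := by
  obtain ⟨hα₀, hβ0, -⟩ := C.regular_near.self_of_nhds
  have hcP : ∀ t, ContinuousAt P (γ t) := fun t =>
    C.diff_P.continuousOn.continuousAt (C.isOpen.mem_nhds (C.mem t))
  have hcM : ∀ t, ContinuousAt M (γ t) := fun t =>
    C.diff_M.continuousOn.continuousAt (C.isOpen.mem_nhds (C.mem t))
  obtain ⟨K, hK⟩ : ∃ K, ∀ t ∈ Icc (0 : ℝ) 1, ‖(P (γ t) - μ) * (μ - M (γ t))‖ ≤ K := by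
    refine isCompact_Icc.exists_bound_of_continuousOn (f := fun t => (P (γ t) - μ) *
      (μ - M (γ t))) fun t _ => ContinuousAt.continuousWithinAt ?_
    exact (((hcP t).comp C.continuous.continuousAt).sub_const _).mul
      (continuousAt_const.sub ((hcM t).comp C.continuous.continuousAt))
  have hV : ∀ᶠ lam in 𝓝 μ, ∀ t ∈ Icc (0 : ℝ) 1,
      ‖(P (deformed γ α β lam t) - lam) * (lam - M (deformed γ α β lam t))‖ < K + 1 := by
    refine isCompact_Icc.eventually_forall_of_forall_eventually (P := fun lam t =>
      ‖(P (deformed γ α β lam t) - lam) * (lam - M (deformed γ α β lam t))‖ < K + 1) fun t ht => ?_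
    have hD := continuousAt_deformed C.continuous hα₀ hβ0 t
    have e : deformed γ α β μ t = γ t := by rw [C.base]
    have c1 : ContinuousAt (fun v : ℂ × ℝ => P (deformed γ α β v.1 v.2)) (μ, t) :=
      ContinuousAt.comp (g := P) (by simp only [e]; exact hcP t) hD
    have c2 : ContinuousAt (fun v : ℂ × ℝ => M (deformed γ α β v.1 v.2)) (μ, t) :=
      ContinuousAt.comp (g := M) (by simp only [e]; exact hcM t) hD
    refine (((c1.sub continuousAt_fst).mul (continuousAt_fst.sub c2)).norm).eventually_lt_const ?_
    simpa only [Pi.mul_apply, Pi.sub_apply, e] using (hK t ht).trans_lt (lt_add_one K)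
  obtain ⟨K1, hK1⟩ := isCompact_Icc.exists_bound_of_continuousOn
    (C.smooth_mid.continuousOn_derivWithin (uniqueDiffOn_Icc one_pos) le_rfl)
  obtain ⟨K2, hK2⟩ := (isCompact_Icc (a := (-1 : ℝ)) (b := 1)).exists_bound_of_continuousOn
    continuous_bumpDeriv.continuousOn
  have hK20 : 0 ≤ K2 := (norm_nonneg _).trans (hK2 0 (by simp))
  have hdist : ∀ {a : ℂ → ℂ} {a₀ : ℂ}, ContinuousAt a μ → a μ = a₀ →
      ∀ᶠ lam in 𝓝 μ, ‖a lam - a₀‖ < 1 := fun ha h => by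
    refine (ha.sub_const _).norm.eventually_lt_const ?_
    simp [h]
  filter_upwards [hV.eventually_nhds, C.regular_near.eventually_nhds,
    (hdist hα₀ C.base_α).eventually_nhds, (hdist hβ0 C.base_β).eventually_nhds] with lam hV hreg ha hb
  obtain ⟨hα, hβ, -, -, hU⟩ := hreg.self_of_nhds
  have hne : ∀ᵐ t : ℝ, t ≠ 1 := by simp [ae_iff]
  refine intervalIntegral.continuousAt_of_dominated_interval
    (bound := fun _ => (K + 2) * (K1 + K2 + K2)) ?_ ?_ intervalIntegrable_const ?_
  · filter_upwards [hreg] with mu h1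
    exact (intervalIntegrable_iff.1 (C.integrable_mid h1.2.2.2.2 h1.2.2.1
      h1.2.2.2.1)).aestronglyMeasurable
  · filter_upwards [hV, hreg, ha, hb] with mu h1 h2 h3 h4
    filter_upwards [hne] with t h5 ht
    rw [uIoc_of_le zero_le_one] at ht
    have ht' : t ∈ Ioo (0 : ℝ) 1 := ⟨ht.1, lt_of_le_of_ne ht.2 h5⟩
    have htc := Ioo_subset_Icc_self ht'
    rw [(C.deriv_mid mu ht').deriv, norm_mul]
    have h6 : ‖rC mu t‖ ^ 2 < K + 1 := by
      rw [← norm_pow, C.sq_rC mu (mem_of_mem_nhds h2.2.2.2.2) t ht']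
      exact h1 t htc
    have h7 : ‖rC mu t‖ ≤ K + 2 := by nlinarith [norm_nonneg (rC mu t), sq_nonneg (‖rC mu t‖ - 1)]
    have h8 : ∀ u ∈ Icc (-1 : ℝ) 1, ∀ z : ℂ, ‖z‖ < 1 → ‖(bumpDeriv u : ℂ) * z‖ ≤ K2 := by
      intro u hu z hz
      rw [norm_mul, norm_real]
      exact (mul_le_mul (hK2 u hu) hz.le (norm_nonneg _) hK20).trans_eq (mul_one _)
    refine mul_le_mul h7 (norm_add₃_le.trans (add_le_add (add_le_add (hK1 t htc)
      (h8 t ⟨by linarith [htc.1], htc.2⟩ _ h3))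
      (h8 (t - 1) ⟨by linarith [htc.1], by linarith [htc.2]⟩ _ h4))) (norm_nonneg _)
      ((norm_nonneg _).trans h7)
  · filter_upwards [hne] with t h5 ht
    rw [uIoc_of_le zero_le_one] at ht
    have ht' : t ∈ Ioo (0 : ℝ) 1 := ⟨ht.1, lt_of_le_of_ne ht.2 h5⟩
    simp only [fun mu => (C.deriv_mid mu ht').deriv, deformedDeriv]
    exact (cont_mid C.cont_rC hU ht').2.2.mul ((continuousAt_const.add
      (continuousAt_const.mul (hα.sub_const _))).add (continuousAt_const.mul (hβ.sub_const _)))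

end HalfContour

/-- The gauge transformation from the system with entries `g₊`, `g₋` to the Dirac operator. -/
noncomputable def gauge (S : ℂ → ℂ) (ε x : ℝ) (y : ℂ × ℂ) : Fin 2 → ℂ :=
  ![exp (I * S x / (2 * ε)) * (y.1 + y.2),
    exp (-(I * S x / (2 * ε))) * (y.2 - y.1)]

theorem exp_mul_exp_neg (z : ℂ) : exp z * exp (-z) = 1 := by
  rw [← exp_add, add_neg_cancel, Complex.exp_zero]

theorem gauge_injective (S : ℂ → ℂ) (ε x : ℝ) : Function.Injective (gauge S ε x) := by
  intro y y' h
  have h0 : y.1 + y.2 = y'.1 + y'.2 := mul_left_cancel₀ (exp_ne_zero _) (congrFun h 0)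
  have h1 : y.2 - y.1 = y'.2 - y'.1 := mul_left_cancel₀ (exp_ne_zero _) (congrFun h 1)
  ext
  · linear_combination (h0 - h1) / 2
  · linear_combination (h0 + h1) / 2

theorem gauge_smul (S : ℂ → ℂ) (ε x : ℝ) (c : ℂ) (y : ℂ × ℂ) : gauge S ε x (c • y) = c • gauge S ε x
    y := by
  ext i
  fin_cases i <;> simp [gauge] <;> ring

theorem gauge_norm {x : ℝ} (hS : (S x).im = 0) (ε : ℝ) (y : ℂ × ℂ) : ‖y‖ ≤ ‖gauge S ε x y‖ ∧ ‖gauge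
    S ε x y‖ ≤ 2 * ‖y‖ := by
  have hr : (I * S x / (2 * ε)).re = 0 := by
    have : I * S x / (2 * ε) = ((S x).re / (2 * ε) : ℝ) * I := by
      rw [← Complex.re_add_im (S x), hS]; push_cast; simp; ring
    rw [this, re_ofReal_mul]; simp
  have e1 : ‖exp (I * S x / (2 * ε))‖ = 1 := by
    rw [Complex.norm_exp, hr, Real.exp_zero]
  have e2 : ‖exp (-(I * S x / (2 * ε)))‖ = 1 := by
    rw [Complex.norm_exp, Complex.neg_re, hr, neg_zero, Real.exp_zero]
  have g0 : ‖gauge S ε x y 0‖ = ‖y.1 + y.2‖ := by simp [gauge, e1]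
  have g1 : ‖gauge S ε x y 1‖ = ‖y.2 - y.1‖ := by simp [gauge, e2]
  have h0 := norm_le_pi_norm (gauge S ε x y) 0
  have h1 := norm_le_pi_norm (gauge S ε x y) 1
  rw [g0] at h0
  rw [g1] at h1
  constructor
  · refine norm_prod_le_iff.2 ⟨?_, ?_⟩
    · have := norm_sub_le (y.1 + y.2) (y.2 - y.1)
      rw [show y.1 + y.2 - (y.2 - y.1) = 2 * y.1 by ring, norm_mul, RCLike.norm_ofNat] at this
      linarith
    · have := norm_add_le (y.1 + y.2) (y.2 - y.1)
      rw [show y.1 + y.2 + (y.2 - y.1) = 2 * y.2 by ring, norm_mul, RCLike.norm_ofNat] at this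
      linarith
  · have a1 := norm_fst_le y
    have a2 := norm_snd_le y
    refine (pi_norm_le_iff_of_nonneg (by positivity)).2 fun i => ?_
    fin_cases i
    · exact g0.le.trans ((norm_add_le _ _).trans (by linarith))
    · exact g1.le.trans ((norm_sub_le _ _).trans (by linarith))

theorem AdmissiblePotentials.hasDerivAt_phase (h : AdmissiblePotentials Ω A S) (ε x : ℝ) :
    HasDerivAt (fun x : ℝ => I * S x / (2 * ε)) (I * deriv S x / (2 * ε)) x :=
  (((h.holomorphic_S.differentiableAt (h.isOpen.mem_nhds (h.real_mem x))).hasDerivAt.comp_ofReal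
    ).const_mul I).div_const _

theorem AdmissiblePotentials.omega_eq (h : AdmissiblePotentials Ω A S) (ε x : ℝ) : omega A S ε x =
    -I * A x * exp (I * S x / (2 * ε)) ^ 2 ∧ conj (omega A S ε x) = I * A x * exp (-(I * S x / (2 *
    ε))) ^ 2 := by
  have hA : conj (A x) = A x := Complex.conj_eq_iff_im.2 (h.real_A x)
  have hS : conj (S x) = S x := Complex.conj_eq_iff_im.2 (h.real_S x)
  constructor
  · rw [omega, ← exp_nat_mul]
    congr 2
    push_cast
    ring
  · simp only [omega, map_mul, map_neg, Complex.conj_I, hA, ← Complex.exp_conj, map_div₀, hS,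
      Complex.conj_ofReal, neg_neg, ← exp_nat_mul]
    congr 2
    push_cast
    ring

theorem hasDerivAt_comp_ofReal {Y : ℂ → ℂ × ℂ} {Y' : ℂ × ℂ} {x : ℝ} (h : HasDerivAt Y Y' x) :
    HasDerivAt (fun x : ℝ => Y x) Y' x := by
  exact (HasDerivAt.fst' h).comp_ofReal.prodMk (HasDerivAt.snd' h).comp_ofReal

theorem IsSol.isSolution_gauge (h : AdmissiblePotentials Ω A S) (hε : ε ≠ 0) {Y : ℂ → ℂ × ℂ}
    (hY : IsSol (pot A S (-I)) (pot A S I) ε lam Ω Y) : IsSolution A S ε lam fun x => gauge S ε x (Y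
    x) := by
  have hε' : (ε : ℂ) * (ε : ℂ)⁻¹ = 1 := mul_inv_cancel₀ (by exact_mod_cast hε)
  have hd : ∀ x : ℝ, HasDerivAt (fun x : ℝ => Y x)
      (sysMatrix (pot A S (-I)) (pot A S I) ε x lam (Y x)) x := fun x =>
    hasDerivAt_comp_ofReal (hY x (h.real_mem x))
  simp only [sysMatrix_apply] at hd
  have d0 : ∀ x : ℝ, HasDerivAt (fun x : ℝ => gauge S ε x (Y x) 0) _ x := fun x =>
    ((h.hasDerivAt_phase ε x).cexp).mul ((HasDerivAt.fst' (hd x)).add (HasDerivAt.snd' (hd x)))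
  have d1 : ∀ x : ℝ, HasDerivAt (fun x : ℝ => gauge S ε x (Y x) 1) _ x := fun x =>
    ((h.hasDerivAt_phase ε x).neg.cexp).mul ((HasDerivAt.snd' (hd x)).sub
      (HasDerivAt.fst' (hd x)))
  refine ⟨differentiable_pi.2 fun i => ?_, fun x => ?_⟩
  · fin_cases i
    · exact fun x => (d0 x).differentiableAt
    · exact fun x => (d1 x).differentiableAt
  · obtain ⟨o1, o2⟩ := h.omega_eq ε x
    have hE := exp_mul_exp_neg (I * S x / (2 * ε))
    ext i
    fin_cases i
    · change -(ε / I) * deriv (fun y => gauge S ε y (Y y) 0) x +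
        omega A S ε x * gauge S ε x (Y x) 1 = lam * gauge S ε x (Y x) 0
      rw [(d0 x).deriv, o1]
      simp only [gauge, Matrix.cons_val_zero, Matrix.cons_val_one, Complex.div_I]
      generalize exp (I * S x / (2 * ε)) = E at *
      generalize exp (-(I * S x / (2 * ε))) = En at *
      simp only [pot, div_eq_mul_inv, mul_inv]
      generalize (ε : ℂ)⁻¹ = iε at *
      linear_combination (ε * iε * E * (deriv S x / 2 * ((Y x).1 + (Y x).2) +
        (-(deriv S x / 2) - I * A x - lam) * (Y x).2 -
        (lam + deriv S x / 2 - I * A x) * (Y x).1)) * I_sq -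
        (E * (deriv S x / 2 * ((Y x).1 + (Y x).2) +
        (-(deriv S x / 2) - I * A x - lam) * (Y x).2 -
        (lam + deriv S x / 2 - I * A x) * (Y x).1)) * hε' -
        I * A x * E * ((Y x).2 - (Y x).1) * hE
    · change -(conj (omega A S ε x)) * gauge S ε x (Y x) 0 +
        (ε / I) * deriv (fun y => gauge S ε y (Y y) 1) x = lam * gauge S ε x (Y x) 1
      rw [(d1 x).deriv, o2]
      simp only [gauge, Matrix.cons_val_zero, Matrix.cons_val_one, Complex.div_I, Pi.neg_apply]
      generalize exp (I * S x / (2 * ε)) = E at *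
      generalize exp (-(I * S x / (2 * ε))) = En at *
      simp only [pot, div_eq_mul_inv, mul_inv]
      generalize (ε : ℂ)⁻¹ = iε at *
      linear_combination (ε * iε * En * (lam * ((Y x).1 - (Y x).2) -
        I * A x * ((Y x).1 + (Y x).2))) * I_sq -
        (En * (lam * ((Y x).1 - (Y x).2) - I * A x * ((Y x).1 + (Y x).2))) * hε' -
        I * A x * En * ((Y x).1 + (Y x).2) * hE

theorem IsSolution.exists_isSol (h : AdmissiblePotentials Ω A S) (hε : ε ≠ 0) {u : ℝ → Fin 2 → ℂ}
    (hu : IsSolution A S ε lam u) : ∃ Y, IsSol (pot A S (-I)) (pot A S I) ε lam Ω Y ∧ ∀ x : ℝ, u x =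
    gauge S ε x (Y x) := by
  have hε' : (ε : ℂ) * (ε : ℂ)⁻¹ = 1 := mul_inv_cancel₀ (by exact_mod_cast hε)
  obtain ⟨hdu, heq⟩ := hu
  have hdi := differentiable_pi.1 hdu
  set E : ℝ → ℂ := fun x => exp (I * S x / (2 * ε)) with hEd
  set En : ℝ → ℂ := fun x => exp (-(I * S x / (2 * ε))) with hEnd
  have hE : ∀ x, E x * En x = 1 := fun x => exp_mul_exp_neg _
  set y1 : ℝ → ℂ := fun x => (En x * u x 0 - E x * u x 1) / 2 with hy1
  set y2 : ℝ → ℂ := fun x => (En x * u x 0 + E x * u x 1) / 2 with hy₂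
  have hue : ∀ x, u x = gauge S ε x (y1 x, y2 x) := fun x => by
    ext i
    fin_cases i
    · change u x 0 = E x * (y1 x + y2 x)
      simp only [hy1, hy₂]; linear_combination -(u x 0) * hE x
    · change u x 1 = En x * (y2 x - y1 x)
      simp only [hy1, hy₂]; linear_combination -(u x 1) * hE x
  have hd : ∀ x : ℝ, HasDerivAt y1 (I * (pot A S (-I) x - lam) / ε * y2 x) x ∧
      HasDerivAt y2 (-(I * (lam - pot A S I x) / ε) * y1 x) x := by
    intro x
    obtain ⟨o1, o2⟩ := h.omega_eq ε x
    have q0 : -(ε / I) * deriv (fun y => u y 0) x + omega A S ε x * u x 1 =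
      lam * u x 0 := congrFun (heq x) 0
    have q1 : -(conj (omega A S ε x)) * u x 0 + (ε / I) *
      deriv (fun y => u y 1) x = lam * u x 1 := congrFun (heq x) 1
    have c0 := (hdi 0 x).hasDerivAt
    have c1 := (hdi 1 x).hasDerivAt
    have a0 : HasDerivAt E (E x * (I * deriv S x / (2 * ε))) x :=
      (h.hasDerivAt_phase ε x).cexp
    have a1 : HasDerivAt En (En x * -(I * deriv S x / (2 * ε))) x :=
      (h.hasDerivAt_phase ε x).neg.cexp
    rw [o1, Complex.div_I] at q0
    rw [o2, Complex.div_I] at q1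
    change _ + -I * A x * E x ^ 2 * _ = _ at q0
    change -(I * A x * En x ^ 2) * _ + _ = _ at q1
    generalize deriv (fun y => u y 0) x = v0 at *
    generalize deriv (fun y => u y 1) x = v1 at *
    have hEx := hE x
    have w0 : v0 = -I * (ε : ℂ)⁻¹ * (lam * u x 0 + I * A x * E x ^ 2 * u x 1) := by
      linear_combination (-I * (ε : ℂ)⁻¹) * q0 + v0 * (ε * (ε : ℂ)⁻¹ * I_sq - hε')
    have w1 : v1 = I * (ε : ℂ)⁻¹ * (lam * u x 1 + I * A x * En x ^ 2 * u x 0) := by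
      linear_combination (I * (ε : ℂ)⁻¹) * q1 + v1 * (ε * (ε : ℂ)⁻¹ * I_sq - hε')
    subst w0 w1
    refine ⟨(((a1.mul c0).sub (a0.mul c1)).div_const 2).congr_deriv ?_,
      (((a1.mul c0).add (a0.mul c1)).div_const 2).congr_deriv ?_⟩ <;>
    simp only [hy1, hy₂, pot, div_eq_mul_inv, mul_inv] <;>
    generalize (ε : ℂ)⁻¹ = iε at * <;>
    generalize E x = e at * <;> generalize En x = f at *
    · linear_combination (-I * iε * I * A x * (e * u x 1 + f * u x 0) / 2) * hEx
    · linear_combination (I * iε * I * A x * (f * u x 0 - e * u x 1) / 2) * hEx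
  obtain ⟨p1, -⟩ := h.pot_facts (-I)
  obtain ⟨m1, -⟩ := h.pot_facts I
  obtain ⟨F1, F2, s1, s2, i₁, i₂, -⟩ := exists_solution_basis h.isOpen h.simplyConnected p1 m1 ε lam
    (h.real_mem 0)
  have hdet : ∀ x : ℝ, det2 (F1 x) (F2 x) = 1 := fun x => by
    rw [s1.det2_eq h.isOpen h.simplyConnected.isPathConnected.isConnected.isPreconnected s2
      (h.real_mem x) (h.real_mem 0), i₁, i₂]
    simp [det2]
  have hF : ∀ {F : ℂ → ℂ × ℂ}, IsSol (pot A S (-I)) (pot A S I) ε lam Ω F →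
      ∀ x : ℝ, det2 (y1 x, y2 x) (F x) = det2 (y1 0, y2 0) (F 0) := by
    intro F hF x
    have hD : ∀ x : ℝ, HasDerivAt (fun x : ℝ => det2 (y1 x, y2 x) (F x)) 0 x := fun x => by
      have h1 := hasDerivAt_comp_ofReal (hF x (h.real_mem x))
      rw [sysMatrix_apply] at h1
      refine (((hd x).1.mul (HasDerivAt.snd' h1)).sub
        ((hd x).2.mul (HasDerivAt.fst' h1))).congr_deriv ?_
      simp only
      ring
    simpa using is_const_of_deriv_eq_zero (fun x => (hD x).differentiableAt)
      (fun x => (hD x).deriv) x 0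
  have hanti : ∀ a b : ℂ × ℂ, det2 a b = -det2 b a := fun a b => by simp only [det2]; ring
  refine ⟨_, (s1.smul (det2 (y1 0, y2 0) (F2 0))).add (s2.smul (-det2 (y1 0, y2 0) (F1 0))),
    fun x => ?_⟩
  rw [hue, ← hF s2 x, ← hF s1 x, ← hanti, ← det2_expand _ _ _ (hdet x)]

theorem exp_smul_left (S : ℂ → ℂ) (ε x : ℝ) (h E : ℂ) (w : Fin 2 → ℂ) : exp (E / ε) • (wkbMatrix S ε
    x h * !![0, 1; 1, 0]).mulVec w = gauge S ε x (exp (E / ε) * (w 0 + w 1) / h, -I * exp (E / ε) *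
    (w 0 - w 1) * h) := by
  ext i
  fin_cases i <;> simp [wkbMatrix, gauge, dotProduct, Fin.sum_univ_two] <;> ring

theorem exp_smul_right (S : ℂ → ℂ) (ε x : ℝ) (h E : ℂ) (w : Fin 2 → ℂ) : exp (E / ε) • (wkbMatrix S
    ε x h).mulVec w = gauge S ε x (I • (exp (E / ε) * (w 0 + w 1) / (I * h), -I * exp (E / ε) * (w 0
    - w 1) * (I * h))) := by
  have h1 : I * (exp (E / ε) * (w 0 + w 1) / (I * h)) = exp (E / ε) * (w 0 + w 1) / h := by
    rw [← mul_div_assoc, mul_div_mul_left _ _ I_ne_zero]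
  have h2 : I * (-I * exp (E / ε) * (w 0 - w 1) * (I * h)) = I * exp (E / ε) * (w 0 - w 1) * h := by
    linear_combination (-I * exp (E / ε) * (w 0 - w 1) * h) * I_sq
  rw [Prod.smul_mk, smul_eq_mul, smul_eq_mul, h1, h2]
  ext i
  fin_cases i <;> simp [wkbMatrix, gauge, dotProduct, Fin.sum_univ_two] <;> ring

theorem exists_symbol_iff {l : Filter ℝ} {h E : ℝ → ℂ} (h0 : ∀ᶠ x in l, h x ≠ 0) (Y : ℝ → ℂ × ℂ) :
    (∃ w : ℝ → Fin 2 → ℂ, Tendsto w l (𝓝 ![1, 0]) ∧ ∀ᶠ x in l, Y x = (exp (E x / ε) * (w x 0 + w x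
    1) / h x, -I * exp (E x / ε) * (w x 0 - w x 1) * h x)) ↔ Tendsto (fun x => wPlus (h x) (E x) ε
    (Y x)) l (𝓝 1) ∧ Tendsto (fun x => wMinus (h x) (E x) ε (Y x)) l (𝓝 0) := by
  constructor
  · rintro ⟨w, hw, hY⟩
    have h1 := tendsto_pi_nhds.1 hw
    refine ⟨(h1 0).congr' ?_, (h1 1).congr' ?_⟩ <;> filter_upwards [hY, h0] with x hx hx0 <;> rw [hx]
    · exact (wPlus_wkb hx0 ε _ _).1.symm
    · exact (wPlus_wkb hx0 ε _ _).2.symm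
  · rintro ⟨h1, h2⟩
    refine ⟨fun x => ![wPlus (h x) (E x) ε (Y x), wMinus (h x) (E x) ε (Y x)],
      tendsto_pi_nhds.2 fun i => ?_, h0.mono fun x hx => wkb_expand hx _⟩
    fin_cases i
    · exact h1
    · exact h2

theorem isLeftWKB_iff (h : AdmissiblePotentials Ω A S) (hε : ε ≠ 0) (W : Branches A S γ α β U)
    (hl : lam ∈ U) (u : ℝ → Fin 2 → ℂ) : IsLeftWKB W ε lam u ↔ ∃ Y, IsSol (pot A S (-I)) (pot A S I)
    ε lam Ω Y ∧ (∀ x : ℝ, u x = gauge S ε x (Y x)) ∧ Tendsto (fun x : ℝ => wPlus (W.HL lam x) (zLeft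
    W lam x) ε (Y x)) atBot (𝓝 1) ∧ Tendsto (fun x : ℝ => wMinus (W.HL lam x) (zLeft W lam x) ε (Y
    x)) atBot (𝓝 0) := by
  have h0 : ∀ᶠ x in atBot, W.HL lam x ≠ 0 := by
    filter_upwards [W.sign_L lam hl, eventually_lt_atBot 0] with x h1 h2 h3
    rw [W.root_L lam hl x h2, h3] at h1
    simp at h1
  constructor
  · rintro ⟨h1, w, hw, h2⟩
    obtain ⟨Y, hY, hu⟩ := h1.exists_isSol h hε
    refine ⟨Y, hY, hu, (exists_symbol_iff h0 fun x : ℝ => Y x).1 ⟨w, hw, h2.mono fun x hx => ?_⟩⟩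
    rw [exp_smul_left, hu] at hx
    exact gauge_injective S ε x hx
  · rintro ⟨Y, hY, hu, hlim⟩
    obtain ⟨w, hw, h2⟩ := (exists_symbol_iff h0 fun x : ℝ => Y x).2 hlim
    refine ⟨?_, w, hw, h2.mono fun x hx => ?_⟩
    · rw [funext hu]; exact hY.isSolution_gauge h hε
    · rw [exp_smul_left, hu, ← hx]

theorem isRightWKB_iff (h : AdmissiblePotentials Ω A S) (hε : ε ≠ 0) (W : Branches A S γ α β U)
    (hl : lam ∈ U) (u : ℝ → Fin 2 → ℂ) : IsRightWKB W ε lam u ↔ ∃ Y, IsSol (pot A S (-I)) (pot A S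
    I) ε lam Ω Y ∧ (∀ x : ℝ, u x = gauge S ε x (I • Y x)) ∧ Tendsto (fun x : ℝ => wPlus (I * W.HR
    lam x) (-(zRight W lam x)) ε (Y x)) atTop (𝓝 1) ∧ Tendsto (fun x : ℝ => wMinus (I * W.HR lam x)
    (-(zRight W lam x)) ε (Y x)) atTop (𝓝 0) := by
  have h0 : ∀ᶠ x in atTop, I * W.HR lam x ≠ 0 := by
    filter_upwards [W.sign_R lam hl, eventually_gt_atTop 1] with x h1 h2 h3
    rw [W.root_R lam hl x h2, (mul_eq_zero.1 h3).resolve_left I_ne_zero] at h1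
    simp at h1
  constructor
  · rintro ⟨h1, w, hw, h2⟩
    obtain ⟨Y, hY, hu⟩ := h1.exists_isSol h hε
    have hII : ∀ y : ℂ × ℂ, I • (-I) • y = y := fun y => by
      rw [smul_smul, mul_neg, Complex.I_mul_I, neg_neg, one_smul]
    refine ⟨_, hY.smul (-I), fun x => by rw [hII, hu],
      (exists_symbol_iff h0 fun x : ℝ => (-I) • Y x).1 ⟨w, hw, h2.mono fun x hx => ?_⟩⟩
    rw [exp_smul_right, hu] at hx
    have := congrArg (fun y => (-I) • y) (gauge_injective S ε x hx)
    simp only [smul_smul, neg_mul, Complex.I_mul_I, neg_neg, one_smul] at this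
    simpa only [neg_mul] using this
  · rintro ⟨Y, hY, hu, hlim⟩
    obtain ⟨w, hw, h2⟩ := (exists_symbol_iff h0 fun x : ℝ => Y x).2 hlim
    refine ⟨?_, w, hw, h2.mono fun x hx => ?_⟩
    · rw [funext hu]; exact (hY.smul I).isSolution_gauge h hε
    · rw [exp_smul_right, hu, ← hx]

include hΩ hΩ' hP hM in
theorem IsSol.exists_smul {u v : ℂ → ℂ × ℂ} (hu : IsSol P M ε lam Ω u) (hv : IsSol P M ε lam Ω v)
    (hp : p ∈ Ω) (h0 : u p ≠ 0) (hd : det2 (u p) (v p) = 0) : ∃ k : ℂ, ∀ x ∈ Ω, v x = k • u x := by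
  obtain ⟨k, hk⟩ : ∃ k : ℂ, v p = k • u p := by
    simp only [det2] at hd
    by_cases h1 : (u p).1 = 0
    · have h2 : (u p).2 ≠ 0 := fun h2 => h0 (Prod.ext h1 h2)
      refine ⟨(v p).2 / (u p).2, Prod.ext ?_ ?_⟩
      · rw [h1, zero_mul, zero_sub, neg_eq_zero, mul_eq_zero] at hd
        simpa [h1] using hd.resolve_left h2
      · simp [h2]
    · refine ⟨(v p).1 / (u p).1, Prod.ext ?_ ?_⟩
      · simp [h1]
      · rw [Prod.smul_snd, smul_eq_mul]; field_simp; linear_combination hd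
  refine ⟨k, fun x hx => ?_⟩
  have := (hv.add (hu.smul (-k))).eq_zero hΩ hΩ' hP hM hp (by simp [hk]) hx
  rw [neg_smul, ← sub_eq_add_neg] at this
  exact sub_eq_zero.1 this

theorem det2_norm_le (u v : ℂ × ℂ) : ‖det2 u v‖ ≤ 2 * ‖u‖ * ‖v‖ := by
  have h1 : ‖u.1 * v.2‖ ≤ ‖u‖ * ‖v‖ := by
    rw [norm_mul]
    exact mul_le_mul (norm_fst_le u) (norm_snd_le v) (norm_nonneg _) (norm_nonneg _)
  have h2 : ‖u.2 * v.1‖ ≤ ‖u‖ * ‖v‖ := by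
    rw [norm_mul]
    exact mul_le_mul (norm_snd_le u) (norm_fst_le v) (norm_nonneg _) (norm_nonneg _)
  have := norm_sub_le (u.1 * v.2) (u.2 * v.1)
  rw [det2]; linarith

/-- The Wronskian of a square integrable and a bounded solution vanishes. -/
theorem IsSol.det2_eq_zero (h : AdmissiblePotentials Ω A S) {Y y : ℂ → ℂ × ℂ}
    (hY : IsSol (pot A S (-I)) (pot A S I) ε lam Ω Y)
    (hy : IsSol (pot A S (-I)) (pot A S I) ε lam Ω y)
    (hu : MemLp (fun x : ℝ => gauge S ε x (Y x)) 2 volume) {K : ℝ} {s : Set ℝ} (hs : volume s = ⊤)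
    (hb : ∀ x ∈ s, ‖y x‖ ≤ K) (hp : p ∈ Ω) : det2 (Y p) (y p) = 0 := by
  by_contra h0
  set D := ‖det2 (Y p) (y p)‖ with hD
  have hD0 : 0 < D := norm_pos_iff.2 h0
  have hK : 0 ≤ |K| := abs_nonneg K
  have hlow : ∀ x ∈ s, D / (2 * (|K| + 1)) ≤ ‖gauge S ε x (Y x)‖ := fun x hx => by
    refine le_trans ?_ (gauge_norm (h.real_S x) ε (Y x)).1
    have h1 := det2_norm_le (Y x) (y x)
    rw [hY.det2_eq h.isOpen h.simplyConnected.isPathConnected.isConnected.isPreconnected hy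
      (h.real_mem x) hp] at h1
    have h2 : 2 * ‖Y x‖ * ‖y x‖ ≤ 2 * ‖Y x‖ * (|K| + 1) := by
      gcongr
      exact (hb x hx).trans ((le_abs_self K).trans (by linarith))
    rw [div_le_iff₀ (by positivity)]
    linarith
  have hδ : 0 < D / (2 * (|K| + 1)) := by positivity
  have h3 := hu.meas_ge_lt_top two_ne_zero ENNReal.ofNat_ne_top
    (ε := (⟨D / (2 * (|K| + 1)), hδ.le⟩ : NNReal)) (fun h4 => hδ.ne' (congrArg NNReal.toReal h4))
  refine h3.ne (top_le_iff.1 (hs.symm.le.trans (measure_mono fun x hx => ?_)))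
  exact hlow x hx

/-- `lam` is an eigenvalue if and only if the solutions decaying at the two ends are proportional. -/
theorem isEigenvalue_iff (h : AdmissiblePotentials Ω A S) (hε : ε ≠ 0) {yL yR : ℂ → ℂ × ℂ}
    (hL : IsSol (pot A S (-I)) (pot A S I) ε lam Ω yL)
    (hR : IsSol (pot A S (-I)) (pot A S I) ε lam Ω yR) (hL0 : ∃ x ∈ Ω, yL x ≠ 0)
    (hR0 : ∃ x ∈ Ω, yR x ≠ 0) {c C : ℝ} (hc : 0 < c)
    (hLd : ∀ᶠ x : ℝ in atBot, ‖yL x‖ ≤ C * Real.exp (c * x)) {c' C' : ℝ} (hc' : 0 < c')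
    (hRd : ∀ᶠ x : ℝ in atTop, ‖yR x‖ ≤ C' * Real.exp (-c' * x)) : IsEigenvalue A S ε lam ↔ ∃ k : ℂ,
    ∀ x ∈ Ω, yR x = k • yL x := by
  obtain ⟨p1, -⟩ := h.pot_facts (-I)
  obtain ⟨m1, -⟩ := h.pot_facts I
  have h0 := h.real_mem 0
  have hn : ∀ {y : ℂ → ℂ × ℂ}, IsSol (pot A S (-I)) (pot A S I) ε lam Ω y →
      (∃ x ∈ Ω, y x ≠ 0) → y (0 : ℝ) ≠ 0 := fun hy ⟨x, hx, h1⟩ h2 =>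
    h1 (hy.eq_zero h.isOpen h.simplyConnected p1 m1 h0 h2 hx)
  constructor
  · rintro ⟨u, hu, hm, hu0⟩
    obtain ⟨Y, hY, hue⟩ := hu.exists_isSol h hε
    have hm' : MemLp (fun x : ℝ => gauge S ε x (Y x)) 2 volume := by rwa [← funext hue]
    have hY0 : Y (0 : ℝ) ≠ 0 := hn hY (by
      obtain ⟨x, hx⟩ := Function.ne_iff.1 hu0
      refine ⟨x, h.real_mem x, fun h1 => hx ?_⟩
      rw [hue, h1]
      ext i; fin_cases i <;> simp [gauge])
    obtain ⟨T, hT⟩ := eventually_atBot.1 (hLd.and (eventually_le_atBot 0))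
    obtain ⟨T', hT'⟩ := eventually_atTop.1 (hRd.and (eventually_ge_atTop 0))
    have e1 := hY.det2_eq_zero h hL hm' (s := Iic T) (K := |C|) Real.volume_Iic (fun x hx => by
      refine (hT x hx).1.trans ((mul_le_mul_of_nonneg_right (le_abs_self C) (Real.exp_pos _).le).trans
        (mul_le_of_le_one_right (abs_nonneg C) (Real.exp_le_one_iff.2 ?_)))
      exact mul_nonpos_of_nonneg_of_nonpos hc.le (hT x hx).2) h0
    have e2 := hY.det2_eq_zero h hR hm' (s := Ici T') (K := |C'|) Real.volume_Ici (fun x hx => by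
      refine (hT' x hx).1.trans ((mul_le_mul_of_nonneg_right (le_abs_self C')
        (Real.exp_pos _).le).trans (mul_le_of_le_one_right (abs_nonneg C')
        (Real.exp_le_one_iff.2 ?_)))
      exact mul_nonpos_of_nonpos_of_nonneg (neg_nonpos.2 hc'.le) (hT' x hx).2) h0
    obtain ⟨a, ha⟩ := hY.exists_smul h.isOpen h.simplyConnected p1 m1 hL h0 hY0 e1
    obtain ⟨b, hb⟩ := hY.exists_smul h.isOpen h.simplyConnected p1 m1 hR h0 hY0 e2
    have ha0 : a ≠ 0 := fun h1 => hn hL hL0 (by rw [ha _ h0, h1, zero_smul])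
    exact ⟨b / a, fun x hx => by rw [ha x hx, hb x hx, smul_smul, div_mul_cancel₀ _ ha0]⟩
  · rintro ⟨k, hk⟩
    have hk0 : k ≠ 0 := fun h1 => hn hR hR0 (by rw [hk _ h0, h1, zero_smul])
    have hsol := hL.isSolution_gauge h hε
    refine ⟨_, hsol, ?_, fun h1 => hn hL hL0 (gauge_injective S ε 0 ?_)⟩
    · have hcont := hsol.1.continuous
      rw [memLp_two_iff_integrable_sq_norm hcont.aestronglyMeasurable]
      have hsq : ∀ {x : ℝ} {K : ℝ}, ‖yL x‖ ≤ K → ‖gauge S ε x (yL x)‖ ^ 2 ≤ (2 * K) ^ 2 := fun {x K} h1 =>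
        pow_le_pow_left₀ (norm_nonneg _) ((gauge_norm (h.real_S x) ε _).2.trans (by linarith)) 2
      refine (hcont.norm.pow 2).locallyIntegrable.integrable_of_isBigO_atBot_atTop
        (g := fun x => Real.exp (2 * c * x)) (g' := fun x => Real.exp (-(2 * c') * x)) ?_ ?_ ?_ ?_
      · refine Asymptotics.IsBigO.of_bound ((2 * C) ^ 2) ?_
        filter_upwards [hLd] with x hx
        rw [Real.norm_of_nonneg (by positivity), Real.norm_of_nonneg (by positivity)]
        refine (hsq hx).trans_eq ?_
        rw [← mul_assoc, mul_pow, ← Real.exp_nat_mul]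
        congr 2; push_cast; ring
      · exact ⟨Iic 0, Iic_mem_atBot 0, integrableOn_exp_mul_Iic (by positivity) 0⟩
      · refine Asymptotics.IsBigO.of_bound ((2 * (‖k‖⁻¹ * C')) ^ 2) ?_
        filter_upwards [hRd] with x hx
        rw [Real.norm_of_nonneg (by positivity), Real.norm_of_nonneg (by positivity)]
        have h1 : ‖yL x‖ ≤ ‖k‖⁻¹ * C' * Real.exp (-c' * x) := by
          rw [hk _ (h.real_mem x), norm_smul] at hx
          rw [mul_assoc, ← div_eq_inv_mul, le_div_iff₀ (norm_pos_iff.2 hk0)]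
          linarith
        refine (hsq h1).trans_eq ?_
        rw [← mul_assoc, mul_pow, ← Real.exp_nat_mul]
        congr 2; push_cast; ring
      · exact ⟨Ioi 0, Ioi_mem_atTop 0, integrableOn_exp_mul_Ioi (by linarith) 0⟩
    · rw [show gauge S ε 0 (yL (0 : ℝ)) = 0 from congrFun h1 0]
      ext i; fin_cases i <;> simp [gauge]

theorem armPhase_left (W : Branches A S γ α β U) (lam : ℂ) (s : ℝ) : armPhase γ α β (fun lam s => I
    * W.qL lam s) lam s = zLeft W lam s := by
  simp only [armPhase, zLeft, phase, mul_assoc, intervalIntegral.integral_const_mul]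

theorem armPhase_right (W : Branches A S γ α β U) (lam : ℂ) (s : ℝ) : armPhase (fun s => γ (1 - s))
    β α (fun lam s => -(I * W.qR lam (1 - s))) lam s = -zRight W lam (1 - s) := by
  rw [armPhase_reflect γ α β (fun lam s => I * W.qR lam s), intervalIntegral.integral_symm]
  simp only [zRight, phase, mul_assoc, intervalIntegral.integral_const_mul]

theorem HalfSolution.ne_zero {V : Set ℂ} {E0 : ℂ → ℂ} {a : ℂ}
    (X : HalfSolution P M Ω μ γ α β r h rC x0 ς e V E0 y H Z a) (hr : ∀ x : ℝ, (x : ℂ) ∈ Ω)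
    (hε : 0 < ε) (hl : lam ∈ V) : ∃ x ∈ Ω, y ε lam x ≠ 0 := by
  by_contra! h0
  have h1 := X.lim_plus ε hε lam hl
  simp only [h0 _ (hr _), smul_zero] at h1
  exact zero_ne_one (tendsto_nhds_unique (tendsto_const_nhds.congr fun t => by simp [wPlus]) h1)

theorem tendsto_one_sub : Tendsto (fun s : ℝ => 1 - s) atBot atTop ∧ Tendsto (fun s : ℝ => 1 - s)
    atTop atBot :=
  ⟨tendsto_atTop_add_const_left _ 1 tendsto_neg_atBot_atTop,
    tendsto_atBot_add_const_left _ 1 tendsto_neg_atTop_atBot⟩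

theorem isLeftWKB_iff_halfSolution (h : AdmissiblePotentials Ω A S) {W : Branches A S γ α β U}
    {V : Set ℂ} {E0 : ℂ → ℂ} {a : ℂ} (X : HalfSolution (pot A S (-I)) (pot A S I) Ω μ γ α β (fun lam
    s => I * W.qL lam s) W.HL rC 0 1 e V E0 y H Z a) (hVU : V ⊆ U) (hε : 0 < ε) (hl : lam ∈ V)
    (u : ℝ → Fin 2 → ℂ) : IsLeftWKB W ε lam u ↔ ∀ x : ℝ, u x = gauge S ε x (exp (E0 lam / ε) • y ε
    lam x) := by
  have h1 := X.lim_plus ε hε lam hl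
  have h2 := X.lim_minus ε hε lam hl
  have h3 := X.unique ε hε lam hl
  simp only [armPhase_left, zero_add, one_mul] at h1 h2 h3
  rw [isLeftWKB_iff h hε.ne' W (hVU hl)]
  constructor
  · rintro ⟨Y, hY, hu, l1, l2⟩ x
    rw [hu, h3 Y hY l1 l2 x (h.real_mem x)]
  · exact fun hu => ⟨_, (X.sol ε hε lam hl).smul _, hu, h1, h2⟩

theorem isRightWKB_iff_halfSolution (h : AdmissiblePotentials Ω A S) {W : Branches A S γ α β U}
    {V : Set ℂ} {E0 : ℂ → ℂ} {a : ℂ} (X : HalfSolution (pot A S (-I)) (pot A S I) Ω μ (fun s => γ (1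
    - s)) β α (fun lam s => -(I * W.qR lam (1 - s))) (fun lam s => I * W.HR lam (1 - s)) rC 1 (-1) e
    V E0 y H Z a) (hVU : V ⊆ U) (hε : 0 < ε) (hl : lam ∈ V) (u : ℝ → Fin 2 → ℂ) : IsRightWKB W ε lam
    u ↔ ∀ x : ℝ, u x = gauge S ε x (I • exp (E0 lam / ε) • y ε lam x) := by
  have h1 := (X.lim_plus ε hε lam hl).comp tendsto_one_sub.2
  have h2 := (X.lim_minus ε hε lam hl).comp tendsto_one_sub.2
  have h3 := X.unique ε hε lam hl
  have hx : ∀ x : ℝ, 1 + -1 * x = 1 - x := fun x => by ring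
  simp only [armPhase_right, hx, Function.comp_def, sub_sub_cancel] at h1 h2 h3
  rw [isRightWKB_iff h hε.ne' W (hVU hl)]
  constructor
  · rintro ⟨Y, hY, hu, l1, l2⟩ x
    rw [hu, h3 Y hY (l1.comp tendsto_one_sub.1) (l2.comp tendsto_one_sub.1) x (h.real_mem x)]
  · exact fun hu => ⟨_, (X.sol ε hε lam hl).smul _, hu, h1, h2⟩

/-- A norming constant is a constant of proportionality on all of `Ω`. -/
theorem isNormingConstant_iff (h : AdmissiblePotentials Ω A S) {W : Branches A S γ α β U}
    {yL yR : ℂ → ℂ × ℂ} (hyL : IsSol (pot A S (-I)) (pot A S I) ε lam Ω yL)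
    (hyR : IsSol (pot A S (-I)) (pot A S I) ε lam Ω yR) (hL : ∀ u, IsLeftWKB W ε lam u ↔ ∀ x : ℝ, u
    x = gauge S ε x (yL x)) (hR : ∀ u, IsRightWKB W ε lam u ↔ ∀ x : ℝ, u x = gauge S ε x (I • yR x))
    (κ : ℂ) : IsNormingConstant W ε lam κ ↔ ∀ x ∈ Ω, I • yR x = κ • yL x := by
  obtain ⟨p1, -⟩ := h.pot_facts (-I)
  obtain ⟨m1, -⟩ := h.pot_facts I
  constructor
  · rintro ⟨uL, uR, h1, h2, h3⟩ x hx
    have h4 := h3 0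
    rw [(hL uL).1 h1, (hR uR).1 h2, ← gauge_smul] at h4
    have h5 := ((hyR.smul I).add (hyL.smul (-κ))).eq_zero h.isOpen h.simplyConnected p1 m1
      (h.real_mem 0) (by rw [gauge_injective S ε 0 h4, neg_smul, add_neg_cancel]) hx
    rw [neg_smul, ← sub_eq_add_neg] at h5
    exact sub_eq_zero.1 h5
  · intro h1
    exact ⟨_, _, (hL _).2 fun _ => rfl, (hR _).2 fun _ => rfl, fun x => by
      rw [h1 x (h.real_mem x), gauge_smul]⟩

/-- The Bohr–Sommerfeld quantization function `T`, equal to `1` exactly at the eigenvalues, and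
the asymptotics of the norming constants. -/
theorem exists_spectral_function (hAS : AdmissiblePotentials Ω A S) (hlam : μ.im ≠ 0)
    (hγ : IsAdmissibleContour A S Ω μ γ) (H1 : ∀ s ∈ Ioo (0 : ℝ) 1, V0 A S μ (γ s) ≠ 0) (hδ : (gPlus
    A S μ (γ 0) = 0 ∧ gPlus A S μ (γ 1) = 0) ∨ (gMinus A S μ (γ 0) = 0 ∧ gMinus A S μ (γ 1) = 0))
    (hα : IsTurningPointFamily A S μ (γ 0) α) (hβ : IsTurningPointFamily A S μ (γ 1) β)
    (hU : U ∈ 𝓝 μ) (W : Branches A S γ α β U) : ∃ (J : ℂ → ℂ) (σ s : ℂ), (σ = 1 ∨ σ = -1) ∧ (s = 1 ∨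
    s = -1) ∧ (∀ lam, J lam = σ * actionIntegral W lam) ∧ (J μ).re = 0 ∧ ∃ R > 0, ∃ C > 0, ∃ ε0 > 0,
    ball μ R ⊆ U ∧ ContinuousOn J (ball μ R) ∧ ∃ T : ℝ → ℂ → ℂ, ∀ ε, 0 < ε → ε < ε0 →
    DifferentiableOn ℂ (T ε) (ball μ R) ∧ ∀ lam ∈ ball μ R, ‖T ε lam * exp (2 * J lam / ε) + 1‖ ≤ C
    * ε ∧ (T ε lam = 1 ↔ IsEigenvalue A S ε lam) ∧ (IsEigenvalue A S ε lam → ∃ κ, IsNormingConstant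
    W ε lam κ) ∧ ∀ κ : ℂ, IsNormingConstant W ε lam κ → ‖κ * exp (J lam / ε) - I * s‖ ≤ C * ε ∧ ‖κ *
    exp (-(J lam / ε)) + I * s‖ ≤ C * ε := by
  obtain ⟨p1, -⟩ := hAS.pot_facts (-I)
  obtain ⟨m1, -⟩ := hAS.pot_facts I
  obtain ⟨σ, hσ, CL, CR⟩ := hγ.exists_halfContours hAS hlam H1 hα hβ hU W
  obtain ⟨e, hed, heL, heR⟩ : ∃ e : ℤ, (∃ d : ℂ, (d = 1 ∨ d = -1) ∧ I ^ e = d * I) ∧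
      ((e = -1 ∧ pot A S (-I) (γ 0) = μ) ∨ (e = 1 ∧ pot A S I (γ 0) = μ)) ∧
      ((e = -1 ∧ pot A S (-I) (γ (1 - 0)) = μ) ∨
        (e = 1 ∧ pot A S I (γ (1 - 0)) = μ)) := by
    simp only [gPlus_eq, gMinus_eq, sub_eq_zero] at hδ
    rw [sub_zero]
    rcases hδ with ⟨h0, h1⟩ | ⟨h0, h1⟩
    · exact ⟨-1, ⟨-1, Or.inr rfl, by simp⟩, Or.inl ⟨rfl, h0⟩, Or.inl ⟨rfl, h1⟩⟩
    · exact ⟨1, ⟨1, Or.inl rfl, by simp⟩, Or.inr ⟨rfl, h0.symm⟩, Or.inr ⟨rfl, h1.symm⟩⟩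
  obtain ⟨d, hd, hId⟩ := hed
  obtain ⟨VL, EL, yL, HL, ZL, aL, hVL, XL⟩ := CL.exists_halfSolution heL
  obtain ⟨VR, ER, yR, HR, ZR, aR, hVR, XR⟩ := CR.exists_halfSolution heR
  set rC : ℂ → ℝ → ℂ := fun lam s => σ * I * W.qC lam s with hrC
  have hp : γ (1 - 1 / 2) = γ (1 / 2) := by norm_num
  have hm : (1 / 2 : ℝ) ∈ Ioo (0 : ℝ) 1 := by norm_num
  have hgR := XR.germ
  have hrR := XR.root
  have hsR := XR.side
  simp only [hp] at hgR hrR hsR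
  have hsL := XL.side
  rw [hId] at hsL hsR
  simp only [smul_smul] at hsL hsR
  have hH : HR (γ (1 / 2)) μ ^ 2 = -HL (γ (1 / 2)) μ ^ 2 := by
    have h1 := XL.root
    have h2 := CL.ne_mid _ hm
    rw [show (1 : ℝ) - 1 / 2 = 1 / 2 by norm_num] at hrR
    refine mul_left_cancel₀ (left_ne_zero_of_mul h2) ?_
    rw [hrR, mul_neg, h1]
  have hreg := CL.regular_near
  obtain ⟨hα₀, hβ0, -⟩ := hreg.self_of_nhds
  have hZp : (ZL (γ (1 / 2)) μ).re = 0 := by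
    have := XL.phase.self_of_nhds
    rw [CL.base] at this
    rw [this]; exact (CL.armPhase_mid hm).1
  have hD : ContinuousAt (fun lam => deformed γ α β lam (1 / 2)) μ :=
    (continuousAt_deformed hγ.continuous hα₀ hβ0 (1 / 2)).comp₂ continuousAt_id continuousAt_const
  have hZ : ∀ᶠ lam in 𝓝 μ, ZR (deformed γ α β lam (1 / 2)) lam =
      armPhase γ α β rC lam 1 - ZL (deformed γ α β lam (1 / 2)) lam := by
    filter_upwards [XL.phase, XR.phase, hreg] with lam h1 h2 h3
    rw [deformed_reflect, armPhase_reflect γ α β rC, show (1 : ℝ) - 1 / 2 = 1 / 2 by norm_num] at h2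
    have hi := CL.integrable_mid h3.2.2.2.2 h3.2.2.1 h3.2.2.2.1
    rw [h1, h2, armPhase, armPhase, intervalIntegral.integral_interval_sub_left hi
      (hi.mono_set (by rw [uIcc_of_le (by norm_num), uIcc_of_le zero_le_one]
                       exact Icc_subset_Icc_right (by norm_num)))]
  have hsg : ∀ {a : ℂ}, a = 1 ∨ a = -1 → a * a = 1 ∧ a ≠ 0 ∧ ‖a‖ = 1 := by
    rintro a (rfl | rfl) <;> simp
  obtain ⟨sL, nL, eL⟩ := hsg XL.sign
  obtain ⟨sR, nR, eR⟩ := hsg XR.sign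
  obtain ⟨s, hs, R, hR, C, hC, ε0, hε0, hball, T, hT⟩ := exists_comparison hAS.isOpen
    hAS.simplyConnected p1 m1 (hγ.mem (1 / 2)) XL.germ hgR hH hZp hD (by rw [CL.base])
    CL.re_armPhase_one hZ hd
    (V := VL ∩ VR) ((XL.isOpen.inter XR.isOpen).mem_nhds ⟨XL.mem, XR.mem⟩)
    (mL := fun ε lam => aL * exp (EL lam / ε))
    (mR := fun ε lam => aR * exp (ER lam / ε))
    (fun _ _ => mul_ne_zero nL (exp_ne_zero _))
    (fun _ _ => mul_ne_zero nR (exp_ne_zero _))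
    (fun ε hε lam hl => XL.sol ε hε lam hl.1) (fun ε hε lam hl => XR.sol ε hε lam hl.2)
    (fun ε hε x hx => (XL.diff ε hε x hx).mono inter_subset_left)
    (fun ε hε x hx => (XR.diff ε hε x hx).mono inter_subset_right) hsL hsR
  obtain ⟨R', hR', hcont⟩ := Metric.eventually_nhds_iff_ball.1 CL.continuousAt_armPhase_one
  have hsub := ball_subset_ball (x := μ) (min_le_left R R')
  have hss : s * aL * aR = 1 ∨ s * aL * aR = -1 := by
    rcases hs with rfl | rfl <;> rcases XL.sign with h | h <;> rcases XR.sign with h' | h' <;>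
      simp [h, h']
  refine ⟨fun lam => armPhase γ α β rC lam 1, σ, s * aL * aR, hσ, hss, fun lam => ?_,
    CL.re_armPhase_one, min R R', lt_min hR hR', C, hC, ε0, hε0,
    fun lam hl => hVL (hball (hsub hl)).1, fun lam hl => (hcont lam
      (ball_subset_ball (min_le_right R R') hl)).continuousWithinAt,
    T, fun ε hε hε' => ⟨(hT ε hε hε').1.mono hsub, fun lam hl => ?_⟩⟩
  · simp only [armPhase, hrC, actionIntegral, phase, mul_assoc, intervalIntegral.integral_const_mul]
  obtain ⟨hl1, hl2⟩ := hball (hsub hl)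
  obtain ⟨t1, t2, t3⟩ := (hT ε hε hε').2 lam (hsub hl)
  have hyL := XL.sol ε hε lam hl1
  have hyR := XR.sol ε hε lam hl2
  have hnc := isNormingConstant_iff (W := W) hAS (hyL.smul (exp (EL lam / ε)))
    (hyR.smul (exp (ER lam / ε)))
    (isLeftWKB_iff_halfSolution hAS XL hVL hε hl1) (isRightWKB_iff_halfSolution hAS XR hVR hε hl2)
  obtain ⟨c, hc, K, -, hK⟩ := XL.decay ε hε lam hl1
  obtain ⟨c', hc', K', -, hK'⟩ := XR.decay ε hε lam hl2
  have hev := isEigenvalue_iff hAS hε.ne' hyL hyR (XL.ne_zero hAS.real_mem hε hl1)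
    (XR.ne_zero hAS.real_mem hε hl2) hc (C := K) (by simpa using hK) hc'
    (C' := K' * Real.exp c') (by
      filter_upwards [tendsto_one_sub.2.eventually hK'] with x hx
      rw [show (1 : ℝ) + -1 * (1 - x) = x by ring] at hx
      refine hx.trans_eq ?_
      rw [mul_assoc, ← Real.exp_add]
      ring_nf)
  refine ⟨t1, t2.trans hev.symm, fun hE => ?_, fun κ hκ => ?_⟩
  · obtain ⟨k, hk⟩ := hev.1 hE
    refine ⟨I * exp (ER lam / ε) * k * exp (-(EL lam / ε)),
      (hnc _).2 fun x hx => ?_⟩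
    rw [hk x hx]
    simp only [smul_smul]
    rw [mul_assoc _ (exp (-(EL lam / ε))), mul_comm (exp (-(EL lam / ε))),
      exp_mul_exp_neg, mul_one]
    congr 1
    ring
  · have h1 := (hnc κ).1 hκ
    have hb : I * (aL * aR) * (-I * κ * (aL * aR)) = κ := by
      linear_combination (-(κ * (aL * aL) * (aR * aR))) * I_sq + κ * (aR * aR) * sL + κ * sR
    have hn : ∀ z : ℂ, ‖z‖ = ‖I * (aL * aR) * z‖ := fun z => by
      rw [norm_mul, norm_mul, norm_mul, eL, eR, norm_I, one_mul, one_mul, one_mul]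
    obtain ⟨b1, b2⟩ := t3 (-I * κ * (aL * aR)) fun x hx => by
      have h2 := congrArg (fun y => (-I * aR) • y) (h1 x hx)
      simp only [smul_smul] at h2 ⊢
      convert h2 using 2
      · linear_combination (aR * exp (ER lam / ε)) * I_sq
      · linear_combination (-I * κ * aR * exp (EL lam / ε)) * sL
    constructor
    · refine le_of_eq_of_le ?_ b1
      rw [hn (_ - s)]
      congr 1
      linear_combination (-exp (armPhase γ α β rC lam 1 / ε)) * hb
    · refine le_of_eq_of_le ?_ b2
      rw [hn (_ + s)]
      congr 1
      linear_combination (-exp (-(armPhase γ α β rC lam 1 / ε))) * hb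

theorem sq_near_one {κ a s : ℂ} {δ : ℝ} (hs : s = 1 ∨ s = -1) (hδ : δ ≤ 1)
    (h1 : ‖κ * exp a - I * s‖ ≤ δ) (h2 : ‖κ * exp (-a) + I * s‖ ≤ δ) : ‖κ - 1‖ ≤ 3 * δ ∨ ‖κ + 1‖ ≤ 3
    * δ := by
  have hs2 : s ^ 2 = 1 := by rcases hs with rfl | rfl <;> norm_num
  have hn : ‖I * s‖ = 1 := by rcases hs with rfl | rfl <;> simp
  have h0 : 0 ≤ δ := (norm_nonneg _).trans h1
  have h3 : (κ - 1) * (κ + 1) = (κ * exp a - I * s) * (κ * exp (-a) + I * s - I * s) +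
      I * s * (κ * exp (-a) + I * s) := by
    linear_combination (-κ ^ 2) * exp_mul_exp_neg a - I_sq * s ^ 2 + hs2
  have h4 : ‖κ - 1‖ * ‖κ + 1‖ ≤ 3 * δ := by
    rw [← norm_mul, h3]
    refine (norm_add_le _ _).trans ?_
    rw [norm_mul, norm_mul, hn]
    have h5 := norm_sub_le (κ * exp (-a) + I * s) (I * s)
    rw [hn] at h5
    have : ‖κ * exp a - I * s‖ * ‖κ * exp (-a) + I * s - I * s‖ ≤ δ * 2 :=
      mul_le_mul h1 (by linarith) (norm_nonneg _) h0
    linarith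
  have h5 : 2 ≤ ‖κ - 1‖ + ‖κ + 1‖ := by
    have := norm_sub_le (κ + 1) (κ - 1)
    rw [show κ + 1 - (κ - 1) = 2 by ring, RCLike.norm_ofNat] at this
    linarith
  rcases le_total 1 ‖κ + 1‖ with h | h
  · exact Or.inl ((le_mul_of_one_le_right (norm_nonneg _) h).trans h4)
  · exact Or.inr ((le_mul_of_one_le_left (norm_nonneg _) (by linarith)).trans h4)

theorem sign_of_quantized {κ J s : ℂ} {C : ℝ} {k : ℤ} (hε : 0 < ε) (hδ : C * ε ≤ 1) (hκ : ‖κ‖ ≤ 4)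
    (h1 : ‖κ * exp (J / ε) - I * s‖ ≤ C * ε) (hJ : ‖J - I * Real.pi * ε * (k + 1 / 2)‖ ≤ C * ε ^ 2)
    : ‖κ - (-1) ^ k * s‖ ≤ 9 * C * ε := by
  have hε' : (ε : ℂ) ≠ 0 := by exact_mod_cast hε.ne'
  set ρ : ℂ := (J - I * Real.pi * ε * (k + 1 / 2)) / ε with hρ
  have hρn : ‖ρ‖ ≤ C * ε := by
    rw [hρ, norm_div, norm_real, Real.norm_of_nonneg hε.le, div_le_iff₀ hε]
    linarith
  have hexp : exp (J / ε) = (-1) ^ k * I * exp ρ := by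
    have : J / ε = k * (Real.pi * I) + Real.pi / 2 * I + ρ := by
      rw [hρ]; field_simp; ring
    rw [this, exp_add, exp_add, Complex.exp_int_mul, Complex.exp_pi_mul_I,
      Complex.exp_pi_div_two_mul_I]
  have hk2 : ((-1 : ℂ) ^ k) * (-1) ^ k = 1 := by
    rw [← mul_zpow, neg_one_mul, neg_neg, one_zpow]
  have hkn : ‖(-1 : ℂ) ^ k‖ = 1 := by rw [norm_zpow, norm_neg, norm_one, one_zpow]
  have h2 : ‖κ * exp ρ - (-1) ^ k * s‖ ≤ C * ε := by
    refine le_of_eq_of_le ?_ h1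
    have : κ * exp (J / ε) - I * s = (-1) ^ k * I * (κ * exp ρ - (-1) ^ k * s) := by
      rw [hexp]; linear_combination (I * s) * hk2
    rw [this, norm_mul, norm_mul, hkn, norm_I, one_mul, one_mul]
  have h3 : ‖κ * (exp ρ - 1)‖ ≤ 4 * (2 * (C * ε)) := by
    rw [norm_mul]
    exact mul_le_mul hκ ((Complex.norm_exp_sub_one_le (hρn.trans hδ)).trans (by linarith))
      (norm_nonneg _) (by norm_num)
  have h4 := norm_sub_le (κ * exp ρ - (-1) ^ k * s) (κ * (exp ρ - 1))
  rw [show κ * exp ρ - (-1) ^ k * s - κ * (exp ρ - 1) = κ - (-1) ^ k * s by ring]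
    at h4
  linarith

/-- Opposite signs at consecutive quantized values of `J`. -/
theorem signs_alternate {κ1 κ2 J1 J2 s : ℂ} {C : ℝ} {k : ℤ} (hs : s = 1 ∨ s = -1) (hε : 0 < ε)
    (hδ : C * ε ≤ 1) (hκ1 : ‖κ1‖ ≤ 4) (hκ2 : ‖κ2‖ ≤ 4) (h1 : ‖κ1 * exp (J1 / ε) - I * s‖ ≤ C * ε)
    (h2 : ‖κ2 * exp (J2 / ε) - I * s‖ ≤ C * ε)
    (hJ1 : ‖J1 - I * Real.pi * ε * (k + 1 / 2)‖ ≤ C * ε ^ 2)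
    (hJ2 : ‖J2 - I * Real.pi * ε * (k + 1 + 1 / 2)‖ ≤ C * ε ^ 2) : (‖κ1 - 1‖ ≤ 9 * C * ε ∧ ‖κ2 + 1‖
    ≤ 9 * C * ε) ∨ (‖κ1 + 1‖ ≤ 9 * C * ε ∧ ‖κ2 - 1‖ ≤ 9 * C * ε) := by
  have a1 := sign_of_quantized hε hδ hκ1 h1 hJ1
  have a2 := sign_of_quantized (k := k + 1) hε hδ hκ2 h2 (by push_cast; exact hJ2)
  rw [zpow_add_one₀ (by norm_num)] at a2
  have hk : (-1 : ℂ) ^ k = 1 ∨ (-1 : ℂ) ^ k = -1 := by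
    rcases Int.even_or_odd k with h | h
    · exact Or.inl h.neg_one_zpow
    · exact Or.inr h.neg_one_zpow
  rcases hk with hk | hk <;> rcases hs with rfl | rfl <;> simp only [hk] at a1 a2 <;>
    norm_num at a1 a2 <;> tauto

end ZakharovShabat

theorem mainTheorem4
    (A S : ℂ → ℂ) (Ω : Set ℂ)
    (hAS : ZakharovShabat.AdmissiblePotentials Ω A S)
    (lam₀ : ℂ) (hlam₀ : lam₀.im ≠ 0)
    (γ : ℝ → ℂ) (hγ : ZakharovShabat.IsAdmissibleContour A S Ω lam₀ γ)
    (H1 : ∀ s ∈ Set.Ioo (0 : ℝ) 1, ZakharovShabat.V0 A S lam₀ (γ s) ≠ 0)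
    (hδ : (ZakharovShabat.gPlus A S lam₀ (γ 0) = 0 ∧ ZakharovShabat.gPlus A S lam₀ (γ 1) = 0) ∨
      (ZakharovShabat.gMinus A S lam₀ (γ 0) = 0 ∧ ZakharovShabat.gMinus A S lam₀ (γ 1) = 0))
    (α β : ℂ → ℂ)
    (hα : ZakharovShabat.IsTurningPointFamily A S lam₀ (γ 0) α)
    (hβ : ZakharovShabat.IsTurningPointFamily A S lam₀ (γ 1) β)
    (U₀ : Set ℂ) (hU₀ : U₀ ∈ nhds lam₀)
    (W : ZakharovShabat.Branches A S γ α β U₀) :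
    ∃ U : Set ℂ, IsOpen U ∧ lam₀ ∈ U ∧ U ⊆ U₀ ∧
      ∃ C ε₀ : ℝ, 0 < C ∧ 0 < ε₀ ∧
        (∀ ε : ℝ, 0 < ε → ε < ε₀ → ∀ lam ∈ U, ZakharovShabat.IsEigenvalue A S ε lam →
          (∃ κ : ℂ, ZakharovShabat.IsNormingConstant W ε lam κ) ∧
          ∀ κ : ℂ, ZakharovShabat.IsNormingConstant W ε lam κ →
            ‖κ - 1‖ ≤ C * ε ∨ ‖κ + 1‖ ≤ C * ε) ∧
        (deriv (ZakharovShabat.actionIntegral W) lam₀ ≠ 0 →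
          ∀ ε : ℝ, 0 < ε → ε < ε₀ → ∀ lam₁ lam₂ : ℂ,
            ZakharovShabat.IsNextEigenvalue W U ε lam₁ lam₂ →
            ∀ κ₁ κ₂ : ℂ, ZakharovShabat.IsNormingConstant W ε lam₁ κ₁ →
              ZakharovShabat.IsNormingConstant W ε lam₂ κ₂ →
              (‖κ₁ - 1‖ ≤ C * ε ∧ ‖κ₂ + 1‖ ≤ C * ε) ∨
              (‖κ₁ + 1‖ ≤ C * ε ∧ ‖κ₂ - 1‖ ≤ C * ε)) := by
  open ZakharovShabat in
  obtain ⟨J, σ, s, hσ, hs, hJ, hJ0, R, hR, C, hC, ε₀, hε₀, hRU, hJc, T, hT⟩ :=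
    exists_spectral_function hAS hlam₀ hγ H1 hδ hα hβ hU₀ W
  have hσ0 : σ ≠ 0 := by rcases hσ with rfl | rfl <;> norm_num
  obtain ⟨V, hVR, hVo, hVm, ε₁, hε₁, halt⟩ : ∃ V ⊆ ball lam₀ R, IsOpen V ∧ lam₀ ∈ V ∧
      ∃ ε₁ > 0, deriv (ZakharovShabat.actionIntegral W) lam₀ ≠ 0 → ∀ ε, 0 < ε → ε < ε₁ →
      ∀ lam₁ ∈ V, ∀ lam₂ ∈ V, T ε lam₁ = 1 → T ε lam₂ = 1 → (J lam₁).im < (J lam₂).im →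
      (∀ mu ∈ V, T ε mu = 1 → ¬ ((J lam₁).im < (J mu).im ∧ (J mu).im < (J lam₂).im)) →
      ∃ k : ℤ, ‖J lam₁ - I * Real.pi * ε * (k + 1 / 2)‖ ≤ C * ε ^ 2 ∧
        ‖J lam₂ - I * Real.pi * ε * (k + 1 + 1 / 2)‖ ≤ C * ε ^ 2 := by
    by_cases hd : deriv (ZakharovShabat.actionIntegral W) lam₀ = 0
    · exact ⟨_, subset_rfl, isOpen_ball, mem_ball_self hR, 1, one_pos,
        fun h => absurd hd h⟩
    · have hdJ : deriv J lam₀ ≠ 0 := by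
        rw [funext hJ, deriv_const_mul_field]
        exact mul_ne_zero hσ0 hd
      obtain ⟨V, h1, h2, h3, ε₁, h4, h5⟩ := ZakharovShabat.exists_alternation hR hε₀ hC hJc hJ0
        (fun ε h h' => (hT ε h h').1) (fun ε h h' lam hl => ((hT ε h h').2 lam hl).1) hdJ
      exact ⟨V, h1, h2, h3, ε₁, h4, fun _ => h5⟩
  have hsmall : ∀ ε : ℝ, ε < min (min ε₀ ε₁) (1 / C) → ε < ε₀ ∧ ε < ε₁ ∧ C * ε ≤ 1 := fun ε h => by
    obtain ⟨h1, h2⟩ := lt_min_iff.1 h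
    rw [lt_div_iff₀ hC] at h2
    exact ⟨(lt_min_iff.1 h1).1, (lt_min_iff.1 h1).2, by linarith⟩
  have hnear : ∀ ε : ℝ, 0 < ε → ε < min (min ε₀ ε₁) (1 / C) → ∀ lam ∈ V, ∀ κ : ℂ,
      ZakharovShabat.IsNormingConstant W ε lam κ →
      ‖κ - 1‖ ≤ 3 * (C * ε) ∨ ‖κ + 1‖ ≤ 3 * (C * ε) := by
    intro ε hε h lam hl κ hκ
    obtain ⟨h1, -, h3⟩ := hsmall ε h
    obtain ⟨b1, b2⟩ := ((hT ε hε h1).2 lam (hVR hl)).2.2.2 κ hκ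
    exact ZakharovShabat.sq_near_one hs h3 b1 b2
  refine ⟨V, hVo, hVm, hVR.trans hRU, 9 * C, min (min ε₀ ε₁) (1 / C), by positivity,
    by positivity, fun ε hε h lam hl hE => ⟨((hT ε hε (hsmall ε h).1).2 lam (hVR hl)).2.2.1 hE,
      fun κ hκ => ?_⟩, fun hd ε hε h lam₁ lam₂ hnext κ₁ κ₂ hκ₁ hκ₂ => ?_⟩
  · have : 0 < C * ε := by positivity
    exact (hnear ε hε h lam hl κ hκ).imp (fun h => by linarith) fun h => by linarith
  obtain ⟨h1, h2, h3⟩ := hsmall ε h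
  obtain ⟨hl₁, hl₂, hE₁, hE₂, him, hno⟩ := hnext
  have hbd : ∀ lam ∈ V, ∀ κ : ℂ, ZakharovShabat.IsNormingConstant W ε lam κ → ‖κ‖ ≤ 4 := by
    intro lam hl κ hκ
    rcases hnear ε hε h lam hl κ hκ with h5 | h5
    · have := norm_add_le (κ - 1) 1
      rw [sub_add_cancel, norm_one] at this
      linarith
    · have := norm_sub_le (κ + 1) 1
      rw [add_sub_cancel_right, norm_one] at this
      linarith
  have hiff : ∀ lam ∈ V, (T ε lam = 1 ↔ ZakharovShabat.IsEigenvalue A S ε lam) := fun lam hl =>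
    ((hT ε hε h1).2 lam (hVR hl)).2.1
  have b₁ := (((hT ε hε h1).2 lam₁ (hVR hl₁)).2.2.2 κ₁ hκ₁).1
  have b₂ := (((hT ε hε h1).2 lam₂ (hVR hl₂)).2.2.2 κ₂ hκ₂).1
  have n₁ := hbd lam₁ hl₁ κ₁ hκ₁
  have n₂ := hbd lam₂ hl₂ κ₂ hκ₂
  have t₁ := (hiff lam₁ hl₁).2 hE₁
  have t₂ := (hiff lam₂ hl₂).2 hE₂
  rcases hσ with rfl | rfl
  · simp only [one_mul] at hJ
    obtain ⟨k, k1, k2⟩ := halt hd ε hε h2 lam₁ hl₁ lam₂ hl₂ t₁ t₂ (by rwa [hJ, hJ])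
      fun mu hmu ht => by simpa only [hJ] using hno mu hmu ((hiff mu hmu).1 ht)
    exact ZakharovShabat.signs_alternate hs hε h3 n₁ n₂ b₁ b₂ k1 k2
  · have hi : ∀ lam, (J lam).im = -(ZakharovShabat.actionIntegral W lam).im := fun lam => by
      rw [hJ]; simp
    obtain ⟨k, k1, k2⟩ := halt hd ε hε h2 lam₂ hl₂ lam₁ hl₁ t₂ t₁ (by rw [hi, hi]; linarith)
      fun mu hmu ht ⟨c1, c2⟩ => hno mu hmu ((hiff mu hmu).1 ht) (by
        rw [hi, hi] at c1 c2
        constructor <;> linarith)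
    exact (ZakharovShabat.signs_alternate hs hε h3 n₂ n₁ b₂ b₁ k1 k2).symm.imp And.symm And.symm
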